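/- Let $k$ be a field and $B=k\langle x,y\rangle/(y^2)$, graded by $\deg x=\deg y=1$. Let $\mathsf{Gr}\,B$ be the category of $\mathbb Z$-graded left $B$-modules with degree-preserving homomorphisms, $\mathsf{Fdim}\,B$ its Serre subcategory of modules that are unions of their finite dimensional (graded) submodules, $\mathsf{QGr}\,B=\mathsf{Gr}\,B/\mathsf{Fdim}\,B$ the quotient category, and $\beta^*:\mathsf{Gr}\,B\to\mathsf{QGr}\,B$ the quotient functor. A Penrose sequence is a sequence $z=z_0z_1z_2\ldots$ of $0$s and $1$s without consecutive $1$s; write $z\sim z'$ if there is an $m$ such that $z_n=z'_n$ for all $n\ge m$. The point module $M_z=ke_0\oplus ke_1\oplus\cdots$, $\deg e_i=i$, is given by $x.e_i=(1-z_i)e_{i+1}$ and $y.e_i=z_ie_{i+1}$, and $\mathcal O_z=\beta^*M_z$. Let $\tau=\frac{1+\sqrt5}{2}$ and $\theta=\pi/5$. A kite (dart) is a quadrangle with sides $1,1,\tau,\tau$ and interior angles $2\theta,2\theta,2\theta,4\theta$ (respectively $\theta,\theta,2\theta,6\theta$). The two vertices on the axis of symmetry of a kite are black and its other two vertices are white;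 the two vertices on the axis of a dart are white and its other two vertices are black. A Penrose tiling is a countable set of kites and darts that covers $\mathbb R^2$, such that distinct tiles have disjoint interiors and are either disjoint or meet in a common vertex or a common edge, and such that a point that is a vertex of several tiles has the same color on each of them. Cutting all kites and darts along their axes gives a tiling by triangles $A$ (half kites) and $a$ (half darts), an $A$-tiling. Amalgamating every $a$ with the $A$ on the other side of its short edge that is not on the axis (coincident vertices having the same color) to a triangle $B$, and renaming the remaining $A$ as $b$, gives a $B$-tiling; amalgamating every $b$ in the $B$-tiling with the $B$ on the other side of the edge of $b$ joining its two vertices of the same color to a triangle congruent to $\tau A$, the remaining $B$ being congruent to $\tau a$, gives an $A$-tiling enlarged by $\tau$; and so on. A Penrose tiling $\mathcal T$ and a point $p\in\mathbb R^2$ on no edge and no axis of symmetry of a tile of $\mathcal T$ thus give a sequence of triangle tilings, and a sequence $z_0z_1\ldots$, where $z_n=0$ if $p$ is in a tile of the larger of the two types of the $n$-th triangle tiling ($A$ for even $n$, $B$ for odd $n$, up to scale) and $z_n=1$ if it is in a tile of the smaller type. For a Penrose sequence $z$, let $\mathcal T_z$ denote any Penrose tiling that gives the sequence $z$ at some point $p$.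 **Theorem.** For every Penrose sequence $z$, the object $\mathcal O_z$ is simple in $\mathsf{QGr}\,B$, and a Penrose tiling $\mathcal T_z$ exists. For all Penrose sequences $z,z'$ and all choices of $\mathcal T_z$ and $\mathcal T_{z'}$ the following are equivalent: 1. $\mathcal O_z\cong\mathcal O_{z'}$ in $\mathsf{QGr}\,B$; 2. $z\sim z'$; 3. there is an isometry $\sigma$ of $\mathbb R^2$ such that $\sigma(\mathcal T_z)=\mathcal T_{z'}$. -/

import Mathlib

open CategoryTheory CategoryTheory.Limits

universe u

noncomputable section

namespace PenroseCurve

/-! ### The graded algebra `B = k⟨x, y⟩ / (y²)` -/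

/-- The defining relation `y² = 0` on the free algebra `k⟨x, y⟩`,
where `x` is the generator `0` and `y` is the generator `1`. -/
inductive BRel (k : Type u) [Field k] : FreeAlgebra k (Fin 2) → FreeAlgebra k (Fin 2) → Prop
  | y_sq : BRel k (FreeAlgebra.ι k 1 * FreeAlgebra.ι k 1) 0

/-- The algebra `B = k⟨x, y⟩ / (y²)`. -/
def B (k : Type u) [Field k] : Type u := RingQuot (BRel k)

instance (k : Type u) [Field k] : Ring (B k) := inferInstanceAs (Ring (RingQuot (BRel k)))

instance (k : Type u) [Field k] : Algebra k (B k) :=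
  inferInstanceAs (Algebra k (RingQuot (BRel k)))

/-- The quotient map from the free algebra to `B`. -/
def mkB (k : Type u) [Field k] : FreeAlgebra k (Fin 2) →ₐ[k] B k :=
  RingQuot.mkAlgHom k (BRel k)

theorem mkB_surjective (k : Type u) [Field k] : Function.Surjective (mkB k) :=
  RingQuot.mkAlgHom_surjective k (BRel k)

/-- The generators of `B`: `gen k 0 = x` and `gen k 1 = y`. -/
def gen (k : Type u) [Field k] (i : Fin 2) : B k :=
  mkB k (FreeAlgebra.ι k i)

/-- The homogeneous component `B_n` for the grading with `deg x = deg y = 1`: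
the span of the words of length `n` in `x` and `y` (so it is zero for negative `n`). -/
def Bdeg (k : Type u) [Field k] (n : ℤ) : Submodule k (B k) :=
  Submodule.span k {b | ∃ w : List (Fin 2), (w.length : ℤ) = n ∧ b = (w.map (gen k)).prod}

theorem B_induction {k : Type u} [Field k] {P : B k → Prop} (hs : ∀ c : k, P (algebraMap k _ c))
    (hadd : ∀ a b, P a → P b → P (a + b)) (hgen : ∀ i, P (gen k i))
    (hmul : ∀ a b, P a → P b → P (a * b)) (b : B k) : P b := by
  obtain ⟨a, rfl⟩ := mkB_surjective k b
  induction a using FreeAlgebra.induction with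
  | grade0 c => rw [AlgHom.commutes]; exact hs c
  | grade1 i => exact hgen i
  | mul a b ha hb => rw [map_mul]; exact hmul _ _ ha hb
  | add a b ha hb => rw [map_add]; exact hadd _ _ ha hb

/-- A subspace that is stable under left multiplication by the generators
is stable under left multiplication by `B`. -/
theorem smul_mem_of_gen {k : Type u} [Field k] {M : Type u} [AddCommGroup M] [Module k M]
    [Module (B k) M] [IsScalarTower k (B k) M] (N : Submodule k M)
    (h : ∀ i, ∀ m ∈ N, gen k i • m ∈ N) (b : B k) : ∀ m ∈ N, b • m ∈ N := by
  induction b using B_induction with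
  | hs c => intro m hm; rw [algebraMap_smul]; exact N.smul_mem c hm
  | hadd a b ha hb => intro m hm; rw [add_smul]; exact N.add_mem (ha m hm) (hb m hm)
  | hgen i => exact h i
  | hmul a b ha hb => intro m hm; rw [mul_smul]; exact ha _ (hb m hm)

theorem gen_mem_Bdeg (k : Type u) [Field k] (i : Fin 2) : gen k i ∈ Bdeg k 1 :=
  Submodule.subset_span ⟨[i], by simp, by simp⟩

theorem gen_one_mul_self (k : Type u) [Field k] : gen k 1 * gen k 1 = 0 := by
  unfold gen
  rw [← map_mul]
  exact (RingQuot.mkAlgHom_rel k BRel.y_sq).trans (map_zero _)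

/-! ### The category `Gr B` of `ℤ`-graded left `B`-modules -/

/-- A `ℤ`-graded left `B`-module: a left `B`-module `M` with a direct sum decomposition
`M = ⨁ M_n` into `k`-subspaces such that `B_i M_j ⊆ M_{i+j}`. -/
structure GrB (k : Type u) [Field k] where
  carrier : Type u
  [addCommGroup : AddCommGroup carrier]
  [moduleBase : Module k carrier]
  [module : Module (B k) carrier]
  [isScalarTower : IsScalarTower k (B k) carrier]
  deg : ℤ → Submodule k carrier
  isInternal : DirectSum.IsInternal deg
  smul_mem_deg : ∀ (i j : ℤ) (b : B k) (m : carrier), b ∈ Bdeg k i → m ∈ deg j →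
    b • m ∈ deg (i + j)

namespace GrB

variable {k : Type u} [Field k]

instance : CoeSort (GrB k) (Type u) := ⟨carrier⟩

attribute [instance] addCommGroup moduleBase module isScalarTower

/-- Morphisms of `Gr B`: the `B`-linear maps that preserve degree. -/
@[ext]
structure Hom (X Y : GrB k) where
  lin : X →ₗ[B k] Y
  map_deg : ∀ (i : ℤ) (x : X), x ∈ X.deg i → lin x ∈ Y.deg i

instance : Category (GrB k) where
  Hom := Hom
  id X := ⟨LinearMap.id, fun _ _ h => h⟩
  comp f g := ⟨g.lin ∘ₗ f.lin, fun i x h => g.map_deg i _ (f.map_deg i x h)⟩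

@[ext]
theorem hom_ext {X Y : GrB k} {f g : X ⟶ Y} (h : ∀ x, f.lin x = g.lin x) : f = g :=
  Hom.ext (LinearMap.ext h)

@[simp] theorem id_lin (X : GrB k) (x : X) : Hom.lin (𝟙 X) x = x := rfl

@[simp] theorem comp_lin {X Y Z : GrB k} (f : X ⟶ Y) (g : Y ⟶ Z) (x : X) :
    (f ≫ g).lin x = g.lin (f.lin x) := rfl

section Preadditive

variable (X Y : GrB k)

instance : Zero (X ⟶ Y) := ⟨⟨0, fun i _ _ => (Y.deg i).zero_mem⟩⟩

instance : Add (X ⟶ Y) :=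
  ⟨fun f g => ⟨f.lin + g.lin, fun i x h => (Y.deg i).add_mem (f.map_deg i x h) (g.map_deg i x h)⟩⟩

instance : Neg (X ⟶ Y) :=
  ⟨fun f => ⟨-f.lin, fun i x h => (Y.deg i).neg_mem (f.map_deg i x h)⟩⟩

variable {X Y}

@[simp] theorem zero_lin (x : X) : Hom.lin (0 : X ⟶ Y) x = 0 := rfl

@[simp] theorem add_lin (f g : X ⟶ Y) (x : X) : (f + g).lin x = f.lin x + g.lin x := rfl

@[simp] theorem neg_lin (f : X ⟶ Y) (x : X) : (-f).lin x = -f.lin x := rfl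

instance : AddCommGroup (X ⟶ Y) where
  add_assoc f g h := by ext x; simp [add_assoc]
  zero_add f := by ext x; simp
  add_zero f := by ext x; simp
  add_comm f g := by ext x; simp [add_comm]
  neg_add_cancel f := by ext x; simp
  nsmul := nsmulRec
  zsmul := zsmulRec

instance : Preadditive (GrB k) where
  add_comp f g h := by intros; ext x; simp
  comp_add f g h := by intros; ext x; simp

end Preadditive

/-- A criterion for a family of subspaces to be a direct sum decomposition. -/
theorem isInternal_of_proj {M P : Type u} [AddCommGroup M] [Module k M] [AddCommGroup P]
    [Module k P] (A : ℤ → Submodule k M) (q : M →ₗ[k] P) (hq : Function.Injective q)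
    (p : ℤ → M →ₗ[k] P) (h₁ : ∀ i, ∀ m ∈ A i, p i m = q m)
    (h₂ : ∀ i j, j ≠ i → ∀ m ∈ A j, p i m = 0) (h₃ : ∀ m, m ∈ ⨆ i, A i) :
    DirectSum.IsInternal A := by
  refine DirectSum.isInternal_submodule_of_iSupIndep_of_iSup_eq_top ?_ (eq_top_iff.2 fun m _ => h₃ m)
  intro i
  rw [Submodule.disjoint_def]
  intro m hm hm'
  have : (⨆ j, ⨆ (_ : j ≠ i), A j) ≤ LinearMap.ker (p i) :=
    iSup₂_le fun j hj m hm => h₂ i j hj m hm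
  apply hq
  rw [← h₁ i m hm, map_zero]
  exact this hm'

/-- The projection of a graded module to its component of degree `i`. -/
def proj (X : GrB k) (i : ℤ) : X →ₗ[k] X :=
  (X.deg i).subtype ∘ₗ DirectSum.component k ℤ (fun j => X.deg j) i ∘ₗ
    (LinearEquiv.ofBijective (DirectSum.coeLinearMap X.deg) X.isInternal).symm.toLinearMap

theorem proj_mem (X : GrB k) (i : ℤ) (x : X) : X.proj i x ∈ X.deg i := by
  simp [proj]

theorem proj_of_mem (X : GrB k) {i : ℤ} {x : X} (h : x ∈ X.deg i) : X.proj i x = x :=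
  congrArg Subtype.val (X.isInternal.ofBijective_coeLinearMap_of_mem h)

theorem proj_of_mem_ne (X : GrB k) {i j : ℤ} (hij : j ≠ i) {x : X} (h : x ∈ X.deg j) :
    X.proj i x = 0 :=
  congrArg Subtype.val (X.isInternal.ofBijective_coeLinearMap_of_mem_ne hij h)

theorem induction_on (X : GrB k) {P : X → Prop} (h : ∀ i, ∀ x ∈ X.deg i, P x)
    (hadd : ∀ x y, P x → P y → P (x + y)) (x : X) : P x := by
  have hx : x ∈ ⨆ i, X.deg i := by rw [X.isInternal.submodule_iSup_eq_top]; trivial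
  induction hx using Submodule.iSup_induction' with
  | mem i x hx => exact h i x hx
  | zero => exact h 0 0 (Submodule.zero_mem _)
  | add x y _ _ hx hy => exact hadd x y hx hy

theorem mem_iff_proj (X : GrB k) {i : ℤ} {x : X} : x ∈ X.deg i ↔ X.proj i x = x :=
  ⟨X.proj_of_mem, fun h => h ▸ X.proj_mem i x⟩

theorem lin_smul {X Y : GrB k} (f : X ⟶ Y) (c : k) (x : X) : f.lin (c • x) = c • f.lin x := by
  rw [← algebraMap_smul (B k), map_smul, algebraMap_smul]

theorem proj_lin {X Y : GrB k} (f : X ⟶ Y) (i : ℤ) (x : X) :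
    Y.proj i (f.lin x) = f.lin (X.proj i x) := by
  induction x using X.induction_on with
  | h j x hx =>
    by_cases hij : j = i
    · subst hij
      rw [proj_of_mem _ hx, proj_of_mem _ (f.map_deg _ _ hx)]
    · rw [proj_of_mem_ne _ hij hx, proj_of_mem_ne _ hij (f.map_deg _ _ hx), map_zero]
  | hadd x y hx hy => simp only [map_add, hx, hy]

/-- A submodule of a graded module is homogeneous (a graded submodule) if it contains the
homogeneous components of its elements. -/
def IsHomogeneous (X : GrB k) (N : Submodule (B k) X) : Prop :=
  ∀ x ∈ N, ∀ i, X.proj i x ∈ N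

theorem mem_iSup_of_homogeneous (X : GrB k) (N : Submodule k X)
    (hN : ∀ x ∈ N, ∀ i, X.proj i x ∈ N) (x : X) (hx : x ∈ N) : x ∈ ⨆ i, X.deg i ⊓ N := by
  classical
  set e := LinearEquiv.ofBijective (DirectSum.coeLinearMap X.deg) X.isInternal
  have hx' : x = ∑ i ∈ (e.symm x).support, X.proj i x := by
    conv_lhs => rw [← e.apply_symm_apply x]
    exact DirectSum.coeLinearMap_eq_dfinsuppSum X.deg (e.symm x)
  rw [hx']
  exact Submodule.sum_mem _ fun i _ =>
    Submodule.mem_iSup_of_mem i ⟨X.proj_mem i x, hN x hx i⟩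

/-- The grading induced on a submodule. -/
def subDeg (X : GrB k) (N : Submodule (B k) X) (i : ℤ) : Submodule k N :=
  (X.deg i).comap (N.subtype.restrictScalars k)

theorem subDeg_isInternal (X : GrB k) (N : Submodule (B k) X) (hN : X.IsHomogeneous N) :
    DirectSum.IsInternal (X.subDeg N) := by
  refine isInternal_of_proj (X.subDeg N) (N.subtype.restrictScalars k) Subtype.val_injective
    (fun i => X.proj i ∘ₗ N.subtype.restrictScalars k) ?_ ?_ ?_
  · intro i m hm
    exact X.proj_of_mem hm
  · intro i j hij m hm
    exact X.proj_of_mem_ne hij hm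
  · intro z
    have hz := X.mem_iSup_of_homogeneous (N.restrictScalars k) hN z.1 z.2
    have hle : (⨆ i, X.deg i ⊓ N.restrictScalars k) ≤
        (⨆ i, X.subDeg N i).map (N.subtype.restrictScalars k) := by
      refine iSup_le fun i y hy => ⟨(⟨y, hy.2⟩ : N), ?_, rfl⟩
      have : (⟨y, hy.2⟩ : N) ∈ X.subDeg N i := hy.1
      exact Submodule.mem_iSup_of_mem i this
    obtain ⟨y, hy, hyx⟩ := hle hz
    have : y = z := Subtype.ext hyx
    exact this ▸ hy

/-- A graded submodule as an object of `Gr B`. -/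
def sub (X : GrB k) (N : Submodule (B k) X) (hN : X.IsHomogeneous N) : GrB k where
  carrier := N
  deg := X.subDeg N
  isInternal := X.subDeg_isInternal N hN
  smul_mem_deg i j b m hb hm := X.smul_mem_deg i j b m.1 hb hm

/-- The quotient of a graded module by a graded submodule as an object of `Gr B`. -/
def quot (X : GrB k) (N : Submodule (B k) X) (hN : X.IsHomogeneous N) : GrB k where
  carrier := X ⧸ N
  deg i := (X.deg i).map (N.mkQ.restrictScalars k)
  isInternal := by
    refine isInternal_of_proj _ LinearMap.id Function.injective_id
      (fun i => (N.restrictScalars k).mapQ (N.restrictScalars k) (X.proj i)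
        fun x hx => hN x hx i) ?_ ?_ ?_
    · rintro i _ ⟨x, hx, rfl⟩
      exact congrArg N.mkQ (X.proj_of_mem hx)
    · rintro i j hij _ ⟨x, hx, rfl⟩
      exact (congrArg N.mkQ (X.proj_of_mem_ne hij hx)).trans (map_zero _)
    · intro m
      rw [← Submodule.map_iSup, X.isInternal.submodule_iSup_eq_top]
      obtain ⟨x, rfl⟩ := N.mkQ_surjective m
      exact ⟨x, trivial, rfl⟩
  smul_mem_deg := by
    rintro i j b _ hb ⟨x, hx, rfl⟩
    exact ⟨b • x, X.smul_mem_deg i j b x hb hx, map_smul N.mkQ b x⟩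

/-- The direct sum of two graded modules. -/
def prod (X Y : GrB k) : GrB k where
  carrier := X × Y
  deg i := (X.deg i).prod (Y.deg i)
  isInternal := by
    refine isInternal_of_proj _ LinearMap.id Function.injective_id
      (fun i => (X.proj i).prodMap (Y.proj i)) ?_ ?_ ?_
    · rintro i ⟨x, y⟩ ⟨hx, hy⟩
      exact Prod.ext (X.proj_of_mem hx) (Y.proj_of_mem hy)
    · rintro i j hij ⟨x, y⟩ ⟨hx, hy⟩
      exact Prod.ext (X.proj_of_mem_ne hij hx) (Y.proj_of_mem_ne hij hy)
    · rintro ⟨x, y⟩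
      have hx : ∀ x : X, ((x, 0) : X × Y) ∈ ⨆ i, (X.deg i).prod (Y.deg i) := fun x => by
        induction x using X.induction_on with
        | h i x hx => exact Submodule.mem_iSup_of_mem i ⟨hx, Submodule.zero_mem _⟩
        | hadd a b ha hb => simpa using add_mem ha hb
      have hy : ∀ y : Y, ((0, y) : X × Y) ∈ ⨆ i, (X.deg i).prod (Y.deg i) := fun y => by
        induction y using Y.induction_on with
        | h i y hy => exact Submodule.mem_iSup_of_mem i ⟨Submodule.zero_mem _, hy⟩
        | hadd a b ha hb => simpa using add_mem ha hb
      simpa using add_mem (hx x) (hy y)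
  smul_mem_deg i j b m hb hm :=
    ⟨X.smul_mem_deg i j b m.1 hb hm.1, Y.smul_mem_deg i j b m.2 hb hm.2⟩

/-- The zero graded module. -/
def zero : GrB k where
  carrier := PUnit.{u + 1}
  deg _ := ⊤
  isInternal := isInternal_of_proj _ LinearMap.id Function.injective_id (fun _ => 0)
    (fun _ _ _ => rfl) (fun _ _ _ _ _ => rfl) fun m => by rw [Subsingleton.elim m 0]; exact Submodule.zero_mem _
  smul_mem_deg _ _ _ _ _ _ := trivial

theorem isZero_zero : IsZero (zero : GrB k) := by
  rw [IsZero.iff_id_eq_zero]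
  ext x
  rfl

instance : HasZeroObject (GrB k) := ⟨⟨zero, isZero_zero⟩⟩

instance : HasBinaryBiproducts (GrB k) := ⟨fun X Y => by
  refine Limits.HasBinaryBiproduct.mk ⟨⟨X.prod Y, ⟨LinearMap.fst (B k) X Y, fun i x h => h.1⟩,
    ⟨LinearMap.snd (B k) X Y, fun i x h => h.2⟩,
    ⟨LinearMap.inl (B k) X Y, fun i x h => ⟨h, Submodule.zero_mem _⟩⟩,
    ⟨LinearMap.inr (B k) X Y, fun i x h => ⟨Submodule.zero_mem _, h⟩⟩, ?_, ?_, ?_, ?_⟩,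
    isBinaryBilimitOfTotal _ ?_⟩
  all_goals ext x
  · rfl
  · rfl
  · rfl
  · rfl
  · exact Prod.ext (add_zero _) (zero_add _)⟩

instance : HasFiniteProducts (GrB k) :=
  hasFiniteProducts_of_has_binary_and_terminal

section KerCoker

variable {X Y : GrB k} (f : X ⟶ Y)

theorem isHomogeneous_ker : X.IsHomogeneous (LinearMap.ker f.lin) := fun x hx i => by
  rw [LinearMap.mem_ker] at hx ⊢
  rw [← proj_lin, hx, map_zero]

theorem isHomogeneous_range : Y.IsHomogeneous (LinearMap.range f.lin) := by
  rintro _ ⟨x, rfl⟩ i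
  exact ⟨X.proj i x, (proj_lin f i x).symm⟩

/-- The inclusion of a graded submodule. -/
def subι (X : GrB k) (N : Submodule (B k) X) (hN : X.IsHomogeneous N) : X.sub N hN ⟶ X :=
  ⟨N.subtype, fun _ _ h => h⟩

/-- The projection to the quotient by a graded submodule. -/
def quotπ (X : GrB k) (N : Submodule (B k) X) (hN : X.IsHomogeneous N) : X ⟶ X.quot N hN :=
  ⟨N.mkQ, fun _ x h => ⟨x, h, rfl⟩⟩

/-- The inclusion of the set-theoretic kernel of `f` is a kernel of `f`. -/
def isLimitKer : IsLimit (KernelFork.ofι (f := f) (subι X _ (isHomogeneous_ker f))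
    (by ext x; exact x.2)) :=
  KernelFork.IsLimit.ofι _ _
    (fun g hg => ⟨g.lin.codRestrict _ fun w => by
      simpa using congrArg (fun h => Hom.lin h w) hg, fun i x h => g.map_deg i x h⟩)
    (fun g hg => rfl)
    (fun g hg m hm => by
      ext x
      exact Subtype.ext (congrArg (fun h => Hom.lin h x) hm))

/-- The projection to the quotient by the image of `f` is a cokernel of `f`. -/
def isColimitCoker : IsColimit (CokernelCofork.ofπ (f := f) (quotπ Y _ (isHomogeneous_range f))
    (by ext x; exact (Submodule.Quotient.mk_eq_zero _).2 ⟨x, rfl⟩)) :=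
  CokernelCofork.IsColimit.ofπ _ _
    (fun g hg => ⟨(LinearMap.range f.lin).liftQ g.lin (by
      rintro _ ⟨x, rfl⟩
      simpa using congrArg (fun h => Hom.lin h x) hg), by
      rintro i _ ⟨x, hx, rfl⟩
      exact g.map_deg i x hx⟩)
    (fun g hg => rfl)
    (fun g hg m hm => by
      ext x
      obtain ⟨y, rfl⟩ := Submodule.mkQ_surjective _ x
      exact congrArg (fun h => Hom.lin h y) hm)

instance : HasKernels (GrB k) := ⟨fun f => ⟨_, isLimitKer f⟩⟩

instance : HasCokernels (GrB k) := ⟨fun f => ⟨_, isColimitCoker f⟩⟩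

theorem injective_of_mono [Mono f] : Function.Injective f.lin := by
  rw [← LinearMap.ker_eq_bot, LinearMap.ker_eq_bot']
  intro x hx
  have h : subι X _ (isHomogeneous_ker f) = 0 := by
    rw [← cancel_mono f, zero_comp]
    ext x
    exact x.2
  exact congrArg (fun h => Hom.lin h (⟨x, hx⟩ : LinearMap.ker f.lin)) h

theorem surjective_of_epi [Epi f] : Function.Surjective f.lin := by
  have h : quotπ Y _ (isHomogeneous_range f) = 0 := by
    rw [← cancel_epi f, comp_zero]
    ext x
    exact (Submodule.Quotient.mk_eq_zero _).2 ⟨x, rfl⟩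
  intro y
  exact (Submodule.Quotient.mk_eq_zero _).1 (congrArg (fun h => Hom.lin h y) h)

theorem mem_deg_of_injective (hf : Function.Injective f.lin) {i : ℤ} {x : X}
    (h : f.lin x ∈ Y.deg i) : x ∈ X.deg i := by
  rw [mem_iff_proj] at h ⊢
  exact hf (by rw [← proj_lin, h])

/-- Every monomorphism of `Gr B` is a kernel. -/
theorem normalMono [Mono f] : Nonempty (NormalMono f) := ⟨{
  Z := Y.quot _ (isHomogeneous_range f)
  g := quotπ Y _ (isHomogeneous_range f)
  w := by ext x; exact (Submodule.Quotient.mk_eq_zero _).2 ⟨x, rfl⟩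
  isLimit := by
    have hf := injective_of_mono f
    have hfac : ∀ {W : GrB k} (g : W ⟶ Y) (_ : g ≫ quotπ Y _ (isHomogeneous_range f) = 0) (w : W),
        ∃ x, f.lin x = g.lin w := fun g hg w =>
      (Submodule.Quotient.mk_eq_zero _).1 (congrArg (fun h => Hom.lin h w) hg)
    have hc : ∀ {W : GrB k} (g : W ⟶ Y) (hg : g ≫ quotπ Y _ (isHomogeneous_range f) = 0) (w : W),
        f.lin ((LinearEquiv.ofInjective f.lin hf).symm
          (g.lin.codRestrict (LinearMap.range f.lin) (hfac g hg) w)) = g.lin w := fun g hg w =>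
      congrArg Subtype.val ((LinearEquiv.ofInjective f.lin hf).apply_symm_apply _)
    refine KernelFork.IsLimit.ofι' _ _ fun {W} g hg =>
      ⟨⟨(LinearEquiv.ofInjective f.lin hf).symm.toLinearMap ∘ₗ
        g.lin.codRestrict (LinearMap.range f.lin) (hfac g hg), ?_⟩, ?_⟩
    · intro i w hw
      refine mem_deg_of_injective f hf ?_
      have := g.map_deg i w hw
      rw [← hc g hg w] at this
      exact this
    · ext w
      exact hc g hg w }⟩

/-- Every epimorphism of `Gr B` is a cokernel. -/
theorem normalEpi [Epi f] : Nonempty (NormalEpi f) := ⟨{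
  W := X.sub _ (isHomogeneous_ker f)
  g := subι X _ (isHomogeneous_ker f)
  w := by ext x; exact x.2
  isColimit := by
    have hf := surjective_of_epi f
    have hc : ∀ {W : GrB k} (g : X ⟶ W) (_ : subι X _ (isHomogeneous_ker f) ≫ g = 0),
        LinearMap.ker f.lin ≤ LinearMap.ker g.lin := fun {W} g hg x hx =>
      LinearMap.mem_ker.2
        (congrArg (fun h : X.sub _ (isHomogeneous_ker f) ⟶ W =>
          h.lin (⟨x, hx⟩ : LinearMap.ker f.lin)) hg)
    have he : ∀ {W : GrB k} (g : X ⟶ W) (hg : subι X _ (isHomogeneous_ker f) ≫ g = 0) (x : X),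
        (LinearMap.ker f.lin).liftQ g.lin (hc g hg)
          ((f.lin.quotKerEquivOfSurjective hf).symm (f.lin x)) = g.lin x := fun g hg x => by
      have : (f.lin.quotKerEquivOfSurjective hf).symm (f.lin x) =
          (LinearMap.ker f.lin).mkQ x := by
        rw [LinearEquiv.symm_apply_eq]
        rfl
      rw [this]
      rfl
    refine CokernelCofork.IsColimit.ofπ' _ _ fun {W} g hg =>
      ⟨⟨(LinearMap.ker f.lin).liftQ g.lin (hc g hg) ∘ₗ
        (f.lin.quotKerEquivOfSurjective hf).symm.toLinearMap, ?_⟩, ?_⟩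
    · intro i y hy
      obtain ⟨x, rfl⟩ := hf y
      have h1 : f.lin (X.proj i x) = f.lin x := by rw [← proj_lin, proj_of_mem _ hy]
      rw [← h1]
      have := g.map_deg i _ (X.proj_mem i x)
      rw [← he g hg] at this
      exact this
    · ext x
      exact he g hg x }⟩

end KerCoker

instance : Abelian (GrB k) where
  normalMonoOfMono f _ := normalMono f
  normalEpiOfEpi f _ := normalEpi f

/-! ### The Serre subcategory `Fdim B` and the quotient category `QGr B` -/

/-- `Fdim B`: the graded modules that are unions of their finite dimensional graded
submodules. -/
def Fdim (k : Type u) [Field k] : ObjectProperty (GrB k) := fun X =>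
  ∀ x : X, ∃ N : Submodule (B k) X, X.IsHomogeneous N ∧
    FiniteDimensional k (N.restrictScalars k) ∧ x ∈ N

theorem Fdim_of_mono {X Y : GrB k} (f : X ⟶ Y) [Mono f] (hY : Fdim k Y) : Fdim k X := by
  intro x
  obtain ⟨N, hN, hfd, hx⟩ := hY (f.lin x)
  refine ⟨N.comap f.lin, fun y hy i => ?_, ?_, hx⟩
  · rw [Submodule.mem_comap] at hy ⊢
    rw [← proj_lin]
    exact hN _ hy i
  · let g : (N.comap f.lin).restrictScalars k →ₗ[k] N.restrictScalars k :=
      { toFun := fun y => ⟨f.lin y.1, y.2⟩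
        map_add' := fun a b => Subtype.ext (map_add f.lin _ _)
        map_smul' := fun c a => Subtype.ext (lin_smul f c _) }
    refine FiniteDimensional.of_injective g fun a b hab => Subtype.ext ?_
    exact injective_of_mono f (congrArg Subtype.val hab)

theorem Fdim_of_epi {X Y : GrB k} (f : X ⟶ Y) [Epi f] (hX : Fdim k X) : Fdim k Y := by
  intro y
  obtain ⟨x, rfl⟩ := surjective_of_epi f y
  obtain ⟨N, hN, hfd, hx⟩ := hX x
  refine ⟨N.map f.lin, ?_, ?_, ⟨x, hx, rfl⟩⟩
  · rintro _ ⟨z, hz, rfl⟩ i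
    exact ⟨X.proj i z, hN z hz i, (proj_lin f i z).symm⟩
  · let g : N.restrictScalars k →ₗ[k] (N.map f.lin).restrictScalars k :=
      { toFun := fun y => ⟨f.lin y.1, ⟨y.1, y.2, rfl⟩⟩
        map_add' := fun a b => Subtype.ext (map_add f.lin _ _)
        map_smul' := fun c a => Subtype.ext (lin_smul f c _) }
    refine Module.Finite.of_surjective g ?_
    rintro ⟨_, z, hz, rfl⟩
    exact ⟨⟨z, hz⟩, rfl⟩

/-- If `x` is homogeneous then `B x` is a graded submodule. -/
theorem isHomogeneous_span (X : GrB k) {j : ℤ} {x : X} (hx : x ∈ X.deg j) :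
    X.IsHomogeneous (Submodule.span (B k) {x}) := by
  let N : Submodule k X := (Submodule.span (B k) {x}).restrictScalars k ⊓
    ⨅ i, ((Submodule.span (B k) {x}).restrictScalars k).comap (X.proj i)
  have hgen : ∀ i, ∀ m ∈ N, gen k i • m ∈ N := by
    rintro i m ⟨hm, hm'⟩
    refine ⟨(Submodule.span (B k) {x}).smul_mem _ hm, ?_⟩
    simp only [SetLike.mem_coe, Submodule.mem_iInf, Submodule.mem_comap] at hm' ⊢
    intro n
    have key : ∀ m : X, X.proj n (gen k i • m) = gen k i • X.proj (n - 1) m := by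
      intro m
      induction m using X.induction_on with
      | h j m hm =>
        have h1 := X.smul_mem_deg 1 j _ _ (gen_mem_Bdeg k i) hm
        by_cases hj : j = n - 1
        · subst hj
          rw [X.proj_of_mem hm]
          rw [show (1 : ℤ) + (n - 1) = n by ring] at h1
          exact X.proj_of_mem h1
        · rw [X.proj_of_mem_ne hj hm, smul_zero]
          exact X.proj_of_mem_ne (by omega) h1
      | hadd a b ha hb => rw [smul_add, map_add, ha, hb, map_add, smul_add]
    rw [key]
    exact (Submodule.span (B k) {x}).smul_mem _ (hm' (n - 1))
  have hxN : x ∈ N := by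
    refine ⟨Submodule.mem_span_singleton_self x, ?_⟩
    simp only [SetLike.mem_coe, Submodule.mem_iInf, Submodule.mem_comap]
    intro i
    by_cases hij : j = i
    · subst hij
      rw [X.proj_of_mem hx]
      exact Submodule.mem_span_singleton_self x
    · rw [X.proj_of_mem_ne hij hx]
      exact Submodule.zero_mem _
  intro y hy i
  obtain ⟨b, rfl⟩ := Submodule.mem_span_singleton.1 hy
  have := (smul_mem_of_gen N hgen b x hxN).2
  simp only [SetLike.mem_coe, Submodule.mem_iInf, Submodule.mem_comap] at this
  exact this i

/-- Sums of elements in finite dimensional graded submodules are in such submodules. -/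
theorem Fdim_of_homogeneous {X : GrB k}
    (h : ∀ j, ∀ x ∈ X.deg j, FiniteDimensional k ((Submodule.span (B k) {x}).restrictScalars k)) :
    Fdim k X := by
  intro x
  induction x using X.induction_on with
  | h j x hx => exact ⟨_, X.isHomogeneous_span hx, h j x hx, Submodule.mem_span_singleton_self x⟩
  | hadd x y hx hy =>
    obtain ⟨N, hN, _, hxN⟩ := hx
    obtain ⟨P, hP, _, hyP⟩ := hy
    refine ⟨N ⊔ P, ?_, ?_, add_mem (Submodule.mem_sup_left hxN) (Submodule.mem_sup_right hyP)⟩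
    · intro z hz i
      obtain ⟨a, ha, b, hb, rfl⟩ := Submodule.mem_sup.1 hz
      rw [map_add]
      exact add_mem (Submodule.mem_sup_left (hN a ha i)) (Submodule.mem_sup_right (hP b hb i))
    · have : (N ⊔ P).restrictScalars k = N.restrictScalars k ⊔ P.restrictScalars k :=
        Submodule.restrictScalars_sup k N P
      rw [this]
      infer_instance

theorem Fdim_of_extension {S : ShortComplex (GrB k)} (hS : S.ShortExact)
    (h₁ : Fdim k S.X₁) (h₃ : Fdim k S.X₃) : Fdim k S.X₂ := by
  refine Fdim_of_homogeneous fun j x hx => ?_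
  -- the part of `S.X₂` that lies over a finite dimensional submodule of `S.X₃`
  have hker : ∀ y : S.X₂, S.g.lin y = 0 → ∃ z, S.f.lin z = y := by
    intro y hy
    have := hS.mono_f
    let u : S.X₂.sub _ (isHomogeneous_ker S.g) ⟶ S.X₁ :=
      hS.exact.lift (subι S.X₂ _ (isHomogeneous_ker S.g)) (by ext z; exact z.2)
    refine ⟨u.lin (⟨y, hy⟩ : LinearMap.ker S.g.lin), ?_⟩
    exact congrArg (fun h : S.X₂.sub _ (isHomogeneous_ker S.g) ⟶ S.X₂ =>
      h.lin (⟨y, hy⟩ : LinearMap.ker S.g.lin))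
      (hS.exact.lift_f (subι S.X₂ _ (isHomogeneous_ker S.g)) (by ext z; exact z.2))
  have hfin : ∀ y : S.X₂, S.g.lin y = 0 → ∃ N : Submodule (B k) S.X₂,
      FiniteDimensional k (N.restrictScalars k) ∧ y ∈ N := by
    intro y hy
    obtain ⟨z, rfl⟩ := hker y hy
    obtain ⟨N, -, _, hz⟩ := h₁ z
    refine ⟨N.map S.f.lin, ?_, ⟨z, hz, rfl⟩⟩
    let g : N.restrictScalars k →ₗ[k] (N.map S.f.lin).restrictScalars k :=
      { toFun := fun y => ⟨S.f.lin y.1, ⟨y.1, y.2, rfl⟩⟩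
        map_add' := fun a b => Subtype.ext (map_add S.f.lin _ _)
        map_smul' := fun c a => Subtype.ext (lin_smul S.f c _) }
    refine Module.Finite.of_surjective g ?_
    rintro ⟨_, z, hz, rfl⟩
    exact ⟨⟨z, hz⟩, rfl⟩
  -- a finite dimensional subspace `V` containing `x` and mapping onto `B (g x)`
  let gk : S.X₂ →ₗ[k] S.X₃ :=
    { toFun := S.g.lin, map_add' := map_add S.g.lin, map_smul' := lin_smul S.g }
  obtain ⟨N₃, -, hN₃, hxN₃⟩ := h₃ (S.g.lin x)
  obtain ⟨V, hVfg, hVmap⟩ : ∃ V : Submodule k S.X₂, V.FG ∧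
      V.map gk = (N₃.restrictScalars k) := by
    have := hS.epi_g
    have hs : Function.Surjective gk := surjective_of_epi S.g
    have hfg : (N₃.restrictScalars k).FG := (Submodule.fg_iff_finiteDimensional _).2 hN₃
    obtain ⟨s, hs'⟩ := hfg
    classical
    refine ⟨Submodule.span k (s.image (Function.surjInv hs)), ⟨_, rfl⟩, ?_⟩
    rw [Submodule.map_span, ← hs']
    congr 1
    ext z
    simp only [Finset.coe_image, Set.mem_image, Finset.mem_coe]
    constructor
    · rintro ⟨_, ⟨a, ha, rfl⟩, rfl⟩
      rwa [Function.surjInv_eq hs]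
    · intro hz
      exact ⟨_, ⟨z, hz, rfl⟩, Function.surjInv_eq hs z⟩
  let V' : Submodule k S.X₂ := V ⊔ Submodule.span k {x}
  have hV'fg : V'.FG := hVfg.sup (Submodule.fg_span_singleton x)
  let lm : Fin 2 → S.X₂ →ₗ[k] S.X₂ := fun i => Module.toModuleEnd k S.X₂ (gen k i)
  let U : Submodule k S.X₂ := (V' ⊔ (V'.map (lm 0) ⊔ V'.map (lm 1))) ⊓ LinearMap.ker gk
  have hUfg : U.FG := by
    have : (V' ⊔ (V'.map (lm 0) ⊔ V'.map (lm 1))).FG :=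
      hV'fg.sup ((hV'fg.map _).sup (hV'fg.map _))
    have := (Submodule.fg_iff_finiteDimensional _).1 this
    exact (Submodule.fg_iff_finiteDimensional _).2
      (Submodule.finiteDimensional_of_le (inf_le_left : U ≤ _))
  obtain ⟨P, hP, hUP⟩ : ∃ P : Submodule (B k) S.X₂, FiniteDimensional k (P.restrictScalars k) ∧
      U ≤ P.restrictScalars k := by
    obtain ⟨s, hs⟩ := hUfg
    have hsU : ∀ a ∈ s, S.g.lin a = 0 := fun a ha =>
      (hs ▸ Submodule.subset_span ha : a ∈ U).2
    have : ∃ P : Submodule (B k) S.X₂, FiniteDimensional k (P.restrictScalars k) ∧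
        ∀ a ∈ s, a ∈ P := by
      clear hs
      classical
      induction s using Finset.induction_on with
      | empty =>
        refine ⟨⊥, ?_, by simp⟩
        rw [Submodule.restrictScalars_bot]
        infer_instance
      | insert a s ha ih =>
        obtain ⟨P, _, hP'⟩ := ih fun b hb => hsU b (Finset.mem_insert_of_mem hb)
        obtain ⟨Q, _, hQ'⟩ := hfin a (hsU a (Finset.mem_insert_self a s))
        refine ⟨P ⊔ Q, ?_, ?_⟩
        · rw [Submodule.restrictScalars_sup k P Q]
          infer_instance
        · intro b hb
          rcases Finset.mem_insert.1 hb with rfl | hb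
          · exact Submodule.mem_sup_right hQ'
          · exact Submodule.mem_sup_left (hP' b hb)
    obtain ⟨P, hP, hsP⟩ := this
    exact ⟨P, hP, hs ▸ Submodule.span_le.2 hsP⟩
  have hV'N : ∀ v ∈ V', gk v ∈ N₃.restrictScalars k := by
    intro v hv
    obtain ⟨a, ha, b, hb, rfl⟩ := Submodule.mem_sup.1 hv
    obtain ⟨c, rfl⟩ := Submodule.mem_span_singleton.1 hb
    rw [map_add, map_smul]
    exact add_mem (hVmap ▸ Submodule.mem_map_of_mem ha) (Submodule.smul_mem _ _ hxN₃)
  let W : Submodule k S.X₂ := V' ⊔ P.restrictScalars k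
  have hW : ∀ i, ∀ m ∈ W, gen k i • m ∈ W := by
    intro i m hm
    obtain ⟨v, hv, p, hp, rfl⟩ := Submodule.mem_sup.1 hm
    rw [smul_add]
    refine add_mem ?_ (Submodule.mem_sup_right (P.smul_mem _ hp))
    have h1 : gk (gen k i • v) ∈ N₃.restrictScalars k := by
      have : gk (gen k i • v) = gen k i • gk v := map_smul S.g.lin _ _
      rw [this]
      exact N₃.smul_mem _ (hV'N v hv)
    rw [← hVmap] at h1
    obtain ⟨v', hv', hvv'⟩ := h1
    have h2 : gen k i • v - v' ∈ U := by
      refine ⟨sub_mem (Submodule.mem_sup_right ?_)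
        (Submodule.mem_sup_left (Submodule.mem_sup_left hv')), ?_⟩
      · fin_cases i
        · exact Submodule.mem_sup_left ⟨v, hv, rfl⟩
        · exact Submodule.mem_sup_right ⟨v, hv, rfl⟩
      · exact LinearMap.mem_ker.2 (by rw [map_sub, hvv', sub_self])
    rw [← sub_add_cancel (gen k i • v) v']
    exact add_mem (Submodule.mem_sup_right (hUP h2))
      (Submodule.mem_sup_left (Submodule.mem_sup_left hv'))
  have hxW : x ∈ W :=
    Submodule.mem_sup_left (Submodule.mem_sup_right (Submodule.mem_span_singleton_self x))
  have := (Submodule.fg_iff_finiteDimensional _).1 hV'fg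
  have hWfd : FiniteDimensional k W := inferInstance
  refine Submodule.finiteDimensional_of_le (S₂ := W) ?_
  intro y hy
  obtain ⟨b, rfl⟩ := Submodule.mem_span_singleton.1 hy
  exact smul_mem_of_gen W hW b x hxW

instance : (Fdim k).IsSerreClass where
  exists_zero := ⟨zero, isZero_zero, fun x => ⟨⊤, fun _ _ _ => trivial, by
    have : Subsingleton ((⊤ : Submodule (B k) (zero : GrB k)).restrictScalars k) :=
      ⟨fun a b => Subtype.ext (Subsingleton.elim (α := PUnit.{u + 1}) a.1 b.1)⟩
    infer_instance, trivial⟩⟩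
  prop_of_mono f _ h := Fdim_of_mono f h
  prop_of_epi f _ h := Fdim_of_epi f h
  prop_X₂_of_shortExact hS h₁ h₃ := Fdim_of_extension hS h₁ h₃

end GrB

/-- The quotient category `QGr B = Gr B / Fdim B`: the localization of `Gr B` at the morphisms
whose kernel and cokernel are in `Fdim B`. -/
abbrev QGrB (k : Type u) [Field k] : Type (u + 1) := (GrB.Fdim k).isoModSerre.Localization

/-- The canonical quotient functor `β^* : Gr B ⥤ QGr B`. -/
abbrev betaStar (k : Type u) [Field k] : GrB k ⥤ QGrB k := (GrB.Fdim k).isoModSerre.Q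

/-! ### Penrose sequences and their point modules -/

/-- A Penrose sequence: a sequence `z_0 z_1 …` of `0`s and `1`s without consecutive `1`s. -/
structure PenroseSeq where
  val : ℕ → Fin 2
  no_consecutive : ∀ n, ¬ (val n = 1 ∧ val (n + 1) = 1)

instance : CoeFun PenroseSeq (fun _ => ℕ → Fin 2) := ⟨PenroseSeq.val⟩

/-- Equivalence of Penrose sequences: `z_{≥ m} = z'_{≥ m}` for some `m`. -/
def PenroseSeq.Equivalent (z z' : PenroseSeq) : Prop := ∃ m, ∀ n, m ≤ n → z n = z' n

section PointModule

variable (k : Type u) [Field k] (z : PenroseSeq)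

/-- The coefficients of the action: `x e_i = (1 - z_i) e_{i+1}` and `y e_i = z_i e_{i+1}`. -/
def pointCoeff (g : Fin 2) (i : ℕ) : k :=
  if g = 0 then 1 - ((z i : ℕ) : k) else ((z i : ℕ) : k)

/-- The action of the generators `x`, `y` on the space with basis `e_0, e_1, …`. -/
def pointGen (g : Fin 2) : Module.End k (ℕ →₀ k) :=
  Finsupp.lsum k fun i => pointCoeff k z g i • Finsupp.lsingle (i + 1)

theorem pointGen_single (g : Fin 2) (i : ℕ) (c : k) :
    pointGen k z g (Finsupp.single i c) = Finsupp.single (i + 1) (pointCoeff k z g i * c) := by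
  simp [pointGen]

theorem pointGen_sq : pointGen k z 1 * pointGen k z 1 = 0 := by
  ext i : 2
  have h := z.no_consecutive i
  have h' : ∀ a : Fin 2, a ≠ 1 → a = 0 := by decide
  have : pointCoeff k z 1 (i + 1) * pointCoeff k z 1 i = 0 := by
    by_cases h0 : z i = 1
    · have := h' _ (fun h1 => h ⟨h0, h1⟩)
      simp [pointCoeff, this]
    · simp [pointCoeff, h' _ h0]
  simp [Module.End.mul_apply, pointGen_single, this]

/-- The action of `B` on the point module. -/
def pointAction : B k →ₐ[k] Module.End k (ℕ →₀ k) :=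
  RingQuot.liftAlgHom k (s := BRel k) ⟨FreeAlgebra.lift k (pointGen k z), by
    rintro _ _ ⟨⟩
    simp [pointGen_sq]⟩

theorem pointAction_gen (g : Fin 2) : pointAction k z (gen k g) = pointGen k z g := by
  unfold pointAction gen mkB
  exact (RingQuot.liftAlgHom_mkAlgHom_apply k _ _ _).trans (FreeAlgebra.lift_ι_apply _ _)

/-- The homogeneous component of degree `n` of the point module: `k e_n` if `n ≥ 0`
and `0` otherwise. -/
def pointDeg (n : ℤ) : Submodule k (ℕ →₀ k) := Finsupp.supported k k {i : ℕ | (i : ℤ) = n}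

theorem mem_pointDeg {n : ℤ} {m : ℕ →₀ k} :
    m ∈ pointDeg k n ↔ ∀ i : ℕ, (i : ℤ) ≠ n → m i = 0 := by
  rw [pointDeg, Finsupp.mem_supported]
  refine ⟨fun h i hi => by_contra fun hm => hi (h (Finsupp.mem_support_iff.2 hm)),
    fun h i hi => by_contra fun hn => Finsupp.mem_support_iff.1 hi (h i hn)⟩

theorem pointDeg_isInternal : DirectSum.IsInternal (pointDeg k) := by
  classical
  refine GrB.isInternal_of_proj _ LinearMap.id Function.injective_id
    (fun n =>
      { toFun := Finsupp.filter fun i : ℕ => (i : ℤ) = n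
        map_add' := fun _ _ => Finsupp.filter_add
        map_smul' := fun _ _ => Finsupp.filter_smul }) ?_ ?_ ?_
  · intro n m hm
    rw [mem_pointDeg] at hm
    refine Finsupp.filter_eq_self_iff _ _ |>.2 fun i hi => by_contra fun h => hi (hm i h)
  · intro n j hj m hm
    rw [mem_pointDeg] at hm
    refine Finsupp.filter_eq_zero_iff _ _ |>.2 fun i hi => hm i fun h => hj (h.symm.trans hi)
  · intro m
    induction m using Finsupp.induction_linear with
    | zero => exact Submodule.zero_mem _
    | add a b ha hb => exact add_mem ha hb
    | single i c =>
      exact Submodule.mem_iSup_of_mem (i : ℤ) (Finsupp.single_mem_supported k c rfl)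

theorem pointGen_mem (g : Fin 2) (j : ℤ) (m : ℕ →₀ k) (hm : m ∈ pointDeg k j) :
    pointGen k z g m ∈ pointDeg k (1 + j) := by
  rw [pointDeg, Finsupp.supported_eq_span_single] at hm
  induction hm using Submodule.span_induction with
  | mem m hm =>
    obtain ⟨i, hi, rfl⟩ := hm
    rw [pointGen_single]
    refine Finsupp.single_mem_supported k _ ?_
    have : (i : ℤ) = j := hi
    change ((i + 1 : ℕ) : ℤ) = 1 + j
    push_cast
    omega
  | zero => rw [map_zero]; exact Submodule.zero_mem _
  | add a b _ _ ha hb => rw [map_add]; exact add_mem ha hb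
  | smul c a _ ha => rw [map_smul]; exact Submodule.smul_mem _ _ ha

theorem pointAction_mem (i j : ℤ) (b : B k) (m : ℕ →₀ k) (hb : b ∈ Bdeg k i)
    (hm : m ∈ pointDeg k j) : pointAction k z b m ∈ pointDeg k (i + j) := by
  induction hb using Submodule.span_induction with
  | mem b hb =>
    obtain ⟨w, rfl, rfl⟩ := hb
    induction w with
    | nil => simpa using hm
    | cons g w ih =>
      rw [List.map_cons, List.prod_cons, map_mul, pointAction_gen, Module.End.mul_apply]
      have := pointGen_mem k z g _ _ ih
      rwa [show (1 : ℤ) + ((w.length : ℤ) + j) = ((g :: w).length : ℤ) + j by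
        rw [List.length_cons]; push_cast; ring] at this
  | zero => rw [map_zero]; exact Submodule.zero_mem _
  | add a b _ _ ha hb => rw [map_add]; exact add_mem ha hb
  | smul c a _ ha => rw [map_smul]; exact Submodule.smul_mem _ _ ha

/-- The point module `M_z = k e_0 ⊕ k e_1 ⊕ ⋯` with `deg e_i = i`, `x e_i = (1 - z_i) e_{i+1}`
and `y e_i = z_i e_{i+1}`. -/
def pointModule : GrB k :=
  letI : Module (B k) (ℕ →₀ k) := Module.compHom _ (pointAction k z).toRingHom
  { carrier := ℕ →₀ k
    isScalarTower := ⟨fun c b m => by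
      change pointAction k z (c • b) m = c • pointAction k z b m
      rw [map_smul]; rfl⟩
    deg := pointDeg k
    isInternal := pointDeg_isInternal k
    smul_mem_deg := pointAction_mem k z }

/-- The basis vector `e_i` of the point module. -/
def pointBasis (i : ℕ) : pointModule k z := (Finsupp.single i 1 : ℕ →₀ k)

theorem x_smul_pointBasis (i : ℕ) :
    gen k 0 • pointBasis k z i = (1 - ((z i : ℕ) : k)) • pointBasis k z (i + 1) := by
  have h : pointAction k z (gen k 0) (Finsupp.single i 1) =
      (1 - ((z i : ℕ) : k)) • (Finsupp.single (i + 1) 1 : ℕ →₀ k) := by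
    rw [pointAction_gen, pointGen_single, Finsupp.smul_single]
    simp [pointCoeff]
  exact h

theorem y_smul_pointBasis (i : ℕ) :
    gen k 1 • pointBasis k z i = ((z i : ℕ) : k) • pointBasis k z (i + 1) := by
  have h : pointAction k z (gen k 1) (Finsupp.single i 1) =
      ((z i : ℕ) : k) • (Finsupp.single (i + 1) 1 : ℕ →₀ k) := by
    rw [pointAction_gen, pointGen_single, Finsupp.smul_single]
    simp [pointCoeff]
  exact h

/-- `𝒪_z = β^* M_z`, the point module viewed as an object of `QGr B`. -/
def pointSheaf : QGrB k := (betaStar k).obj (pointModule k z)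

end PointModule

/-! ### Penrose tilings of the plane by kites and darts

The plane `ℝ²` is identified with `ℂ`, with its Euclidean distance. -/

/-- The golden ratio `τ = (1 + √5) / 2`. -/
abbrev tau : ℝ := Real.goldenRatio

/-- `S` is the union of the two triangles `t h l` and `t h r`, glued along the axis `t h`. -/
def IsQuad (S : Set ℂ) (t l h r : ℂ) : Prop :=
  S = convexHull ℝ {t, h, l} ∪ convexHull ℝ {t, h, r}

/-- `S` is a kite with vertices `t, l, h, r` in cyclic order: the sides are `|tl| = |tr| = τ` and
`|hl| = |hr| = 1`, and the axis of symmetry `t h` has length `τ`. Hence the two halves are the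
(mirror congruent, as `l ≠ r`) isosceles triangles with sides `1, τ, τ`, and the interior angles
at `t, l, h, r` are `2θ, 2θ, 4θ, 2θ`, where `θ = π / 5`. -/
def IsKite (S : Set ℂ) (t l h r : ℂ) : Prop :=
  dist t l = tau ∧ dist t r = tau ∧ dist h l = 1 ∧ dist h r = 1 ∧ dist t h = tau ∧ l ≠ r ∧
    IsQuad S t l h r

/-- `S` is a dart with vertices `t, l, h, r` in cyclic order: the sides are `|tl| = |tr| = τ` and
`|hl| = |hr| = 1`, and the axis of symmetry `t h` has length `1`. Hence the two halves are the
(mirror congruent, as `l ≠ r`) isosceles triangles with sides `1, 1, τ`, and the interior angles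
at `t, l, h, r` are `2θ, θ, 6θ, θ`, where `θ = π / 5`. -/
def IsDart (S : Set ℂ) (t l h r : ℂ) : Prop :=
  dist t l = tau ∧ dist t r = tau ∧ dist h l = 1 ∧ dist h r = 1 ∧ dist t h = 1 ∧ l ≠ r ∧
    IsQuad S t l h r

/-- `v` is a black vertex of the tile `S`: a vertex on the axis of a kite, or a vertex off the
axis of a dart. -/
def IsBlackVertex (S : Set ℂ) (v : ℂ) : Prop :=
  ∃ t l h r, (IsKite S t l h r ∧ (v = t ∨ v = h)) ∨ (IsDart S t l h r ∧ (v = l ∨ v = r))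

/-- `v` is a white vertex of the tile `S`: a vertex off the axis of a kite, or a vertex on the
axis of a dart. -/
def IsWhiteVertex (S : Set ℂ) (v : ℂ) : Prop :=
  ∃ t l h r, (IsKite S t l h r ∧ (v = l ∨ v = r)) ∨ (IsDart S t l h r ∧ (v = t ∨ v = h))

/-- `v` is a vertex of the tile `S`. -/
def IsVertex (S : Set ℂ) (v : ℂ) : Prop := IsBlackVertex S v ∨ IsWhiteVertex S v

/-- The segment `E` is an edge of the tile `S` (each edge occurs because `l` and `r` can be
interchanged). -/
def IsEdge (S E : Set ℂ) : Prop :=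
  ∃ t l h r, (IsKite S t l h r ∨ IsDart S t l h r) ∧ (E = segment ℝ t l ∨ E = segment ℝ h l)

/-- A Penrose tiling: a countable family `T` of kites and darts that covers the plane, such that
distinct tiles have disjoint interiors and meet edge to edge (if they meet, then in a common vertex
or a common edge), and such that a common vertex of two tiles has the same color on both. -/
structure IsPenroseTiling (T : Set (Set ℂ)) : Prop where
  countable : T.Countable
  prototiles : ∀ S ∈ T, ∃ t l h r, IsKite S t l h r ∨ IsDart S t l h r
  covers : ⋃₀ T = Set.univ
  disjoint : ∀ S ∈ T, ∀ S' ∈ T, S ≠ S' → Disjoint (interior S) (interior S')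
  edge_to_edge : ∀ S ∈ T, ∀ S' ∈ T, S ≠ S' → (S ∩ S').Nonempty →
    (∃ v, S ∩ S' = {v} ∧ IsVertex S v ∧ IsVertex S' v) ∨
      (IsEdge S (S ∩ S') ∧ IsEdge S' (S ∩ S'))
  matching : ∀ S ∈ T, ∀ S' ∈ T, ∀ v, ¬ (IsBlackVertex S v ∧ IsWhiteVertex S' v)

/-! ### Composition of triangle tilings -/

/-- A triangular tile with labelled vertices. The acute ones (`acute = true`) have interior angles
`θ, 2θ, 2θ` at `t, h, w`, the obtuse ones have interior angles `θ, 3θ, θ` at `t, h, w`. The vertices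
`t` and `h` have the same color and `w` has the other one. -/
structure TriTile where
  acute : Bool
  t : ℂ
  h : ℂ
  w : ℂ

namespace TriTile

/-- The closed triangle. -/
def region (D : TriTile) : Set ℂ := convexHull ℝ {D.t, D.h, D.w}

/-- The union of the sides of the triangle. -/
def sides (D : TriTile) : Set ℂ :=
  segment ℝ D.t D.h ∪ segment ℝ D.t D.w ∪ segment ℝ D.h D.w

end TriTile

/-- The `A`-tiling of a tiling by kites and darts: every tile is cut along its axis `t h`.
The half kites are the large (acute) tiles `A`, the half darts are the small (obtuse) tiles `a`. -/
def aTiling (T : Set (Set ℂ)) : Set TriTile :=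
  {D | (∃ S ∈ T, ∃ r, IsKite S D.t D.w D.h r) ∧ D.acute = true} ∪
    {D | (∃ S ∈ T, ∃ r, IsDart S D.t D.w D.h r) ∧ D.acute = false}

/-- Composition from an `A`-tiling to a `B`-tiling. A tile `A` with vertices `t, h, r` and a tile `a`
with vertices `w, r, h` that lie on both sides of the common side `h r`, with coincident vertices
of the same color and `r` between `t` and `w`, are amalgamated to a tile `B` with vertices
`t, h, w`. The tiles `A` that are not absorbed in this way become the tiles `b`. Here `B` is obtuse
and is the larger tile, `b` is acute and is the smaller tile. -/
def composeA (𝒯 : Set TriTile) : Set TriTile :=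
  {D | ∃ t h w r, D = ⟨false, t, h, w⟩ ∧
      (⟨true, t, h, r⟩ : TriTile) ∈ 𝒯 ∧ (⟨false, w, r, h⟩ : TriTile) ∈ 𝒯 ∧ Wbtw ℝ t r w} ∪
    {D | ∃ t h w, D = ⟨true, t, h, w⟩ ∧ (⟨true, t, h, w⟩ : TriTile) ∈ 𝒯 ∧
      ¬ ∃ v, (⟨false, v, w, h⟩ : TriTile) ∈ 𝒯 ∧ Wbtw ℝ t w v}

/-- Composition from a `B`-tiling to a (`τ` times larger) `A`-tiling. A tile `B` with vertices
`w, q, t` and a tile `b` with vertices `w, q, h` that lie on both sides of the common side `w q`,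
with `q` between `t` and `h`, are amalgamated to a tile `τA` with vertices `t, h, w`. The
tiles `B` that are not absorbed in this way become the tiles `τa`. Here `τA` is acute and is the
larger tile, `τa` is obtuse and is the smaller tile. -/
def composeB (𝒯 : Set TriTile) : Set TriTile :=
  {D | ∃ t h w q, D = ⟨true, t, h, w⟩ ∧
      (⟨false, w, q, t⟩ : TriTile) ∈ 𝒯 ∧ (⟨true, w, q, h⟩ : TriTile) ∈ 𝒯 ∧ Wbtw ℝ t q h} ∪
    {D | ∃ t h w, D = ⟨false, t, h, w⟩ ∧ (⟨false, t, h, w⟩ : TriTile) ∈ 𝒯 ∧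
      ¬ ∃ v, (⟨true, t, h, v⟩ : TriTile) ∈ 𝒯 ∧ Wbtw ℝ w h v}

/-- The `n`-th triangle tiling obtained from a tiling by kites and darts by cutting and repeated
composition. It is an `A`-tiling for even `n` and a `B`-tiling for odd `n`; the tilings are
not shrunk, so the scale of the `n`-th one is `τ ^ (n / 2)`. -/
def level (T : Set (Set ℂ)) : ℕ → Set TriTile
  | 0 => aTiling T
  | n + 1 => if Even n then composeA (level T n) else composeB (level T n)

/-- Whether `D`, as a tile of the `n`-th tiling, is of the larger type: these are the acute tiles
(`A`) for even `n` and the obtuse tiles (`B`) for odd `n`. -/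
def IsLarge (n : ℕ) (D : TriTile) : Prop := D.acute = true ↔ Even n

/-- `z` is the sequence of `T` at the point `p`: the point `p` does not lie on an edge or on the
axis of symmetry of a tile of `T`, and `z_n` is `0` or `1` according as `p` is in a tile of the
larger or of the smaller type of the `n`-th tiling. -/
structure IsSequenceAt (T : Set (Set ℂ)) (p : ℂ) (z : PenroseSeq) : Prop where
  generic : ∀ D ∈ aTiling T, p ∉ D.sides
  code : ∀ n, ∃ D ∈ level T n, p ∈ D.region ∧ (z n = 0 ↔ IsLarge n D)

/-- `T` is a Penrose tiling `𝒯_z` determined by the sequence `z`: a Penrose tiling that has the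
sequence `z` at some point of the plane. -/
def IsPenroseTilingOf (z : PenroseSeq) (T : Set (Set ℂ)) : Prop :=
  IsPenroseTiling T ∧ ∃ p, IsSequenceAt T p z

end PenroseCurve

end

noncomputable section

namespace PenroseCurve

open GrB

/-! ### Point modules in the quotient category: simplicity and isomorphism classes. -/

section Algebra

variable {k : Type u} [Field k]

/-! Algebra. On every point module `x + y` acts as the shift sending `e_i` to `e_{i+1}`, since the
coefficients `1 - z_i` and `z_i` add up to 1. Hence a point module has no nonzero finite dimensional
submodule (`pointModule_torsionFree`). As its components have dimension at most one, a nonzero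
graded submodule contains all `e_i` with `i` large, so every nonzero map into a point module has
cokernel in `Fdim` (`epiModSerre_of_ne_zero`). Writing a nonzero monomorphism into `𝒪_z` as a
fraction gives simplicity. An isomorphism `𝒪_z ≅ 𝒪_{z'}` is a roof `M_z ← X → M_{z'}`; an element of
`X` over `e_m`, together with its shifts, shows through the action of `y` that `z_n` and `z'_n`
vanish simultaneously for `n ≥ m`. Conversely, equal tails give a common truncation of the two
modules.

Geometry. A triangle is given by a `Frame`: a vertex `t`, a vector `d` to the vertex `h`, and a root
`ε` of `ε² = τε - 1`, one of the two numbers `exp(±πi/5)`; the choice of `ε` is the orientation.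
Incidence questions become identities that follow from `τ² = τ + 1` and `ε² = τε - 1`. The matching
rules take the form `Good`: across each side lies the mirror image, or a tile of the other type in
one prescribed position. This form is inherited by composed tilings (`Good.compose`), holds for
Penrose tilings by kites and darts (`IsPenroseTiling.good`), and gives back such tilings
(`Good.isPenroseTiling_quads`).

Isometric tilings have equivalent sequences. Adjacent tiles of different types lie in one tile three
levels higher (`Good.merge_of_ex`). So two adjacent tiles either have a common ancestor or have
ancestors that are mirror images of each other on all levels (`Good.merge_or_mir`). In both cases
their ancestors eventually have the same type. The plane without the countably many vertices is
connected, so this extends to any two tiles (`Good.eventually_acute_eq`): up to finitely many terms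
the sequence does not depend on the point.

Equivalent sequences give isometric tilings. If the sequences agree from `m` on, an isometry takes
the ancestor of level `m` in one tiling to that in the other. The type of the parent determines the
parent (`Frame.Par.eq_of_c_eq`), so all higher ancestors agree, and a tiling is determined by such a
chain of ancestors (`Good.eq_of_common`).

Existence. A sequence prescribes a chain of tiles, each a part of the next one, whose decompositions
are nested patches. They form a tiling if every tile of the chain is interior to a later one
(`tower_chainTower`). For the sequence of zeros, however, all tiles of the chain lie on one side of
a line. Therefore the first terms of `z` are continued by a period for which the chain does exhaust
the plane, and a limit of the resulting towers along an ultrafilter contains the whole chain of `z`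
(`exists_tower_limit`). -/

theorem GrB.eq_zero_of_proj {X : GrB k} {x : X} (h : ∀ i, X.proj i x = 0) : x = 0 := by
  let N : Submodule k X := ⨅ i, LinearMap.ker (X.proj i)
  have hN : ∀ y ∈ N, ∀ i, X.proj i y = 0 := fun y hy i => by
    simp only [N, Submodule.mem_iInf, LinearMap.mem_ker] at hy
    exact hy i
  have hx : x ∈ N := by
    simp only [N, Submodule.mem_iInf, LinearMap.mem_ker]
    exact h
  have h1 := X.mem_iSup_of_homogeneous N (fun y hy i => by
    rw [hN y hy i]; exact N.zero_mem) x hx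
  have h2 : (⨆ i, X.deg i ⊓ N) = ⊥ := by
    refine iSup_eq_bot.2 fun i => (Submodule.eq_bot_iff _).2 fun y hy => ?_
    rw [← X.proj_of_mem hy.1, hN y hy.2 i]
  rw [h2] at h1
  exact (Submodule.mem_bot k).1 h1

/-- The abstract kernel and cokernel in the Serre conditions are replaced by the concrete ones, so
that the conditions can be tested on elements. -/
theorem monoModSerre_iff_ker {X Y : GrB k} (f : X ⟶ Y) :
    (Fdim k).monoModSerre f ↔ Fdim k (X.sub _ (isHomogeneous_ker f)) :=
  (Fdim k).prop_iff_of_iso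
    (IsLimit.conePointUniqueUpToIso (kernelIsKernel f) (isLimitKer f))

theorem epiModSerre_iff_coker {X Y : GrB k} (f : X ⟶ Y) :
    (Fdim k).epiModSerre f ↔ Fdim k (Y.quot _ (isHomogeneous_range f)) :=
  (Fdim k).prop_iff_of_iso
    (IsColimit.coconePointUniqueUpToIso (cokernelIsCokernel f) (isColimitCoker f))

variable (z : PenroseSeq)

/-- The coefficients of an element of the point module. -/
def pointRepr (m : pointModule k z) : ℕ →₀ k := m

theorem gen_smul_repr (g : Fin 2) (m : pointModule k z) (i : ℕ) :
    pointRepr z (gen k g • m) (i + 1) = pointCoeff k z g i * pointRepr z m i := by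
  have h : pointRepr z (gen k g • m) = pointGen k z g (pointRepr z m) := by
    change pointAction k z (gen k g) (pointRepr z m) = _
    rw [pointAction_gen]
  rw [h]
  generalize pointRepr z m = m
  induction m using Finsupp.induction_linear with
  | zero => simp
  | add a b ha hb =>
    rw [map_add (pointGen k z g) a b, Finsupp.add_apply, ha, hb, Finsupp.add_apply, mul_add]
  | single j c =>
    rw [pointGen_single]
    by_cases hij : j = i
    · subst hij; simp
    · rw [Finsupp.single_eq_of_ne (by omega), Finsupp.single_eq_of_ne (by omega), mul_zero]

/-- The coefficients `1 - z_i` and `z_i` have sum 1, so `x + y` is the shift, whatever the sequence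
is. -/
theorem shift_smul_repr (m : pointModule k z) (i : ℕ) :
    pointRepr z ((gen k 0 + gen k 1) • m) (i + 1) = pointRepr z m i := by
  have : pointRepr z ((gen k 0 + gen k 1) • m) =
      pointRepr z (gen k 0 • m) + pointRepr z (gen k 1 • m) := by
    rw [add_smul]; rfl
  rw [this, Finsupp.add_apply, gen_smul_repr, gen_smul_repr, ← add_mul]
  simp [pointCoeff]

theorem shift_pow_smul_repr (n : ℕ) (m : pointModule k z) (i : ℕ) :
    pointRepr z ((gen k 0 + gen k 1) ^ n • m) (i + n) = pointRepr z m i := by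
  induction n with
  | zero => simp
  | succ n ih => rw [pow_succ', mul_smul, ← add_assoc, shift_smul_repr, ih]

theorem shift_smul_basis (i : ℕ) :
    (gen k 0 + gen k 1) • pointBasis k z i = pointBasis k z (i + 1) := by
  rw [add_smul, x_smul_pointBasis, y_smul_pointBasis, ← add_smul]
  simp

theorem shift_pow_smul_basis (n i : ℕ) :
    (gen k 0 + gen k 1) ^ n • pointBasis k z i = pointBasis k z (i + n) := by
  induction n with
  | zero => simp
  | succ n ih => rw [pow_succ', mul_smul, ih, shift_smul_basis, add_assoc]

theorem pointModule_eq_smul_basis {i : ℕ} {m : pointModule k z}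
    (hm : m ∈ (pointModule k z).deg (i : ℤ)) : m = pointRepr z m i • pointBasis k z i := by
  have hm' := (mem_pointDeg k (m := pointRepr z m)).1 hm
  have : pointRepr z m = pointRepr z m i • (Finsupp.single i 1 : ℕ →₀ k) := by
    ext j
    by_cases hij : j = i
    · subst hij; simp
    · rw [hm' j (by exact_mod_cast hij), Finsupp.smul_apply, Finsupp.single_eq_of_ne hij, smul_zero]
  exact this

theorem pointBasis_mem_deg (i : ℕ) : pointBasis k z i ∈ (pointModule k z).deg (i : ℤ) :=
  (mem_pointDeg k (m := Finsupp.single i 1)).2 fun j hj =>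
    Finsupp.single_eq_of_ne fun h => hj (by exact_mod_cast h)

theorem pointModule_deg_neg {n : ℤ} (hn : n < 0) {m : pointModule k z}
    (hm : m ∈ (pointModule k z).deg n) : m = 0 := by
  have hm' := (mem_pointDeg k (m := pointRepr z m)).1 hm
  have : pointRepr z m = 0 := by
    ext j
    exact hm' j (by omega)
  exact this

/-- Point modules have no finite dimensional submodules other than zero. -/
theorem pointModule_torsionFree (N : Submodule (B k) (pointModule k z))
    (hN : FiniteDimensional k (N.restrictScalars k)) (m : pointModule k z) (hm : m ∈ N) :
    m = 0 := by
  obtain ⟨s, hs⟩ := (Submodule.fg_iff_finiteDimensional _).2 hN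
  -- Finitely many generators have bounded support. The `K`-th power of the shift moves the support
  -- of `m` to indices `≥ K`, where all elements of `N` vanish.
  obtain ⟨K, hK⟩ : ∃ K : ℕ, ∀ a ∈ s, ∀ i, K ≤ i → pointRepr z a i = 0 := by
    classical
    refine ⟨(s.sup fun a => (pointRepr z a).support.sup id) + 1, fun a ha i hi => ?_⟩
    by_contra h
    have h1 : i ≤ (pointRepr z a).support.sup id :=
      Finset.le_sup (f := id) (Finsupp.mem_support_iff.2 h)
    have h2 : (pointRepr z a).support.sup id ≤ s.sup fun a => (pointRepr z a).support.sup id :=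
      Finset.le_sup (f := fun a => (pointRepr z a).support.sup id) ha
    omega
  have hN' : ∀ a ∈ N, ∀ i, K ≤ i → pointRepr z a i = 0 := by
    intro a ha i hi
    have ha' : a ∈ Submodule.span k (s : Set (pointModule k z)) := by rw [hs]; exact ha
    induction ha' using Submodule.span_induction with
    | mem a h => exact hK a h i hi
    | zero => rfl
    | add a b h1 h2 iha ihb =>
      have ea := iha (by have := hs ▸ h1; exact this)
      have eb := ihb (by have := hs ▸ h2; exact this)
      change pointRepr z a i + pointRepr z b i = 0
      rw [ea, eb, add_zero]
    | smul c a h iha =>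
      have ea := iha (by have := hs ▸ h; exact this)
      change c * pointRepr z a i = 0
      rw [ea, mul_zero]
  have : pointRepr z m = 0 := by
    ext i
    rw [← shift_pow_smul_repr z K m i]
    exact hN' _ (N.smul_mem _ hm) _ (by omega)
  exact this

/-- A nonzero element has a nonzero homogeneous component, which is a scalar multiple of some `e_n`.
Shifting then puts all later basis vectors into the submodule. -/
theorem pointModule_basis_mem (N : Submodule (B k) (pointModule k z))
    (hN : (pointModule k z).IsHomogeneous N) (hne : N ≠ ⊥) : ∃ n, pointBasis k z n ∈ N := by
  obtain ⟨m, hm, hm0⟩ := N.ne_bot_iff.1 hne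
  obtain ⟨i, hi⟩ : ∃ i, (pointModule k z).proj i m ≠ 0 := by
    by_contra! h
    exact hm0 (GrB.eq_zero_of_proj h)
  have h1 := (pointModule k z).proj_mem i m
  rcases lt_or_ge i 0 with h0 | h0
  · exact absurd (pointModule_deg_neg z h0 h1) hi
  · lift i to ℕ using h0
    have h2 := pointModule_eq_smul_basis z h1
    set c := pointRepr z ((pointModule k z).proj i m) i with hc
    have hc0 : c ≠ 0 := by
      intro h
      rw [h, zero_smul] at h2
      exact hi h2
    refine ⟨i, ?_⟩
    have h3 : pointBasis k z i = c⁻¹ • (pointModule k z).proj i m := by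
      rw [h2, smul_smul, inv_mul_cancel₀ hc0, one_smul]
    rw [h3]
    exact (N.restrictScalars k).smul_mem _ (hN m hm i)

theorem Fdim_quot_of_basis_mem (N : Submodule (B k) (pointModule k z))
    (hN : (pointModule k z).IsHomogeneous N) {n : ℕ} (hn : pointBasis k z n ∈ N) :
    Fdim k ((pointModule k z).quot N hN) := by
  classical
  have hmem : ∀ i, n ≤ i → pointBasis k z i ∈ N := fun i hi => by
    obtain ⟨j, rfl⟩ := Nat.exists_eq_add_of_le hi
    rw [← shift_pow_smul_basis]
    exact N.smul_mem _ hn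
  let q : pointModule k z →ₗ[k] (pointModule k z).quot N hN := N.mkQ.restrictScalars k
  have hspan : ∀ m : pointModule k z, q m ∈ Submodule.span k
      (((Finset.range n).image fun i => q (pointBasis k z i) : Finset _) :
        Set ((pointModule k z).quot N hN)) := by
    intro m
    suffices h : ∀ m : ℕ →₀ k, q (m : pointModule k z) ∈ Submodule.span k
      (((Finset.range n).image fun i => q (pointBasis k z i) : Finset _) :
        Set ((pointModule k z).quot N hN)) from h m
    intro m
    induction m using Finsupp.induction_linear with
    | zero => exact (map_zero q).symm ▸ Submodule.zero_mem _
    | add a b ha hb => exact (map_add q a b).symm ▸ Submodule.add_mem _ ha hb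
    | single i c =>
      have h1 : (Finsupp.single i c : ℕ →₀ k) = (c • pointBasis k z i : pointModule k z) := by
        change _ = c • (Finsupp.single i 1 : ℕ →₀ k)
        simp
      rw [h1, map_smul]
      refine Submodule.smul_mem _ _ ?_
      by_cases hi : i < n
      · exact Submodule.subset_span
          (Finset.mem_coe.2 (Finset.mem_image_of_mem _ (Finset.mem_range.2 hi)))
      · have : q (pointBasis k z i) = 0 :=
          (Submodule.Quotient.mk_eq_zero _).2 (hmem i (by omega))
        rw [this]
        exact Submodule.zero_mem _
  intro x
  refine ⟨⊤, fun _ _ _ => trivial, ?_, trivial⟩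
  refine (Submodule.fg_iff_finiteDimensional _).1
    ⟨(Finset.range n).image fun i => q (pointBasis k z i), top_le_iff.1 fun y _ => ?_⟩
  obtain ⟨m, rfl⟩ := N.mkQ_surjective y
  exact hspan m

theorem not_Fdim_pointModule : ¬ Fdim k (pointModule k z) := fun h => by
  obtain ⟨N, -, hfd, hm⟩ := h (pointBasis k z 0)
  have h0 := pointModule_torsionFree z N hfd _ hm
  have : pointRepr z (pointBasis k z 0) 0 = 0 := by rw [h0]; rfl
  have h1 : pointRepr z (pointBasis k z 0) 0 = 1 := Finsupp.single_eq_same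
  exact one_ne_zero (h1.symm.trans this)

/-- The element lies in a finite dimensional submodule of the kernel of `s`, and the image of that
under `f` is a finite dimensional submodule of a point module. This transfers vanishing from one leg
of a roof to the other. -/
theorem eq_zero_of_Fdim_ker {X : GrB k} (f : X ⟶ pointModule k z)
    {Y : GrB k} (s : X ⟶ Y) (hs : (Fdim k).monoModSerre s) {x : X} (hx : s.lin x = 0) :
    f.lin x = 0 := by
  obtain ⟨N, -, hfd, hm⟩ := (monoModSerre_iff_ker s).1 hs (⟨x, hx⟩ : LinearMap.ker s.lin)
  let h : X.sub _ (isHomogeneous_ker s) ⟶ pointModule k z := subι X _ (isHomogeneous_ker s) ≫ f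
  refine pointModule_torsionFree z (N.map h.lin) ?_ _ ⟨_, hm, rfl⟩
  let g' : N.restrictScalars k →ₗ[k] (N.map h.lin).restrictScalars k :=
    { toFun := fun y => ⟨h.lin y.1, ⟨y.1, y.2, rfl⟩⟩
      map_add' := fun a b => Subtype.ext (map_add h.lin _ _)
      map_smul' := fun c a => Subtype.ext (lin_smul h c _) }
  refine Module.Finite.of_surjective g' ?_
  rintro ⟨_, y, hy, rfl⟩
  exact ⟨⟨y, hy⟩, rfl⟩

/-- This is the source of simplicity: the image contains all `e_i` from some index on, so the
cokernel is finite dimensional. -/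
theorem epiModSerre_of_ne_zero {X : GrB k} (f : X ⟶ pointModule k z) (hf : f ≠ 0) :
    (Fdim k).epiModSerre f := by
  rw [epiModSerre_iff_coker]
  obtain ⟨n, hn⟩ := pointModule_basis_mem z _ (isHomogeneous_range f) (by
    intro h
    rw [LinearMap.range_eq_bot] at h
    exact hf (Hom.ext h))
  exact Fdim_quot_of_basis_mem z _ _ hn

open ObjectProperty SerreClassLocalization in
theorem simple_betaStar_pointModule : Simple ((betaStar k).obj (pointModule k z)) where
  mono_isIso_iff_nonzero {Y} f _ := by
    have := Localization.essSurj (betaStar k) (Fdim k).isoModSerre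
    constructor
    · intro _ h0
      have h1 : IsZero ((betaStar k).obj (pointModule k z)) := by
        rw [IsZero.iff_id_eq_zero]
        calc 𝟙 _ = inv f ≫ f := (IsIso.inv_hom_id f).symm
          _ = inv f ≫ 0 := congrArg _ h0
          _ = 0 := comp_zero
      exact not_Fdim_pointModule z ((isZero_obj_iff (betaStar k) (Fdim k) _).1 h1)
    · intro hf
      let e := (betaStar k).objObjPreimageIso Y
      -- The morphism `f` is replaced by the numerator `φ.f` of a fraction. It is mono modulo `Fdim`
      -- because `f` is mono, and epi modulo `Fdim` because it is nonzero.
      obtain ⟨φ, hφ⟩ := Localization.exists_rightFraction (betaStar k) (Fdim k).isoModSerre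
        (X := (betaStar k).objPreimage Y) (Y := pointModule k z) (e.hom ≫ f)
      have hs : IsIso ((betaStar k).map φ.s) :=
        Localization.inverts (betaStar k) (Fdim k).isoModSerre _ φ.hs
      have h1 : (betaStar k).map φ.s ≫ e.hom ≫ f = (betaStar k).map φ.f := by
        rw [hφ]
        exact MorphismProperty.RightFraction.map_s_comp_map _ _ _
      have hg : φ.f ≠ 0 := by
        intro h
        rw [h, Functor.map_zero] at h1
        apply hf
        rw [← cancel_epi e.hom, ← cancel_epi ((betaStar k).map φ.s), h1, comp_zero, comp_zero]
      have hm : Mono ((betaStar k).map φ.f) := by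
        rw [← h1]; infer_instance
      have hi : IsIso ((betaStar k).map φ.f) :=
        (isIso_map_iff (betaStar k) (Fdim k) φ.f).2
          ⟨(mono_map_iff (betaStar k) (Fdim k) φ.f).1 hm, epiModSerre_of_ne_zero z _ hg⟩
      have h2 : f = e.inv ≫ inv ((betaStar k).map φ.s) ≫ (betaStar k).map φ.f := by
        rw [← h1]; simp
      rw [h2]
      infer_instance

instance simple_pointSheaf : Simple (pointSheaf k z) := simple_betaStar_pointModule z

variable (z' : PenroseSeq)

/-- If the range were zero, the point module would embed into the cokernel and lie in `Fdim`. Taking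
the component of degree `n` makes the preimage of `e_n` homogeneous. -/
theorem basis_mem_range_of_epiModSerre {X : GrB k} (s : X ⟶ pointModule k z)
    (hs : (Fdim k).epiModSerre s) : ∃ n : ℕ, ∃ x ∈ X.deg (n : ℤ), s.lin x = pointBasis k z n := by
  have hne : LinearMap.range s.lin ≠ ⊥ := by
    intro h
    rw [epiModSerre_iff_coker] at hs
    let q := quotπ (pointModule k z) _ (isHomogeneous_range s)
    have hq : Mono q := by
      refine Preadditive.mono_of_cancel_zero _ fun {W} g hg => ?_
      ext w
      have h1 : g.lin w ∈ LinearMap.range s.lin :=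
        (Submodule.Quotient.mk_eq_zero _).1 (congrArg (fun h => Hom.lin h w) hg)
      rw [h] at h1
      exact (Submodule.mem_bot _).1 h1
    exact not_Fdim_pointModule z (Fdim_of_mono q hs)
  obtain ⟨n, x, hx⟩ := pointModule_basis_mem z _ (isHomogeneous_range s) hne
  refine ⟨n, X.proj n x, X.proj_mem _ _, ?_⟩
  rw [← proj_lin, hx, (pointModule k z).proj_of_mem (pointBasis_mem_deg z n)]

open ObjectProperty SerreClassLocalization in
theorem equivalent_of_iso
    (e : (betaStar k).obj (pointModule k z) ≅ (betaStar k).obj (pointModule k z')) : z.Equivalent z' := by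
  obtain ⟨φ, hφ⟩ := Localization.exists_rightFraction (betaStar k) (Fdim k).isoModSerre
    (X := pointModule k z) (Y := pointModule k z') e.hom
  obtain ⟨s, hs, g⟩ := φ
  have hsi : IsIso ((betaStar k).map s) :=
    Localization.inverts (betaStar k) (Fdim k).isoModSerre _ hs
  have h1 : (betaStar k).map s ≫ e.hom = (betaStar k).map g := by
    rw [hφ]
    exact MorphismProperty.RightFraction.map_s_comp_map ⟨s, hs, g⟩ (betaStar k) _
  have hg : (Fdim k).isoModSerre g := by
    rw [← isIso_map_iff (betaStar k) (Fdim k), ← h1]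
    exact IsIso.comp_isIso
  obtain ⟨m, x, hx, hsx⟩ := basis_mem_range_of_epiModSerre z s hs.2
  obtain ⟨c, hgx⟩ : ∃ c : k, g.lin x = c • pointBasis k z' m :=
    ⟨_, pointModule_eq_smul_basis z' (g.map_deg _ _ hx)⟩
  have hc : c ≠ 0 := by
    intro h
    rw [h, zero_smul] at hgx
    have h2 := eq_zero_of_Fdim_ker z s g hg.1 hgx
    rw [hsx] at h2
    have h3 : pointRepr z (pointBasis k z m) m = 1 := Finsupp.single_eq_same
    rw [h2] at h3
    exact zero_ne_one h3
  -- The element `y` lies over multiples of `e_n` in both modules. Multiplying it by the second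
  -- generator gives zero on one side exactly if it gives zero on the other.
  have key : ∀ n, m ≤ n → (((z n : ℕ) : k) = 0 ↔ ((z' n : ℕ) : k) = 0) := by
    intro n hn
    obtain ⟨j, rfl⟩ := Nat.exists_eq_add_of_le hn
    set y := (gen k 0 + gen k 1) ^ j • x with hy
    have hsy : s.lin (gen k 1 • y) = ((z (m + j) : ℕ) : k) • pointBasis k z (m + j + 1) := by
      rw [map_smul, hy, map_smul, hsx, shift_pow_smul_basis, y_smul_pointBasis]
    have hgy : g.lin (gen k 1 • y) = (c * ((z' (m + j) : ℕ) : k)) • pointBasis k z' (m + j + 1) := by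
      have : g.lin y = c • pointBasis k z' (m + j) := by
        rw [hy, map_smul, hgx, smul_comm, shift_pow_smul_basis]
      rw [map_smul, this, smul_comm, y_smul_pointBasis, smul_smul]
    have hne : ∀ (w : PenroseSeq) (b : k) (i : ℕ), b • pointBasis k w i = 0 → b = 0 := by
      intro w b i h
      have h3 : pointRepr w (b • pointBasis k w i) i = b := by
        change b * (Finsupp.single i 1 : ℕ →₀ k) i = b
        simp
      rw [h] at h3
      exact h3.symm
    constructor
    · intro h
      rw [h, zero_smul] at hsy
      have := eq_zero_of_Fdim_ker z' g s hs.1 hsy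
      rw [hgy] at this
      exact (mul_eq_zero.1 (hne _ _ _ this)).resolve_left hc
    · intro h
      rw [h, mul_zero, zero_smul] at hgy
      have := eq_zero_of_Fdim_ker z s g hg.1 hgy
      rw [hsy] at this
      exact hne _ _ _ this
  refine ⟨m, fun n hn => ?_⟩
  have h2 : ∀ a b : Fin 2, ((((a : ℕ) : k) = 0) ↔ (((b : ℕ) : k) = 0)) → a = b := by
    intro a b h
    have ha : a = 0 ∨ a = 1 := by omega
    have hb : b = 0 ∨ b = 1 := by omega
    rcases ha with rfl | rfl <;> rcases hb with rfl | rfl <;> simp at h ⊢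
  exact h2 _ _ (key n hn)

/-- The map of truncated point modules that sends `e_i` to `e_i`. -/
theorem exists_truncation (m : ℕ) (h : ∀ n, m ≤ n → z n = z' n) :
    ∃ (X : GrB k) (s : X ⟶ pointModule k z) (g : X ⟶ pointModule k z'),
      (Fdim k).isoModSerre s ∧ (Fdim k).isoModSerre g := by
  let N : Submodule k (pointModule k z) := Finsupp.supported k k {i : ℕ | m ≤ i}
  have hgen : ∀ i, ∀ x ∈ N, gen k i • x ∈ N := by
    intro i x hx
    have hx' : ∀ j, j < m → pointRepr z x j = 0 := fun j hj => by
      by_contra h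
      exact absurd ((Finsupp.mem_supported k _).1 hx (Finsupp.mem_support_iff.2 h))
        (by simpa using hj)
    refine (Finsupp.mem_supported k _).2 fun j hj => ?_
    have hj' : pointRepr z (gen k i • x) j ≠ 0 := Finsupp.mem_support_iff.1 hj
    by_contra hjm
    have hjm : j < m := by simpa using hjm
    rcases j with _ | j
    · apply hj'
      change (pointAction k z (gen k i) (pointRepr z x)) 0 = 0
      rw [pointAction_gen]
      generalize pointRepr z x = x
      induction x using Finsupp.induction_linear with
      | zero => simp
      | add a b ha hb => rw [map_add, Finsupp.add_apply, ha, hb, add_zero]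
      | single j c => rw [pointGen_single, Finsupp.single_eq_of_ne (by omega)]
    · rw [gen_smul_repr, hx' j (by omega), mul_zero] at hj'
      exact hj' rfl
  let NB : Submodule (B k) (pointModule k z) :=
    { N with smul_mem' := fun b x hx => smul_mem_of_gen N hgen b x hx }
  have hrepr : ∀ x ∈ NB, ∀ j, j < m → pointRepr z x j = 0 := fun x hx j hj => by
    by_contra h
    exact absurd ((Finsupp.mem_supported k _).1 hx (Finsupp.mem_support_iff.2 h))
      (by simpa using hj)
  have hproj : ∀ (x : pointModule k z) (n : ℤ),
      (pointModule k z).proj n x = (Finsupp.filter (fun i : ℕ => (i : ℤ) = n) x : ℕ →₀ k) := by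
    intro x n
    induction x using (pointModule k z).induction_on with
    | h j x hx =>
      have hx' := (mem_pointDeg k (m := pointRepr z x)).1 hx
      by_cases hj : j = n
      · subst hj
        rw [(pointModule k z).proj_of_mem hx]
        exact ((Finsupp.filter_eq_self_iff _ (pointRepr z x)).2
          fun i hi => by_contra fun h => hi (hx' i h)).symm
      · rw [(pointModule k z).proj_of_mem_ne hj hx]
        exact ((Finsupp.filter_eq_zero_iff _ (pointRepr z x)).2 fun i hi =>
          hx' i fun h => hj (h.symm.trans hi)).symm
    | hadd a b ha hb =>
      rw [map_add, ha, hb]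
      exact (Finsupp.filter_add (v := pointRepr z a) (v' := pointRepr z b)).symm
  have hhom : (pointModule k z).IsHomogeneous NB := by
    intro x hx n
    rw [hproj]
    refine (Finsupp.mem_supported k _).2 fun j hj => ?_
    have hj' : j ∈ (Finsupp.filter (fun i : ℕ => (i : ℤ) = n) (pointRepr z x)).support := hj
    rw [Finsupp.support_filter] at hj'
    exact (Finsupp.mem_supported k _).1 hx (Finset.mem_filter.1 hj').1
  let X := (pointModule k z).sub NB hhom
  let s : X ⟶ pointModule k z := subι _ NB hhom
  -- the identity of `ℕ →₀ k` commutes with the two actions on the truncation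
  let id' : pointModule k z → pointModule k z' := fun x => (pointRepr z x : ℕ →₀ k)
  have hact : ∀ b : B k, ∀ x ∈ NB, id' (b • x) = b • id' x := by
    intro b
    induction b using B_induction with
    | hs c =>
      intro x _
      rw [algebraMap_smul, algebraMap_smul]
      rfl
    | hadd a b ha hb =>
      intro x hx
      rw [add_smul, add_smul, ← ha x hx, ← hb x hx]
      rfl
    | hgen i =>
      intro x hx
      have h1 : id' (gen k i • x) = pointGen k z i (pointRepr z x) := by
        change pointAction k z (gen k i) (pointRepr z x) = _
        rw [pointAction_gen]
      have h2 : gen k i • id' x = pointGen k z' i (pointRepr z x) := by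
        change pointAction k z' (gen k i) (pointRepr z x) = _
        rw [pointAction_gen]
      rw [h1, h2]
      have hx' : pointRepr z x ∈ Finsupp.supported k k {i : ℕ | m ≤ i} := hx
      rw [Finsupp.supported_eq_span_single] at hx'
      generalize pointRepr z x = v at hx'
      induction hx' using Submodule.span_induction with
      | mem y hy =>
        obtain ⟨j, hj, rfl⟩ := hy
        rw [pointGen_single, pointGen_single]
        simp only [pointCoeff, h j hj]
        rfl
      | zero => rw [map_zero, map_zero]
      | add a b _ _ ha hb => rw [map_add, map_add, ha, hb]
      | smul c a _ ha => rw [map_smul, map_smul, ha]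
    | hmul a b ha hb =>
      intro x hx
      rw [mul_smul, mul_smul, ← hb x hx, ha _ (NB.smul_mem b hx)]
  let g : X ⟶ pointModule k z' :=
    ⟨{ toFun := fun x => id' x.1
       map_add' := fun _ _ => rfl
       map_smul' := fun b x => hact b x.1 x.2 }, fun _ _ hx => hx⟩
  -- Both legs are injective maps from the truncation into a point module. They are nonzero because
  -- `e_m` is in the truncation, hence also epi modulo `Fdim`.
  have hcok : ∀ (w : PenroseSeq) (f : X ⟶ pointModule k w)
      (hinj : ∀ x, f.lin x = 0 → x = 0), (Fdim k).isoModSerre f := by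
    intro w f hinj
    have hem : pointBasis k z m ∈ NB := Finsupp.single_mem_supported k _ (le_refl m)
    have hfne : f ≠ 0 := by
      intro h0
      have h1 := congrArg Subtype.val (hinj ⟨_, hem⟩ (by rw [h0]; rfl))
      have h3 : pointRepr z (pointBasis k z m) m = 1 := Finsupp.single_eq_same
      have h1 : pointBasis k z m = 0 := h1
      rw [h1] at h3
      exact zero_ne_one h3
    have hmono : Mono f := by
      refine Preadditive.mono_of_cancel_zero _ fun {W} a ha => ?_
      ext y
      exact hinj _ (congrArg (fun h => Hom.lin h y) ha)
    exact ⟨(Fdim k).monoModSerre_of_mono f, epiModSerre_of_ne_zero w f hfne⟩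
  exact ⟨X, s, g, hcok z s fun x hx => Subtype.ext hx, hcok z' g fun x hx => Subtype.ext hx⟩

theorem nonempty_iso_iff_equivalent :
    Nonempty (pointSheaf k z ≅ pointSheaf k z') ↔ z.Equivalent z' := by
  refine ⟨fun ⟨e⟩ => equivalent_of_iso z z' e, fun ⟨m, h⟩ => ?_⟩
  obtain ⟨X, s, g, hs, hg⟩ := exists_truncation (k := k) z z' m h
  have h1 := Localization.inverts (betaStar k) (Fdim k).isoModSerre _ hs
  have h2 := Localization.inverts (betaStar k) (Fdim k).isoModSerre _ hg
  exact ⟨(@asIso _ _ _ _ _ h1).symm ≪≫ @asIso _ _ _ _ _ h2⟩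

end Algebra

end PenroseCurve

end

/-! ### The golden ratio, tenth roots of unity, and coordinates of triangles. -/

noncomputable section

namespace PenroseCurve

/-- The golden ratio, as a constant that is not unfolded by `simp`. -/
def gold : ℝ := tau

theorem tau_eq_gold : tau = gold := rfl

theorem gold_sq : gold ^ 2 = gold + 1 := Real.goldenRatio_sq

theorem one_lt_gold : 1 < gold := Real.one_lt_goldenRatio

theorem gold_sq_complex : (gold : ℂ) ^ 2 = gold + 1 := by exact_mod_cast gold_sq

theorem gold_gt : 1.6 < gold := by
  nlinarith [gold_sq, one_lt_gold]

theorem gold_lt : gold < 1.62 := by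
  nlinarith [gold_sq, one_lt_gold]

theorem gold_pos : 0 < gold := Real.goldenRatio_pos

theorem gold_ne_zero_complex : (gold : ℂ) ≠ 0 := by exact_mod_cast gold_pos.ne'

/-- `ε` is one of the two primitive tenth roots of unity `exp (± π i / 5)`. -/
def IsRoot (ε : ℂ) : Prop := ε ^ 2 = gold * ε - 1

/-- The discriminant `τ² - 4` is negative, so the roots are not real, and the imaginary part of the
equation gives the real part `τ / 2`. -/
theorem IsRoot.parts {ε : ℂ} (h : IsRoot ε) : ε.re = gold / 2 ∧ ε.im ^ 2 = 1 - gold ^ 2 / 4 := by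
  have h1 := congrArg Complex.re h
  have h2 := congrArg Complex.im h
  simp [pow_two] at h1 h2
  have h3 : ε.im ≠ 0 := by
    intro h0
    rw [h0] at h1
    nlinarith [sq_nonneg (ε.re - gold / 2), gold_lt, gold_pos]
  have h4 : ε.re = gold / 2 := by
    have : ε.im * (2 * ε.re - gold) = 0 := by linarith
    have := (mul_eq_zero.1 this).resolve_left h3
    linarith
  refine ⟨h4, ?_⟩
  rw [h4] at h1
  nlinarith

theorem IsRoot.im_ne_zero {ε : ℂ} (h : IsRoot ε) : ε.im ≠ 0 := by
  intro h0
  have := h.parts.2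
  rw [h0] at this
  nlinarith [gold_lt, gold_pos]

theorem IsRoot.conj_eq {ε : ℂ} (h : IsRoot ε) : (starRingEnd ℂ) ε = gold - ε := by
  apply Complex.ext
  · simp [h.parts.1]
    ring
  · simp

theorem IsRoot.norm {ε : ℂ} (h : IsRoot ε) : ‖ε‖ = 1 := by
  have h1 : ‖ε‖ ^ 2 = 1 := by
    rw [← Complex.normSq_eq_norm_sq, Complex.normSq_apply]
    obtain ⟨h1, h2⟩ := h.parts
    rw [h1]
    linear_combination h2
  nlinarith [norm_nonneg ε]

theorem IsRoot.ne_zero {ε : ℂ} (h : IsRoot ε) : ε ≠ 0 := by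
  intro h0
  have := h.norm
  rw [h0] at this
  simp at this

theorem IsRoot.conj {ε : ℂ} (h : IsRoot ε) : IsRoot (gold - ε) := by
  unfold IsRoot at *
  linear_combination h

theorem IsRoot.eq_or {ε ε' : ℂ} (h : IsRoot ε) (h' : IsRoot ε') : ε' = ε ∨ ε' = gold - ε := by
  unfold IsRoot at *
  have : (ε' - ε) * (ε' - (gold - ε)) = 0 := by linear_combination h' - h
  rcases mul_eq_zero.1 this with h | h
  · exact Or.inl (sub_eq_zero.1 h)
  · exact Or.inr (sub_eq_zero.1 h)

theorem IsRoot.ne_conj {ε : ℂ} (h : IsRoot ε) : ε ≠ gold - ε := by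
  intro h0
  have h1 := congrArg Complex.im h0
  simp at h1
  exact h.im_ne_zero (by linarith)

theorem isRoot_of_norm {ε : ℂ} (h1 : ‖ε‖ = 1) (h2 : 2 * ε.re = gold) : IsRoot ε := by
  have h3 : ε.re ^ 2 + ε.im ^ 2 = 1 := by
    have : ‖ε‖ ^ 2 = 1 := by rw [h1]; norm_num
    rw [← Complex.normSq_eq_norm_sq, Complex.normSq_apply] at this
    linarith
  unfold IsRoot
  apply Complex.ext
  · simp [pow_two]; linear_combination ε.re * h2 - h3
  · simp [pow_two]; linear_combination ε.im * h2

/-- The root with positive imaginary part. -/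
def zeta : ℂ := ⟨gold / 2, √(1 - gold ^ 2 / 4)⟩

theorem isRoot_zeta : IsRoot zeta := by
  have h : 0 ≤ 1 - gold ^ 2 / 4 := by nlinarith [gold_lt, gold_pos]
  have := Real.mul_self_sqrt h
  unfold IsRoot zeta
  apply Complex.ext
  · simp [pow_two] at *; nlinarith
  · simp [pow_two]; ring

/-- A position of a triangular tile: it has the vertices `t`, `h = t + d` and `w`, where `w` is in
the direction that is `d` turned by `ε`. -/
@[ext]
structure Frame where
  c : Bool
  ε : ℂ
  t : ℂ
  d : ℂ

namespace Frame

/-- The ratio `|t w| / |t h|`. -/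
def kap (f : Frame) : ℝ := if f.c then 1 else gold

/-- The inverse of `kap`. -/
def sig (f : Frame) : ℝ := if f.c then 1 else gold - 1

@[simp] theorem kap_true (ε t d : ℂ) : kap ⟨true, ε, t, d⟩ = 1 := rfl
@[simp] theorem kap_false (ε t d : ℂ) : kap ⟨false, ε, t, d⟩ = gold := rfl
@[simp] theorem sig_true (ε t d : ℂ) : sig ⟨true, ε, t, d⟩ = 1 := rfl
@[simp] theorem sig_false (ε t d : ℂ) : sig ⟨false, ε, t, d⟩ = gold - 1 := rfl

theorem sig_mul_kap (f : Frame) : f.sig * f.kap = 1 := by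
  unfold sig kap
  split
  · norm_num
  · linarith [gold_sq]

theorem sig_pos (f : Frame) : 0 < f.sig := by
  unfold sig
  split
  · norm_num
  · linarith [gold_gt]

theorem kap_pos (f : Frame) : 0 < f.kap := by
  unfold kap
  split
  · norm_num
  · exact gold_pos

/-- The point with coordinates `a`, `b` in the basis `d`, `ε d`. -/
def pt (f : Frame) (a b : ℝ) : ℂ := f.t + (a + b * f.ε) * f.d

/-- The tile at the position `f`. -/
def tile (f : Frame) : TriTile := ⟨f.c, f.t, f.t + f.d, f.t + f.kap * f.ε * f.d⟩

/-- The vertices `t`, `h`, `w`. -/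
def vtx (f : Frame) : Fin 3 → ℂ := ![f.t, f.t + f.d, f.t + f.kap * f.ε * f.d]

/-- A nondegenerate frame. -/
structure Valid (f : Frame) : Prop where
  root : IsRoot f.ε
  ne : f.d ≠ 0

/-- The second coordinate in the basis `d`, `ε d`. -/
def cb (f : Frame) (x : ℂ) : ℝ := ((x - f.t) / f.d).im / f.ε.im

/-- The first coordinate in the basis `d`, `ε d`. -/
def ca (f : Frame) (x : ℂ) : ℝ := ((x - f.t) / f.d).re - f.cb x * f.ε.re

/-- The barycentric coordinates with respect to `t`, `h`, `w`. -/
def co (f : Frame) (i : Fin 3) (x : ℂ) : ℝ :=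
  (![1 - f.ca x - f.sig * f.cb x, f.ca x, f.sig * f.cb x] : Fin 3 → ℝ) i

variable {f g : Frame}

theorem pt_coord (hf : f.Valid) (x : ℂ) : f.pt (f.ca x) (f.cb x) = x := by
  have h1 : ((f.ca x : ℂ) + f.cb x * f.ε) = (x - f.t) / f.d := by
    have := hf.root.im_ne_zero
    apply Complex.ext
    · simp [ca]
    · simp [cb]
      field_simp
  rw [pt, h1, div_mul_cancel₀ _ hf.ne]
  ring

theorem cb_pt (hf : f.Valid) (a b : ℝ) : f.cb (f.pt a b) = b := by
  have h1 : (f.pt a b - f.t) / f.d = a + b * f.ε := by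
    rw [pt]
    field_simp [hf.ne]
    ring
  have := hf.root.im_ne_zero
  rw [cb, h1]
  simp
  field_simp

theorem ca_pt (hf : f.Valid) (a b : ℝ) : f.ca (f.pt a b) = a := by
  have h1 : (f.pt a b - f.t) / f.d = a + b * f.ε := by
    rw [pt]
    field_simp [hf.ne]
    ring
  rw [ca, cb_pt hf, h1]
  simp

theorem co_pt (hf : f.Valid) (a b : ℝ) (i : Fin 3) :
    f.co i (f.pt a b) = (![1 - a - f.sig * b, a, f.sig * b] : Fin 3 → ℝ) i := by
  rw [co, ca_pt hf, cb_pt hf]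

theorem exists_pt (hf : f.Valid) (x : ℂ) : ∃ a b : ℝ, x = f.pt a b :=
  ⟨_, _, (pt_coord hf x).symm⟩

theorem co_zero (f : Frame) : f.co 0 = fun x => 1 - f.ca x - f.sig * f.cb x := rfl

theorem co_one (f : Frame) : f.co 1 = f.ca := rfl

theorem co_two (f : Frame) : f.co 2 = fun x => f.sig * f.cb x := rfl

theorem co_sum (x : ℂ) : f.co 0 x + f.co 1 x + f.co 2 x = 1 := by
  simp only [co_zero, co_one, co_two]
  ring

theorem vtx_pt (f : Frame) : f.vtx = ![f.pt 0 0, f.pt 1 0, f.pt 0 f.kap] := by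
  simp [vtx, pt]

theorem co_vtx (hf : f.Valid) (i j : Fin 3) : f.co i (f.vtx j) = if i = j then 1 else 0 := by
  have := sig_mul_kap f
  rw [vtx_pt]
  fin_cases j <;> fin_cases i <;> simp [co_pt hf, this]

theorem co_comb (x y : ℂ) (a b : ℝ) (hab : a + b = 1) (i : Fin 3) :
    f.co i (a * x + b * y) = a * f.co i x + b * f.co i y := by
  have h : (a * x + b * y - f.t) / f.d = a * ((x - f.t) / f.d) + b * ((y - f.t) / f.d) := by
    have : (a : ℂ) + b = 1 := by exact_mod_cast hab
    rw [show a * x + b * y - f.t = a * (x - f.t) + b * (y - f.t) by linear_combination f.t * this]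
    ring
  have hb : f.cb (a * x + b * y) = a * f.cb x + b * f.cb y := by
    rw [cb, h]; simp [cb]; ring
  have ha : f.ca (a * x + b * y) = a * f.ca x + b * f.ca y := by
    rw [ca, hb, h]; simp [ca]; ring
  fin_cases i
  · simp only [co, hb, ha]
    simp
    linear_combination -hab
  · simp [co, ha]
  · simp [co, hb]; ring

theorem continuous_co (f : Frame) (i : Fin 3) : Continuous (f.co i) := by
  have h1 : Continuous f.cb := by unfold cb; fun_prop
  have h2 : Continuous f.ca := by unfold ca; fun_prop
  fin_cases i
  · simp only [Fin.zero_eta, co_zero]; fun_prop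
  · simp only [Fin.mk_one, co_one]; fun_prop
  · simp only [Fin.reduceFinMk, co_two]; fun_prop

theorem eq_sum_vtx (hf : f.Valid) (x : ℂ) :
    x = f.co 0 x * f.t + f.co 1 x * (f.t + f.d) + f.co 2 x * (f.t + f.kap * f.ε * f.d) := by
  conv_lhs => rw [← pt_coord hf x]
  have : (f.sig : ℂ) * f.kap = 1 := by exact_mod_cast sig_mul_kap f
  simp [co, pt]
  linear_combination -f.cb x * f.ε * f.d * this

theorem mem_region (hf : f.Valid) {x : ℂ} : x ∈ f.tile.region ↔ ∀ i, 0 ≤ f.co i x := by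
  constructor
  · intro hx i
    have hc : Convex ℝ {x | 0 ≤ f.co i x} := by
      intro x hx y hy a b ha hb hab
      simp only [Set.mem_ofPred_eq, Complex.real_smul] at *
      rw [co_comb _ _ _ _ hab]
      positivity
    refine convexHull_min ?_ hc hx
    have hv : ∀ j, 0 ≤ f.co i (f.vtx j) := fun j => by
      rw [co_vtx hf]; split <;> norm_num
    intro y hy
    rcases hy with rfl | rfl | rfl
    · exact hv 0
    · exact hv 1
    · exact hv 2
  · intro h
    rw [eq_sum_vtx hf x, TriTile.region]
    have hs := f.co_sum x
    have hconv := convex_convexHull ℝ ({f.tile.t, f.tile.h, f.tile.w} : Set ℂ)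
    have := hconv.sum_mem (t := Finset.univ) (w := fun i => f.co i x) (z := f.vtx)
      (fun i _ => h i) (by simp [Fin.sum_univ_three, hs])
      (fun i _ => subset_convexHull ℝ _ (by fin_cases i <;> simp [tile, vtx]))
    simpa [Fin.sum_univ_three, vtx] using this

theorem isClosed_region (hf : f.Valid) : IsClosed f.tile.region := by
  have : f.tile.region = ⋂ i, {x | 0 ≤ f.co i x} := by
    ext x
    simp [mem_region hf]
  rw [this]
  exact isClosed_iInter fun i => isClosed_le continuous_const (f.continuous_co i)

theorem mem_interior (hf : f.Valid) {x : ℂ} :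
    x ∈ interior f.tile.region ↔ ∀ i, 0 < f.co i x := by
  constructor
  · intro hx i
    -- Moving away from the vertex `i` by the factor `1 + r` changes the coordinate `i` to `(1 + r)
    -- * co i x - r`. It can stay nonnegative for some `r > 0` only if `co i x` is positive.
    have h0 : Filter.Tendsto (fun r : ℝ => x + r * (x - f.vtx i)) (nhds 0) (nhds x) := by
      have : Continuous (fun r : ℝ => x + r * (x - f.vtx i)) := by fun_prop
      simpa using this.tendsto 0
    have h1 := h0.eventually (mem_interior_iff_mem_nhds.1 hx)
    have h2 : ∀ᶠ r : ℝ in nhdsWithin 0 (Set.Ioi 0), x + r * (x - f.vtx i) ∈ f.tile.region :=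
      h1.filter_mono nhdsWithin_le_nhds
    obtain ⟨r, hr, hr0⟩ := (h2.and self_mem_nhdsWithin).exists
    have hr0 : 0 < r := hr0
    have h3 := (mem_region hf).1 hr i
    have h4 : x + r * (x - f.vtx i) = ((1 + r : ℝ) : ℂ) * x + ((-r : ℝ) : ℂ) * f.vtx i := by
      push_cast; ring
    rw [h4, co_comb _ _ _ _ (by ring), co_vtx hf, if_pos rfl] at h3
    by_contra h5
    push Not at h5
    nlinarith
  · intro h
    have ho : IsOpen (⋂ i, {x | 0 < f.co i x}) :=
      isOpen_iInter_of_finite fun i => isOpen_lt continuous_const (f.continuous_co i)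
    refine interior_maximal (fun y hy => ?_) ho (Set.mem_iInter.2 h)
    exact (mem_region hf).2 fun i => (Set.mem_iInter.1 hy i).le

theorem eq_of_tile_eq (hf : f.Valid) (hg : g.Valid) (h : f.tile = g.tile) : f = g := by
  obtain ⟨c, ε, t, d⟩ := f
  obtain ⟨c', ε', t', d'⟩ := g
  simp only [tile, TriTile.mk.injEq] at h
  obtain ⟨rfl, rfl, h1, h2⟩ := h
  have hd : d = d' := by simpa using h1
  subst hd
  have hk : (kap ⟨c, ε, t, d⟩ : ℂ) ≠ 0 := by exact_mod_cast (kap_pos _).ne'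
  have he : kap ⟨c, ε, t, d⟩ = kap ⟨c, ε', t, d⟩ := rfl
  rw [← he] at h2
  have : ε = ε' := by
    have h3 : (kap ⟨c, ε, t, d⟩ : ℂ) * d * (ε - ε') = 0 := by linear_combination h2
    exact sub_eq_zero.1 ((mul_eq_zero.1 h3).resolve_left (mul_ne_zero hk hf.ne))
  subst this
  rfl

/-! ### Neighbors and parents -/

/-- The reflection of a tile in the side that is opposite to the vertex number `i`. -/
def mir (f : Frame) : Fin 3 → Frame := fun i =>
  if i = 2 then ⟨f.c, gold - f.ε, f.t, f.d⟩
  else if i = 1 then ⟨f.c, gold - f.ε, f.t, f.ε ^ 2 * f.d⟩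
  else if f.c then ⟨f.c, gold - f.ε, f.t + f.d + f.ε * f.d, -(f.ε * f.d)⟩
  else ⟨f.c, gold - f.ε, f.t + f.d + (gold - f.ε) * f.d, -((gold - f.ε) * f.d)⟩

/-- `Ex e f i g`: the tile `g` is of the type different from `f` and fits to `f` along the side
opposite to the vertex number `i` of `f`; `e` says if this is in a tiling of an even level. -/
inductive Ex : Bool → Frame → Fin 3 → Frame → Prop
  | even_acute_one (ε t d : ℂ) :
    Ex true ⟨true, ε, t, d⟩ 1 ⟨false, ε, t + ε * d, -((gold - 1) * d)⟩
  | even_obtuse_one (ε t d : ℂ) :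
    Ex true ⟨false, ε, t, d⟩ 1 ⟨true, ε, t + gold * ε * d, -(gold * d)⟩
  | even_acute_zero (ε t d : ℂ) :
    Ex true ⟨true, ε, t, d⟩ 0 ⟨false, ε, t + gold * ε * d, -((gold - 1) * ε * d)⟩
  | even_obtuse_zero (ε t d : ℂ) :
    Ex true ⟨false, ε, t, d⟩ 0 ⟨true, ε, t + gold ^ 2 * d, -(gold * (gold - ε) * d)⟩
  | odd_acute_two (ε t d : ℂ) : Ex false ⟨true, ε, t, d⟩ 2 ⟨false, gold - ε, t, d⟩
  | odd_obtuse_two (ε t d : ℂ) : Ex false ⟨false, ε, t, d⟩ 2 ⟨true, gold - ε, t, d⟩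
  | odd_acute_one (ε t d : ℂ) :
    Ex false ⟨true, ε, t, d⟩ 1 ⟨false, ε, t - (gold - ε) * d, (gold - ε) * d⟩
  | odd_obtuse_zero (ε t d : ℂ) :
    Ex false ⟨false, ε, t, d⟩ 0 ⟨true, ε, t + d, ε * d⟩

/-- `Par e f F`: the tile `f` of a tiling can be a part of the tile `F` of the composed tiling. -/
inductive Par : Bool → Frame → Frame → Prop
  | even_acute_large (ε t d : ℂ) : Par true ⟨true, ε, t, d⟩ ⟨false, ε, t, d⟩
  | even_acute_small (ε t d : ℂ) : Par true ⟨true, ε, t, d⟩ ⟨true, ε, t, d⟩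
  | even_obtuse (ε t d : ℂ) :
    Par true ⟨false, ε, t, d⟩ ⟨false, ε, t + gold ^ 2 * d, -(gold * (gold - ε) * d)⟩
  | odd_obtuse_large (ε t d : ℂ) :
    Par false ⟨false, ε, t, d⟩ ⟨true, gold - ε, t + gold * ε * d, -(gold * ε ^ 2 * d)⟩
  | odd_obtuse_small (ε t d : ℂ) : Par false ⟨false, ε, t, d⟩ ⟨false, ε, t, d⟩
  | odd_acute (ε t d : ℂ) :
    Par false ⟨true, ε, t, d⟩
      ⟨true, ε, t + ε * d + gold * (gold - ε) ^ 2 * d, -(gold * (gold - ε) ^ 2 * d)⟩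

/-- `g` fits to `f` along the side opposite to the vertex number `i`. -/
def Nbr (e : Bool) (f : Frame) (i : Fin 3) (g : Frame) : Prop := g = f.mir i ∨ Ex e f i g

/-- The length of the vector `d` for tiles of the given type, in a tiling of scale `s`. -/
def len (e : Bool) (s : ℝ) (c : Bool) : ℝ := if c || !e then gold * s else s

/-- The frames of tiles of a tiling of scale `s`. -/
structure Ok (e : Bool) (s : ℝ) (f : Frame) : Prop where
  root : IsRoot f.ε
  pos : 0 < s
  norm_d : ‖f.d‖ = len e s f.c

theorem len_pos (e : Bool) {s : ℝ} (hs : 0 < s) (c : Bool) : 0 < len e s c := by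
  have := gold_pos
  unfold len
  split <;> positivity

theorem Ok.valid {e : Bool} {s : ℝ} (h : Ok e s f) : f.Valid :=
  ⟨h.root, fun h0 => by
    have := len_pos e h.pos f.c
    rw [← h.norm_d, h0, norm_zero] at this
    exact lt_irrefl _ this⟩

theorem norm_gold : ‖(gold : ℂ)‖ = gold := by
  rw [Complex.norm_real, Real.norm_of_nonneg gold_pos.le]

theorem norm_gold_sub_one : ‖(gold : ℂ) - 1‖ = gold - 1 := by
  rw [← Complex.ofReal_one, ← Complex.ofReal_sub, Complex.norm_real,
    Real.norm_of_nonneg (by linarith [gold_gt])]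

theorem Ok.mir {e : Bool} {s : ℝ} (h : Ok e s f) (i : Fin 3) : Ok e s (f.mir i) := by
  obtain ⟨c, ε, t, d⟩ := f
  obtain ⟨h1, h2, h3⟩ := h
  have h4 := h1.norm
  have h5 := h1.conj.norm
  fin_cases i <;> cases c <;> refine ⟨h1.conj, h2, ?_⟩ <;> simp_all [Frame.mir]

theorem Ok.ex {e : Bool} {s : ℝ} (h : Ok e s f) {i : Fin 3} (hg : Ex e f i g) : Ok e s g := by
  obtain ⟨h1, h2, h3⟩ := h
  have h4 := h1.norm
  have h5 := h1.conj.norm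
  have h6 := norm_gold
  have h7 := norm_gold_sub_one
  have h8 := gold_sq
  cases hg <;>
    refine ⟨by first | exact h1 | exact h1.conj, h2, ?_⟩ <;>
    simp_all [len] <;> linear_combination s * h8

theorem Ok.nbr {e : Bool} {s : ℝ} (h : Ok e s f) {i : Fin 3} (hg : Nbr e f i g) : Ok e s g := by
  rcases hg with rfl | hg
  · exact h.mir i
  · exact h.ex hg

/-- The scale of the composed tiling. -/
def nextScale (e : Bool) (s : ℝ) : ℝ := if e then s else gold * s

theorem Ok.par {e : Bool} {s : ℝ} {F : Frame} (h : Ok e s f) (hF : Par e f F) :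
    Ok (!e) (nextScale e s) F := by
  obtain ⟨h1, h2, h3⟩ := h
  have h4 := h1.norm
  have h5 := h1.conj.norm
  have h6 := norm_gold
  have h8 := gold_sq
  have h9 := gold_pos
  cases hF <;>
    refine ⟨by first | exact h1 | exact h1.conj, by simp [nextScale]; positivity, ?_⟩ <;>
    simp_all [len, nextScale]

/-- A tile has at most two possible parents, and they have different types. Hence a sequence of
types determines the whole chain of ancestors. -/
theorem Par.eq_of_c_eq {e : Bool} {F F' : Frame} (h : Par e f F) (h' : Par e f F')
    (hc : F.c = F'.c) : F = F' := by
  cases h <;> cases h' <;> first | rfl | exact absurd hc (by simp)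

end Frame

end PenroseCurve

end

/-! ### Adjacent triangles and the points on their common side. -/

noncomputable section

namespace PenroseCurve

open Topology

namespace Frame

variable {f g F : Frame} {e : Bool} {s : ℝ}

theorem gold_mul_sub_one : gold * (gold - 1) = 1 := by linear_combination gold_sq

/-- The barycentric coordinates with respect to adjacent triangles. -/
structure Glued (f : Frame) (i : Fin 3) (g : Frame) (k l i' k' l' : Fin 3) (m p q : ℝ) : Prop where
  hk : k ≠ i
  hl : l ≠ i
  cover : ∀ j, j = i ∨ j = k ∨ j = l
  cover' : ∀ j, j = i' ∨ j = k' ∨ j = l'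
  pos : 0 < m
  coi : ∀ y, g.co i' y = -m * f.co i y
  cok : ∀ y, g.co k' y = f.co k y + p * f.co i y
  col : ∀ y, g.co l' y = f.co l y + q * f.co i y

/-- Points are `pt a b` with arbitrary real `a`, `b`, so it suffices to know the change of
coordinates `A`, `B` and to verify three identities. -/
theorem Glued.mk' (hf : f.Valid) (hg : g.Valid) {k l i i' k' l' : Fin 3} {m p q : ℝ}
    (A B : ℝ → ℝ → ℝ) (hAB : ∀ a b, f.pt a b = g.pt (A a b) (B a b))
    (hk : k ≠ i) (hl : l ≠ i) (cover : ∀ j, j = i ∨ j = k ∨ j = l)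
    (cover' : ∀ j, j = i' ∨ j = k' ∨ j = l') (pos : 0 < m)
    (h : ∀ a b, (![1 - A a b - g.sig * B a b, A a b, g.sig * B a b] : Fin 3 → ℝ) i' =
        -m * (![1 - a - f.sig * b, a, f.sig * b] : Fin 3 → ℝ) i ∧
      (![1 - A a b - g.sig * B a b, A a b, g.sig * B a b] : Fin 3 → ℝ) k' =
        (![1 - a - f.sig * b, a, f.sig * b] : Fin 3 → ℝ) k +
          p * (![1 - a - f.sig * b, a, f.sig * b] : Fin 3 → ℝ) i ∧
      (![1 - A a b - g.sig * B a b, A a b, g.sig * B a b] : Fin 3 → ℝ) l' =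
        (![1 - a - f.sig * b, a, f.sig * b] : Fin 3 → ℝ) l +
          q * (![1 - a - f.sig * b, a, f.sig * b] : Fin 3 → ℝ) i) :
    Glued f i g k l i' k' l' m p q := by
  have hco : ∀ y j, g.co j y = (![1 - A (f.ca y) (f.cb y) - g.sig * B (f.ca y) (f.cb y),
      A (f.ca y) (f.cb y), g.sig * B (f.ca y) (f.cb y)] : Fin 3 → ℝ) j := by
    intro y j
    conv_lhs => rw [← pt_coord hf y, hAB, co_pt hg]
  refine ⟨hk, hl, cover, cover', pos, fun y => ?_, fun y => ?_, fun y => ?_⟩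
  · rw [hco]; exact (h _ _).1
  · rw [hco]; exact (h _ _).2.1
  · rw [hco]; exact (h _ _).2.2

theorem mir_two (f : Frame) : f.mir 2 = ⟨f.c, gold - f.ε, f.t, f.d⟩ := rfl

theorem mir_one (f : Frame) : f.mir 1 = ⟨f.c, gold - f.ε, f.t, f.ε ^ 2 * f.d⟩ := rfl

theorem mir_zero_acute (ε t d : ℂ) :
    mir ⟨true, ε, t, d⟩ 0 = ⟨true, gold - ε, t + d + ε * d, -(ε * d)⟩ := rfl

theorem mir_zero_obtuse (ε t d : ℂ) : mir ⟨false, ε, t, d⟩ 0 =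
    ⟨false, gold - ε, t + d + (gold - ε) * d, -((gold - ε) * d)⟩ := rfl

theorem mir_glued (hf : Ok e s f) (i : Fin 3) :
    ∃ k l p q, Glued f i (f.mir i) k l i k l 1 p q := by
  have hv := hf.valid
  have hg := (hf.mir i).valid
  have hr : f.ε ^ 2 = gold * f.ε - 1 := hf.root
  have hs := tau_eq_gold ▸ gold_sq
  have hC := gold_sq_complex
  have h1 := gold_mul_sub_one
  have hR := gold_sq
  obtain ⟨c, ε, t, d⟩ := f
  simp only at hr
  fin_cases i
  · cases c
    · refine ⟨1, 2, gold ^ 2, 1 - gold, Glued.mk' hv hg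
        (fun a b => 1 - (a - 1) * gold - b * gold) (fun a b => (a - 1) + b * gold)
        (fun a b => ?_) (by decide) (by decide) (by decide) (by decide) (by norm_num)
        (fun a b => ⟨?_, ?_, ?_⟩)⟩
      · simp only [pt, Fin.zero_eta, mir_zero_obtuse]
        push_cast
        grind
      all_goals simp [mir_zero_obtuse]; grind
    · refine ⟨1, 2, 1, 1, Glued.mk' hv hg
        (fun a b => 1 - b) (fun a b => 1 - a)
        (fun a b => ?_) (by decide) (by decide) (by decide) (by decide) (by norm_num)
        (fun a b => ⟨?_, ?_, ?_⟩)⟩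
      · simp only [pt, Fin.zero_eta, mir_zero_acute]
        push_cast
        grind
      all_goals simp [mir_zero_acute]; try ring
  · refine ⟨0, 2, 2 - sig ⟨c, ε, t, d⟩ * gold, sig ⟨c, ε, t, d⟩ * gold, Glued.mk' hv hg
      (fun a b => -a) (fun a b => gold * a + b)
      (fun a b => ?_) (by decide) (by decide) (by decide) (by decide) (by norm_num)
      (fun a b => ⟨?_, ?_, ?_⟩)⟩
    · simp only [pt, Fin.mk_one, mir_one]
      push_cast
      grind
    all_goals cases c <;> simp [mir_one] <;> grind
  · refine ⟨0, 1, 2 - gold * kap ⟨c, ε, t, d⟩, gold * kap ⟨c, ε, t, d⟩, Glued.mk' hv hg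
      (fun a b => a + gold * b) (fun a b => -b)
      (fun a b => ?_) (by decide) (by decide) (by decide) (by decide) (by norm_num)
      (fun a b => ⟨?_, ?_, ?_⟩)⟩
    · simp only [pt, Fin.reduceFinMk, mir_two]
      push_cast
      grind
    all_goals cases c <;> simp [mir_two] <;> grind

/-- The constant `m` is the quotient of the heights of `f` and `g` over the common side: `τ` or `τ -
1 = τ⁻¹` here, and 1 for mirror images. As barycentric coordinates have sum 1, `p + q = 1 + m`. -/
theorem Ex.glued (hf : Ok e s f) {i : Fin 3} (h : Ex e f i g) :
    ∃ k l i' k' l' m p q, Glued f i g k l i' k' l' m p q := by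
  have hv := hf.valid
  have hg := (hf.ex h).valid
  have hr : f.ε ^ 2 = gold * f.ε - 1 := hf.root
  have hC := gold_sq_complex
  have h1 := gold_mul_sub_one
  have hR := gold_sq
  have hp := gold_pos
  have hp' : 0 < gold - 1 := by linarith [one_lt_gold]
  cases h with
  | even_acute_one ε t d =>
    refine ⟨0, 2, 1, 2, 0, gold, 1, gold, Glued.mk' hv hg
      (fun a b => -gold * a) (fun a b => gold * (1 - b)) (fun a b => ?_)
      (by decide) (by decide) (by decide) (by decide) hp (fun a b => ⟨?_, ?_, ?_⟩)⟩
    · simp only [pt] at *; push_cast; grind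
    all_goals simp; try grind
  | even_obtuse_one ε t d =>
    refine ⟨0, 2, 1, 2, 0, gold - 1, 1, gold - 1, Glued.mk' hv hg
      (fun a b => -(gold - 1) * a) (fun a b => 1 - (gold - 1) * b) (fun a b => ?_)
      (by decide) (by decide) (by decide) (by decide) hp' (fun a b => ⟨?_, ?_, ?_⟩)⟩
    · simp only [pt] at *; push_cast; grind
    all_goals simp; try grind
  | even_acute_zero ε t d =>
    refine ⟨1, 2, 0, 2, 1, gold, 0, gold ^ 2, Glued.mk' hv hg
      (fun a b => gold ^ 2 - gold ^ 2 * a - gold * b) (fun a b => gold * a) (fun a b => ?_)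
      (by decide) (by decide) (by decide) (by decide) hp (fun a b => ⟨?_, ?_, ?_⟩)⟩
    · simp only [pt] at *; push_cast; grind
    all_goals simp; try grind
  | even_obtuse_zero ε t d =>
    refine ⟨1, 2, 0, 2, 1, gold - 1, gold, 0, Glued.mk' hv hg
      (fun a b => (gold - 1) * b) (fun a b => -(gold - 1) * a + gold - b) (fun a b => ?_)
      (by decide) (by decide) (by decide) (by decide) hp' (fun a b => ⟨?_, ?_, ?_⟩)⟩
    · simp only [pt] at *; push_cast; grind
    all_goals simp; try grind
  | odd_acute_two ε t d =>
    refine ⟨0, 1, 2, 0, 1, gold - 1, 0, gold, Glued.mk' hv hg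
      (fun a b => a + gold * b) (fun a b => -b) (fun a b => ?_)
      (by decide) (by decide) (by decide) (by decide) hp' (fun a b => ⟨?_, ?_, ?_⟩)⟩
    · simp only [pt] at *; push_cast; grind
    all_goals simp; try grind
  | odd_obtuse_two ε t d =>
    refine ⟨0, 1, 2, 0, 1, gold, 0, gold ^ 2, Glued.mk' hv hg
      (fun a b => a + gold * b) (fun a b => -b) (fun a b => ?_)
      (by decide) (by decide) (by decide) (by decide) hp (fun a b => ⟨?_, ?_, ?_⟩)⟩
    · simp only [pt] at *; push_cast; grind
    all_goals simp; try grind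
  | odd_acute_one ε t d =>
    refine ⟨0, 2, 0, 1, 2, gold - 1, 1, gold - 1, Glued.mk' hv hg
      (fun a b => 1 - b) (fun a b => a + gold * b) (fun a b => ?_)
      (by decide) (by decide) (by decide) (by decide) hp' (fun a b => ⟨?_, ?_, ?_⟩)⟩
    · simp only [pt] at *; push_cast; grind
    all_goals simp; try grind
  | odd_obtuse_zero ε t d =>
    refine ⟨1, 2, 1, 0, 2, gold, gold, 1, Glued.mk' hv hg
      (fun a b => (a - 1) * gold + b) (fun a b => 1 - a) (fun a b => ?_)
      (by decide) (by decide) (by decide) (by decide) hp (fun a b => ⟨?_, ?_, ?_⟩)⟩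
    · simp only [pt] at *; push_cast; grind
    all_goals simp; try grind

theorem Nbr.glued (hf : Ok e s f) {i : Fin 3} (h : Nbr e f i g) :
    ∃ k l i' k' l' m p q, Glued f i g k l i' k' l' m p q := by
  rcases h with rfl | h
  · obtain ⟨k, l, p, q, h⟩ := mir_glued hf i
    exact ⟨_, _, _, _, _, _, _, _, h⟩
  · exact h.glued hf

theorem mir_ε (f : Frame) (i : Fin 3) : (f.mir i).ε = gold - f.ε := by
  unfold mir
  split_ifs <;> rfl

theorem mir_c (f : Frame) (i : Fin 3) : (f.mir i).c = f.c := by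
  unfold mir
  split_ifs <;> rfl

theorem Nbr.ne (hf : f.Valid) {i : Fin 3} (h : Nbr e f i g) : g ≠ f := by
  rintro rfl
  rcases h with h | h
  · exact hf.root.ne_conj ((congrArg Frame.ε h).trans (mir_ε g i))
  · cases h

/-- `x` lies on the side opposite to the vertex number `i` and is not a vertex. -/
def OpenEdge (f : Frame) (i : Fin 3) (x : ℂ) : Prop := f.co i x = 0 ∧ ∀ j, j ≠ i → 0 < f.co j x

theorem OpenEdge.mem (hf : f.Valid) {i : Fin 3} {x : ℂ} (h : f.OpenEdge i x) :
    x ∈ f.tile.region :=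
  (mem_region hf).2 fun j => by
    by_cases hj : j = i
    · rw [hj, h.1]
    · exact (h.2 j hj).le

/-- Near `x` the coordinates belonging to the two ends of the side stay positive in both triangles.
The sign of the remaining one decides in which of the triangles a point lies. -/
theorem Glued.nhds (hf : f.Valid) (hg : g.Valid) {i k l i' k' l' : Fin 3} {m p q : ℝ}
    (h : Glued f i g k l i' k' l' m p q) {x : ℂ} (hx : f.OpenEdge i x) :
    f.tile.region ∪ g.tile.region ∈ 𝓝 x ∧ g.OpenEdge i' x := by
  have hk0 : 0 < g.co k' x := by rw [h.cok, hx.1]; simpa using hx.2 k h.hk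
  have hl0 : 0 < g.co l' x := by rw [h.col, hx.1]; simpa using hx.2 l h.hl
  have ev : ∀ (F : Frame) (j : Fin 3), 0 < F.co j x → ∀ᶠ y in 𝓝 x, 0 < F.co j y := fun F j hj =>
    (F.continuous_co j).continuousAt.eventually (lt_mem_nhds hj)
  refine ⟨?_, ?_, fun j hj => ?_⟩
  · filter_upwards [ev f k (hx.2 k h.hk), ev f l (hx.2 l h.hl), ev g k' hk0, ev g l' hl0]
      with y h1 h2 h3 h4
    rcases le_or_gt 0 (f.co i y) with h5 | h5
    · left
      refine (mem_region hf).2 fun j => ?_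
      rcases h.cover j with rfl | rfl | rfl
      exacts [h5, h1.le, h2.le]
    · right
      refine (mem_region hg).2 fun j => ?_
      rcases h.cover' j with rfl | rfl | rfl
      · rw [h.coi]; nlinarith [h.pos]
      exacts [h3.le, h4.le]
  · rw [h.coi, hx.1, mul_zero]
  · rcases h.cover' j with rfl | rfl | rfl
    exacts [absurd rfl hj, hk0, hl0]

theorem Nbr.nhds (hf : Ok e s f) {i : Fin 3} (h : Nbr e f i g) {x : ℂ} (hx : f.OpenEdge i x) :
    f.tile.region ∪ g.tile.region ∈ 𝓝 x ∧ ∃ i', g.OpenEdge i' x := by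
  obtain ⟨k, l, i', k', l', m, p, q, hG⟩ := h.glued hf
  have := hG.nhds hf.valid (hf.nbr h).valid hx
  exact ⟨this.1, i', this.2⟩

theorem mem_region_cases (hf : f.Valid) {x : ℂ} (hx : x ∈ f.tile.region) :
    x ∈ interior f.tile.region ∨ (∃ i, f.OpenEdge i x) ∨ ∃ j, x = f.vtx j := by
  have h := (mem_region hf).1 hx
  have hs := f.co_sum x
  have hx' := eq_sum_vtx hf x
  rcases (h 0).eq_or_lt with h0 | h0 <;> rcases (h 1).eq_or_lt with h1 | h1 <;>
    rcases (h 2).eq_or_lt with h2 | h2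
  · rw [← h0, ← h1, ← h2] at hs; norm_num at hs
  · right; right; refine ⟨2, ?_⟩
    rw [← h0, ← h1] at hs
    have : f.co 2 x = 1 := by linarith
    rw [hx', ← h0, ← h1, this]; simp [vtx]
  · right; right; refine ⟨1, ?_⟩
    rw [← h0, ← h2] at hs
    have : f.co 1 x = 1 := by linarith
    rw [hx', ← h0, ← h2, this]; simp [vtx]
  · right; left; refine ⟨0, h0.symm, ?_⟩
    intro j hj; fin_cases j
    exacts [absurd rfl hj, h1, h2]
  · right; right; refine ⟨0, ?_⟩
    rw [← h1, ← h2] at hs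
    have : f.co 0 x = 1 := by linarith
    rw [hx', ← h1, ← h2, this]; simp [vtx]
  · right; left; refine ⟨1, h1.symm, ?_⟩
    intro j hj; fin_cases j
    exacts [h0, absurd rfl hj, h2]
  · right; left; refine ⟨2, h2.symm, ?_⟩
    intro j hj; fin_cases j
    exacts [h0, h1, absurd rfl hj]
  · left
    refine (mem_interior hf).2 fun j => ?_
    fin_cases j
    exacts [h0, h1, h2]

theorem exists_openEdge (hf : f.Valid) (i : Fin 3) : ∃ x, f.OpenEdge i x := by
  have hs := f.sig_pos
  have hk := sig_mul_kap f
  have hk0 := f.kap_pos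
  fin_cases i
  · refine ⟨f.pt (1/2) (f.kap/2), ?_, fun j hj => ?_⟩
    · rw [co_pt hf]; simp; linarith
    · rw [co_pt hf]; fin_cases j <;> simp at hj ⊢; positivity
  · refine ⟨f.pt 0 (f.kap/2), ?_, fun j hj => ?_⟩
    · rw [co_pt hf]; simp
    · rw [co_pt hf]; fin_cases j <;> simp at hj ⊢
      · nlinarith
      · positivity
  · refine ⟨f.pt (1/2) 0, ?_, fun j hj => ?_⟩
    · rw [co_pt hf]; simp
    · rw [co_pt hf]; fin_cases j <;> simp at hj ⊢; norm_num

/-- The centroid. -/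
def center (f : Frame) : ℂ := f.pt (1/3) (f.kap/3)

theorem co_center (hf : f.Valid) (i : Fin 3) : f.co i f.center = 1 / 3 := by
  have hk := sig_mul_kap f
  rw [center, co_pt hf]
  fin_cases i
  · simp; linarith
  · simp
  · simp; linarith

theorem center_mem_interior (hf : f.Valid) : f.center ∈ interior f.tile.region :=
  (mem_interior hf).2 fun i => by rw [co_center hf]; norm_num

theorem exists_interior_near (hf : f.Valid) {x : ℂ} (hx : x ∈ f.tile.region) {U : Set ℂ}
    (hU : U ∈ 𝓝 x) : ∃ y ∈ U, y ∈ interior f.tile.region := by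
  have h0 : Filter.Tendsto (fun r : ℝ => ((1 - r : ℝ) : ℂ) * x + (r : ℂ) * f.center)
      (𝓝[>] 0) (𝓝 x) := by
    have : Continuous (fun r : ℝ => ((1 - r : ℝ) : ℂ) * x + (r : ℂ) * f.center) := by fun_prop
    have := this.tendsto 0
    simp only [sub_zero, Complex.ofReal_one, one_mul, Complex.ofReal_zero, zero_mul,
      add_zero] at this
    exact this.mono_left nhdsWithin_le_nhds
  have h1 : ∀ᶠ r : ℝ in 𝓝[>] 0, r < 1 := nhdsWithin_le_nhds (gt_mem_nhds one_pos)
  obtain ⟨r, ⟨hr, hr1⟩, hr0⟩ := (((h0.eventually hU).and h1).and self_mem_nhdsWithin).exists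
  have hr0 : 0 < r := hr0
  refine ⟨_, hr, (mem_interior hf).2 fun i => ?_⟩
  rw [co_comb _ _ _ _ (by ring), co_center hf]
  have := (mem_region hf).1 hx i
  have : 0 ≤ (1 - r) * f.co i x := mul_nonneg (by linarith) this
  linarith

end Frame

/-! ### Tilings by triangles -/

open PenroseCurve.Frame

/-- An edge to edge tiling of the plane by triangles that satisfies the matching rules; `e` says
if these are the rules for even levels, and `s` is the scale. -/
structure Good (e : Bool) (s : ℝ) (𝒯 : Set TriTile) : Prop where
  shape : ∀ D ∈ 𝒯, ∃ f, Ok e s f ∧ f.tile = D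
  across : ∀ f, Ok e s f → f.tile ∈ 𝒯 → ∀ i, ∃ g, Nbr e f i g ∧ g.tile ∈ 𝒯
  disj : ∀ D ∈ 𝒯, ∀ D' ∈ 𝒯, (interior D.region ∩ interior D'.region).Nonempty → D = D'
  cover : ∀ x, ∃ D ∈ 𝒯, x ∈ D.region

/-- `x` is a vertex of a tile. -/
def IsVtx (𝒯 : Set TriTile) (x : ℂ) : Prop := ∃ D ∈ 𝒯, x = D.t ∨ x = D.h ∨ x = D.w

theorem isVtx_of_vtx {𝒯 : Set TriTile} {f : Frame} (hf : f.tile ∈ 𝒯) (j : Fin 3) :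
    IsVtx 𝒯 (f.vtx j) := by
  refine ⟨_, hf, ?_⟩
  fin_cases j <;> simp [vtx, tile]

namespace Good

variable {e : Bool} {s : ℝ} {𝒯 : Set TriTile} (hG : Good e s 𝒯)
include hG

theorem eq_of_mem_interior {D D' : TriTile} (hD : D ∈ 𝒯) (hD' : D' ∈ 𝒯) {x : ℂ}
    (hx : x ∈ interior D.region) (hx' : x ∈ D'.region) : D = D' := by
  obtain ⟨f, hf, rfl⟩ := hG.shape D' hD'
  obtain ⟨y, hy, hy'⟩ := exists_interior_near hf.valid hx' (isOpen_interior.mem_nhds hx)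
  exact hG.disj _ hD _ hD' ⟨y, hy, hy'⟩

theorem eq_or_eq_of_nhds {D D₁ D₂ : TriTile} (hD : D ∈ 𝒯) (h1 : D₁ ∈ 𝒯) (h2 : D₂ ∈ 𝒯) {x : ℂ}
    (h : D₁.region ∪ D₂.region ∈ 𝓝 x) (hx : x ∈ D.region) : D = D₁ ∨ D = D₂ := by
  obtain ⟨f, hf, rfl⟩ := hG.shape D hD
  obtain ⟨y, hy, hy'⟩ := exists_interior_near hf.valid hx h
  rcases hy with hy | hy
  · exact Or.inl (hG.eq_of_mem_interior hD h1 hy' hy)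
  · exact Or.inr (hG.eq_of_mem_interior hD h2 hy' hy)

/-- At a point inside the side, `f` and `g` fill a neighborhood, so a third tile through this point
overlaps one of them and equals it. -/
theorem nbr_unique {f g g' : Frame} (hf : Ok e s f) (hfT : f.tile ∈ 𝒯) {i : Fin 3}
    (hg : Nbr e f i g) (hgT : g.tile ∈ 𝒯) (hg' : Nbr e f i g') (hgT' : g'.tile ∈ 𝒯) : g = g' := by
  obtain ⟨x, hx⟩ := exists_openEdge hf.valid i
  obtain ⟨h1, -⟩ := hg.nhds hf hx
  obtain ⟨-, j, h2⟩ := hg'.nhds hf hx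
  rcases hG.eq_or_eq_of_nhds hgT' hfT hgT h1 (h2.mem (hf.nbr hg').valid) with h | h
  · exact absurd (eq_of_tile_eq (hf.nbr hg').valid hf.valid h) (hg'.ne hf.valid)
  · exact (eq_of_tile_eq (hf.nbr hg').valid (hf.nbr hg).valid h).symm

theorem not_mir_of_ex {f g : Frame} (hf : Ok e s f) (hfT : f.tile ∈ 𝒯) {i : Fin 3}
    (hg : Ex e f i g) (hgT : g.tile ∈ 𝒯) : (f.mir i).tile ∉ 𝒯 := by
  intro h
  have h1 := hG.nbr_unique hf hfT (Or.inl rfl) h (Or.inr hg) hgT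
  have h2 := congrArg Frame.c h1
  cases hg <;> simp [mir] at h2

theorem local_structure {f : Frame} (hf : Ok e s f) (hfT : f.tile ∈ 𝒯) {x : ℂ}
    (hx : x ∈ f.tile.region) (hV : ¬ IsVtx 𝒯 x) :
    x ∈ interior f.tile.region ∨ ∃ i g, f.OpenEdge i x ∧ Nbr e f i g ∧ g.tile ∈ 𝒯 ∧
      x ∈ g.tile.region ∧ f.tile.region ∪ g.tile.region ∈ 𝓝 x := by
  rcases mem_region_cases hf.valid hx with h | ⟨i, h⟩ | ⟨j, rfl⟩
  · exact Or.inl h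
  · obtain ⟨g, hg, hgT⟩ := hG.across f hf hfT i
    obtain ⟨h1, j, h2⟩ := hg.nhds hf h
    exact Or.inr ⟨i, g, h, hg, hgT, h2.mem (hf.nbr hg).valid, h1⟩
  · exact absurd (isVtx_of_vtx hfT j) hV

/-- Tiles that meet a connected set `O` without vertices are connected by a chain of tiles, such
that two subsequent ones have a common point in `O`. -/
theorem mem_of_preconnected {O : Set ℂ} (hO : IsPreconnected O) (hV : ∀ x ∈ O, ¬ IsVtx 𝒯 x)
    (𝒮 : Set TriTile) (h0 : ∃ D ∈ 𝒯, D ∈ 𝒮 ∧ (D.region ∩ O).Nonempty)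
    (hstep : ∀ D ∈ 𝒯, D ∈ 𝒮 → ∀ D' ∈ 𝒯, ∀ x ∈ O, x ∈ D.region → x ∈ D'.region → D' ∈ 𝒮) :
    ∀ D ∈ 𝒯, (D.region ∩ O).Nonempty → D ∈ 𝒮 := by
  intro D₁ hD₁ ⟨x₁, hx₁, hxO₁⟩
  obtain ⟨D₀, hD₀, hS₀, x₀, hx₀, hxO₀⟩ := h0
  by_contra hS₁
  -- By `hstep` both tiles at a point of `O` are in `𝒮` or both are not. So the tiles in `𝒮` and the
  -- others cover `O` by two open sets, which meet because `O` is connected.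
  set U := interior (⋃ D ∈ 𝒯 ∩ 𝒮, D.region)
  set U' := interior (⋃ D ∈ 𝒯 \ 𝒮, D.region)
  have hloc : ∀ x ∈ O, ∀ D ∈ 𝒯, x ∈ D.region → (D ∈ 𝒮 → x ∈ U) ∧ (D ∉ 𝒮 → x ∈ U') := by
    intro x hxO D hD hx
    obtain ⟨f, hf, rfl⟩ := hG.shape D hD
    obtain ⟨D', hD', hx', hn⟩ : ∃ D' ∈ 𝒯, x ∈ D'.region ∧ f.tile.region ∪ D'.region ∈ 𝓝 x := by
      rcases hG.local_structure hf hD hx (hV x hxO) with h | ⟨i, g, -, -, hgT, hxg, h⟩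
      · exact ⟨_, hD, hx, by rw [Set.union_self]; exact mem_interior_iff_mem_nhds.1 h⟩
      · exact ⟨_, hgT, hxg, h⟩
    constructor
    · intro hS
      have hS' := hstep _ hD hS D' hD' x hxO hx hx'
      refine mem_interior_iff_mem_nhds.2 (Filter.mem_of_superset hn (Set.union_subset ?_ ?_))
      · exact Set.subset_biUnion_of_mem (u := TriTile.region) (show f.tile ∈ 𝒯 ∩ 𝒮 from ⟨hD, hS⟩)
      · exact Set.subset_biUnion_of_mem (u := TriTile.region) (show D' ∈ 𝒯 ∩ 𝒮 from ⟨hD', hS'⟩)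
    · intro hS
      have hS' : D' ∉ 𝒮 := fun h => hS (hstep _ hD' h _ hD x hxO hx' hx)
      refine mem_interior_iff_mem_nhds.2 (Filter.mem_of_superset hn (Set.union_subset ?_ ?_))
      · exact Set.subset_biUnion_of_mem (u := TriTile.region) (show f.tile ∈ 𝒯 \ 𝒮 from ⟨hD, hS⟩)
      · exact Set.subset_biUnion_of_mem (u := TriTile.region) (show D' ∈ 𝒯 \ 𝒮 from ⟨hD', hS'⟩)
  obtain ⟨x, hxO, hxU, hxU'⟩ := hO U U' isOpen_interior isOpen_interior
    (fun x hx => by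
      obtain ⟨D, hD, hxD⟩ := hG.cover x
      by_cases hS : D ∈ 𝒮
      · exact Or.inl ((hloc x hx D hD hxD).1 hS)
      · exact Or.inr ((hloc x hx D hD hxD).2 hS))
    ⟨x₀, hxO₀, (hloc _ hxO₀ _ hD₀ hx₀).1 hS₀⟩ ⟨x₁, hxO₁, (hloc _ hxO₁ _ hD₁ hx₁).2 hS₁⟩
  obtain ⟨D, hD, hxD⟩ := Set.mem_iUnion₂.1 (interior_subset hxU)
  obtain ⟨D', hD', hxD'⟩ := Set.mem_iUnion₂.1 (interior_subset hxU')
  exact hD'.2 (hstep _ hD.1 hD.2 _ hD'.1 x hxO hxD hxD')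

end Good

end PenroseCurve

end

/-! ### Forced neighbors: every small tile lies next to a large one that absorbs it. -/

noncomputable section

namespace PenroseCurve

open Topology

namespace Frame

variable {f g F : Frame} {e : Bool} {s : ℝ}

theorem mk_congr {c : Bool} {ε t d ε' t' d' : ℂ} (h1 : ε = ε') (h2 : t = t') (h3 : d = d') :
    (⟨c, ε, t, d⟩ : Frame) = ⟨c, ε', t', d'⟩ := by rw [h1, h2, h3]

theorem mir_mir (hf : f.Valid) (i : Fin 3) : (f.mir i).mir i = f := by
  have hr : f.ε ^ 2 = gold * f.ε - 1 := hf.root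
  have hC := gold_sq_complex
  obtain ⟨c, ε, t, d⟩ := f
  simp only at hr
  fin_cases i
  · cases c
    · simp only [Fin.zero_eta, mir_zero_obtuse]
      exact mk_congr (by ring) (by grind) (by grind)
    · simp only [Fin.zero_eta, mir_zero_acute]
      exact mk_congr (by ring) (by grind) (by grind)
  · simp only [Fin.mk_one, mir_one]
    exact mk_congr (by ring) rfl (by grind)
  · simp only [Fin.reduceFinMk, mir_two]
    exact mk_congr (by ring) rfl rfl

theorem nbr_even_two (h : Nbr true f 2 g) : g = f.mir 2 := by
  rcases h with h | h
  · exact h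
  · cases h

theorem nbr_odd_acute_zero {ε t d : ℂ} (h : Nbr false ⟨true, ε, t, d⟩ 0 g) :
    g = mir ⟨true, ε, t, d⟩ 0 := by
  rcases h with h | h
  · exact h
  · cases h

theorem nbr_odd_obtuse_one {ε t d : ℂ} (h : Nbr false ⟨false, ε, t, d⟩ 1 g) :
    g = mir ⟨false, ε, t, d⟩ 1 := by
  rcases h with h | h
  · exact h
  · cases h

theorem Ok.norm_even_acute {ε t d : ℂ} (h : Ok true s ⟨true, ε, t, d⟩) : ‖d‖ = gold * s := h.norm_d
theorem Ok.norm_even_obtuse {ε t d : ℂ} (h : Ok true s ⟨false, ε, t, d⟩) : ‖d‖ = s := h.norm_d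
theorem Ok.norm_odd {c : Bool} {ε t d : ℂ} (h : Ok false s ⟨c, ε, t, d⟩) : ‖d‖ = gold * s := by
  cases c <;> exact h.norm_d

/-- A point on a segment that divides it in the golden ratio. -/
theorem wbtw_golden {x y z : ℂ} {u : ℝ} (h : Wbtw ℝ x y z) (h1 : ‖y - x‖ = gold * u)
    (h2 : ‖z - y‖ = u) (hu : 0 < u) : z = x + gold * (y - x) := by
  obtain ⟨r, ⟨hr0, hr1⟩, rfl⟩ := h
  simp only [AffineMap.lineMap_apply, vsub_eq_sub, vadd_eq_add, Complex.real_smul] at *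
  have e1 : r * (z - x) + x - x = r * (z - x) := by ring
  have e2 : z - (r * (z - x) + x) = ((1 - r : ℝ) : ℂ) * (z - x) := by push_cast; ring
  rw [e1, norm_mul, Complex.norm_real, Real.norm_of_nonneg hr0] at h1
  rw [e2, norm_mul, Complex.norm_real, Real.norm_of_nonneg (by linarith)] at h2
  have h3 : ‖z - x‖ = (1 + gold) * u := by linarith
  have h4 : r * gold = 1 := by
    rw [h3] at h1
    have : u * (r * (1 + gold) - gold) = 0 := by linarith
    have := (mul_eq_zero.1 this).resolve_left hu.ne'
    have hg := gold_sq
    have hp := gold_pos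
    have : gold * (r * gold - 1) = 0 := by linear_combination this + r * hg
    linarith [(mul_eq_zero.1 this).resolve_left hp.ne']
  have h5 : (r : ℂ) * gold = 1 := by exact_mod_cast h4
  linear_combination (-(z - x)) * h5

theorem wbtw_of_golden {x y z : ℂ} (h : z = x + gold * (y - x)) : Wbtw ℝ x y z := by
  refine ⟨gold - 1, ⟨by linarith [one_lt_gold], by linarith [gold_lt]⟩, ?_⟩
  have h1 := gold_sq_complex
  simp only [AffineMap.lineMap_apply, vsub_eq_sub, vadd_eq_add, Complex.real_smul]
  rw [h]
  push_cast
  linear_combination (y - x) * h1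

/-- The tiles are equal if a point is interior to one tile and belongs to the other. -/
theorem _root_.PenroseCurve.Good.frame_eq {𝒯 : Set TriTile} (hG : Good e s 𝒯) (hf : Ok e s f)
    (hg : Ok e s g) (hfT : f.tile ∈ 𝒯) (hgT : g.tile ∈ 𝒯) {a b a' b' : ℝ}
    (h : f.pt a b = g.pt a' b') (h1 : 0 < 1 - a - f.sig * b ∧ 0 < a ∧ 0 < b)
    (h2 : 0 ≤ 1 - a' - g.sig * b' ∧ 0 ≤ a' ∧ 0 ≤ b') : f = g := by
  refine eq_of_tile_eq hf.valid hg.valid (hG.eq_of_mem_interior hfT hgT (x := f.pt a b) ?_ ?_)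
  · refine (mem_interior hf.valid).2 fun i => ?_
    rw [co_pt hf.valid]
    have := f.sig_pos
    fin_cases i
    exacts [h1.1, h1.2.1, mul_pos this h1.2.2]
  · refine (mem_region hg.valid).2 fun i => ?_
    rw [h, co_pt hg.valid]
    have := g.sig_pos
    fin_cases i
    exacts [h2.1, h2.2.1, mul_nonneg this.le h2.2.2]

theorem _root_.PenroseCurve.Good.eq_or_eq_of_openEdge {𝒯 : Set TriTile} (hG : Good e s 𝒯)
    {k : Frame} (hf : Ok e s f) (hg : Ok e s g) (hfT : f.tile ∈ 𝒯) (hgT : g.tile ∈ 𝒯) {i : Fin 3}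
    (hk : Nbr e f i k) (hkT : k.tile ∈ 𝒯) {x : ℂ} (hx : f.OpenEdge i x) (hx' : x ∈ g.tile.region) :
    g = f ∨ g = k := by
  obtain ⟨h1, -⟩ := hk.nhds hf hx
  rcases hG.eq_or_eq_of_nhds hgT hfT hkT h1 hx' with h | h
  · exact Or.inl (eq_of_tile_eq hg.valid hf.valid h)
  · exact Or.inr (eq_of_tile_eq hg.valid (hf.nbr hk).valid h)

end Frame

open PenroseCurve.Frame

namespace Good

variable {s : ℝ} {𝒯 : Set TriTile} {ε t d : ℂ}

theorem mir_two_mem (hG : Good true s 𝒯) {f : Frame} (hf : Ok true s f) (hT : f.tile ∈ 𝒯) :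
    (f.mir 2).tile ∈ 𝒯 := by
  obtain ⟨g, hg, hgT⟩ := hG.across f hf hT 2
  rwa [← nbr_even_two hg]

theorem mir_zero_mem (hG : Good false s 𝒯) (hf : Ok false s ⟨true, ε, t, d⟩)
    (hT : (⟨true, ε, t, d⟩ : Frame).tile ∈ 𝒯) : (mir ⟨true, ε, t, d⟩ 0).tile ∈ 𝒯 := by
  obtain ⟨g, hg, hgT⟩ := hG.across _ hf hT 0
  rwa [← nbr_odd_acute_zero hg]

theorem mir_one_mem (hG : Good false s 𝒯) (hf : Ok false s ⟨false, ε, t, d⟩)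
    (hT : (⟨false, ε, t, d⟩ : Frame).tile ∈ 𝒯) : (mir ⟨false, ε, t, d⟩ 1).tile ∈ 𝒯 := by
  obtain ⟨g, hg, hgT⟩ := hG.across _ hf hT 1
  rwa [← nbr_odd_obtuse_one hg]

/-- In a tiling of an even level, a small tile is next to a large tile that absorbs it. -/
theorem even_obtuse_zero_mem (hG : Good true s 𝒯) (hf : Ok true s ⟨false, ε, t, d⟩)
    (hT : (⟨false, ε, t, d⟩ : Frame).tile ∈ 𝒯) :
    (⟨true, ε, t + gold ^ 2 * d, -(gold * (gold - ε) * d)⟩ : Frame).tile ∈ 𝒯 := by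
  obtain ⟨g, hg | hg, hgT⟩ := hG.across _ hf hT 0
  · exfalso
    subst hg
    have hr : ε ^ 2 = gold * ε - 1 := hf.root
    have hC := gold_sq_complex
    have h4 := gold_sq
    have h5 := gold_gt
    have h6 := gold_lt
    -- A dart has the angle `6θ` at `h`. Two darts that are mirror images in `h w` would need `12θ >
    -- 10θ` there, so their outer halves overlap; the coordinates describe a common point.
    have h3 := hG.frame_eq ((hf.mir 0).mir 2) (hf.mir 2) (hG.mir_two_mem (hf.mir 0) hgT)
      (hG.mir_two_mem hf hT) (a := 1 - 1 / 4 * gold) (b := 1 / 4) (a' := 3 / 4) (b' := 1 / 4 * gold) ?_ ?_ ?_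
    · have := congrArg Frame.ε h3
      simp only [mir_ε] at this
      exact hf.root.ne_conj (by linear_combination this)
    · simp only [pt, mir_zero_obtuse, mir_two]
      push_cast
      grind
    · simp only [mir_zero_obtuse, mir_two, sig_false]
      exact ⟨by nlinarith, by nlinarith, by nlinarith⟩
    · simp only [mir_two, sig_false]
      exact ⟨by nlinarith, by nlinarith, by nlinarith⟩
  · cases hg
    exact hgT

/-- In a tiling of an odd level, a small tile is next to a large tile that absorbs it. -/
theorem odd_acute_two_mem (hG : Good false s 𝒯) (hf : Ok false s ⟨true, ε, t, d⟩)
    (hT : (⟨true, ε, t, d⟩ : Frame).tile ∈ 𝒯) :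
    (⟨false, gold - ε, t, d⟩ : Frame).tile ∈ 𝒯 := by
  obtain ⟨g, hg | hg, hgT⟩ := hG.across _ hf hT 2
  · exfalso
    subst hg
    have hr : ε ^ 2 = gold * ε - 1 := hf.root
    have hC := gold_sq_complex
    have h4 := gold_sq
    have h5 := gold_gt
    have h6 := gold_lt
    have hm := hG.mir_zero_mem hf hT
    have hm' := hG.mir_zero_mem (hf.mir 2) hgT
    -- The four acute tiles `f`, `f.mir 2` and their reflections in the side `h w` have angle `2θ`
    -- at `h` and leave a gap of `2θ`. The tiles that border the gap from its two sides have angle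
    -- `2θ` or `3θ` at `h`, so they overlap, but they have opposite orientations.
    have key : ∀ ε t d : ℂ, Ok false s ⟨true, ε, t, d⟩ → (⟨true, ε, t, d⟩ : Frame).tile ∈ 𝒯 →
        ∃ c, Ok false s ⟨c, gold - ε, t, d⟩ ∧ (⟨c, gold - ε, t, d⟩ : Frame).tile ∈ 𝒯 := by
      intro ε t d hf hT
      obtain ⟨g, hg | hg, hgT⟩ := hG.across _ hf hT 2
      · subst hg
        exact ⟨true, hf.mir 2, hgT⟩
      · have := hf.ex hg
        cases hg
        exact ⟨false, this, hgT⟩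
    obtain ⟨c, hk, hkT⟩ := key _ _ _ (hf.mir 0) hm
    obtain ⟨c', hk', hkT'⟩ := key _ _ _ ((hf.mir 2).mir 0) hm'
    have h3 := hG.frame_eq hk hk' hkT hkT' (a := 1 - 1 / 4 * gold) (b := 1 / 4)
      (a' := 1 - 1 / 4 * gold) (b' := 1 / 4) ?_ ?_ ?_
    · have := congrArg Frame.ε h3
      simp only [mir_two] at this
      exact hf.root.ne_conj (by linear_combination this)
    · simp only [pt, mir_two]
      push_cast
      grind
    · cases c
      · simp only [sig_false]
        exact ⟨by nlinarith, by nlinarith, by nlinarith⟩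
      · simp only [sig_true]
        exact ⟨by nlinarith, by nlinarith, by nlinarith⟩
    · cases c'
      · simp only [sig_false]
        exact ⟨by nlinarith, by nlinarith, by nlinarith⟩
      · simp only [sig_true]
        exact ⟨by nlinarith, by nlinarith, by nlinarith⟩
  · cases hg
    exact hgT

end Good

end PenroseCurve

end

/-! ### Composition in terms of frames: parents, parts and regions. -/

noncomputable section

namespace PenroseCurve

open Topology
open PenroseCurve.Frame

theorem Frame.Valid.of_eq {f g : Frame} (hf : f.Valid) (h1 : g.ε = f.ε) (h2 : g.d = f.d) :
    g.Valid := ⟨h1 ▸ hf.root, h2 ▸ hf.ne⟩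

namespace Good

variable {s : ℝ} {𝒯 : Set TriTile} {ε t d v : ℂ}

/-- The lengths of `t r` and `r v` are in the ratio `τ`, and `r` lies between `t` and `v`. This
fixes `v`, hence the only possible position of the absorbed tile. -/
theorem absorb_even (hG : Good true s 𝒯) (hf : Ok true s ⟨true, ε, t, d⟩)
    (hT : (⟨false, v, t + ε * d, t + d⟩ : TriTile) ∈ 𝒯) (hv : Wbtw ℝ t (t + ε * d) v) :
    (⟨false, v, t + ε * d, t + d⟩ : TriTile) =
      (⟨false, ε, t + gold * ε * d, -((gold - 1) * ε * d)⟩ : Frame).tile := by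
  obtain ⟨⟨c, δ, w, d'⟩, hg, h⟩ := hG.shape _ hT
  have h0 : c = false := congrArg TriTile.acute h
  subst h0
  simp only [tile, TriTile.mk.injEq, kap_false, true_and] at h ⊢
  obtain ⟨rfl, h1, h2⟩ := h
  have hr : ε ^ 2 = gold * ε - 1 := hf.root
  have hC := gold_sq_complex
  have h3 := wbtw_golden hv (u := s)
    (by rw [add_sub_cancel_left, norm_mul, hf.root.norm, one_mul, hf.norm_even_acute])
    (by rw [← h1, sub_add_cancel_left, norm_neg, hg.norm_even_obtuse]) hf.pos
  exact ⟨by linear_combination h3, by ring, by grind⟩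

/-- As in the even case, betweenness and the two lengths fix the third vertex `v`. -/
theorem absorb_odd (hG : Good false s 𝒯) (hf : Ok false s ⟨false, ε, t, d⟩)
    (hT : (⟨true, t, t + d, v⟩ : TriTile) ∈ 𝒯) (hv : Wbtw ℝ (t + gold * ε * d) (t + d) v) :
    (⟨true, t, t + d, v⟩ : TriTile) = (⟨true, gold - ε, t, d⟩ : Frame).tile := by
  obtain ⟨⟨c, δ, w, d'⟩, hg, h⟩ := hG.shape _ hT
  have h0 : c = true := congrArg TriTile.acute h
  subst h0
  simp only [tile, TriTile.mk.injEq, kap_true, true_and] at h ⊢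
  obtain ⟨rfl, h1, h2⟩ := h
  obtain rfl : d' = d := by linear_combination h1
  have hr : ε ^ 2 = gold * ε - 1 := hf.root
  have hC := gold_sq_complex
  have h4 : δ ≠ ε → δ = gold - ε := fun h => (hf.root.eq_or hg.root).resolve_left h
  have h3 := wbtw_golden hv (u := s) ?_ ?_ hf.pos
  · rw [h3]
    push_cast
    grind
  · rw [show w + d' - (w + gold * ε * d') = -(ε ^ 2 * d') by rw [hr]; ring, norm_neg, norm_mul,
      norm_pow, hf.root.norm, one_pow, one_mul, hf.norm_odd]
  · rw [← h2, show w + ((1 : ℝ) : ℂ) * δ * d' - (w + d') = (δ - 1) * d' by push_cast; ring,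
      norm_mul, hf.norm_odd]
    have hd : δ ^ 2 = gold * δ - 1 := hg.root
    have : (δ - 1) = (gold - 1) * δ ^ 3 := by grind
    rw [this, norm_mul, norm_pow, hg.root.norm, norm_gold_sub_one]
    linear_combination s * gold_mul_sub_one

/-- The neighbor across the side `h w` is the mirror image or an absorbed tile. So the negative
condition for the unabsorbed tiles in `composeA` becomes the presence of the mirror image.
`mem_composeB` does the same for the side `t h`. -/
theorem mem_composeA (hG : Good true s 𝒯) {D : TriTile} : D ∈ composeA 𝒯 ↔
    ∃ ε t d, Ok true s ⟨true, ε, t, d⟩ ∧ (⟨true, ε, t, d⟩ : Frame).tile ∈ 𝒯 ∧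
      ((D = (⟨false, ε, t, d⟩ : Frame).tile ∧
        (⟨false, ε, t + gold * ε * d, -((gold - 1) * ε * d)⟩ : Frame).tile ∈ 𝒯) ∨
      (D = (⟨true, ε, t, d⟩ : Frame).tile ∧ (mir ⟨true, ε, t, d⟩ 0).tile ∈ 𝒯)) := by
  constructor
  · rintro (⟨t, h, w, r, rfl, h1, h2, h3⟩ | ⟨t, h, w, rfl, h1, h2⟩)
    · obtain ⟨⟨c, ε, t, d⟩, hf, h⟩ := hG.shape _ h1
      have h0 : c = true := congrArg TriTile.acute h
      subst h0
      have hm := h ▸ h1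
      simp only [tile, TriTile.mk.injEq, kap_true, true_and, Complex.ofReal_one, one_mul] at h
      obtain ⟨rfl, rfl, rfl⟩ := h
      have h4 := hG.absorb_even hf h2 h3
      refine ⟨ε, t, d, hf, hm, Or.inl ⟨?_, h4 ▸ h2⟩⟩
      have := congrArg TriTile.t h4
      simp only [tile] at this ⊢
      rw [this]
      rfl
    · obtain ⟨⟨c, ε, t, d⟩, hf, h⟩ := hG.shape _ h1
      have h0 : c = true := congrArg TriTile.acute h
      subst h0
      refine ⟨ε, t, d, hf, h ▸ h1, Or.inr ⟨h.symm, ?_⟩⟩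
      obtain ⟨g, hg | hg, hgT⟩ := hG.across _ hf (h ▸ h1) 0
      · exact hg ▸ hgT
      · exfalso
        simp only [tile, TriTile.mk.injEq, kap_true, true_and, Complex.ofReal_one, one_mul] at h
        obtain ⟨rfl, rfl, rfl⟩ := h
        have hC := gold_sq_complex
        have hr : ε ^ 2 = gold * ε - 1 := hf.root
        cases hg
        refine h2 ⟨t + gold * ε * d, ?_, wbtw_of_golden (by ring)⟩
        convert hgT using 1
        simp only [tile, TriTile.mk.injEq, true_and, kap_false]
        exact ⟨by ring, by grind⟩
  · rintro ⟨ε, t, d, hf, hT, ⟨rfl, h⟩ | ⟨rfl, h⟩⟩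
    · left
      have hC := gold_sq_complex
      have hr : ε ^ 2 = gold * ε - 1 := hf.root
      refine ⟨t, t + d, t + gold * ε * d, t + ε * d, rfl, ?_, ?_, wbtw_of_golden (by ring)⟩
      · convert hT using 1
        simp [tile]
      · convert h using 1
        simp only [tile, TriTile.mk.injEq, true_and, kap_false]
        exact ⟨by ring, by grind⟩
    · right
      refine ⟨t, t + d, t + ε * d, by simp [tile], by convert hT using 1; simp [tile], ?_⟩
      rintro ⟨v, h1, h2⟩
      have h3 := hG.absorb_even hf h1 h2
      exact hG.not_mir_of_ex hf hT (Ex.even_acute_zero ε t d) (h3 ▸ h1) h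

theorem mem_composeB (hG : Good false s 𝒯) {D : TriTile} : D ∈ composeB 𝒯 ↔
    ∃ ε t d, Ok false s ⟨false, ε, t, d⟩ ∧ (⟨false, ε, t, d⟩ : Frame).tile ∈ 𝒯 ∧
      ((D = (⟨true, gold - ε, t + gold * ε * d, -(gold * ε ^ 2 * d)⟩ : Frame).tile ∧
        (⟨true, gold - ε, t, d⟩ : Frame).tile ∈ 𝒯) ∨
      (D = (⟨false, ε, t, d⟩ : Frame).tile ∧ (mir ⟨false, ε, t, d⟩ 2).tile ∈ 𝒯)) := by
  have hC := gold_sq_complex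
  constructor
  · rintro (⟨t', h', w', q', rfl, h1, h2, h3⟩ | ⟨t', h', w', rfl, h1, h2⟩)
    · obtain ⟨⟨c, ε, t, d⟩, hf, h⟩ := hG.shape _ h1
      have h0 : c = false := congrArg TriTile.acute h
      subst h0
      have hm := h ▸ h1
      have hr : ε ^ 2 = gold * ε - 1 := hf.root
      simp only [tile, TriTile.mk.injEq, kap_false, true_and] at h
      obtain ⟨rfl, rfl, rfl⟩ := h
      have h4 := hG.absorb_odd hf h2 h3
      refine ⟨ε, t, d, hf, hm, Or.inl ⟨?_, h4 ▸ h2⟩⟩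
      have := congrArg TriTile.w h4
      simp only [tile, TriTile.mk.injEq, true_and, kap_true] at this ⊢
      rw [this]
      push_cast
      exact ⟨by grind, by grind⟩
    · obtain ⟨⟨c, ε, t, d⟩, hf, h⟩ := hG.shape _ h1
      have h0 : c = false := congrArg TriTile.acute h
      subst h0
      have hr : ε ^ 2 = gold * ε - 1 := hf.root
      refine ⟨ε, t, d, hf, h ▸ h1, Or.inr ⟨h.symm, ?_⟩⟩
      obtain ⟨g, hg | hg, hgT⟩ := hG.across _ hf (h ▸ h1) 2
      · exact hg ▸ hgT
      · exfalso
        simp only [tile, TriTile.mk.injEq, kap_false, true_and] at h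
        obtain ⟨rfl, rfl, rfl⟩ := h
        cases hg
        refine h2 ⟨_, hgT, wbtw_of_golden ?_⟩
        simp only [kap_true]
        push_cast
        grind
  · rintro ⟨ε, t, d, hf, hT, ⟨rfl, h⟩ | ⟨rfl, h⟩⟩
    · left
      have hr : ε ^ 2 = gold * ε - 1 := hf.root
      refine ⟨t + gold * ε * d, t + (gold - ε) * d, t, t + d, ?_, hT, ?_,
        wbtw_of_golden (by grind)⟩
      · simp only [tile, TriTile.mk.injEq, true_and, kap_true]
        push_cast
        exact ⟨by grind, by grind⟩
      · convert h using 1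
        simp [tile]
    · right
      refine ⟨t, t + d, t + gold * ε * d, rfl, hT, ?_⟩
      rintro ⟨v, h1, h2⟩
      have h3 := hG.absorb_odd hf h1 h2
      exact hG.not_mir_of_ex hf hT (Ex.odd_obtuse_two ε t d) (h3 ▸ h1) h

theorem false_mem_composeA (hG : Good true s 𝒯) (hf : Ok true s ⟨true, ε, t, d⟩) :
    (⟨false, ε, t, d⟩ : Frame).tile ∈ composeA 𝒯 ↔ (⟨true, ε, t, d⟩ : Frame).tile ∈ 𝒯 ∧
      (⟨false, ε, t + gold * ε * d, -((gold - 1) * ε * d)⟩ : Frame).tile ∈ 𝒯 := by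
  rw [hG.mem_composeA]
  constructor
  · rintro ⟨ε', t', d', hf', hT, ⟨h, h'⟩ | ⟨h, -⟩⟩
    · have := eq_of_tile_eq (f := ⟨false, ε, t, d⟩) (g := ⟨false, ε', t', d'⟩)
        (hf.valid.of_eq rfl rfl) (hf'.valid.of_eq rfl rfl) h
      simp only [Frame.mk.injEq, true_and] at this
      obtain ⟨rfl, rfl, rfl⟩ := this
      exact ⟨hT, h'⟩
    · exact absurd (congrArg TriTile.acute h) (by simp [tile])
  · exact fun h => ⟨ε, t, d, hf, h.1, Or.inl ⟨rfl, h.2⟩⟩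

theorem true_mem_composeA (hG : Good true s 𝒯) (hf : Ok true s ⟨true, ε, t, d⟩) :
    (⟨true, ε, t, d⟩ : Frame).tile ∈ composeA 𝒯 ↔ (⟨true, ε, t, d⟩ : Frame).tile ∈ 𝒯 ∧
      (mir ⟨true, ε, t, d⟩ 0).tile ∈ 𝒯 := by
  rw [hG.mem_composeA]
  constructor
  · rintro ⟨ε', t', d', hf', hT, ⟨h, -⟩ | ⟨h, h'⟩⟩
    · exact absurd (congrArg TriTile.acute h) (by simp [tile])
    · have := eq_of_tile_eq hf.valid hf'.valid h
      simp only [Frame.mk.injEq, true_and] at this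
      obtain ⟨rfl, rfl, rfl⟩ := this
      exact ⟨hT, h'⟩
  · exact fun h => ⟨ε, t, d, hf, h.1, Or.inr ⟨rfl, h.2⟩⟩

theorem _root_.PenroseCurve.Frame.valid_large {ε t d : ℂ} {c c' : Bool}
    (hf : (⟨c, ε, t, d⟩ : Frame).Valid) :
    (⟨c', gold - ε, t + gold * ε * d, -(gold * ε ^ 2 * d)⟩ : Frame).Valid :=
  ⟨hf.root.conj, neg_ne_zero.2 (mul_ne_zero (mul_ne_zero gold_ne_zero_complex
    (pow_ne_zero 2 hf.root.ne_zero)) hf.ne)⟩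

theorem true_mem_composeB (hG : Good false s 𝒯) (hf : Ok false s ⟨false, ε, t, d⟩) :
    (⟨true, gold - ε, t + gold * ε * d, -(gold * ε ^ 2 * d)⟩ : Frame).tile ∈ composeB 𝒯 ↔
      (⟨false, ε, t, d⟩ : Frame).tile ∈ 𝒯 ∧ (⟨true, gold - ε, t, d⟩ : Frame).tile ∈ 𝒯 := by
  rw [hG.mem_composeB]
  constructor
  · rintro ⟨ε', t', d', hf', hT, ⟨h, h'⟩ | ⟨h, -⟩⟩
    · have := eq_of_tile_eq (valid_large hf.valid) (valid_large hf'.valid) h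
      simp only [Frame.mk.injEq, true_and] at this
      obtain ⟨h1, h2, h3⟩ := this
      obtain rfl : ε = ε' := by linear_combination -h1
      have h4 : (gold * ε ^ 2) * (d - d') = 0 := by linear_combination -h3
      have h5 : (gold : ℂ) * ε ^ 2 ≠ 0 :=
        mul_ne_zero gold_ne_zero_complex (pow_ne_zero 2 hf.root.ne_zero)
      obtain rfl : d = d' := sub_eq_zero.1 ((mul_eq_zero.1 h4).resolve_left h5)
      obtain rfl : t = t' := by linear_combination h2
      exact ⟨hT, h'⟩
    · exact absurd (congrArg TriTile.acute h) (by simp [tile])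
  · exact fun h => ⟨ε, t, d, hf, h.1, Or.inl ⟨rfl, h.2⟩⟩

theorem false_mem_composeB (hG : Good false s 𝒯) (hf : Ok false s ⟨false, ε, t, d⟩) :
    (⟨false, ε, t, d⟩ : Frame).tile ∈ composeB 𝒯 ↔ (⟨false, ε, t, d⟩ : Frame).tile ∈ 𝒯 ∧
      (mir ⟨false, ε, t, d⟩ 2).tile ∈ 𝒯 := by
  rw [hG.mem_composeB]
  constructor
  · rintro ⟨ε', t', d', hf', hT, ⟨h, -⟩ | ⟨h, h'⟩⟩
    · exact absurd (congrArg TriTile.acute h) (by simp [tile])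
    · have := eq_of_tile_eq hf.valid hf'.valid h
      simp only [Frame.mk.injEq, true_and] at this
      obtain ⟨rfl, rfl, rfl⟩ := this
      exact ⟨hT, h'⟩
  · exact fun h => ⟨ε, t, d, hf, h.1, Or.inr ⟨rfl, h.2⟩⟩

theorem par_even_acute (hG : Good true s 𝒯) (hf : Ok true s ⟨true, ε, t, d⟩)
    (hT : (⟨true, ε, t, d⟩ : Frame).tile ∈ 𝒯) :
    (⟨false, ε, t, d⟩ : Frame).tile ∈ composeA 𝒯 ∨
      (⟨true, ε, t, d⟩ : Frame).tile ∈ composeA 𝒯 := by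
  rw [hG.false_mem_composeA hf, hG.true_mem_composeA hf]
  obtain ⟨g, rfl | hg, hgT⟩ := hG.across _ hf hT 0
  · exact Or.inr ⟨hT, hgT⟩
  · cases hg
    exact Or.inl ⟨hT, hgT⟩

theorem par_even_obtuse (hG : Good true s 𝒯) (hf : Ok true s ⟨false, ε, t, d⟩)
    (hT : (⟨false, ε, t, d⟩ : Frame).tile ∈ 𝒯) :
    (⟨false, ε, t + gold ^ 2 * d, -(gold * (gold - ε) * d)⟩ : Frame).tile ∈ composeA 𝒯 := by
  have hC := gold_sq_complex
  have hr : ε ^ 2 = gold * ε - 1 := hf.root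
  have h1 := hG.even_obtuse_zero_mem hf hT
  rw [hG.false_mem_composeA (hf.ex (Ex.even_obtuse_zero ε t d))]
  refine ⟨h1, ?_⟩
  convert hT using 2
  exact mk_congr rfl (by grind) (by grind)

theorem par_odd_obtuse (hG : Good false s 𝒯) (hf : Ok false s ⟨false, ε, t, d⟩)
    (hT : (⟨false, ε, t, d⟩ : Frame).tile ∈ 𝒯) :
    (⟨true, gold - ε, t + gold * ε * d, -(gold * ε ^ 2 * d)⟩ : Frame).tile ∈ composeB 𝒯 ∨
      (⟨false, ε, t, d⟩ : Frame).tile ∈ composeB 𝒯 := by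
  rw [hG.true_mem_composeB hf, hG.false_mem_composeB hf]
  obtain ⟨g, rfl | hg, hgT⟩ := hG.across _ hf hT 2
  · exact Or.inr ⟨hT, hgT⟩
  · cases hg
    exact Or.inl ⟨hT, hgT⟩

theorem par_odd_acute (hG : Good false s 𝒯) (hf : Ok false s ⟨true, ε, t, d⟩)
    (hT : (⟨true, ε, t, d⟩ : Frame).tile ∈ 𝒯) :
    (⟨true, ε, t + ε * d + gold * (gold - ε) ^ 2 * d, -(gold * (gold - ε) ^ 2 * d)⟩ :
      Frame).tile ∈ composeB 𝒯 := by
  have hC := gold_sq_complex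
  have hr : ε ^ 2 = gold * ε - 1 := hf.root
  have h1 := hG.odd_acute_two_mem hf hT
  have h2 := (hG.true_mem_composeB (hf.ex (Ex.odd_acute_two ε t d))).2
    ⟨h1, by rwa [sub_sub_cancel]⟩
  convert h2 using 2
  exact mk_congr (by ring) (by grind) rfl

end Good

/-- The tiling that is composed of a tiling of an even or of an odd level. -/
def compose (e : Bool) (𝒯 : Set TriTile) : Set TriTile :=
  if e then composeA 𝒯 else composeB 𝒯

theorem compose_true (𝒯 : Set TriTile) : compose true 𝒯 = composeA 𝒯 := rfl
theorem compose_false (𝒯 : Set TriTile) : compose false 𝒯 = composeB 𝒯 := rfl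

theorem Frame.region_subset {f F : Frame} (hf : f.Valid) (hF : F.Valid) (A B : ℝ → ℝ → ℝ)
    (h : ∀ a b, f.pt a b = F.pt (A a b) (B a b))
    (h' : ∀ a b, 0 ≤ a → 0 ≤ b → 0 ≤ 1 - a - f.sig * b →
      0 ≤ 1 - A a b - F.sig * B a b ∧ 0 ≤ A a b ∧ 0 ≤ B a b) :
    f.tile.region ⊆ F.tile.region := by
  intro x hx
  obtain ⟨a, b, rfl⟩ := exists_pt hf x
  rw [mem_region hf] at hx
  simp only [co_pt hf] at hx
  have h2 : 0 ≤ b := by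
    have : 0 ≤ f.sig * b := hx 2
    exact (mul_nonneg_iff_of_pos_left f.sig_pos).1 this
  obtain ⟨k0, k1, k2⟩ := h' a b (hx 1) h2 (hx 0)
  rw [h, mem_region hF]
  intro i
  rw [co_pt hF]
  have := F.sig_pos
  fin_cases i
  exacts [k0, k1, mul_nonneg this.le k2]

theorem Frame.Par.region_subset {e : Bool} {s : ℝ} {f F : Frame} (hf : Ok e s f)
    (h : Par e f F) : f.tile.region ⊆ F.tile.region := by
  have hv := hf.valid
  have hF := (hf.par h).valid
  have hr : f.ε ^ 2 = gold * f.ε - 1 := hf.root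
  have hC := gold_sq_complex
  have hR := gold_sq
  have h1 := one_lt_gold
  have h2 := gold_lt
  cases h with
  | even_acute_large ε t d =>
    refine Frame.region_subset hv hF (fun a b => a) (fun a b => b) (fun a b => rfl)
      fun a b ha hb hab => ?_
    simp only [sig_true, sig_false] at *
    exact ⟨by nlinarith, ha, hb⟩
  | even_acute_small => exact subset_rfl
  | even_obtuse ε t d =>
    refine Frame.region_subset hv hF (fun a b => (gold - 1) * b)
      (fun a b => gold + (1 - gold) * a - b) (fun a b => ?_) fun a b ha hb hab => ?_
    · simp only [pt] at *; push_cast; grind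
    · simp only [sig_false] at *
      have e1 : 1 - (gold - 1) * b - (gold - 1) * (gold + (1 - gold) * a - b) =
        (gold - 1) ^ 2 * a := by linear_combination -hR
      have e2 : gold + (1 - gold) * a - b = gold * (1 - a - (gold - 1) * b) + a := by
        linear_combination b * hR
      have : 0 ≤ gold - 1 := by linarith
      have := gold_pos
      rw [e1, e2]
      exact ⟨by positivity, by positivity, by positivity⟩
  | odd_obtuse_large ε t d =>
    refine Frame.region_subset hv hF (fun a b => (gold - 1) * a)
      (fun a b => 1 - a - (gold - 1) * b) (fun a b => ?_) fun a b ha hb hab => ?_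
    · simp only [pt] at *; push_cast; grind
    · simp only [sig_true, sig_false] at *
      exact ⟨by nlinarith, by nlinarith, hab⟩
  | odd_obtuse_small => exact subset_rfl
  | odd_acute ε t d =>
    refine Frame.region_subset hv hF (fun a b => (gold - 1) * a + b)
      (fun a b => 1 - a - b) (fun a b => ?_) fun a b ha hb hab => ?_
    · simp only [pt] at *; push_cast; grind
    · simp only [sig_true] at *
      exact ⟨by nlinarith, by nlinarith, by linarith⟩

namespace Good

variable {e : Bool} {s : ℝ} {𝒯 : Set TriTile}

theorem exists_par (hG : Good e s 𝒯) {f : Frame} (hf : Ok e s f) (hT : f.tile ∈ 𝒯) :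
    ∃ F, Par e f F ∧ F.tile ∈ compose e 𝒯 := by
  obtain ⟨c, ε, t, d⟩ := f
  cases e <;> cases c
  · rcases hG.par_odd_obtuse hf hT with h | h
    · exact ⟨_, Par.odd_obtuse_large .., h⟩
    · exact ⟨_, Par.odd_obtuse_small .., h⟩
  · exact ⟨_, Par.odd_acute .., hG.par_odd_acute hf hT⟩
  · exact ⟨_, Par.even_obtuse .., hG.par_even_obtuse hf hT⟩
  · rcases hG.par_even_acute hf hT with h | h
    · exact ⟨_, Par.even_acute_large .., h⟩
    · exact ⟨_, Par.even_acute_small .., h⟩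

/-- Two different parents would require both the mirror image and a tile of the other type across
the same side. -/
theorem par_unique (hG : Good e s 𝒯) {f F F' : Frame} (hf : Ok e s f) (h : Par e f F)
    (hT : F.tile ∈ compose e 𝒯) (h' : Par e f F') (hT' : F'.tile ∈ compose e 𝒯) : F = F' := by
  have k1 : ∀ {ε t d : ℂ}, Good true s 𝒯 → Ok true s ⟨true, ε, t, d⟩ →
      (⟨false, ε, t, d⟩ : Frame).tile ∈ composeA 𝒯 →
      (⟨true, ε, t, d⟩ : Frame).tile ∈ composeA 𝒯 → False := fun hG hf h h' =>
    hG.not_mir_of_ex hf ((hG.true_mem_composeA hf).1 h').1 (Ex.even_acute_zero ..)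
      ((hG.false_mem_composeA hf).1 h).2 ((hG.true_mem_composeA hf).1 h').2
  have k2 : ∀ {ε t d : ℂ}, Good false s 𝒯 → Ok false s ⟨false, ε, t, d⟩ →
      (⟨true, gold - ε, t + gold * ε * d, -(gold * ε ^ 2 * d)⟩ : Frame).tile ∈ composeB 𝒯 →
      (⟨false, ε, t, d⟩ : Frame).tile ∈ composeB 𝒯 → False := fun hG hf h h' =>
    hG.not_mir_of_ex hf ((hG.true_mem_composeB hf).1 h).1 (Ex.odd_obtuse_two ..)
      ((hG.true_mem_composeB hf).1 h).2 ((hG.false_mem_composeB hf).1 h').2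
  cases h <;> cases h' <;> first
    | rfl
    | exact (k1 hG hf hT hT').elim
    | exact (k1 hG hf hT' hT).elim
    | exact (k2 hG hf hT hT').elim
    | exact (k2 hG hf hT' hT).elim

theorem shape_compose (hG : Good e s 𝒯) {D : TriTile} (hD : D ∈ compose e 𝒯) :
    ∃ f F, Ok e s f ∧ f.tile ∈ 𝒯 ∧ Par e f F ∧ F.tile = D := by
  cases e
  · obtain ⟨ε, t, d, hf, hT, ⟨rfl, -⟩ | ⟨rfl, -⟩⟩ := hG.mem_composeB.1 hD
    · exact ⟨_, _, hf, hT, Par.odd_obtuse_large .., rfl⟩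
    · exact ⟨_, _, hf, hT, Par.odd_obtuse_small .., rfl⟩
  · obtain ⟨ε, t, d, hf, hT, ⟨rfl, -⟩ | ⟨rfl, -⟩⟩ := hG.mem_composeA.1 hD
    · exact ⟨_, _, hf, hT, Par.even_acute_large .., rfl⟩
    · exact ⟨_, _, hf, hT, Par.even_acute_small .., rfl⟩

theorem mem_of_par (hG : Good e s 𝒯) {f F : Frame} (hf : Ok e s f) (h : Par e f F)
    (hT : F.tile ∈ compose e 𝒯) : f.tile ∈ 𝒯 := by
  have hC := gold_sq_complex
  have hr : f.ε ^ 2 = gold * f.ε - 1 := hf.root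
  cases h with
  | even_acute_large ε t d => exact ((hG.false_mem_composeA hf).1 hT).1
  | even_acute_small ε t d => exact ((hG.true_mem_composeA hf).1 hT).1
  | even_obtuse ε t d =>
    have := ((hG.false_mem_composeA (hf.ex (Ex.even_obtuse_zero ε t d))).1 hT).2
    convert this using 2
    exact mk_congr rfl (by grind) (by grind)
  | odd_obtuse_large ε t d => exact ((hG.true_mem_composeB hf).1 hT).1
  | odd_obtuse_small ε t d => exact ((hG.false_mem_composeB hf).1 hT).1
  | odd_acute ε t d =>
    have h1 : (⟨true, ε, t + ε * d + gold * (gold - ε) ^ 2 * d,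
        -(gold * (gold - ε) ^ 2 * d)⟩ : Frame) = ⟨true, gold - (gold - ε),
        t + gold * (gold - ε) * d, -(gold * (gold - ε) ^ 2 * d)⟩ :=
      mk_congr (by ring) (by grind) rfl
    have := ((hG.true_mem_composeB (hf.ex (Ex.odd_acute_two ε t d))).1 (h1 ▸ hT)).2
    rwa [sub_sub_cancel] at this

theorem exists_child (hG : Good e s 𝒯) {D : TriTile} (hT : D ∈ compose e 𝒯) {x : ℂ}
    (hx : x ∈ D.region) :
    ∃ f F, Ok e s f ∧ f.tile ∈ 𝒯 ∧ Par e f F ∧ F.tile = D ∧ x ∈ f.tile.region := by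
  have hC := gold_sq_complex
  have hR := gold_sq
  have h0 := gold_pos
  cases e
  · obtain ⟨ε, t, d, hf, hT', ⟨rfl, h⟩ | ⟨rfl, -⟩⟩ := hG.mem_composeB.1 hT
    · have hr : ε ^ 2 = gold * ε - 1 := hf.root
      have hF := (hf.par (Par.odd_obtuse_large ε t d)).valid
      have hg := hf.ex (Ex.odd_obtuse_two ε t d)
      obtain ⟨a, b, rfl⟩ := exists_pt hF x
      have hx := (mem_region hF).1 hx
      simp only [co_pt hF, sig_true] at hx
      have x0 : 0 ≤ 1 - a - 1 * b := hx 0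
      have x1 : 0 ≤ a := hx 1
      have x2 : 0 ≤ 1 * b := hx 2
      -- This is the second coordinate of the point with respect to the obtuse part. Its zero set is
      -- the line of the common side along which the large tile is cut.
      rcases le_total 0 (gold - gold ^ 2 * a - gold * b) with h1 | h1
      · refine ⟨_, _, hf, hT', Par.odd_obtuse_large .., rfl, ?_⟩
        have : pt ⟨true, gold - ε, t + gold * ε * d, -(gold * ε ^ 2 * d)⟩ a b =
            pt ⟨false, ε, t, d⟩ (gold * a) (gold - gold ^ 2 * a - gold * b) := by
          simp only [pt]; push_cast; grind
        rw [this, mem_region hf.valid]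
        intro i
        rw [co_pt hf.valid]
        fin_cases i
        · simp; nlinarith
        · simp; positivity
        · simp; exact mul_nonneg (by linarith [one_lt_gold]) h1
      · refine ⟨_, ⟨true, gold - ε, t + gold * ε * d, -(gold * ε ^ 2 * d)⟩, hg, h, ?_, rfl, ?_⟩
        · have := Par.odd_acute (gold - ε) t d
          convert this using 1
          exact mk_congr rfl (by grind) (by grind)
        have : pt ⟨true, gold - ε, t + gold * ε * d, -(gold * ε ^ 2 * d)⟩ a b =
            pt ⟨true, gold - ε, t, d⟩ (gold ^ 2 * (1 - a - 1 * b))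
              (-(gold - gold ^ 2 * a - gold * b)) := by
          simp only [pt]; push_cast; grind
        rw [this, mem_region hg.valid]
        intro i
        rw [co_pt hg.valid]
        fin_cases i
        · simp; nlinarith
        · simp at *; positivity
        · simp; linarith
    · exact ⟨_, _, hf, hT', Par.odd_obtuse_small .., rfl, hx⟩
  · obtain ⟨ε, t, d, hf, hT', ⟨rfl, h⟩ | ⟨rfl, -⟩⟩ := hG.mem_composeA.1 hT
    · have hr : ε ^ 2 = gold * ε - 1 := hf.root
      have hF := (hf.par (Par.even_acute_large ε t d)).valid
      have hg := hf.ex (Ex.even_acute_zero ε t d)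
      obtain ⟨a, b, rfl⟩ := exists_pt hF x
      have hx := (mem_region hF).1 hx
      simp only [co_pt hF, sig_false] at hx
      have x0 : 0 ≤ 1 - a - (gold - 1) * b := hx 0
      have x1 : 0 ≤ a := hx 1
      have x2 : 0 ≤ (gold - 1) * b := hx 2
      have x2 : 0 ≤ b := (mul_nonneg_iff_of_pos_left (by linarith [one_lt_gold])).1 x2
      -- The line `a + b = 1` contains the common side of the two parts.
      rcases le_total 0 (1 - a - b) with h1 | h1
      · refine ⟨_, _, hf, hT', Par.even_acute_large .., rfl, ?_⟩
        have : pt ⟨false, ε, t, d⟩ a b = pt ⟨true, ε, t, d⟩ a b := rfl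
        rw [this, mem_region hf.valid]
        intro i
        rw [co_pt hf.valid]
        fin_cases i
        · simpa using h1
        · exact x1
        · simpa using x2
      · refine ⟨_, ⟨false, ε, t, d⟩, hg, h, ?_, rfl, ?_⟩
        · have := Par.even_obtuse ε (t + gold * ε * d) (-((gold - 1) * ε * d))
          convert this using 1
          exact mk_congr rfl (by grind) (by grind)
        have : pt ⟨false, ε, t, d⟩ a b =
            pt ⟨false, ε, t + gold * ε * d, -((gold - 1) * ε * d)⟩
              (gold ^ 2 * (1 - a - (gold - 1) * b)) (gold * a) := by
          simp only [pt]; push_cast; grind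
        rw [this, mem_region hg.valid]
        intro i
        rw [co_pt hg.valid]
        fin_cases i
        · simp; nlinarith
        · simp; positivity
        · simp; exact mul_nonneg (by linarith [one_lt_gold]) (by positivity)
    · exact ⟨_, _, hf, hT', Par.even_acute_small .., rfl, hx⟩

end Good

end PenroseCurve

end

/-! ### The composed tiling again satisfies the matching rules. -/

noncomputable section

namespace PenroseCurve

open Topology
open PenroseCurve.Frame

theorem Frame.Ex.of_eq {e : Bool} {f g g' : Frame} {i : Fin 3} (h : Ex e f i g) (h' : g' = g) :
    Ex e f i g' := h' ▸ h

namespace Good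

variable {s : ℝ} {𝒯 : Set TriTile} {ε t d : ℂ}

/-- The sides 0 and 2 are sides of one of the two parts. Side 1 consists of a side of each part;
there the other half of the dart containing the small part decides, as its parent is the mirror
image. -/
theorem across_even_large (hG : Good true s 𝒯) (hf : Ok true s ⟨true, ε, t, d⟩)
    (hT : (⟨true, ε, t, d⟩ : Frame).tile ∈ 𝒯)
    (ha : (⟨false, ε, t + gold * ε * d, -((gold - 1) * ε * d)⟩ : Frame).tile ∈ 𝒯) (i : Fin 3) :
    ∃ G, Nbr false ⟨false, ε, t, d⟩ i G ∧ G.tile ∈ composeA 𝒯 := by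
  have hC := gold_sq_complex
  have hr : ε ^ 2 = gold * ε - 1 := hf.root
  have hg := hf.ex (Ex.even_acute_zero ε t d)
  fin_cases i
  · have hside : ∀ G, G = mir ⟨false, ε, t + gold * ε * d, -((gold - 1) * ε * d)⟩ 1 → G.tile ∈ 𝒯 →
        ∃ G, Nbr false ⟨false, ε, t, d⟩ 0 G ∧ G.tile ∈ composeA 𝒯 := by
      rintro G rfl h
      refine ⟨_, Or.inl ?_, hG.par_even_obtuse (hg.mir 1) h⟩
      rw [mir_zero_obtuse]
      exact mk_congr rfl (by grind) (by grind)
    obtain ⟨n, hn | hn, hnT⟩ := hG.across _ hg ha 1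
    · exact hside n hn hnT
    · have hn1 := hg.ex hn
      have hn' : n = ⟨true, ε, t + d, ε * d⟩ := by
        cases hn
        exact mk_congr rfl (by grind) (by grind)
      subst hn'
      rcases hG.par_even_acute hn1 hnT with h | h
      · exfalso
        have ha1 := ((hG.false_mem_composeA hn1).1 h).2
        have hg1 := hn1.ex (Ex.even_acute_zero _ _ _)
        have hm := hG.mir_two_mem hg ha
        have hm1 := hG.mir_two_mem hg1 ha1
        obtain ⟨k, hk, hkT⟩ := hG.across _ (hg.mir 2) hm 1
        have h1 := gold_mul_sub_one
        have h2 := one_lt_gold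
        have h3 := gold_lt
        -- If the tile across the side were also absorbing, the halves of two darts would meet at a
        -- point inside side 1 of one of them, and so would be equal or neighbors. But they have the
        -- same type and the same orientation, which excludes neighbors, and different vectors `d`.
        have hx : OpenEdge (mir ⟨false, ε, t + gold * ε * d, -((gold - 1) * ε * d)⟩ 2) 1
            ((mir ⟨false, ε, t + gold * ε * d, -((gold - 1) * ε * d)⟩ 2).pt 0 (1 / 2)) := by
          constructor
          · rw [co_pt (hg.mir 2).valid]; simp
          · intro j hj
            rw [co_pt (hg.mir 2).valid]
            fin_cases j
            · simp [mir_two]; linarith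
            · exact absurd rfl hj
            · simp [mir_two]; linarith
        have hx' : (mir ⟨false, ε, t + gold * ε * d, -((gold - 1) * ε * d)⟩ 2).pt 0 (1 / 2) ∈
            (mir ⟨false, ε, t + d + gold * ε * (ε * d), -((gold - 1) * ε * (ε * d))⟩ 2).tile.region := by
          have : (mir ⟨false, ε, t + gold * ε * d, -((gold - 1) * ε * d)⟩ 2).pt 0 (1 / 2) =
              (mir ⟨false, ε, t + d + gold * ε * (ε * d), -((gold - 1) * ε * (ε * d))⟩ 2).pt (1 / 2)
                (1 / 2 * gold) := by
            simp only [pt, mir_two]; push_cast; grind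
          rw [this, mem_region (hg1.mir 2).valid]
          intro j
          rw [co_pt (hg1.mir 2).valid]
          fin_cases j
          · simp [mir_two]; linarith
          · simp
          · simp [mir_two]; nlinarith
        rcases hG.eq_or_eq_of_openEdge (hg.mir 2) (hg1.mir 2) hm hm1 hk hkT hx hx' with h | h
        · simp only [mir_two, Frame.mk.injEq, true_and] at h
          have h4 : ((gold : ℂ) - 1) * ε * d ≠ 0 := by
            simpa using hg.valid.ne
          have h5 : ((gold : ℂ) - 1) * ε * d * (ε - 1) = 0 := by linear_combination -h.2
          have h6 : ε = 1 := sub_eq_zero.1 ((mul_eq_zero.1 h5).resolve_left h4)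
          exact hf.root.im_ne_zero (show ε.im = 0 by rw [h6]; simp)
        · subst h
          rcases hk with hk | hk
          · have := congrArg Frame.ε hk
            simp only [mir_ε] at this
            exact hf.root.ne_conj (by linear_combination -this)
          · have := hk
            rw [mir_two, mir_two] at this
            cases this
      · exact ⟨_, Or.inr (Ex.odd_obtuse_zero ε t d), h⟩
  · have hm := hG.mir_two_mem hg ha
    refine ⟨_, Or.inl ?_, hG.par_even_obtuse (hg.mir 2) hm⟩
    simp only [Fin.mk_one, mir_one]
    exact mk_congr rfl (by grind) (by grind)
  · rcases hG.par_even_acute (hf.mir 2) (hG.mir_two_mem hf hT) with h | h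
    · exact ⟨_, Or.inl rfl, h⟩
    · exact ⟨_, Or.inr (Ex.odd_obtuse_two ε t d), h⟩

theorem across_even_small (hG : Good true s 𝒯) (hf : Ok true s ⟨true, ε, t, d⟩)
    (hT : (⟨true, ε, t, d⟩ : Frame).tile ∈ 𝒯) (hm : (mir ⟨true, ε, t, d⟩ 0).tile ∈ 𝒯) (i : Fin 3) :
    ∃ G, Nbr false ⟨true, ε, t, d⟩ i G ∧ G.tile ∈ composeA 𝒯 := by
  have hC := gold_sq_complex
  have hr : ε ^ 2 = gold * ε - 1 := hf.root
  fin_cases i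
  · refine ⟨_, Or.inl rfl, (hG.true_mem_composeA (hf.mir 0)).2 ⟨hm, ?_⟩⟩
    have := mir_mir hf.valid 0
    simp only [mir_zero_acute] at this ⊢
    rwa [this]
  · obtain ⟨n, hn | hn, hnT⟩ := hG.across _ hf hT 1
    · subst hn
      rcases hG.par_even_acute (hf.mir 1) hnT with h | h
      · exfalso
        have ha1 := ((hG.false_mem_composeA (hf.mir 1)).1 h).2
        have hg1 := (hf.mir 1).ex (Ex.even_acute_zero _ _ _)
        have hk := hG.mir_two_mem hg1 ha1
        have h1 := gold_mul_sub_one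
        have h2 := one_lt_gold
        have h3 := gold_lt
        -- Otherwise three acute tiles with angle `2θ` and a dart with angle `6θ` would meet at `w`,
        -- which is more than `10θ`. The coordinates give a point in which `f.mir 0` and a half of
        -- the dart overlap.
        have := hG.frame_eq (hf.mir 0) (hg1.mir 2) hm hk (a := 1 / 4) (b := 1 / 2)
          (a' := 1 / 2 - 1 / 4 * gold) (b' := 1 / 2 * gold) ?_ ?_ ?_
        · have := congrArg Frame.c this
          simp [mir] at this
        · simp only [pt, mir_two, mir_zero_acute]; push_cast; grind
        · simp [mir_zero_acute]; norm_num
        · simp only [mir_two, sig_false]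
          exact ⟨by nlinarith, by linarith, by linarith⟩
      · exact ⟨_, Or.inl rfl, h⟩
    · have hn1 := hf.ex hn
      cases hn
      refine ⟨_, Or.inr ((Ex.odd_acute_one ε t d).of_eq ?_), hG.par_even_obtuse hn1 hnT⟩
      exact mk_congr rfl (by grind) (by grind)
  · rcases hG.par_even_acute (hf.mir 2) (hG.mir_two_mem hf hT) with h | h
    · exact ⟨_, Or.inr (Ex.odd_acute_two ε t d), h⟩
    · exact ⟨_, Or.inl rfl, h⟩

theorem across_odd_large (hG : Good false s 𝒯) (hf : Ok false s ⟨false, ε, t, d⟩)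
    (hT : (⟨false, ε, t, d⟩ : Frame).tile ∈ 𝒯)
    (hb : (⟨true, gold - ε, t, d⟩ : Frame).tile ∈ 𝒯) (i : Fin 3) :
    ∃ G, Nbr true ⟨true, gold - ε, t + gold * ε * d, -(gold * ε ^ 2 * d)⟩ i G ∧
      G.tile ∈ composeB 𝒯 := by
  have hC := gold_sq_complex
  have hr : ε ^ 2 = gold * ε - 1 := hf.root
  have hg := hf.ex (Ex.odd_obtuse_two ε t d)
  fin_cases i
  · obtain ⟨n, hn | hn, hnT⟩ := hG.across _ hg hb 1
    · subst hn
      refine ⟨_, Or.inl ?_, hG.par_odd_acute (hg.mir 1) hnT⟩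
      simp only [Fin.zero_eta, mir_zero_acute]
      exact mk_congr rfl (by grind) (by grind)
    · have hn1 := hg.ex hn
      cases hn
      rcases hG.par_odd_obtuse hn1 hnT with h | h
      · exfalso
        have hc := ((hG.true_mem_composeB hn1).1 h).2
        have hc1 := hn1.ex (Ex.odd_obtuse_two _ _ _)
        have hm := hG.mir_one_mem hf hT
        have hm1 := hG.mir_zero_mem hc1 hc
        obtain ⟨k, hk, hkT⟩ := hG.across _ (hf.mir 1) hm 2
        have h1 := gold_mul_sub_one
        have h2 := one_lt_gold
        have h3 := gold_lt
        -- The two tiles would share a side `t h` with `t` and `h` interchanged, whereas the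
        -- neighbor of the other type across side 2 has the same `t` and `h`.
        have hx : OpenEdge (mir ⟨false, ε, t, d⟩ 1) 2 ((mir ⟨false, ε, t, d⟩ 1).pt (1 / 2) 0) := by
          constructor
          · rw [co_pt (hf.mir 1).valid]; simp
          · intro j hj
            rw [co_pt (hf.mir 1).valid]
            fin_cases j
            · simp; norm_num
            · simp
            · exact absurd rfl hj
        have hx' : (mir ⟨false, ε, t, d⟩ 1).pt (1 / 2) 0 ∈
            (mir ⟨true, gold - (gold - ε), t - (gold - (gold - ε)) * d,
              (gold - (gold - ε)) * d⟩ 0).tile.region := by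
          have : (mir ⟨false, ε, t, d⟩ 1).pt (1 / 2) 0 =
              (mir ⟨true, gold - (gold - ε), t - (gold - (gold - ε)) * d,
                (gold - (gold - ε)) * d⟩ 0).pt (1 / 2) 0 := by
            simp only [pt, mir_one, mir_zero_acute]; push_cast; grind
          rw [this, mem_region (hc1.mir 0).valid]
          intro j
          rw [co_pt (hc1.mir 0).valid]
          fin_cases j
          · simp; norm_num
          · simp
          · simp
        rcases hG.eq_or_eq_of_openEdge (hf.mir 1) (hc1.mir 0) hm hm1 hk hkT hx hx' with h | h
        · have := congrArg Frame.c h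
          simp [mir_c] at this
        · subst h
          rcases hk with hk | hk
          · have := congrArg Frame.c hk
            simp [mir_c] at this
          · have h4 : mir ⟨false, ε, t, d⟩ 1 = ⟨false, gold - ε, t, ε ^ 2 * d⟩ := rfl
            rw [h4] at hk
            generalize hk' : mir ⟨true, _, _, _⟩ 0 = k at hk
            cases hk
            have := congrArg Frame.ε hk'
            simp only [mir_ε] at this
            exact hf.root.ne_conj (by linear_combination -this)
      · refine ⟨_, Or.inr ((Ex.even_acute_zero _ _ _).of_eq ?_), h⟩
        exact mk_congr rfl (by grind) (by grind)
  · rcases hG.par_odd_obtuse (hf.mir 1) (hG.mir_one_mem hf hT) with h | h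
    · refine ⟨_, Or.inl ?_, h⟩
      simp only [Fin.mk_one, mir_one]
      exact mk_congr rfl (by grind) (by grind)
    · refine ⟨_, Or.inr ((Ex.even_acute_one _ _ _).of_eq ?_), h⟩
      exact mk_congr rfl (by grind) (by grind)
  · refine ⟨_, Or.inl ?_, hG.par_odd_acute (hg.mir 0) (hG.mir_zero_mem hg hb)⟩
    simp only [Fin.reduceFinMk, mir_two]
    exact mk_congr rfl (by grind) (by grind)

theorem across_odd_small (hG : Good false s 𝒯) (hf : Ok false s ⟨false, ε, t, d⟩)
    (hT : (⟨false, ε, t, d⟩ : Frame).tile ∈ 𝒯) (hm : (mir ⟨false, ε, t, d⟩ 2).tile ∈ 𝒯)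
    (i : Fin 3) : ∃ G, Nbr true ⟨false, ε, t, d⟩ i G ∧ G.tile ∈ composeB 𝒯 := by
  have hC := gold_sq_complex
  have hr : ε ^ 2 = gold * ε - 1 := hf.root
  fin_cases i
  · obtain ⟨n, hn | hn, hnT⟩ := hG.across _ hf hT 0
    · subst hn
      rcases hG.par_odd_obtuse (hf.mir 0) hnT with h | h
      · exfalso
        have hc := ((hG.true_mem_composeB (hf.mir 0)).1 h).2
        have hc1 := (hf.mir 0).ex (Ex.odd_obtuse_two _ _ _)
        have h1 := gold_mul_sub_one
        have h2 := one_lt_gold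
        have h3 := gold_lt
        -- Otherwise three obtuse tiles with angle `3θ` and an acute one with angle `2θ` would meet
        -- at `h`, which is `11θ > 10θ`.
        have := hG.frame_eq hc1 (hf.mir 2) hc hm (a := 3 / 8) (b := 1 / 2)
          (a' := 1 / 2) (b' := 5 / 8) ?_ ?_ ?_
        · have := congrArg Frame.c this
          simp [mir] at this
        · simp only [pt, mir_two]; push_cast; grind
        · simp only [sig_true]; norm_num
        · simp only [mir_two, sig_false]
          exact ⟨by nlinarith, by linarith, by linarith⟩
      · exact ⟨_, Or.inl rfl, h⟩
    · have hn1 := hf.ex hn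
      cases hn
      refine ⟨_, Or.inr ((Ex.even_obtuse_zero _ _ _).of_eq ?_), hG.par_odd_acute hn1 hnT⟩
      exact mk_congr rfl (by grind) (by grind)
  · rcases hG.par_odd_obtuse (hf.mir 1) (hG.mir_one_mem hf hT) with h | h
    · refine ⟨_, Or.inr ((Ex.even_obtuse_one _ _ _).of_eq ?_), h⟩
      exact mk_congr (by ring) (by grind) (by grind)
    · exact ⟨_, Or.inl rfl, h⟩
  · refine ⟨_, Or.inl rfl, (hG.false_mem_composeB (hf.mir 2)).2 ⟨hm, ?_⟩⟩
    have := mir_mir hf.valid 2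
    simp only [mir_two] at this ⊢
    rwa [this]

/-- The composed tiling satisfies the matching rules. -/
protected theorem compose {e : Bool} (hG : Good e s 𝒯) :
    Good (!e) (nextScale e s) (compose e 𝒯) where
  shape D hD := by
    obtain ⟨f, F, hf, -, h, rfl⟩ := hG.shape_compose hD
    exact ⟨F, hf.par h, rfl⟩
  across F hF hT i := by
    cases e
    · obtain ⟨ε, t, d, hf, hT', ⟨hD, h⟩ | ⟨hD, h⟩⟩ := hG.mem_composeB.1 hT
      · rw [eq_of_tile_eq hF.valid (valid_large hf.valid) hD]
        exact hG.across_odd_large hf hT' h i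
      · rw [eq_of_tile_eq hF.valid hf.valid hD]
        exact hG.across_odd_small hf hT' h i
    · obtain ⟨ε, t, d, hf, hT', ⟨hD, h⟩ | ⟨hD, h⟩⟩ := hG.mem_composeA.1 hT
      · rw [eq_of_tile_eq hF.valid (g := ⟨false, ε, t, d⟩) (hf.valid.of_eq rfl rfl) hD]
        exact hG.across_even_large hf hT' h i
      · rw [eq_of_tile_eq hF.valid hf.valid hD]
        exact hG.across_even_small hf hT' h i
  -- Overlapping composed tiles have a part in common, and a part has only one parent.
  disj D hD D' hD' := by
    rintro ⟨x, hx, hx'⟩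
    obtain ⟨f, F, hf, hfT, h, rfl, hxf⟩ := hG.exists_child hD (interior_subset hx)
    obtain ⟨y, hy, hyf⟩ := exists_interior_near hf.valid hxf (isOpen_interior.mem_nhds hx')
    obtain ⟨g, G, hg, hgT, h', rfl, hyg⟩ := hG.exists_child hD' (interior_subset hy)
    have := eq_of_tile_eq hf.valid hg.valid (hG.eq_of_mem_interior hfT hgT hyf hyg)
    subst this
    rw [hG.par_unique hf h hD h' hD']
  cover x := by
    obtain ⟨D, hD, hx⟩ := hG.cover x
    obtain ⟨f, hf, rfl⟩ := hG.shape D hD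
    obtain ⟨F, h, hF⟩ := hG.exists_par hf hD
    exact ⟨_, hF, h.region_subset hf hx⟩

end Good

end PenroseCurve

end

/-! ### Merging of adjacent tiles of different types. -/

noncomputable section

namespace PenroseCurve

open Topology
open PenroseCurve.Frame

theorem IsRoot.eq_zero_of_add_mul {ε : ℂ} (h : IsRoot ε) {a b : ℝ} (h0 : (a : ℂ) + b * ε = 0) :
    a = 0 ∧ b = 0 := by
  have h1 := congrArg Complex.im h0
  have h2 := congrArg Complex.re h0
  simp at h1 h2
  have h3 : b = 0 := h1.resolve_right h.im_ne_zero
  rw [h3] at h2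
  exact ⟨by simpa using h2, h3⟩

theorem Frame.Ex.symm {e : Bool} {f g : Frame} {i : Fin 3} (hf : IsRoot f.ε) (h : Ex e f i g) :
    ∃ j, Ex e g j f := by
  have hC := gold_sq_complex
  have hr : f.ε ^ 2 = gold * f.ε - 1 := hf
  cases h with
  | even_acute_one ε t d =>
    exact ⟨1, (Ex.even_obtuse_one _ _ _).of_eq (mk_congr rfl (by grind) (by grind))⟩
  | even_obtuse_one ε t d =>
    exact ⟨1, (Ex.even_acute_one _ _ _).of_eq (mk_congr rfl (by grind) (by grind))⟩
  | even_acute_zero ε t d =>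
    exact ⟨0, (Ex.even_obtuse_zero _ _ _).of_eq (mk_congr rfl (by grind) (by grind))⟩
  | even_obtuse_zero ε t d =>
    exact ⟨0, (Ex.even_acute_zero _ _ _).of_eq (mk_congr rfl (by grind) (by grind))⟩
  | odd_acute_two ε t d =>
    exact ⟨2, (Ex.odd_obtuse_two _ _ _).of_eq (mk_congr (by ring) rfl rfl)⟩
  | odd_obtuse_two ε t d =>
    exact ⟨2, (Ex.odd_acute_two _ _ _).of_eq (mk_congr (by ring) rfl rfl)⟩
  | odd_acute_one ε t d =>
    exact ⟨0, (Ex.odd_obtuse_zero _ _ _).of_eq (mk_congr rfl (by grind) (by grind))⟩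
  | odd_obtuse_zero ε t d =>
    exact ⟨1, (Ex.odd_acute_one _ _ _).of_eq (mk_congr rfl (by grind) (by grind))⟩

theorem Frame.Ex.c_eq {e : Bool} {f g : Frame} {i : Fin 3} (h : Ex e f i g) : g.c = !f.c := by
  cases h <;> rfl

/-- A mirror image has the other orientation, and the other kind of neighbor has the other type. -/
theorem Frame.Nbr.not_of_ε_eq {e : Bool} {f g : Frame} (hf : f.Valid) (h : f = g ∨ ∃ j, Nbr e f j g)
    (hc : g.c = f.c) (hε : g.ε = f.ε) : f = g := by
  rcases h with h | ⟨j, rfl | h⟩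
  · exact h
  · rw [mir_ε] at hε
    exact absurd hε.symm hf.root.ne_conj
  · cases h <;> simp at hc

namespace Good

variable {e : Bool} {s : ℝ} {𝒯 : Set TriTile} {ε t d : ℂ} {f g F G : Frame}

theorem merge_even_acute_zero (hG : Good true s 𝒯) (hf : Ok true s ⟨true, ε, t, d⟩)
    (h : Ex true ⟨true, ε, t, d⟩ 0 g) (hT : (⟨true, ε, t, d⟩ : Frame).tile ∈ 𝒯) (hgT : g.tile ∈ 𝒯)
    (hF : Par true ⟨true, ε, t, d⟩ F) (hFT : F.tile ∈ composeA 𝒯) (hGg : Par true g G) :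
    F = G := by
  have hC := gold_sq_complex
  have hr : ε ^ 2 = gold * ε - 1 := hf.root
  cases h
  cases hGg
  cases hF
  · exact mk_congr rfl (by grind) (by grind)
  · exact absurd ((hG.true_mem_composeA hf).1 hFT).2
      (hG.not_mir_of_ex hf hT (Ex.even_acute_zero ..) hgT)

theorem merge_odd_acute_two (hG : Good false s 𝒯) (hf : Ok false s ⟨true, ε, t, d⟩)
    (h : Ex false ⟨true, ε, t, d⟩ 2 g) (hT : (⟨true, ε, t, d⟩ : Frame).tile ∈ 𝒯)
    (hgT : g.tile ∈ 𝒯)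
    (hF : Par false ⟨true, ε, t, d⟩ F) (hGg : Par false g G) (hGT : G.tile ∈ composeB 𝒯) :
    F = G := by
  have hC := gold_sq_complex
  have hr : ε ^ 2 = gold * ε - 1 := hf.root
  have hg := hf.ex h
  cases h
  cases hF
  cases hGg
  · exact mk_congr (by ring) (by grind) (by grind)
  · refine absurd ((hG.false_mem_composeB hg).1 hGT).2
      (hG.not_mir_of_ex hg hgT (Ex.odd_obtuse_two ..) ?_)
    rwa [sub_sub_cancel]

/-- Contact along side 1 of an acute tile on an even level becomes, unless the parents coincide,
contact along side 1 on the odd level above. `merge_odd_acute_one` turns that into contact along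
side 0 on the next even level, where the two tiles are amalgamated. -/
theorem merge_even_acute_one (hf : Ok true s ⟨true, ε, t, d⟩)
    (h : Ex true ⟨true, ε, t, d⟩ 1 g) (hF : Par true ⟨true, ε, t, d⟩ F) (hGg : Par true g G)
    (hN : F = G ∨ ∃ j, Nbr false F j G) : F = G ∨ (F.c = true ∧ Ex false F 1 G) := by
  have hC := gold_sq_complex
  have hr : ε ^ 2 = gold * ε - 1 := hf.root
  have hFv := (hf.par hF).valid
  cases h
  cases hGg
  cases hF
  · exact Or.inl (Nbr.not_of_ε_eq hFv hN rfl rfl)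
  · refine Or.inr ⟨rfl, (Ex.odd_acute_one _ _ _).of_eq (mk_congr rfl (by grind) (by grind))⟩

theorem merge_odd_acute_one (hf : Ok false s ⟨true, ε, t, d⟩)
    (h : Ex false ⟨true, ε, t, d⟩ 1 g) (hF : Par false ⟨true, ε, t, d⟩ F) (hGg : Par false g G)
    (hN : F = G ∨ ∃ j, Nbr true F j G) : F = G ∨ (F.c = true ∧ Ex true F 0 G) := by
  have hC := gold_sq_complex
  have hr : ε ^ 2 = gold * ε - 1 := hf.root
  have hd : d ≠ 0 := hf.valid.ne
  have hg0 := gold_pos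
  have hnz := gold_ne_zero_complex
  -- The numbers 1 and `ε` are independent over `ℝ`. Comparing coefficients of the vectors `d`
  -- excludes that the parents are mirror images, since this would give relations such as `τ = 0`.
  have key : ∀ a b : ℝ, ((a : ℂ) + b * ε) * (gold * d) = 0 → a = 0 ∧ b = 0 := fun a b h =>
    hf.root.eq_zero_of_add_mul ((mul_eq_zero.1 h).resolve_right (mul_ne_zero hnz hd))
  cases h
  cases hF
  cases hGg
  · left
    rcases hN with h | ⟨j, h | h⟩
    · exact h
    · exfalso
      have h1 := congrArg Frame.d h
      fin_cases j
      · simp only [Fin.zero_eta, mir_zero_acute] at h1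
        have := (key gold 0 (by push_cast; grind)).1
        linarith
      · simp only [Fin.mk_one, mir_one] at h1
        have := (key 1 (-1) (by push_cast; grind)).1
        linarith
      · simp only [Fin.reduceFinMk, mir_two] at h1
        have := (key gold (-(gold + 1)) (by push_cast; grind)).1
        linarith
    · cases h
  · refine Or.inr ⟨rfl, (Ex.even_acute_zero _ _ _).of_eq (mk_congr rfl (by grind) (by grind))⟩

/-- Composition only removes vertices. So a point that is not a vertex of the first tiling is not a
vertex on any level. -/
theorem isVtx_of_compose (hG : Good e s 𝒯) {x : ℂ} (h : IsVtx (compose e 𝒯) x) : IsVtx 𝒯 x := by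
  have hC := gold_sq_complex
  obtain ⟨D, hD, h⟩ := h
  cases e
  · obtain ⟨ε, t, d, hf, hT, ⟨rfl, hb⟩ | ⟨rfl, -⟩⟩ := hG.mem_composeB.1 hD
    · have hr : ε ^ 2 = gold * ε - 1 := hf.root
      rcases h with rfl | rfl | rfl
      · exact ⟨_, hT, Or.inr (Or.inr rfl)⟩
      · refine ⟨_, hb, Or.inr (Or.inr ?_)⟩
        simp only [tile, kap_true]; push_cast; grind
      · refine ⟨_, hT, Or.inl ?_⟩
        simp only [tile, kap_true]; push_cast; grind
    · exact ⟨_, hT, h⟩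
  · obtain ⟨ε, t, d, hf, hT, ⟨rfl, hb⟩ | ⟨rfl, -⟩⟩ := hG.mem_composeA.1 hD
    · rcases h with rfl | rfl | rfl
      · exact ⟨_, hT, Or.inl rfl⟩
      · exact ⟨_, hT, Or.inr (Or.inl rfl)⟩
      · exact ⟨_, hb, Or.inl rfl⟩
    · exact ⟨_, hT, h⟩

/-- Two tiles with a common point that is not a vertex are equal or neighbors. -/
theorem eq_or_nbr (hG : Good e s 𝒯) {x : ℂ} (hV : ¬ IsVtx 𝒯 x) (hf : Ok e s f) (hg : Ok e s g)
    (hfT : f.tile ∈ 𝒯) (hgT : g.tile ∈ 𝒯) (hxf : x ∈ f.tile.region) (hxg : x ∈ g.tile.region) :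
    f = g ∨ ∃ j, f.OpenEdge j x ∧ Nbr e f j g := by
  rcases hG.local_structure hf hfT hxf hV with h | ⟨i, k, hx, hk, hkT, -, -⟩
  · exact Or.inl (eq_of_tile_eq hf.valid hg.valid (hG.eq_of_mem_interior hfT hgT h hxg))
  · rcases hG.eq_or_eq_of_openEdge hf hg hfT hgT hk hkT hx hxg with rfl | rfl
    · exact Or.inl rfl
    · exact Or.inr ⟨i, hx, hk⟩

end Good

/-! ### The tower of compositions -/

/-- Whether `n` is even. -/
def ev (n : ℕ) : Bool := decide (Even n)

theorem ev_succ (n : ℕ) : ev (n + 1) = !ev n := by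
  by_cases h : Even n <;> simp [ev, Nat.even_add_one, h, -Nat.not_even_iff_odd]

/-- The scale of the `n`-th tiling. -/
def scale : ℕ → ℝ
  | 0 => 1
  | n + 1 => nextScale (ev n) (scale n)

/-- The `n`-th composition of a tiling. -/
def lev (𝒯 : Set TriTile) : ℕ → Set TriTile
  | 0 => 𝒯
  | n + 1 => compose (ev n) (lev 𝒯 n)

theorem level_eq_lev (T : Set (Set ℂ)) (n : ℕ) : level T n = lev (aTiling T) n := by
  induction n with
  | zero => rfl
  | succ n ih => simp [level, lev, ih, compose, ev]

namespace Good

variable {𝒯 : Set TriTile} (hG : Good true 1 𝒯)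
include hG

theorem lev (n : ℕ) : Good (ev n) (scale n) (lev 𝒯 n) := by
  induction n with
  | zero => exact hG
  | succ n ih =>
    rw [ev_succ]
    exact ih.compose

theorem exists_anc {n m : ℕ} (h : n ≤ m) {D : TriTile} (hD : D ∈ PenroseCurve.lev 𝒯 n) :
    ∃ E ∈ PenroseCurve.lev 𝒯 m, D.region ⊆ E.region := by
  induction m, h using Nat.le_induction with
  | base => exact ⟨D, hD, subset_rfl⟩
  | succ m _ ih =>
    obtain ⟨E, hE, h⟩ := ih
    obtain ⟨f, hf, rfl⟩ := (hG.lev m).shape E hE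
    obtain ⟨F, hF, hFT⟩ := (hG.lev m).exists_par hf hE
    exact ⟨_, hFT, h.trans (hF.region_subset hf)⟩

theorem interior_nonempty {n : ℕ} {D : TriTile} (hD : D ∈ PenroseCurve.lev 𝒯 n) :
    (interior D.region).Nonempty := by
  obtain ⟨f, hf, rfl⟩ := (hG.lev n).shape D hD
  exact ⟨_, center_mem_interior hf.valid⟩

theorem anc_unique {n m : ℕ} {D E E' : TriTile} (hD : D ∈ PenroseCurve.lev 𝒯 n)
    (hE : E ∈ PenroseCurve.lev 𝒯 m) (hE' : E' ∈ PenroseCurve.lev 𝒯 m) (h : D.region ⊆ E.region)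
    (h' : D.region ⊆ E'.region) : E = E' := by
  obtain ⟨x, hx⟩ := hG.interior_nonempty hD
  exact (hG.lev m).disj _ hE _ hE' ⟨x, interior_mono h hx, interior_mono h' hx⟩

theorem anc_mono {n m m' : ℕ} (hm : m ≤ m') {D E E' : TriTile} (hD : D ∈ PenroseCurve.lev 𝒯 n)
    (hE : E ∈ PenroseCurve.lev 𝒯 m) (hE' : E' ∈ PenroseCurve.lev 𝒯 m') (h : D.region ⊆ E.region)
    (h' : D.region ⊆ E'.region) : E.region ⊆ E'.region := by
  obtain ⟨E₁, hE₁, h₁⟩ := hG.exists_anc hm hE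
  rwa [hG.anc_unique hD hE' hE₁ h' (h.trans h₁)]

theorem par_of_subset {m : ℕ} {f F : Frame} (hf : Ok (ev m) (scale m) f)
    (hF : Ok (ev (m + 1)) (scale (m + 1)) F) (hfT : f.tile ∈ PenroseCurve.lev 𝒯 m)
    (hFT : F.tile ∈ PenroseCurve.lev 𝒯 (m + 1)) (h : f.tile.region ⊆ F.tile.region) :
    Par (ev m) f F := by
  obtain ⟨F', hF', hFT'⟩ := (hG.lev m).exists_par hf hfT
  have := hG.anc_unique (m := m + 1) hfT hFT hFT' h (hF'.region_subset hf)
  rwa [eq_of_tile_eq hF.valid (hf.par hF').valid this]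

theorem isVtx_lev {n : ℕ} {x : ℂ} (h : IsVtx (PenroseCurve.lev 𝒯 n) x) : IsVtx 𝒯 x := by
  induction n with
  | zero => exact h
  | succ n ih => exact ih ((hG.lev n).isVtx_of_compose h)

theorem exists_par_par {n : ℕ} {f g : Frame} {x : ℂ} (hV : ¬ IsVtx 𝒯 x)
    (hf : Ok (ev n) (scale n) f) (hg : Ok (ev n) (scale n) g)
    (hfT : f.tile ∈ PenroseCurve.lev 𝒯 n) (hgT : g.tile ∈ PenroseCurve.lev 𝒯 n)
    (hxf : x ∈ f.tile.region) (hxg : x ∈ g.tile.region) :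
    ∃ F G, Par (ev n) f F ∧ Par (ev n) g G ∧ F.tile ∈ PenroseCurve.lev 𝒯 (n + 1) ∧
      G.tile ∈ PenroseCurve.lev 𝒯 (n + 1) ∧ (F = G ∨ ∃ j, Nbr (ev (n + 1)) F j G) := by
  obtain ⟨F, hF, hFT⟩ := (hG.lev n).exists_par hf hfT
  obtain ⟨G, hGg, hGT⟩ := (hG.lev n).exists_par hg hgT
  refine ⟨F, G, hF, hGg, hFT, hGT, ?_⟩
  have e1 := ev_succ n
  rcases (hG.lev (n + 1)).eq_or_nbr (fun h => hV (hG.isVtx_lev h)) (e1 ▸ hf.par hF)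
    (e1 ▸ hg.par hGg) hFT hGT (hF.region_subset hf hxf) (hGg.region_subset hg hxg) with h | ⟨j, -, h⟩
  · exact Or.inl h
  · exact Or.inr ⟨j, h⟩

/-- The bound 3 is attained by contact along side 1 on an even level: one level to reach side 1 on
an odd level, one to reach side 0 on an even level, and one for the amalgamation. -/
theorem merge_of_acute {x : ℂ} (hV : ¬ IsVtx 𝒯 x) {n : ℕ} {f g : Frame} {i : Fin 3}
    (hf : Ok (ev n) (scale n) f) (hfT : f.tile ∈ PenroseCurve.lev 𝒯 n)
    (hgT : g.tile ∈ PenroseCurve.lev 𝒯 n) (hxf : x ∈ f.tile.region) (hxg : x ∈ g.tile.region)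
    (hc : f.c = true) (h : Ex (ev n) f i g) :
    ∃ m ≤ n + 3, ∃ E ∈ PenroseCurve.lev 𝒯 m, f.tile.region ⊆ E.region ∧
      g.tile.region ⊆ E.region := by
  have step0 : ∀ {n : ℕ} {f g : Frame}, Ok (ev n) (scale n) f → f.tile ∈ PenroseCurve.lev 𝒯 n →
      g.tile ∈ PenroseCurve.lev 𝒯 n → x ∈ f.tile.region → x ∈ g.tile.region → f.c = true →
      (ev n = true ∧ Ex (ev n) f 0 g ∨ ev n = false ∧ Ex (ev n) f 2 g) →
      ∃ m ≤ n + 1, ∃ E ∈ PenroseCurve.lev 𝒯 m, f.tile.region ⊆ E.region ∧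
        g.tile.region ⊆ E.region := by
    intro n f g hf hfT hgT hxf hxg hc h
    have hg : Ok (ev n) (scale n) g := h.elim (fun h => hf.ex h.2) fun h => hf.ex h.2
    obtain ⟨F, G, hF, hGg, hFT, hGT, hN⟩ := hG.exists_par_par hV hf hg hfT hgT hxf hxg
    refine ⟨n + 1, le_rfl, _, hFT, hF.region_subset hf, ?_⟩
    have hFG : F = G := by
      obtain ⟨c, ε, t, d⟩ := f
      obtain rfl : c = true := hc
      have hn := hG.lev n
      have hFT' : F.tile ∈ compose (ev n) (PenroseCurve.lev 𝒯 n) := hFT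
      have hGT' : G.tile ∈ compose (ev n) (PenroseCurve.lev 𝒯 n) := hGT
      generalize ev n = e at *
      rcases h with ⟨rfl, h⟩ | ⟨rfl, h⟩
      · exact hn.merge_even_acute_zero hf h hfT hgT hF hFT' hGg
      · exact hn.merge_odd_acute_two hf h hfT hgT hF hGg hGT'
    rw [hFG]
    exact hGg.region_subset hg
  have step1 : ∀ {n : ℕ} {f g : Frame}, Ok (ev n) (scale n) f → f.tile ∈ PenroseCurve.lev 𝒯 n →
      g.tile ∈ PenroseCurve.lev 𝒯 n → x ∈ f.tile.region → x ∈ g.tile.region → f.c = true →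
      ev n = false → Ex (ev n) f 1 g →
      ∃ m ≤ n + 2, ∃ E ∈ PenroseCurve.lev 𝒯 m, f.tile.region ⊆ E.region ∧
        g.tile.region ⊆ E.region := by
    intro n f g hf hfT hgT hxf hxg hc he h
    have hg := hf.ex h
    obtain ⟨F, G, hF, hGg, hFT, hGT, hN⟩ := hG.exists_par_par hV hf hg hfT hgT hxf hxg
    have hFs := hF.region_subset hf
    have hGs := hGg.region_subset hg
    have hFo := hf.par hF
    have e1 := ev_succ n
    have : F = G ∨ (F.c = true ∧ Ex (ev (n + 1)) F 0 G) := by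
      obtain ⟨c, ε, t, d⟩ := f
      obtain rfl : c = true := hc
      rw [e1] at hN ⊢
      rw [he] at *
      exact merge_odd_acute_one hf h hF hGg hN
    rcases this with rfl | ⟨hc', h'⟩
    · exact ⟨n + 1, by omega, _, hFT, hFs, hGs⟩
    · obtain ⟨m, hm, E, hE, h1, h2⟩ := step0 (e1 ▸ hFo) hFT hGT (hFs hxf) (hGs hxg) hc'
        (Or.inl ⟨by rw [e1, he]; rfl, h'⟩)
      exact ⟨m, hm, E, hE, hFs.trans h1, hGs.trans h2⟩
  rcases he : ev n with _ | _
  · by_cases hi : i = 2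
    · subst hi
      obtain ⟨m, hm, h⟩ := step0 hf hfT hgT hxf hxg hc (Or.inr ⟨he, h⟩)
      exact ⟨m, by omega, h⟩
    · have : i = 1 := by
        obtain ⟨c, ε, t, d⟩ := f
        obtain rfl : c = true := hc
        rw [he] at h
        cases h
        · exact absurd rfl hi
        · rfl
      subst this
      obtain ⟨m, hm, h⟩ := step1 hf hfT hgT hxf hxg hc he h
      exact ⟨m, by omega, h⟩
  · by_cases hi : i = 0
    · subst hi
      obtain ⟨m, hm, h⟩ := step0 hf hfT hgT hxf hxg hc (Or.inl ⟨he, h⟩)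
      exact ⟨m, by omega, h⟩
    · have : i = 1 := by
        obtain ⟨c, ε, t, d⟩ := f
        obtain rfl : c = true := hc
        rw [he] at h
        cases h
        · rfl
        · exact absurd rfl hi
      subst this
      have hg := hf.ex h
      obtain ⟨F, G, hF, hGg, hFT, hGT, hN⟩ := hG.exists_par_par hV hf hg hfT hgT hxf hxg
      have hFs := hF.region_subset hf
      have hGs := hGg.region_subset hg
      have hFo := hf.par hF
      have e1 := ev_succ n
      have : F = G ∨ (F.c = true ∧ Ex (ev (n + 1)) F 1 G) := by
        obtain ⟨c, ε, t, d⟩ := f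
        obtain rfl : c = true := hc
        rw [e1] at hN ⊢
        rw [he] at *
        exact merge_even_acute_one hf h hF hGg hN
      rcases this with rfl | ⟨hc', h'⟩
      · exact ⟨n + 1, by omega, _, hFT, hFs, hGs⟩
      · obtain ⟨m, hm, E, hE, h1, h2⟩ := step1 (e1 ▸ hFo) hFT hGT (hFs hxf) (hGs hxg) hc'
          (by rw [e1, he]; rfl) h'
        exact ⟨m, hm, E, hE, hFs.trans h1, hGs.trans h2⟩

/-- Adjacent tiles of different types are in a common tile of a higher level. -/
theorem merge_of_ex {x : ℂ} (hV : ¬ IsVtx 𝒯 x) {n : ℕ} {f g : Frame} {i : Fin 3}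
    (hf : Ok (ev n) (scale n) f) (hfT : f.tile ∈ PenroseCurve.lev 𝒯 n)
    (hgT : g.tile ∈ PenroseCurve.lev 𝒯 n) (hxf : x ∈ f.tile.region) (hxg : x ∈ g.tile.region)
    (h : Ex (ev n) f i g) :
    ∃ E ∈ PenroseCurve.lev 𝒯 (n + 3), f.tile.region ⊆ E.region ∧ g.tile.region ⊆ E.region := by
  have : ∃ m ≤ n + 3, ∃ E ∈ PenroseCurve.lev 𝒯 m, f.tile.region ⊆ E.region ∧
      g.tile.region ⊆ E.region := by
    cases hc : f.c
    · obtain ⟨j, h'⟩ := h.symm hf.root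
      have hc' : g.c = true := by rw [h.c_eq, hc]; rfl
      obtain ⟨m, hm, E, hE, h1, h2⟩ := hG.merge_of_acute hV (hf.ex h) hgT hfT hxg hxf hc' h'
      exact ⟨m, hm, E, hE, h2, h1⟩
    · exact hG.merge_of_acute hV hf hfT hgT hxf hxg hc h
  obtain ⟨m, hm, E, hE, h1, h2⟩ := this
  obtain ⟨E', hE', h3⟩ := hG.exists_anc hm hE
  exact ⟨E', hE', h1.trans h3, h2.trans h3⟩

/-- Two tiles with a common point that is not a vertex are in a common tile of some level, or
the tiles that contain them are mirror images of each other on all levels. -/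
theorem merge_or_mir {x : ℂ} (hV : ¬ IsVtx 𝒯 x) {D D' : TriTile}
    (hx : x ∈ D.region) (hx' : x ∈ D'.region) :
    (∃ n, ∃ E ∈ PenroseCurve.lev 𝒯 n, D.region ⊆ E.region ∧ D'.region ⊆ E.region) ∨
    ∀ n f g, Ok (ev n) (scale n) f → Ok (ev n) (scale n) g → f.tile ∈ PenroseCurve.lev 𝒯 n →
      g.tile ∈ PenroseCurve.lev 𝒯 n → D.region ⊆ f.tile.region → D'.region ⊆ g.tile.region →
      ∃ i, f.OpenEdge i x ∧ g = f.mir i := by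
  by_cases h : ∃ n, ∃ E ∈ PenroseCurve.lev 𝒯 n, D.region ⊆ E.region ∧ D'.region ⊆ E.region
  · exact Or.inl h
  refine Or.inr fun n f g hf hg hfT hgT h1 h2 => ?_
  rcases (hG.lev n).eq_or_nbr (fun h => hV (hG.isVtx_lev h)) hf hg hfT hgT (h1 hx) (h2 hx') with
    rfl | ⟨j, hj, h3 | h3⟩
  · exact absurd ⟨n, _, hfT, h1, h2⟩ h
  · exact ⟨j, hj, h3⟩
  · obtain ⟨E, hE, h4, h5⟩ := hG.merge_of_ex hV hf hfT hgT (h1 hx) (h2 hx') h3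
    exact absurd ⟨_, E, hE, h1.trans h4, h2.trans h5⟩ h

end Good

end PenroseCurve

end

noncomputable section

namespace PenroseCurve

open Topology
open PenroseCurve.Frame

/-! ### The action of isometries -/

/-- The image of a tile under a map of the plane. -/
def TriTile.map (σ : ℂ → ℂ) (D : TriTile) : TriTile := ⟨D.acute, σ D.t, σ D.h, σ D.w⟩

theorem image_convexHull (σ : ℂ ≃ᵢ ℂ) (s : Set ℂ) :
    σ '' convexHull ℝ s = convexHull ℝ (σ '' s) :=
  AffineMap.image_convexHull σ.toRealAffineIsometryEquiv.toAffineEquiv.toAffineMap s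

theorem wbtw_map_iff (σ : ℂ ≃ᵢ ℂ) {x y z : ℂ} : Wbtw ℝ (σ x) (σ y) (σ z) ↔ Wbtw ℝ x y z :=
  AffineEquiv.wbtw_map_iff σ.toRealAffineIsometryEquiv.toAffineEquiv

theorem TriTile.region_map (σ : ℂ ≃ᵢ ℂ) (D : TriTile) : (D.map σ).region = σ '' D.region := by
  simp [TriTile.region, TriTile.map, image_convexHull, Set.image_insert_eq]

theorem TriTile.map_symm_map (σ : ℂ ≃ᵢ ℂ) (D : TriTile) : (D.map σ.symm).map σ = D := by
  simp [TriTile.map]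

theorem isQuad_image (σ : ℂ ≃ᵢ ℂ) {S : Set ℂ} {t l h r : ℂ} :
    IsQuad (σ '' S) (σ t) (σ l) (σ h) (σ r) ↔ IsQuad S t l h r := by
  have : convexHull ℝ {σ t, σ h, σ l} ∪ convexHull ℝ {σ t, σ h, σ r} =
      σ '' (convexHull ℝ {t, h, l} ∪ convexHull ℝ {t, h, r}) := by
    simp [Set.image_union, image_convexHull, Set.image_insert_eq]
  rw [IsQuad, IsQuad, this]
  exact σ.injective.image_injective.eq_iff

theorem isKite_image (σ : ℂ ≃ᵢ ℂ) {S : Set ℂ} {t l h r : ℂ} :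
    IsKite (σ '' S) (σ t) (σ l) (σ h) (σ r) ↔ IsKite S t l h r := by
  simp [IsKite, isQuad_image, σ.dist_eq]

theorem isDart_image (σ : ℂ ≃ᵢ ℂ) {S : Set ℂ} {t l h r : ℂ} :
    IsDart (σ '' S) (σ t) (σ l) (σ h) (σ r) ↔ IsDart S t l h r := by
  simp [IsDart, isQuad_image, σ.dist_eq]

theorem map_mem_aTiling (σ : ℂ ≃ᵢ ℂ) (T : Set (Set ℂ)) (D : TriTile) :
    D.map σ ∈ aTiling ((fun S : Set ℂ => σ '' S) '' T) ↔ D ∈ aTiling T := by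
  simp only [aTiling, Set.mem_union, Set.mem_ofPred_eq, Set.exists_mem_image]
  exact or_congr
    (and_congr (exists_congr fun S => and_congr Iff.rfl
      (σ.surjective.exists.trans (exists_congr fun r => isKite_image σ))) Iff.rfl)
    (and_congr (exists_congr fun S => and_congr Iff.rfl
      (σ.surjective.exists.trans (exists_congr fun r => isDart_image σ))) Iff.rfl)

theorem mem_composeA_iff {𝒯 : Set TriTile} {D : TriTile} : D ∈ composeA 𝒯 ↔
    (D.acute = false ∧ ∃ r, (⟨true, D.t, D.h, r⟩ : TriTile) ∈ 𝒯 ∧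
      (⟨false, D.w, r, D.h⟩ : TriTile) ∈ 𝒯 ∧ Wbtw ℝ D.t r D.w) ∨
    (D.acute = true ∧ D ∈ 𝒯 ∧
      ¬ ∃ v, (⟨false, v, D.w, D.h⟩ : TriTile) ∈ 𝒯 ∧ Wbtw ℝ D.t D.w v) := by
  constructor
  · rintro (⟨t, h, w, r, rfl, h⟩ | ⟨t, h, w, rfl, h⟩)
    exacts [Or.inl ⟨rfl, r, h⟩, Or.inr ⟨rfl, h⟩]
  · obtain ⟨c, t, h, w⟩ := D
    rintro (⟨rfl, r, h⟩ | ⟨rfl, h⟩)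
    exacts [Or.inl ⟨_, _, _, r, rfl, h⟩, Or.inr ⟨_, _, _, rfl, h⟩]

theorem mem_composeB_iff {𝒯 : Set TriTile} {D : TriTile} : D ∈ composeB 𝒯 ↔
    (D.acute = true ∧ ∃ q, (⟨false, D.w, q, D.t⟩ : TriTile) ∈ 𝒯 ∧
      (⟨true, D.w, q, D.h⟩ : TriTile) ∈ 𝒯 ∧ Wbtw ℝ D.t q D.h) ∨
    (D.acute = false ∧ D ∈ 𝒯 ∧
      ¬ ∃ v, (⟨true, D.t, D.h, v⟩ : TriTile) ∈ 𝒯 ∧ Wbtw ℝ D.w D.h v) := by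
  constructor
  · rintro (⟨t, h, w, r, rfl, h⟩ | ⟨t, h, w, rfl, h⟩)
    exacts [Or.inl ⟨rfl, r, h⟩, Or.inr ⟨rfl, h⟩]
  · obtain ⟨c, t, h, w⟩ := D
    rintro (⟨rfl, r, h⟩ | ⟨rfl, h⟩)
    exacts [Or.inl ⟨_, _, _, r, rfl, h⟩, Or.inr ⟨_, _, _, rfl, h⟩]

theorem map_mem_compose (σ : ℂ ≃ᵢ ℂ) {𝒯 𝒯' : Set TriTile}
    (h : ∀ D : TriTile, D.map σ ∈ 𝒯' ↔ D ∈ 𝒯) (e : Bool) (D : TriTile) :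
    D.map σ ∈ compose e 𝒯' ↔ D ∈ compose e 𝒯 := by
  have h' : ∀ c t a b, (⟨c, σ t, σ a, σ b⟩ : TriTile) ∈ 𝒯' ↔ (⟨c, t, a, b⟩ : TriTile) ∈ 𝒯 :=
    fun c t a b => h ⟨c, t, a, b⟩
  cases e
  · rw [compose_false, compose_false, mem_composeB_iff, mem_composeB_iff]
    refine or_congr (and_congr Iff.rfl (σ.surjective.exists.trans (exists_congr fun r => ?_)))
      (and_congr Iff.rfl (and_congr (h D) (not_congr
        (σ.surjective.exists.trans (exists_congr fun v => ?_)))))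
    all_goals simp only [TriTile.map, h', wbtw_map_iff]
  · rw [compose_true, compose_true, mem_composeA_iff, mem_composeA_iff]
    refine or_congr (and_congr Iff.rfl (σ.surjective.exists.trans (exists_congr fun r => ?_)))
      (and_congr Iff.rfl (and_congr (h D) (not_congr
        (σ.surjective.exists.trans (exists_congr fun v => ?_)))))
    all_goals simp only [TriTile.map, h', wbtw_map_iff]

theorem map_mem_lev (σ : ℂ ≃ᵢ ℂ) {𝒯 𝒯' : Set TriTile}
    (h : ∀ D : TriTile, D.map σ ∈ 𝒯' ↔ D ∈ 𝒯) (n : ℕ) (D : TriTile) :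
    D.map σ ∈ lev 𝒯' n ↔ D ∈ lev 𝒯 n := by
  induction n generalizing D with
  | zero => exact h D
  | succ n ih => exact map_mem_compose σ ih _ D

/-- The map `φ` is the action of the isometry `σ` on positions of tiles. -/
structure Acts (σ : ℂ ≃ᵢ ℂ) (φ : Frame → Frame) : Prop where
  tile : ∀ f, (φ f).tile = f.tile.map σ
  ok : ∀ e s f, Ok e s f → Ok e s (φ f)
  nbr : ∀ e f i g, Nbr e f i g → Nbr e (φ f) i (φ g)

theorem Good.map {e : Bool} {s : ℝ} {𝒯 𝒯' : Set TriTile} {σ : ℂ ≃ᵢ ℂ} {φ : Frame → Frame}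
    (hG : Good e s 𝒯) (hφ : Acts σ φ) (h : ∀ D : TriTile, D.map σ ∈ 𝒯' ↔ D ∈ 𝒯) :
    Good e s 𝒯' := by
  have h' : ∀ D ∈ 𝒯', ∃ f, Ok e s f ∧ f.tile ∈ 𝒯 ∧ (φ f).tile = D := by
    intro D hD
    have h1 := (h (D.map σ.symm)).1 (by rwa [TriTile.map_symm_map])
    obtain ⟨f, hf, hfD⟩ := hG.shape _ h1
    exact ⟨f, hf, hfD ▸ h1, by rw [hφ.tile, hfD, TriTile.map_symm_map]⟩
  refine ⟨fun D hD => ?_, fun F hF hFT i => ?_, fun D hD D' hD' => ?_, fun x => ?_⟩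
  · obtain ⟨f, hf, -, rfl⟩ := h' D hD
    exact ⟨_, hφ.ok _ _ _ hf, rfl⟩
  · obtain ⟨f, hf, hfT, hfF⟩ := h' _ hFT
    rw [← eq_of_tile_eq (hφ.ok _ _ _ hf).valid hF.valid hfF]
    obtain ⟨g, hg, hgT⟩ := hG.across f hf hfT i
    exact ⟨φ g, hφ.nbr _ _ _ _ hg, by rw [hφ.tile, h]; exact hgT⟩
  · obtain ⟨f, hf, hfT, rfl⟩ := h' _ hD
    obtain ⟨g, hg, hgT, rfl⟩ := h' _ hD'
    rintro ⟨x, hx⟩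
    simp only [hφ.tile, TriTile.region_map] at hx ⊢
    have hi : ∀ A : Set ℂ, interior (σ '' A) = σ '' interior A := fun A =>
      (σ.toHomeomorph.image_interior A).symm
    rw [hi, hi, ← Set.image_inter σ.injective] at hx
    obtain ⟨y, hy, -⟩ := hx
    rw [hG.disj _ hfT _ hgT ⟨y, hy⟩]
  · obtain ⟨D, hD, hx⟩ := hG.cover (σ.symm x)
    refine ⟨D.map σ, (h D).2 hD, ?_⟩
    rw [TriTile.region_map]
    exact ⟨_, hx, σ.apply_symm_apply x⟩

theorem exists_acts {e : Bool} {s : ℝ} {f f' : Frame} (hf : Ok e s f) (hf' : Ok e s f')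
    (hc : f.c = f'.c) : ∃ σ φ, Acts σ φ ∧ φ f = f' := by
  have hd := hf.valid.ne
  have hd' := hf'.valid.ne
  have hn : ‖f.d‖ = ‖f'.d‖ := by rw [hf.norm_d, hf'.norm_d, hc]
  -- The isometry is `u * ρ x` plus a constant, where `ρ` is the identity or the conjugation
  -- according as the orientations agree or not. The formulas for neighbors are linear in `t` and
  -- `d`, with coefficients that are real polynomials in `ε`, so they are compatible with it.
  have mk : ∀ (ρ : ℂ →+* ℂ), (∀ r : ℝ, ρ r = r) → (∀ x, ‖ρ x‖ = ‖x‖) → Function.Surjective ρ →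
      f'.ε = ρ f.ε → (∀ ε, IsRoot ε → IsRoot (ρ ε)) → ∃ σ φ, Acts σ φ ∧ φ f = f' := by
    intro ρ hρ hρn hρs hε hroot
    obtain ⟨u, hu⟩ : ∃ u, u = f'.d / ρ f.d := ⟨_, rfl⟩
    have hρd : ρ f.d ≠ 0 := by
      rw [← norm_ne_zero_iff, hρn, norm_ne_zero_iff]; exact hd
    have hun : ‖u‖ = 1 := by
      rw [hu, norm_div, hρn, hn, div_self (norm_ne_zero_iff.2 hd')]
    have hu0 : u ≠ 0 := by
      intro h0
      rw [h0, norm_zero] at hun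
      norm_num at hun
    set σ₀ : ℂ → ℂ := fun x => u * ρ x + (f'.t - u * ρ f.t) with hσ₀
    have hiso : Isometry σ₀ := by
      refine Isometry.of_dist_eq fun x y => ?_
      simp only [hσ₀, dist_eq_norm]
      rw [show u * ρ x + (f'.t - u * ρ f.t) - (u * ρ y + (f'.t - u * ρ f.t)) = u * ρ (x - y) by
        rw [map_sub]; ring, norm_mul, hun, hρn, one_mul]
    have hsurj : Function.Surjective σ₀ := fun y => by
      obtain ⟨x, hx⟩ := hρs ((y - (f'.t - u * ρ f.t)) / u)
      refine ⟨x, ?_⟩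
      simp only [hσ₀, hx]
      field_simp
      ring
    let σ : ℂ ≃ᵢ ℂ := ⟨Equiv.ofBijective σ₀ ⟨hiso.injective, hsurj⟩, hiso⟩
    have hσ : ∀ x, σ x = u * ρ x + (f'.t - u * ρ f.t) := fun x => rfl
    refine ⟨σ, fun g => ⟨g.c, ρ g.ε, u * ρ g.t + (f'.t - u * ρ f.t), u * ρ g.d⟩, ⟨?_, ?_, ?_⟩, ?_⟩
    · rintro ⟨c, ε, t, d⟩
      simp only [tile, TriTile.map, hσ, map_add, map_mul, hρ, TriTile.mk.injEq, true_and]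
      exact ⟨by ring, by cases c <;> simp <;> ring⟩
    · intro e s g hg
      refine ⟨hroot _ hg.root, hg.pos, ?_⟩
      simp only [norm_mul, hun, hρn, one_mul]
      exact hg.norm_d
    · have h1 : ρ (gold : ℂ) = gold := hρ gold
      rintro e g i k (rfl | h)
      · left
        obtain ⟨c, ε, t, d⟩ := g
        fin_cases i
        · cases c
          · simp only [Fin.zero_eta, mir_zero_obtuse, map_sub, map_add, map_mul, h1, map_neg]
            exact mk_congr rfl (by ring) (by ring)
          · simp only [Fin.zero_eta, mir_zero_acute, map_sub, map_add, map_mul, h1, map_neg]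
            exact mk_congr rfl (by ring) (by ring)
        · simp only [Fin.mk_one, mir_one, map_sub, map_pow, map_mul, h1]
          exact mk_congr rfl (by ring) (by ring)
        · simp only [Fin.reduceFinMk, mir_two, map_sub, h1]
      · right
        cases h <;> simp only [map_sub, map_add, map_mul, h1, map_neg, map_pow, map_one]
        · exact (Ex.even_acute_one _ _ _).of_eq (mk_congr rfl (by ring) (by ring))
        · exact (Ex.even_obtuse_one _ _ _).of_eq (mk_congr rfl (by ring) (by ring))
        · exact (Ex.even_acute_zero _ _ _).of_eq (mk_congr rfl (by ring) (by ring))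
        · exact (Ex.even_obtuse_zero _ _ _).of_eq (mk_congr rfl (by ring) (by ring))
        · exact (Ex.odd_acute_two _ _ _).of_eq (mk_congr rfl (by ring) (by ring))
        · exact (Ex.odd_obtuse_two _ _ _).of_eq (mk_congr rfl (by ring) (by ring))
        · exact (Ex.odd_acute_one _ _ _).of_eq (mk_congr rfl (by ring) (by ring))
        · exact (Ex.odd_obtuse_zero _ _ _).of_eq (mk_congr rfl (by ring) (by ring))
    · refine Frame.ext hc hε.symm (by ring) ?_
      simp only [hu, div_mul_cancel₀ _ hρd]
  rcases hf.root.eq_or hf'.root with h | h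
  · exact mk (RingHom.id ℂ) (fun _ => rfl) (fun _ => rfl) Function.surjective_id h fun _ h => h
  · refine mk (starRingEnd ℂ) (fun r => Complex.conj_ofReal r) (fun x => by simp)
      (fun x => ⟨starRingEnd ℂ x, Complex.conj_conj x⟩) ?_ fun ε hε => hε.conj_eq ▸ hε.conj
    rw [h, hf.root.conj_eq]

/-! ### Connectedness -/

namespace Good

theorem countable {e : Bool} {s : ℝ} {𝒯 : Set TriTile} (hG : Good e s 𝒯) : 𝒯.Countable := by
  refine Set.PairwiseDisjoint.countable_of_isOpen (s := fun D => interior D.region)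
    (fun D hD D' hD' hne => ?_) (fun _ _ => isOpen_interior) fun D hD => ?_
  · exact Set.disjoint_iff_inter_eq_empty.2 (Set.not_nonempty_iff_eq_empty.1 fun h =>
      hne (hG.disj _ hD _ hD' h))
  · obtain ⟨f, hf, rfl⟩ := hG.shape D hD
    exact ⟨_, center_mem_interior hf.valid⟩

theorem countable_isVtx {e : Bool} {s : ℝ} {𝒯 : Set TriTile} (hG : Good e s 𝒯) :
    {x | IsVtx 𝒯 x}.Countable := by
  have : {x | IsVtx 𝒯 x} = ⋃ D ∈ 𝒯, {D.t, D.h, D.w} := by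
    ext x
    simp [IsVtx]
  rw [this]
  exact hG.countable.biUnion fun D _ => Set.Countable.insert _ (Set.Countable.insert _
    (Set.countable_singleton _))

/-- The plane without a countable set is connected. So a property that passes across sides, at
points outside `V`, passes from one tile to all tiles. -/
theorem mem_of_countable_compl {e : Bool} {s : ℝ} {𝒯 : Set TriTile} (hG : Good e s 𝒯) {V : Set ℂ}
    (hV : V.Countable) (h : ∀ x, IsVtx 𝒯 x → x ∈ V) (𝒮 : Set TriTile) (h0 : ∃ D ∈ 𝒯, D ∈ 𝒮)
    (hstep : ∀ D ∈ 𝒯, D ∈ 𝒮 → ∀ D' ∈ 𝒯, ∀ x ∉ V, x ∈ D.region → x ∈ D'.region → D' ∈ 𝒮) :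
    𝒯 ⊆ 𝒮 := by
  have hne : ∀ D ∈ 𝒯, (D.region ∩ Vᶜ).Nonempty := by
    intro D hD
    obtain ⟨f, hf, rfl⟩ := hG.shape D hD
    obtain ⟨x, hx, hxV⟩ := (hV.dense_compl ℝ).inter_open_nonempty _ isOpen_interior
      ⟨_, center_mem_interior hf.valid⟩
    exact ⟨x, interior_subset hx, hxV⟩
  obtain ⟨D₀, hD₀, hS₀⟩ := h0
  intro D hD
  exact hG.mem_of_preconnected
    (hV.isConnected_compl_of_one_lt_rank (by rw [Complex.rank_real_complex]; norm_num)).isPreconnected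
    (fun x hx hx' => hx (h x hx')) 𝒮 ⟨D₀, hD₀, hS₀, hne _ hD₀⟩
    (fun D hD hS D' hD' x hx => hstep D hD hS D' hD' x hx) D hD (hne _ hD)

variable {𝒯 : Set TriTile} (hG : Good true 1 𝒯)
include hG

/-- The types of the tiles that contain two given tiles agree on all sufficiently high levels. -/
theorem eventually_acute_eq {D D' : TriTile} (hD : D ∈ 𝒯) (hD' : D' ∈ 𝒯) :
    ∃ N, ∀ n ≥ N, ∀ E ∈ PenroseCurve.lev 𝒯 n, ∀ E' ∈ PenroseCurve.lev 𝒯 n,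
      D.region ⊆ E.region → D'.region ⊆ E'.region → E.acute = E'.acute := by
  refine hG.mem_of_countable_compl hG.countable_isVtx (fun x hx => hx)
    {D' | ∃ N, ∀ n ≥ N, ∀ E ∈ PenroseCurve.lev 𝒯 n, ∀ E' ∈ PenroseCurve.lev 𝒯 n,
      D.region ⊆ E.region → D'.region ⊆ E'.region → E.acute = E'.acute}
    ⟨D, hD, 0, fun n _ E hE E' hE' h h' => by rw [hG.anc_unique (n := 0) hD hE hE' h h']⟩ ?_ hD'
  rintro D₁ hD₁ ⟨N, hN⟩ D₂ hD₂ x hx hx₁ hx₂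
  rcases hG.merge_or_mir hx hx₁ hx₂ with ⟨m, F, hF, h1, h2⟩ | h
  · refine ⟨max N m, fun n hn E hE E' hE' hE1 hE2 => ?_⟩
    obtain ⟨E₁, hE₁, h3⟩ := hG.exists_anc ((le_max_right _ _).trans hn) hF
    rw [hG.anc_unique (n := 0) hD₂ hE' hE₁ hE2 (h2.trans h3)]
    exact hN n ((le_max_left _ _).trans hn) E hE _ hE₁ hE1 (h1.trans h3)
  · refine ⟨N, fun n hn E hE E' hE' hE1 hE2 => ?_⟩
    obtain ⟨E₁, hE₁, h3⟩ := hG.exists_anc (n := 0) (Nat.zero_le n) hD₁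
    obtain ⟨f, hf, rfl⟩ := (hG.lev n).shape _ hE₁
    obtain ⟨g, hg, rfl⟩ := (hG.lev n).shape _ hE'
    obtain ⟨i, -, rfl⟩ := h n f g hf hg hE₁ hE' h3 hE2
    rw [hN n hn E hE _ hE₁ hE1 h3]
    exact (mir_c f i).symm

/-- Two tilings coincide if they have a common tile on all sufficiently high levels. -/
theorem eq_of_common {𝒯' : Set TriTile} (hG' : Good true 1 𝒯') {D : TriTile} (hD : D ∈ 𝒯) {m : ℕ}
    (h : ∀ n ≥ m, ∃ E ∈ PenroseCurve.lev 𝒯 n, E ∈ PenroseCurve.lev 𝒯' n ∧ D.region ⊆ E.region) :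
    𝒯 = 𝒯' := by
  have hsub : 𝒯 ⊆ 𝒯' := by
    have key := hG.mem_of_countable_compl (hG.countable_isVtx.union hG'.countable_isVtx)
      (fun x hx => Or.inl hx)
      {D | ∃ N, ∀ n ≥ N, ∀ E ∈ PenroseCurve.lev 𝒯 n, D.region ⊆ E.region →
        E ∈ PenroseCurve.lev 𝒯' n} ⟨D, hD, m, fun n hn E hE hE1 => ?_⟩ ?_
    · intro D hD
      obtain ⟨N, hN⟩ := key hD
      obtain ⟨E, hE, h1⟩ := hG.exists_anc (n := 0) (Nat.zero_le N) hD
      have hE' := hN N le_rfl E hE h1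
      -- Descent from level `N` to level 0: a composed tile forces its parts to be tiles of the
      -- preceding tiling, by `mem_of_par`.
      clear hN key h
      induction N generalizing E with
      | zero => rwa [hG.anc_unique (n := 0) (m := 0) hD hD hE subset_rfl h1]
      | succ N ih =>
        obtain ⟨E₁, hE₁, h2⟩ := hG.exists_anc (n := 0) (Nat.zero_le N) hD
        have h3 := hG.anc_mono (Nat.le_succ N) (n := 0) hD hE₁ hE h2 h1
        refine ih E₁ hE₁ h2 ?_
        obtain ⟨f, hf, rfl⟩ := (hG.lev N).shape _ hE₁
        obtain ⟨F, hF, rfl⟩ := (hG.lev (N + 1)).shape _ hE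
        exact (hG'.lev N).mem_of_par hf (hG.par_of_subset hf hF hE₁ hE h3) hE'
    · obtain ⟨E₁, hE₁, hE₁', h1⟩ := h n hn
      rwa [hG.anc_unique (n := 0) hD hE hE₁ hE1 h1]
    · rintro D₁ hD₁ ⟨N, hN⟩ D₂ hD₂ x hx hx₁ hx₂
      have hxV : ¬ IsVtx 𝒯 x := fun h => hx (Or.inl h)
      have hxV' : ¬ IsVtx 𝒯' x := fun h => hx (Or.inr h)
      rcases hG.merge_or_mir hxV hx₁ hx₂ with ⟨m, F, hF, h1, h2⟩ | h
      · refine ⟨max N m, fun n hn E hE hE1 => ?_⟩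
        obtain ⟨E₁, hE₁, h3⟩ := hG.exists_anc ((le_max_right _ _).trans hn) hF
        rw [hG.anc_unique (n := 0) hD₂ hE hE₁ hE1 (h2.trans h3)]
        exact hN n ((le_max_left _ _).trans hn) _ hE₁ (h1.trans h3)
      · refine ⟨N, fun n hn E hE hE1 => ?_⟩
        obtain ⟨E₁, hE₁, h3⟩ := hG.exists_anc (n := 0) (Nat.zero_le n) hD₁
        obtain ⟨f, hf, rfl⟩ := (hG.lev n).shape _ hE₁
        obtain ⟨g, hg, rfl⟩ := (hG.lev n).shape _ hE
        obtain ⟨i, hi, rfl⟩ := h n f g hf hg hE₁ hE h3 hE1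
        have hfT' := hN n hn _ hE₁ h3
        obtain ⟨k, hk | hk, hkT⟩ := (hG'.lev n).across f hf hfT' i
        · rwa [← hk]
        · exfalso
          -- If `𝒯'` had a tile `k` of the other type here, then `f` and `k` would lie in one tile
          -- of level `n + 3` of `𝒯'`. This is the ancestor `f₃` of `f` in both tilings, so `x` is
          -- interior to it. But in `𝒯` the point `x` also lies in the mirror image of `f₃`.
          obtain ⟨hnh, j, hkx⟩ := Nbr.nhds hf (Or.inr hk) hi
          have hxf := h3 hx₁
          have hxk := hkx.mem (hf.ex hk).valid
          obtain ⟨F, hF, hF1, hF2⟩ := hG'.merge_of_ex hxV' hf hfT' hkT hxf hxk hk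
          obtain ⟨E₃, hE₃, h4⟩ := hG.exists_anc (Nat.le_add_right n 3) hE₁
          have hE₃' := hN (n + 3) (by omega) E₃ hE₃ (h3.trans h4)
          have hFE : F = E₃ := hG'.anc_unique hfT' hF hE₃' hF1 h4
          obtain ⟨E₄, hE₄, h5⟩ := hG.exists_anc (Nat.le_add_right n 3) hE
          obtain ⟨f₃, hf₃, rfl⟩ := (hG.lev (n + 3)).shape _ hE₃
          obtain ⟨f₄, hf₄, rfl⟩ := (hG.lev (n + 3)).shape _ hE₄
          obtain ⟨i₃, -, rfl⟩ := h (n + 3) f₃ f₄ hf₃ hf₄ hE₃ hE₄ (h3.trans h4) (hE1.trans h5)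
          have hxi : x ∈ interior f₃.tile.region := by
            refine mem_interior_iff_mem_nhds.2 (Filter.mem_of_superset hnh ?_)
            exact Set.union_subset h4 (hFE ▸ hF2)
          have := (hG.lev (n + 3)).eq_of_mem_interior hE₃ hE₄ hxi (h5 (hE1 hx₂))
          have := congrArg Frame.ε (eq_of_tile_eq hf₃.valid hf₄.valid this)
          rw [mir_ε] at this
          exact hf₃.root.ne_conj this
  refine hsub.antisymm fun D' hD' => ?_
  obtain ⟨x, hx⟩ := hG'.interior_nonempty (n := 0) hD'
  obtain ⟨D₁, hD₁, hx₁⟩ := hG.cover x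
  rwa [hG'.eq_of_mem_interior hD' (hsub hD₁) hx hx₁]

end Good

end PenroseCurve

end

noncomputable section

namespace PenroseCurve

open Topology
open PenroseCurve.Frame

/-! ### Kites and darts -/

/-- The kite or dart that consists of a triangle and its mirror image. -/
def Frame.quad (f : Frame) : Set ℂ := f.tile.region ∪ (f.mir 2).tile.region

/-- By the law of cosines the third length forces the quotient of `x` and `kap * d`, a number of
norm 1, to have real part `τ / 2`. -/
theorem exists_root_of_norm {c : Bool} {d x : ℂ} (hd : ‖d‖ = len true 1 c) (hx : ‖x‖ = gold)
    (hdx : ‖d - x‖ = 1) : ∃ ε, IsRoot ε ∧ x = kap ⟨c, ε, 0, d⟩ * ε * d := by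
  have hd0 : d ≠ 0 := by
    rw [← norm_ne_zero_iff, hd]
    exact (len_pos true one_pos c).ne'
  have hR := gold_sq
  have hg := gold_pos
  have hgc := gold_ne_zero_complex
  have expand : ∀ ε : ℂ, ‖ε‖ = 1 → ∀ r : ℝ, ‖1 - r * ε‖ ^ 2 = 1 - 2 * r * ε.re + r ^ 2 := by
    intro ε hε r
    have h1 : ε.re ^ 2 + ε.im ^ 2 = 1 := by
      have := Complex.sq_norm ε
      rw [hε, Complex.normSq_apply] at this
      linarith
    rw [← Complex.normSq_eq_norm_sq, Complex.normSq_apply]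
    simp
    linear_combination r ^ 2 * h1
  cases c
  · simp only [len] at hd
    simp at hd
    have hε : ‖x / (gold * d)‖ = 1 := by
      rw [norm_div, norm_mul, norm_gold, hd, hx, mul_one, div_self hg.ne']
    refine ⟨x / (gold * d), isRoot_of_norm hε ?_, by simp; field_simp⟩
    have h1 : d - x = (1 - gold * (x / (gold * d))) * d := by field_simp
    rw [h1, norm_mul, hd, mul_one] at hdx
    have := expand _ hε gold
    rw [hdx] at this
    have : gold * (gold - 2 * (x / (gold * d)).re) = 0 := by linarith
    linarith [(mul_eq_zero.1 this).resolve_left hg.ne']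
  · simp only [len] at hd
    simp at hd
    have hε : ‖x / d‖ = 1 := by
      rw [norm_div, hd, hx, div_self hg.ne']
    refine ⟨x / d, isRoot_of_norm hε ?_, by simp; field_simp⟩
    have h1 : d - x = (1 - (1 : ℝ) * (x / d)) * d := by push_cast; field_simp
    rw [h1, norm_mul, hd] at hdx
    have := expand _ hε 1
    have h2 : ‖1 - ((1 : ℝ) : ℂ) * (x / d)‖ ^ 2 * gold ^ 2 = 1 := by
      rw [← mul_pow, hdx, one_pow]
    rw [this] at h2
    have : gold ^ 2 * (gold - 2 * (x / d).re) = 0 := by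
      linear_combination h2 + (gold - 1) * hR
    linarith [(mul_eq_zero.1 this).resolve_left (by positivity)]

/-- The vertex `w`. -/
def Frame.w (f : Frame) : ℂ := f.t + f.kap * f.ε * f.d

/-- The vertex `h`. -/
def Frame.h (f : Frame) : ℂ := f.t + f.d

/-- The mirror image of the vertex `w`. -/
def Frame.w' (f : Frame) : ℂ := f.t + f.kap * (gold - f.ε) * f.d

section Dist

variable {f : Frame} (hf : Ok true 1 f)
include hf

theorem Frame.Ok.kap_mul_norm : f.kap * ‖f.d‖ = gold := by
  rw [hf.norm_d]
  obtain ⟨c, ε, t, d⟩ := f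
  cases c <;> simp [len]

theorem Frame.Ok.dist_t_w : dist f.t f.w = gold := by
  rw [dist_comm, dist_eq_norm, Frame.w, add_sub_cancel_left, norm_mul, norm_mul, hf.root.norm,
    Complex.norm_real, Real.norm_of_nonneg f.kap_pos.le, mul_one, hf.kap_mul_norm]

theorem Frame.Ok.dist_t_w' : dist f.t f.w' = gold := by
  rw [dist_comm, dist_eq_norm, Frame.w', add_sub_cancel_left, norm_mul, norm_mul,
    hf.root.conj.norm, Complex.norm_real, Real.norm_of_nonneg f.kap_pos.le, mul_one,
    hf.kap_mul_norm]

theorem Frame.Ok.dist_h_w : dist f.h f.w = 1 := by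
  have hr : f.ε ^ 2 = gold * f.ε - 1 := hf.root
  have hC := gold_sq_complex
  have h1 := hf.root.norm
  have hd := hf.norm_d
  have h2 := norm_gold_sub_one
  rw [dist_eq_norm, Frame.h, Frame.w]
  obtain ⟨c, ε, t, d⟩ := f
  simp only at *
  cases c
  · rw [show t + d - (t + kap ⟨false, ε, t, d⟩ * ε * d) = -(ε ^ 2 * d) by
      simp only [kap_false]; rw [hr]; ring]
    simp [h1, hd, len]
  · rw [show t + d - (t + kap ⟨true, ε, t, d⟩ * ε * d) = (1 - gold) * (ε ^ 3 * d) by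
      simp only [kap_true]; push_cast; grind]
    rw [norm_mul, norm_mul, norm_pow, h1, hd, norm_sub_rev, h2]
    simp [len]
    linarith [gold_mul_sub_one]

theorem Frame.Ok.dist_t_h : dist f.t f.h = len true 1 f.c := by
  rw [dist_comm, dist_eq_norm, Frame.h, add_sub_cancel_left, hf.norm_d]

/-- This value distinguishes `w w'` from all other pairs of vertices, whose distances are 1 or `τ`.
-/
theorem Frame.Ok.dist_w_w' : dist f.w f.w' ^ 2 = gold + 2 := by
  have h1 : f.w - f.w' = f.kap * f.d * (f.ε - (gold - f.ε)) := by
    simp only [Frame.w, Frame.w']; ring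
  have h2 : f.ε - (gold - f.ε) = ((2 * f.ε.im : ℝ) : ℂ) * Complex.I := by
    apply Complex.ext
    · simp; linarith [hf.root.parts.1]
    · simp; ring
  rw [dist_eq_norm, h1, h2, norm_mul, norm_mul, norm_mul, Complex.norm_real,
    Real.norm_of_nonneg f.kap_pos.le, hf.kap_mul_norm, Complex.norm_real, Complex.norm_I, mul_one,
    mul_pow, Real.norm_eq_abs, sq_abs, mul_pow, hf.root.parts.2]
  have := gold_sq
  linear_combination (4 - gold ^ 2 - (gold + 1)) * this + (-1 : ℝ) * this

end Dist

theorem Frame.w_mir (f : Frame) : (f.mir 2).w = f.w' := rfl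

theorem Frame.w'_mir (f : Frame) : (f.mir 2).w' = f.w := by
  simp only [Frame.w, Frame.w', mir_two, sub_sub_cancel]
  rfl

theorem quad_mir {f : Frame} (hf : f.Valid) : (f.mir 2).quad = f.quad := by
  rw [Frame.quad, mir_mir hf, Set.union_comm]
  rfl

theorem quad_eq (f : Frame) : f.quad = convexHull ℝ {f.t, f.h, f.w} ∪ convexHull ℝ {f.t, f.h, f.w'} :=
  rfl

theorem exists_frame_of_dist {c : Bool} {S : Set ℂ} {t l h r : ℂ} (h1 : dist t l = gold)
    (h2 : dist t r = gold) (h3 : dist h l = 1) (h4 : dist h r = 1)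
    (h5 : dist t h = len true 1 c) (h6 : l ≠ r) (h7 : IsQuad S t l h r) :
    ∃ f, Ok true 1 f ∧ f.c = c ∧ f.t = t ∧ f.h = h ∧ f.w = l ∧ f.w' = r ∧ S = f.quad := by
  have hd : ‖h - t‖ = len true 1 c := by rw [← dist_eq_norm, dist_comm, h5]
  obtain ⟨ε, hε, hl⟩ := exists_root_of_norm (x := l - t) hd
    (by rw [← dist_eq_norm, dist_comm, h1]) (by rw [sub_sub_sub_cancel_right, ← dist_eq_norm, h3])
  obtain ⟨δ, hδ, hr⟩ := exists_root_of_norm (x := r - t) hd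
    (by rw [← dist_eq_norm, dist_comm, h2]) (by rw [sub_sub_sub_cancel_right, ← dist_eq_norm, h4])
  have hk : kap ⟨c, ε, 0, h - t⟩ = kap ⟨c, ε, t, h - t⟩ := rfl
  have hk' : kap ⟨c, δ, 0, h - t⟩ = kap ⟨c, ε, t, h - t⟩ := rfl
  rw [hk] at hl
  rw [hk'] at hr
  have hne : δ ≠ ε := by
    rintro rfl
    exact h6 (by linear_combination hl - hr)
  have hδ' := (hε.eq_or hδ).resolve_left hne
  have e1 : Frame.h ⟨c, ε, t, h - t⟩ = h := by simp [Frame.h]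
  have e2 : Frame.w ⟨c, ε, t, h - t⟩ = l := by
    simp only [Frame.w]; linear_combination -hl
  have e3 : Frame.w' ⟨c, ε, t, h - t⟩ = r := by
    simp only [Frame.w']; rw [← hδ']; linear_combination -hr
  refine ⟨⟨c, ε, t, h - t⟩, ⟨hε, one_pos, hd⟩, rfl, rfl, e1, e2, e3, ?_⟩
  rw [quad_eq, e1, e2, e3]
  exact h7

theorem Frame.Ok.isQuad {f : Frame} : IsQuad f.quad f.t f.w f.h f.w' := quad_eq f

theorem Frame.Ok.w_ne_w' {f : Frame} (hf : Ok true 1 f) : f.w ≠ f.w' := by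
  intro h
  have := hf.dist_w_w'
  rw [h, dist_self] at this
  linarith [gold_pos]

theorem Frame.Ok.dist_h_w' {f : Frame} (hf : Ok true 1 f) : dist f.h f.w' = 1 := (hf.mir 2).dist_h_w

theorem isKite_iff {S : Set ℂ} {t l h r : ℂ} : IsKite S t l h r ↔
    ∃ f, Ok true 1 f ∧ f.c = true ∧ f.t = t ∧ f.h = h ∧ f.w = l ∧ f.w' = r ∧ S = f.quad := by
  constructor
  · rintro ⟨h1, h2, h3, h4, h5, h6, h7⟩
    refine exists_frame_of_dist h1 h2 h3 h4 (c := true) ?_ h6 h7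
    rw [h5]
    simp [len, gold]
  · rintro ⟨f, hf, hc, rfl, rfl, rfl, rfl, rfl⟩
    refine ⟨hf.dist_t_w, hf.dist_t_w', hf.dist_h_w, hf.dist_h_w', ?_, hf.w_ne_w', Ok.isQuad⟩
    rw [hf.dist_t_h, hc]
    simp [len, gold]

theorem isDart_iff {S : Set ℂ} {t l h r : ℂ} : IsDart S t l h r ↔
    ∃ f, Ok true 1 f ∧ f.c = false ∧ f.t = t ∧ f.h = h ∧ f.w = l ∧ f.w' = r ∧ S = f.quad := by
  constructor
  · rintro ⟨h1, h2, h3, h4, h5, h6, h7⟩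
    refine exists_frame_of_dist h1 h2 h3 h4 (c := false) ?_ h6 h7
    rw [h5]
    simp [len]
  · rintro ⟨f, hf, hc, rfl, rfl, rfl, rfl, rfl⟩
    refine ⟨hf.dist_t_w, hf.dist_t_w', hf.dist_h_w, hf.dist_h_w', ?_, hf.w_ne_w', Ok.isQuad⟩
    rw [hf.dist_t_h, hc]
    simp [len]

theorem Frame.tile_eq (f : Frame) : f.tile = ⟨f.c, f.t, f.h, f.w⟩ := rfl

theorem mem_aTiling {T : Set (Set ℂ)} {D : TriTile} :
    D ∈ aTiling T ↔ ∃ f, Ok true 1 f ∧ f.tile = D ∧ f.quad ∈ T := by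
  obtain ⟨c, t, h, w⟩ := D
  simp only [aTiling, Set.mem_union, Set.mem_ofPred_eq]
  constructor
  · rintro (⟨⟨S, hS, r, h⟩, rfl⟩ | ⟨⟨S, hS, r, h⟩, rfl⟩)
    · obtain ⟨f, hf, hc, rfl, rfl, rfl, rfl, rfl⟩ := isKite_iff.1 h
      exact ⟨f, hf, by rw [tile_eq, hc], hS⟩
    · obtain ⟨f, hf, hc, rfl, rfl, rfl, rfl, rfl⟩ := isDart_iff.1 h
      exact ⟨f, hf, by rw [tile_eq, hc], hS⟩
  · rintro ⟨f, hf, h, hS⟩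
    rw [tile_eq, TriTile.mk.injEq] at h
    obtain ⟨rfl, rfl, rfl, rfl⟩ := h
    cases hc : f.c
    · exact Or.inr ⟨⟨_, hS, f.w', isDart_iff.2 ⟨f, hf, hc, rfl, rfl, rfl, rfl, rfl⟩⟩, rfl⟩
    · exact Or.inl ⟨⟨_, hS, f.w', isKite_iff.2 ⟨f, hf, hc, rfl, rfl, rfl, rfl, rfl⟩⟩, rfl⟩

/-! ### The vertices of a kite or dart are determined by the set -/

/-- An affine function with a strict maximum at `v` would be smaller than `L v` on the whole hull if
it were so on the generating points. Such exposed points can be recognized from the set alone. -/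
theorem mem_of_exposed {s S : Set ℂ} {v : ℂ} (hv : v ∈ convexHull ℝ s) (hs : s ⊆ S) (L : ℂ → ℝ)
    (hL : ∀ x y (a b : ℝ), a + b = 1 → L (a * x + b * y) = a * L x + b * L y)
    (h : ∀ p ∈ S, p ≠ v → L p < L v) : v ∈ s := by
  by_contra hvs
  have hc : Convex ℝ {p | L p < L v} := by
    intro x hx y hy a b ha hb hab
    simp only [Set.mem_ofPred_eq, Complex.real_smul] at *
    rw [hL _ _ _ _ hab]
    rcases ha.eq_or_lt with rfl | ha
    · obtain rfl : b = 1 := by linarith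
      linarith
    · have : L v = a * L v + b * L v := by rw [← add_mul, hab, one_mul]
      nlinarith
  have := convexHull_min (fun p hp => h p (hs hp) fun h => hvs (h ▸ hp)) hc hv
  exact absurd this (lt_irrefl (L v))

theorem vertices_of_exposed {g : Frame} {v : ℂ} (hv : v ∈ g.quad) (L : ℂ → ℝ)
    (hL : ∀ x y (a b : ℝ), a + b = 1 → L (a * x + b * y) = a * L x + b * L y)
    (h : ∀ p ∈ g.quad, p ≠ v → L p < L v) : v = g.t ∨ v = g.h ∨ v = g.w ∨ v = g.w' := by
  rcases hv with hv | hv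
  · have := mem_of_exposed hv ((subset_convexHull ℝ _).trans Set.subset_union_left) L hL h
    rcases this with h | h | h
    exacts [Or.inl h, Or.inr (Or.inl h), Or.inr (Or.inr (Or.inl h))]
  · have := mem_of_exposed hv ((subset_convexHull ℝ _).trans Set.subset_union_right) L hL h
    rcases this with h | h | h
    exacts [Or.inl h, Or.inr (Or.inl h), Or.inr (Or.inr (Or.inr h))]

theorem Frame.eq_vtx_of_co {f : Frame} (hf : f.Valid) {x : ℂ} (hx : x ∈ f.tile.region) {i : Fin 3}
    (h : 1 ≤ f.co i x) : x = f.vtx i := by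
  have h0 := (mem_region hf).1 hx
  have hs := f.co_sum x
  have h00 := h0 0
  have h01 := h0 1
  have h02 := h0 2
  rw [eq_sum_vtx hf x]
  fin_cases i
  · simp only [Fin.zero_eta] at h
    rw [show f.co 1 x = 0 by linarith, show f.co 2 x = 0 by linarith, show f.co 0 x = 1 by linarith]
    simp [vtx]
  · simp only [Fin.mk_one] at h
    rw [show f.co 1 x = 1 by linarith, show f.co 2 x = 0 by linarith, show f.co 0 x = 0 by linarith]
    simp [vtx]
  · simp only [Fin.reduceFinMk] at h
    rw [show f.co 1 x = 0 by linarith, show f.co 2 x = 1 by linarith, show f.co 0 x = 0 by linarith]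
    simp [vtx]

theorem Frame.co_mir_two {f : Frame} (hf : f.Valid) (x : ℂ) :
    (f.mir 2).co 2 x = -f.co 2 x ∧
      (f.mir 2).co 1 x = f.co 1 x + gold * f.kap * f.co 2 x := by
  have hg : (f.mir 2).Valid := ⟨hf.root.conj, hf.ne⟩
  obtain ⟨a, b, rfl⟩ := exists_pt hf x
  have : f.pt a b = (f.mir 2).pt (a + gold * b) (-b) := by
    simp only [pt, mir_two]; push_cast; ring
  have h1 : (f.mir 2).sig = f.sig := rfl
  have h2 := sig_mul_kap f
  constructor
  · conv_lhs => rw [this]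
    rw [co_pt hg, co_pt hf]
    simp [h1]
  · conv_lhs => rw [this]
    rw [co_pt hg, co_pt hf, co_pt hf]
    simp
    linear_combination -gold * b * h2

section Unique

variable {f g : Frame} (hf : Ok true 1 f)
include hf

theorem w_mem_vertices (h : f.quad = g.quad) : f.w = g.t ∨ f.w = g.h ∨ f.w = g.w ∨ f.w = g.w' := by
  have hv := hf.valid
  have hw : f.w ∈ f.quad := Or.inl (subset_convexHull ℝ _ (by simp [tile, Frame.w]))
  have hw2 : f.co 2 f.w = 1 := co_vtx hv 2 2
  refine vertices_of_exposed (h ▸ hw) (f.co 2) (fun x y a b hab => co_comb x y a b hab 2) ?_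
  rw [← h]
  rintro p (hp | hp) hne
  · by_contra hlt
    exact hne (eq_vtx_of_co hv hp (i := 2) (by linarith))
  · have h1 := (mem_region (hf.mir 2).valid).1 hp 2
    rw [(co_mir_two hv p).1] at h1
    linarith

theorem t_mem_vertices (h : f.quad = g.quad) : f.t = g.t ∨ f.t = g.h ∨ f.t = g.w ∨ f.t = g.w' := by
  have hv := hf.valid
  have hg := gold_pos
  have hk := f.kap_pos
  have hgk : 0 < gold * f.kap := mul_pos hg hk
  have hw : f.t ∈ f.quad := Or.inl (subset_convexHull ℝ _ (by simp [tile]))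
  have h1 : f.co 1 f.t = 0 := co_vtx hv 1 0
  have h2 : f.co 2 f.t = 0 := co_vtx hv 2 0
  have key : ∀ (f : Frame) (p : ℂ), f.Valid → p ∈ f.tile.region → 0 < gold * f.kap → p ≠ f.t →
      0 < f.co 1 p + gold * f.kap / 2 * f.co 2 p := by
    intro f p hv hp hgk hne
    have h0 := (mem_region hv).1 hp
    have hs := f.co_sum p
    have h00 := h0 0
    have h01 := h0 1
    have h02 := h0 2
    by_contra hlt
    refine hne (eq_vtx_of_co hv hp (i := 0) ?_)
    have : f.co 1 p = 0 := by nlinarith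
    have : f.co 2 p = 0 := by nlinarith
    linarith
  refine vertices_of_exposed (h ▸ hw) (fun x => -(f.co 1 x + gold * f.kap / 2 * f.co 2 x))
    (fun x y a b hab => ?_) ?_
  · simp only [co_comb x y a b hab]; ring
  rw [← h]
  rintro p (hp | hp) hne
  · rw [h1, h2]
    linarith [key f p hv hp hgk hne]
  · rw [h1, h2]
    have h3 := key (f.mir 2) p (hf.mir 2).valid hp hgk hne
    rw [(co_mir_two hv p).1, (co_mir_two hv p).2] at h3
    have h4 : (f.mir 2).kap = f.kap := rfl
    rw [h4] at h3
    linarith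

/-- Only a kite has this property: the angle of a dart at `h` is reflex, so `h` is not exposed
there. -/
theorem h_mem_vertices (hc : f.c = true) (h : f.quad = g.quad) :
    f.h = g.t ∨ f.h = g.h ∨ f.h = g.w ∨ f.h = g.w' := by
  have hv := hf.valid
  have hg := gold_pos
  have hg2 := gold_lt
  have hk : f.kap = 1 := by rw [kap, hc]; rfl
  have hw : f.h ∈ f.quad := Or.inl (subset_convexHull ℝ _ (by simp [tile, Frame.h]))
  have h1 : f.co 1 f.h = 1 := co_vtx hv 1 1
  have h2 : f.co 2 f.h = 0 := co_vtx hv 2 1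
  have key : ∀ (f : Frame) (p : ℂ), f.Valid → p ∈ f.tile.region → p ≠ f.h →
      f.co 1 p + gold / 2 * f.co 2 p < 1 := by
    intro f p hv hp hne
    have h0 := (mem_region hv).1 hp
    have hs := f.co_sum p
    have h00 := h0 0
    have h01 := h0 1
    have h02 := h0 2
    by_contra hlt
    refine hne (eq_vtx_of_co hv hp (i := 1) ?_)
    have : f.co 2 p = 0 := by nlinarith
    rw [this] at hlt
    linarith
  refine vertices_of_exposed (h ▸ hw) (fun x => f.co 1 x + gold / 2 * f.co 2 x)
    (fun x y a b hab => ?_) ?_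
  · simp only [co_comb x y a b hab]; ring
  rw [← h]
  rintro p (hp | hp) hne
  · rw [h1, h2]
    linarith [key f p hv hp hne]
  · rw [h1, h2]
    have h3 := key (f.mir 2) p (hf.mir 2).valid hp hne
    rw [(co_mir_two hv p).1, (co_mir_two hv p).2, hk] at h3
    linarith

end Unique

/-- The three vertices determine `ε` and `kap * d`. The type remains: for a kite `h` is exposed,
hence a vertex of the other tile as well, and the distances do not fit a dart. -/
theorem eq_of_t_w_w' {f g : Frame} (hf : Ok true 1 f) (hg : Ok true 1 g) (h : f.quad = g.quad)
    (h1 : f.w = g.w) (h2 : f.w' = g.w') (h3 : f.t = g.t) : f = g := by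
  have hnz := gold_ne_zero_complex
  have key : (f.kap : ℂ) * f.d = g.kap * g.d := by
    simp only [Frame.w, Frame.w', h3] at h1 h2
    have : (gold : ℂ) * (f.kap * f.d - g.kap * g.d) = 0 := by linear_combination h1 + h2
    exact sub_eq_zero.1 ((mul_eq_zero.1 this).resolve_left hnz)
  have hε : f.ε = g.ε := by
    simp only [Frame.w, h3] at h1
    have h4 : (f.kap : ℂ) * f.d ≠ 0 := mul_ne_zero (by exact_mod_cast f.kap_pos.ne') hf.valid.ne
    have : (f.kap : ℂ) * f.d * (f.ε - g.ε) = 0 := by linear_combination h1 - g.ε * key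
    exact sub_eq_zero.1 ((mul_eq_zero.1 this).resolve_left h4)
  have main : ∀ {f g : Frame}, Ok true 1 f → Ok true 1 g → f.quad = g.quad → f.w = g.w →
      f.w' = g.w' → f.t = g.t → f.c = true → g.c = false → False := by
    intro f g hf hg h h1 h2 h3 hc hc'
    have hl : len true 1 true = gold := by simp [len]
    have hl' : len true 1 false = 1 := by simp [len]
    have hg1 := one_lt_gold
    rcases h_mem_vertices hf hc h with h4 | h4 | h4 | h4
    · have := hf.dist_t_h
      rw [h4, h3, dist_self, hc, hl] at this
      linarith
    · have := hf.dist_t_h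
      rw [h4, h3, hg.dist_t_h, hc, hc', hl, hl'] at this
      linarith
    · have := hf.dist_h_w
      rw [h4, h1, dist_self] at this
      linarith
    · have := hf.dist_h_w'
      rw [h4, h2, dist_self] at this
      linarith
  have hc : f.c = g.c := by
    cases hc : f.c <;> cases hc' : g.c
    · rfl
    · exact (main hg hf h.symm h1.symm h2.symm h3.symm hc' hc).elim
    · exact (main hf hg h h1 h2 h3 hc hc').elim
    · rfl
  have hk : f.kap = g.kap := by rw [kap, kap, hc]
  refine Frame.ext hc hε h3 ?_
  rw [hk] at key
  exact mul_left_cancel₀ (by exact_mod_cast g.kap_pos.ne') key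

/-- A kite or dart is cut into two triangles in a unique way. -/
theorem quad_injective {f g : Frame} (hf : Ok true 1 f) (hg : Ok true 1 g) (h : f.quad = g.quad) :
    g = f ∨ g = f.mir 2 := by
  have hR := gold_sq
  have hg1 := one_lt_gold
  have hg2 := gold_lt
  -- The distance of `w` and `w'` is larger than the other distances of two vertices.
  have far : ∀ x y : ℂ, dist x y ^ 2 = gold + 2 → ∀ r : ℝ, (r = gold ∨ r = 1 ∨ r = 0) →
      dist x y = r → False := by
    rintro x y h r (rfl | rfl | rfl) h' <;> rw [h'] at h <;> nlinarith
  have hl : len true 1 g.c = gold ∨ len true 1 g.c = 1 := by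
    cases g.c <;> simp [len]
  have main : ∀ {g : Frame}, Ok true 1 g → f.quad = g.quad → f.w = g.w → f.w' = g.w' → f = g := by
    intro g hg h h1 h2
    refine eq_of_t_w_w' hf hg h h1 h2 ?_
    rcases t_mem_vertices hf h with h4 | h4 | h4 | h4
    · exact h4
    · have := hf.dist_t_w
      rw [h4, h1, hg.dist_h_w] at this
      linarith
    · have := hf.dist_t_w
      rw [h4, h1, dist_self] at this
      linarith
    · have := hf.dist_t_w'
      rw [h4, h2, dist_self] at this
      linarith
  have hww := hf.dist_w_w'
  have a1 := hg.dist_t_w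
  have a2 := hg.dist_t_w'
  have a3 := hg.dist_h_w
  have a4 := hg.dist_h_w'
  have a5 := hg.dist_t_h
  have hm : f.w' = g.t ∨ f.w' = g.h ∨ f.w' = g.w ∨ f.w' = g.w' :=
    w_mem_vertices (hf.mir 2) ((quad_mir hf.valid).trans h)
  have cases16 : (f.w = g.w ∧ f.w' = g.w') ∨ (f.w = g.w' ∧ f.w' = g.w) := by
    rcases w_mem_vertices hf h with h1 | h1 | h1 | h1 <;> rcases hm with h2 | h2 | h2 | h2
    · exact (far _ _ hww 0 (by simp) (by rw [h1, h2, dist_self])).elim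
    · exact (far _ _ hww _ (hl.imp id Or.inl) (by rw [h1, h2, a5])).elim
    · exact (far _ _ hww gold (by simp) (by rw [h1, h2, a1])).elim
    · exact (far _ _ hww gold (by simp) (by rw [h1, h2, a2])).elim
    · exact (far _ _ hww _ (hl.imp id Or.inl) (by rw [h1, h2, dist_comm, a5])).elim
    · exact (far _ _ hww 0 (by simp) (by rw [h1, h2, dist_self])).elim
    · exact (far _ _ hww 1 (by simp) (by rw [h1, h2, a3])).elim
    · exact (far _ _ hww 1 (by simp) (by rw [h1, h2, a4])).elim
    · exact (far _ _ hww gold (by simp) (by rw [h1, h2, dist_comm, a1])).elim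
    · exact (far _ _ hww 1 (by simp) (by rw [h1, h2, dist_comm, a3])).elim
    · exact (far _ _ hww 0 (by simp) (by rw [h1, h2, dist_self])).elim
    · exact Or.inl ⟨h1, h2⟩
    · exact (far _ _ hww gold (by simp) (by rw [h1, h2, dist_comm, a2])).elim
    · exact (far _ _ hww 1 (by simp) (by rw [h1, h2, dist_comm, a4])).elim
    · exact Or.inr ⟨h1, h2⟩
    · exact (far _ _ hww 0 (by simp) (by rw [h1, h2, dist_self])).elim
  rcases cases16 with ⟨h1, h2⟩ | ⟨h1, h2⟩
  · exact Or.inl (main hg h h1 h2).symm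
  · right
    have := main (hg.mir 2) (h.trans (quad_mir hg.valid).symm) h1 (h2.trans g.w'_mir.symm)
    rw [this, mir_mir hg.valid]

/-! ### Vertices and edges -/

theorem exists_quad_iff {f : Frame} (hf : Ok true 1 f) (P : Frame → Prop) :
    (∃ g, Ok true 1 g ∧ f.quad = g.quad ∧ P g) ↔ P f ∨ P (f.mir 2) := by
  constructor
  · rintro ⟨g, hg, h, hP⟩
    rcases quad_injective hf hg h with rfl | rfl
    exacts [Or.inl hP, Or.inr hP]
  · rintro (h | h)
    exacts [⟨f, hf, rfl, h⟩, ⟨_, hf.mir 2, (quad_mir hf.valid).symm, h⟩]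

theorem isBlackVertex_quad {f : Frame} (hf : Ok true 1 f) {v : ℂ} : IsBlackVertex f.quad v ↔
    (f.c = true ∧ (v = f.t ∨ v = f.h)) ∨ (f.c = false ∧ (v = f.w ∨ v = f.w')) := by
  have : IsBlackVertex f.quad v ↔ ∃ g, Ok true 1 g ∧ f.quad = g.quad ∧
      ((g.c = true ∧ (v = g.t ∨ v = g.h)) ∨ (g.c = false ∧ (v = g.w ∨ v = g.w'))) := by
    constructor
    · rintro ⟨t, l, h, r, ⟨hk, h'⟩ | ⟨hk, h'⟩⟩
      · obtain ⟨g, hg, hc, rfl, rfl, rfl, rfl, h⟩ := isKite_iff.1 hk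
        exact ⟨g, hg, h, Or.inl ⟨hc, h'⟩⟩
      · obtain ⟨g, hg, hc, rfl, rfl, rfl, rfl, h⟩ := isDart_iff.1 hk
        exact ⟨g, hg, h, Or.inr ⟨hc, h'⟩⟩
    · rintro ⟨g, hg, h, ⟨hc, h'⟩ | ⟨hc, h'⟩⟩
      · exact ⟨_, _, _, _, Or.inl ⟨isKite_iff.2 ⟨g, hg, hc, rfl, rfl, rfl, rfl, h⟩, h'⟩⟩
      · exact ⟨_, _, _, _, Or.inr ⟨isDart_iff.2 ⟨g, hg, hc, rfl, rfl, rfl, rfl, h⟩, h'⟩⟩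
  rw [this, exists_quad_iff hf, mir_c, f.w_mir, f.w'_mir]
  have e1 : (f.mir 2).t = f.t := rfl
  have e2 : (f.mir 2).h = f.h := rfl
  rw [e1, e2]
  tauto

theorem isWhiteVertex_quad {f : Frame} (hf : Ok true 1 f) {v : ℂ} : IsWhiteVertex f.quad v ↔
    (f.c = true ∧ (v = f.w ∨ v = f.w')) ∨ (f.c = false ∧ (v = f.t ∨ v = f.h)) := by
  have : IsWhiteVertex f.quad v ↔ ∃ g, Ok true 1 g ∧ f.quad = g.quad ∧
      ((g.c = true ∧ (v = g.w ∨ v = g.w')) ∨ (g.c = false ∧ (v = g.t ∨ v = g.h))) := by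
    constructor
    · rintro ⟨t, l, h, r, ⟨hk, h'⟩ | ⟨hk, h'⟩⟩
      · obtain ⟨g, hg, hc, rfl, rfl, rfl, rfl, h⟩ := isKite_iff.1 hk
        exact ⟨g, hg, h, Or.inl ⟨hc, h'⟩⟩
      · obtain ⟨g, hg, hc, rfl, rfl, rfl, rfl, h⟩ := isDart_iff.1 hk
        exact ⟨g, hg, h, Or.inr ⟨hc, h'⟩⟩
    · rintro ⟨g, hg, h, ⟨hc, h'⟩ | ⟨hc, h'⟩⟩
      · exact ⟨_, _, _, _, Or.inl ⟨isKite_iff.2 ⟨g, hg, hc, rfl, rfl, rfl, rfl, h⟩, h'⟩⟩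
      · exact ⟨_, _, _, _, Or.inr ⟨isDart_iff.2 ⟨g, hg, hc, rfl, rfl, rfl, rfl, h⟩, h'⟩⟩
  rw [this, exists_quad_iff hf, mir_c, f.w_mir, f.w'_mir]
  have e1 : (f.mir 2).t = f.t := rfl
  have e2 : (f.mir 2).h = f.h := rfl
  rw [e1, e2]
  tauto

/-- The segment between a vertex on the axis and `w`. -/
theorem isEdge_iff {S E : Set ℂ} : IsEdge S E ↔
    ∃ f, Ok true 1 f ∧ S = f.quad ∧ (E = segment ℝ f.t f.w ∨ E = segment ℝ f.h f.w) := by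
  constructor
  · rintro ⟨t, l, h, r, hk | hk, h'⟩
    · obtain ⟨g, hg, hc, rfl, rfl, rfl, rfl, h⟩ := isKite_iff.1 hk
      exact ⟨g, hg, h, h'⟩
    · obtain ⟨g, hg, hc, rfl, rfl, rfl, rfl, h⟩ := isDart_iff.1 hk
      exact ⟨g, hg, h, h'⟩
  · rintro ⟨g, hg, h, h'⟩
    cases hc : g.c
    · exact ⟨_, _, _, _, Or.inr (isDart_iff.2 ⟨g, hg, hc, rfl, rfl, rfl, rfl, h⟩), h'⟩
    · exact ⟨_, _, _, _, Or.inl (isKite_iff.2 ⟨g, hg, hc, rfl, rfl, rfl, rfl, h⟩), h'⟩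

end PenroseCurve

end

noncomputable section

namespace PenroseCurve

open Topology
open PenroseCurve.Frame

/-! ### Penrose tilings by kites and darts as triangle tilings -/

/-- Up to isometry there are only two triangles for given `e` and `s`, so the radii can be chosen
uniformly. -/
theorem exists_ball_subset (e : Bool) {s : ℝ} (hs : 0 < s) : ∃ r > 0, ∃ R, ∀ f, Ok e s f →
    ∃ y, Metric.ball y r ⊆ f.tile.region ∧ f.tile.region ⊆ Metric.closedBall y R := by
  have base : ∀ c, Ok e s ⟨c, zeta, 0, len e s c⟩ := fun c =>
    ⟨isRoot_zeta, hs, by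
      rw [Complex.norm_real, Real.norm_of_nonneg (len_pos e hs c).le]⟩
  have h1 : ∀ c, ∃ r > 0, ∃ R, ∃ y, Metric.ball y r ⊆ (tile ⟨c, zeta, 0, len e s c⟩).region ∧
      (tile ⟨c, zeta, 0, len e s c⟩).region ⊆ Metric.closedBall y R := by
    intro c
    have hy := center_mem_interior (base c).valid
    obtain ⟨r, hr, hr'⟩ := Metric.mem_nhds_iff.1 (mem_interior_iff_mem_nhds.1 hy)
    have hb : Bornology.IsBounded (tile ⟨c, zeta, 0, len e s c⟩).region :=
      ((Set.toFinite _).isCompact_convexHull ℝ).isBounded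
    obtain ⟨R, hR⟩ := hb.subset_closedBall (center ⟨c, zeta, 0, len e s c⟩)
    exact ⟨r, hr, R, _, hr', hR⟩
  choose r hr R y h2 h3 using h1
  refine ⟨min (r true) (r false), lt_min (hr _) (hr _), max (R true) (R false), fun f hf => ?_⟩
  obtain ⟨σ, φ, hφ, hfφ⟩ := exists_acts (base f.c) hf rfl
  have h4 : f.tile.region = σ '' (tile ⟨f.c, zeta, 0, len e s f.c⟩).region := by
    rw [← TriTile.region_map, ← hφ.tile, hfφ]
  refine ⟨σ (y f.c), ?_, ?_⟩
  · rw [h4]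
    refine subset_trans ?_ (Set.image_mono (h2 f.c))
    rw [σ.image_ball]
    refine Metric.ball_subset_ball ?_
    cases f.c
    exacts [min_le_right _ _, min_le_left _ _]
  · rw [h4]
    refine (Set.image_mono (h3 f.c)).trans ?_
    rw [σ.image_closedBall]
    refine Metric.closedBall_subset_closedBall ?_
    cases f.c
    exacts [le_max_right _ _, le_max_left _ _]

/-- The sets that meet the unit disc contain disjoint discs of equal area inside a bounded region.
-/
theorem finite_of_balls {ι : Type*} {S : ι → Set ℂ} {y : ι → ℂ} {r R : ℝ} (hr : 0 < r)
    (h2 : ∀ i, Metric.ball (y i) r ⊆ S i) (h3 : ∀ i, S i ⊆ Metric.closedBall (y i) R)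
    (hd : ∀ i j, i ≠ j → Disjoint (interior (S i)) (interior (S j))) (x : ℂ) :
    {i | (S i ∩ Metric.ball x 1).Nonempty}.Finite := by
  let As : {i // (S i ∩ Metric.ball x 1).Nonempty} → Set ℂ := fun i => Metric.ball (y i.1) r
  have hfin := MeasureTheory.Measure.finite_const_le_meas_of_disjoint_iUnion
    (MeasureTheory.volume : MeasureTheory.Measure ℂ)
    (ε := MeasureTheory.volume (Metric.ball (0 : ℂ) r)) (Metric.measure_ball_pos _ _ hr)
    (As := As) (fun _ => measurableSet_ball) ?_ ?_
  · have huniv : {i | MeasureTheory.volume (Metric.ball (0 : ℂ) r) ≤ MeasureTheory.volume (As i)} =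
        Set.univ := by
      ext i
      simp only [Set.mem_ofPred_eq, Set.mem_univ, iff_true]
      exact (MeasureTheory.Measure.addHaar_ball_center MeasureTheory.volume (y i.1) r).ge
    rw [huniv] at hfin
    exact (hfin.image Subtype.val).subset fun i hi => ⟨⟨i, hi⟩, trivial, rfl⟩
  · intro i j hne
    exact (hd i.1 j.1 fun h => hne (Subtype.ext h)).mono
      (interior_maximal (h2 _) Metric.isOpen_ball) (interior_maximal (h2 _) Metric.isOpen_ball)
  · refine ne_top_of_le_ne_top (b := MeasureTheory.volume (Metric.ball x (R + 1 + r)))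
      MeasureTheory.measure_ball_lt_top.ne (MeasureTheory.measure_mono ?_)
    refine Set.iUnion_subset fun i p hp => ?_
    obtain ⟨q, hq, hq'⟩ := i.2
    have e1 := Metric.mem_closedBall.1 (h3 _ hq)
    have e2 := Metric.mem_ball.1 hq'
    have e3 := Metric.mem_ball.1 hp
    have e4 := dist_triangle p (y i.1) x
    have e5 := dist_triangle (y i.1) q x
    rw [dist_comm (y i.1) q] at e5
    exact Metric.mem_ball.2 (by linarith)

namespace IsPenroseTiling

variable {T : Set (Set ℂ)} (hT : IsPenroseTiling T)
include hT

theorem exists_frame {S : Set ℂ} (hS : S ∈ T) : ∃ f, Ok true 1 f ∧ S = f.quad := by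
  obtain ⟨t, l, h, r, hk | hk⟩ := hT.prototiles S hS
  · obtain ⟨f, hf, -, -, -, -, -, h⟩ := isKite_iff.1 hk
    exact ⟨f, hf, h⟩
  · obtain ⟨f, hf, -, -, -, -, -, h⟩ := isDart_iff.1 hk
    exact ⟨f, hf, h⟩

theorem locally_finite (x : ℂ) : {S ∈ T | (S ∩ Metric.ball x 1).Nonempty}.Finite := by
  obtain ⟨r, hr, R, hrR⟩ := exists_ball_subset true one_pos
  have h1 : ∀ S : T, ∃ y, Metric.ball y r ⊆ S.1 ∧ S.1 ⊆ Metric.closedBall y (3 * R) := by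
    rintro ⟨S, hS⟩
    obtain ⟨f, hf, rfl⟩ := hT.exists_frame hS
    obtain ⟨y, h1, h2⟩ := hrR f hf
    obtain ⟨y', -, h2'⟩ := hrR _ (hf.mir 2)
    have ht : f.t ∈ f.tile.region := subset_convexHull ℝ _ (by simp [tile])
    have ht' : f.t ∈ (f.mir 2).tile.region := subset_convexHull ℝ _ (by simp [tile, mir_two])
    have e1 := Metric.mem_closedBall.1 (h2 ht)
    have e2 := Metric.mem_closedBall.1 (h2' ht')
    have hR : 0 ≤ R := dist_nonneg.trans e1
    refine ⟨y, h1.trans Set.subset_union_left, ?_⟩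
    rintro p (hp | hp)
    · have := Metric.mem_closedBall.1 (h2 hp)
      exact Metric.mem_closedBall.2 (by linarith)
    · have := Metric.mem_closedBall.1 (h2' hp)
      have e3 := dist_triangle p y' y
      have e4 := dist_triangle y' f.t y
      rw [dist_comm y' f.t] at e4
      exact Metric.mem_closedBall.2 (by linarith)
  choose y h2 h3 using h1
  refine ((finite_of_balls hr h2 h3 (fun S S' hne => hT.disjoint S.1 S.2 S'.1 S'.2 fun h =>
    hne (Subtype.ext h)) x).image Subtype.val).subset ?_
  rintro S ⟨hS, hSx⟩
  exact ⟨⟨S, hS⟩, hSx, rfl⟩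

end IsPenroseTiling

theorem segment_injective {a b c d : ℂ} (h : segment ℝ a b = segment ℝ c d) :
    (a = c ∧ b = d) ∨ (a = d ∧ b = c) := by
  have ha : a ∈ segment ℝ c d := h ▸ left_mem_segment ℝ a b
  have hb : b ∈ segment ℝ c d := h ▸ right_mem_segment ℝ a b
  have hc : c ∈ segment ℝ a b := h.symm ▸ left_mem_segment ℝ c d
  have hd : d ∈ segment ℝ a b := h.symm ▸ right_mem_segment ℝ c d
  -- Parametrize each end by the other segment. As `a` and `b` are extreme, convex combinations of
  -- the parameters `p`, `q` with the values 0 and 1 force these parameters to be 0 and 1 in one of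
  -- the two orders.
  rw [segment_eq_image'] at ha hb hc hd
  obtain ⟨p, ⟨hp0, hp1⟩, hp⟩ := hc
  obtain ⟨q, ⟨hq0, hq1⟩, hq⟩ := hd
  obtain ⟨r, ⟨hr0, hr1⟩, hr⟩ := ha
  obtain ⟨s, ⟨hs0, hs1⟩, hs⟩ := hb
  simp only [Complex.real_smul] at *
  by_cases hab : b - a = 0
  · rw [hab, mul_zero, add_zero] at hp hq
    have : a = b := by linear_combination -hab
    left
    exact ⟨hp, by rw [← hq, this]⟩
  have e1 : (1 - r) * p + r * q = 0 := by
    have : (((1 - r) * p + r * q : ℝ) : ℂ) * (b - a) = 0 := by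
      push_cast
      rw [← hp, ← hq] at hr
      linear_combination hr
    exact_mod_cast (mul_eq_zero.1 this).resolve_right hab
  have e2 : (1 - s) * (1 - p) + s * (1 - q) = 0 := by
    have : (((1 - s) * (1 - p) + s * (1 - q) : ℝ) : ℂ) * (b - a) = 0 := by
      push_cast
      rw [← hp, ← hq] at hs
      linear_combination -hs
    exact_mod_cast (mul_eq_zero.1 this).resolve_right hab
  have n1 : 0 ≤ (1 - r) * p := mul_nonneg (by linarith) hp0
  have n2 : 0 ≤ r * q := mul_nonneg hr0 hq0
  have n3 : 0 ≤ (1 - s) * (1 - p) := mul_nonneg (by linarith) (by linarith)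
  have n4 : 0 ≤ s * (1 - q) := mul_nonneg hs0 (by linarith)
  have z1 : (1 - r) * p = 0 := by linarith
  have z2 : r * q = 0 := by linarith
  have z3 : (1 - s) * (1 - p) = 0 := by linarith
  have z4 : s * (1 - q) = 0 := by linarith
  by_cases hp00 : p = 0
  · subst hp00
    have : s = 1 := by linarith
    subst this
    have : q = 1 := by linarith
    subst this
    left
    simp at hp hq
    exact ⟨hp, hq⟩
  · have : r = 1 := by
      have := (mul_eq_zero.1 z1).resolve_right hp00
      linarith
    subst this
    have : q = 0 := by linarith
    subst this
    have : s = 0 := by linarith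
    subst this
    have : p = 1 := by linarith
    subst this
    right
    simp at hp hq
    exact ⟨hq, hp⟩

/-- The vertex on the axis that bounds the side opposite to the vertex number `i`, where `i ≠ 2`. -/
def Frame.ax (f : Frame) (i : Fin 3) : ℂ := if i = 1 then f.t else f.h

theorem Frame.Ok.dist_ax {f : Frame} (hf : Ok true 1 f) (i : Fin 3) :
    dist (f.ax i) f.w = if i = 1 then gold else 1 := by
  unfold Frame.ax
  split
  exacts [hf.dist_t_w, hf.dist_h_w]

/-- Once the type and the labelled ends of a side are given, only the orientation is free. -/
theorem eq_or_eq_mir_of_edge {f g : Frame} {s : ℝ} (hf : Ok true s f) (hg : Ok true s g)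
    (hc : f.c = g.c) {i : Fin 3} (hi : i ≠ 2) (h1 : f.ax i = g.ax i) (h2 : f.w = g.w) :
    g = f ∨ g = f.mir i := by
  have hr : f.ε ^ 2 = gold * f.ε - 1 := hf.root
  have hr' : g.ε ^ 2 = gold * g.ε - 1 := hg.root
  have hC := gold_sq_complex
  have hε := hf.root.eq_or hg.root
  have hgn := gold_ne_zero_complex
  obtain ⟨c, ε, t, d⟩ := f
  obtain ⟨c', δ, t', d'⟩ := g
  obtain rfl : c = c' := hc
  simp only at hr hr' hε
  have hi' : i = 0 ∨ i = 1 := by fin_cases i <;> simp at hi ⊢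
  rcases hi' with rfl | rfl <;> rcases hε with rfl | rfl <;> cases c <;>
    simp only [Frame.ax, Frame.h, Frame.w, kap_true, kap_false, Complex.ofReal_one, one_mul,
      if_true, show ((0 : Fin 3) = 1) = False by simp, if_false] at h1 h2
  · exact Or.inl (mk_congr rfl (by grind) (by grind))
  · exact Or.inl (mk_congr rfl (by grind) (by grind))
  · refine Or.inr ?_
    rw [mir_zero_obtuse]
    exact mk_congr rfl (by grind) (by grind)
  · refine Or.inr ?_
    rw [mir_zero_acute]
    exact mk_congr rfl (by grind) (by grind)
  · exact Or.inl (mk_congr rfl (by grind) (by grind))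
  · exact Or.inl (mk_congr rfl (by grind) (by grind))
  · refine Or.inr ?_
    rw [mir_one]
    exact mk_congr rfl (by grind) (by grind)
  · refine Or.inr ?_
    rw [mir_one]
    exact mk_congr rfl (by grind) (by grind)

/-- For tiles of different types the colors of axis vertices are opposite. So the fitting neighbor
has its `w` at the axis vertex of `f`, and its axis vertex at the `w` of `f`. -/
theorem exists_even_ex {f : Frame} {i : Fin 3} (hf : IsRoot f.ε) (hi : i ≠ 2) :
    ∃ k, Ex true f i k ∧ k.ax i = f.w ∧ k.w = f.ax i := by
  have hr : f.ε ^ 2 = gold * f.ε - 1 := hf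
  have hC := gold_sq_complex
  obtain ⟨c, ε, t, d⟩ := f
  simp only at hr
  have hi' : i = 0 ∨ i = 1 := by fin_cases i <;> simp at hi ⊢
  rcases hi' with rfl | rfl <;> cases c
  · refine ⟨_, Ex.even_obtuse_zero .., ?_⟩
    simp [Frame.ax, Frame.h, Frame.w]
    constructor <;> grind
  · refine ⟨_, Ex.even_acute_zero .., ?_⟩
    simp [Frame.ax, Frame.h, Frame.w]
    constructor <;> grind
  · refine ⟨_, Ex.even_obtuse_one .., ?_⟩
    simp [Frame.ax, Frame.w]
    try grind
  · refine ⟨_, Ex.even_acute_one .., ?_⟩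
    simp [Frame.ax, Frame.w]
    try grind

theorem co_eq_zero_of_mem_segment {f : Frame} (hf : f.Valid) {i : Fin 3} (hi : i ≠ 2) {x : ℂ}
    (hx : x ∈ segment ℝ (f.ax i) f.w) : f.co i x = 0 := by
  obtain ⟨a, b, -, -, hab, rfl⟩ := hx
  simp only [Complex.real_smul]
  have h2 : f.co i f.w = 0 := by
    have := co_vtx hf i 2
    rwa [if_neg hi] at this
  have h1 : f.co i (f.ax i) = 0 := by
    unfold Frame.ax
    split
    · rename_i h
      have := co_vtx hf i 0
      rwa [if_neg (by rw [h]; decide)] at this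
    · rename_i h
      have := co_vtx hf i 1
      rwa [if_neg h] at this
  rw [co_comb _ _ _ _ hab, h1, h2]
  ring

theorem Frame.segment_subset (f : Frame) (i : Fin 3) : segment ℝ (f.ax i) f.w ⊆ f.tile.region := by
  refine segment_subset_convexHull ?_ ?_
  · unfold Frame.ax
    split <;> simp [tile, Frame.h]
  · simp [tile, Frame.w]

theorem Frame.OpenEdge.ne_vtx {f : Frame} (hf : f.Valid) {i : Fin 3} {x : ℂ} (h : f.OpenEdge i x)
    (j : Fin 3) : x ≠ f.vtx j := by
  rintro rfl
  have key : ∀ i j : Fin 3, ∃ k : Fin 3, k ≠ i ∧ k ≠ j := by decide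
  obtain ⟨k, hk1, hk2⟩ := key i j
  have := h.2 k hk1
  rw [co_vtx hf, if_neg hk2] at this
  exact lt_irrefl _ this

theorem Frame.OpenEdge.notMem_mir {f : Frame} (hf : f.Valid) {i : Fin 3} (hi : i ≠ 2) {x : ℂ}
    (h : f.OpenEdge i x) : x ∉ (f.mir 2).tile.region := by
  intro hx
  have h1 := (mem_region (f := f.mir 2) ⟨hf.root.conj, hf.ne⟩).1 hx 2
  rw [(co_mir_two hf x).1] at h1
  linarith [h.2 2 hi.symm]

theorem Frame.OpenEdge.not_isVertex {f : Frame} (hf : Ok true 1 f) {i : Fin 3} (hi : i ≠ 2) {x : ℂ}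
    (h : f.OpenEdge i x) : ¬ IsVertex f.quad x := by
  have h0 := h.ne_vtx hf.valid 0
  have h1 := h.ne_vtx hf.valid 1
  have h2 := h.ne_vtx hf.valid 2
  have h3 : x ≠ f.w' := by
    rintro rfl
    refine h.notMem_mir hf.valid hi (subset_convexHull ℝ _ ?_)
    rw [← f.w_mir]
    simp [tile, Frame.w]
  change x ≠ f.t at h0
  change x ≠ f.h at h1
  change x ≠ f.w at h2
  rw [IsVertex, isBlackVertex_quad hf, isWhiteVertex_quad hf]
  tauto

/-- The other tile at an interior point of the side meets the first one in an edge, whose length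
decides which side of the other tile it is. The colors decide which ends coincide: axis vertices
with axis vertices for tiles of the same type, with exchanged roles for different types. The one
remaining ambiguity, a reflection in the side, would produce an overlap. -/
theorem IsPenroseTiling.across_aTiling {T : Set (Set ℂ)} (hT : IsPenroseTiling T) {f : Frame}
    (hf : Ok true 1 f) (hfT : f.quad ∈ T) {i : Fin 3} (hi : i ≠ 2) :
    ∃ g, Nbr true f i g ∧ g.quad ∈ T := by
  have hv := hf.valid
  obtain ⟨x, hx⟩ := exists_openEdge hv i
  have hxm := hx.notMem_mir hv hi
  -- There is another tile at the point `x`.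
  obtain ⟨S, hS, hSf, hxS⟩ : ∃ S ∈ T, S ≠ f.quad ∧ x ∈ S := by
    by_contra hcon
    push Not at hcon
    -- The other tiles near `x` are finitely many closed sets. If none contains `x`, they avoid a
    -- neighborhood of `x`, and a point of it beyond the side, in the interior of `f.mir i`, is in
    -- no tile at all.
    set 𝓕 := {S ∈ T | (S ∩ Metric.ball x 1).Nonempty} \ {f.quad}
    have hfin : 𝓕.Finite := (hT.locally_finite x).sdiff
    have hcl : IsClosed (⋃ S ∈ 𝓕, S) := hfin.isClosed_biUnion fun S hS => by
      obtain ⟨g, hg, rfl⟩ := hT.exists_frame hS.1.1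
      exact (isClosed_region hg.valid).union (isClosed_region (hg.mir 2).valid)
    have hxF : x ∉ ⋃ S ∈ 𝓕, S := by
      simp only [Set.mem_iUnion, not_exists]
      exact fun S hS => hcon S hS.1.1 hS.2
    obtain ⟨k, l, p, q, hgl⟩ := mir_glued hf i
    have hxg := (hgl.nhds hv (hf.mir i).valid hx).2.mem (hf.mir i).valid
    obtain ⟨y, ⟨⟨hy1, hy2⟩, hy3⟩, hy⟩ := exists_interior_near (hf.mir i).valid hxg
      (Filter.inter_mem (Filter.inter_mem (hcl.isOpen_compl.mem_nhds hxF)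
        (Metric.ball_mem_nhds x one_pos))
        ((isClosed_region (hf.mir 2).valid).isOpen_compl.mem_nhds hxm))
    obtain ⟨S, hS, hyS⟩ : ∃ S ∈ T, y ∈ S := by
      have : y ∈ ⋃₀ T := by rw [hT.covers]; trivial
      exact this
    refine hy1 (Set.mem_biUnion (x := S) ⟨⟨hS, y, hyS, hy2⟩, ?_⟩ hyS)
    rintro rfl
    rcases hyS with hyS | hyS
    · have h1 := (mem_region hv).1 hyS i
      have h2 := (mem_interior (hf.mir i).valid).1 hy i
      rw [hgl.coi] at h2
      linarith
    · exact hy3 hyS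
  have hne : (f.quad ∩ S).Nonempty := ⟨x, Or.inl (hx.mem hv), hxS⟩
  have hxE : x ∈ f.quad ∩ S := ⟨Or.inl (hx.mem hv), hxS⟩
  have hdisj := hT.disjoint _ hfT _ hS hSf.symm
  rcases hT.edge_to_edge _ hfT _ hS hSf.symm hne with ⟨v, hv1, hv2, -⟩ | ⟨hE, hE'⟩
  · rw [hv1] at hxE
    obtain rfl : x = v := hxE
    exact absurd hv2 (hx.not_isVertex hf hi)
  have hEf : f.quad ∩ S = segment ℝ (f.ax i) f.w := by
    obtain ⟨f₁, hf₁, hq, h⟩ := isEdge_iff.1 hE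
    have hj : ∃ j : Fin 3, j ≠ 2 ∧ f.quad ∩ S = segment ℝ (f₁.ax j) f₁.w := by
      rcases h with h | h
      · exact ⟨1, by decide, h⟩
      · exact ⟨0, by decide, h⟩
    obtain ⟨j, hj2, hj⟩ := hj
    rw [hj] at hxE ⊢
    rcases quad_injective hf hf₁ hq with rfl | rfl
    · have h0 := co_eq_zero_of_mem_segment hv hj2 hxE
      by_cases hij : j = i
      · rw [hij]
      · exact absurd h0 (hx.2 j hij).ne'
    · exact absurd (segment_subset _ _ hxE) hxm
  obtain ⟨g, hg, rfl, h⟩ := isEdge_iff.1 hE'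
  obtain ⟨j, hj2, hj⟩ : ∃ j : Fin 3, j ≠ 2 ∧ f.quad ∩ g.quad = segment ℝ (g.ax j) g.w := by
    rcases h with h | h
    · exact ⟨1, by decide, h⟩
    · exact ⟨0, by decide, h⟩
  have hends := segment_injective (hEf.symm.trans hj)
  have hlen : j = i := by
    have h1 : dist (f.ax i) f.w = dist (g.ax j) g.w := by
      rcases hends with ⟨h1, h2⟩ | ⟨h1, h2⟩
      · rw [h1, h2]
      · rw [h1, h2, dist_comm]
    rw [hf.dist_ax, hg.dist_ax] at h1
    have := one_lt_gold
    by_cases hi1 : i = 1 <;> by_cases hj1 : j = 1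
    · rw [hi1, hj1]
    · rw [if_pos hi1, if_neg hj1] at h1; linarith
    · rw [if_neg hi1, if_pos hj1] at h1; linarith
    · fin_cases i <;> fin_cases j <;> simp_all
  subst hlen
  have hax : ∀ (k : Frame), k.ax j = k.t ∨ k.ax j = k.h := by
    intro k
    unfold Frame.ax
    split <;> simp
  have m1 := fun v => hT.matching _ hfT _ hS v
  have m2 := fun v => hT.matching _ hS _ hfT v
  simp only [isBlackVertex_quad hf, isWhiteVertex_quad hf, isBlackVertex_quad hg,
    isWhiteVertex_quad hg] at m1 m2
  by_cases hc : f.c = g.c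
  · have hends' : f.ax j = g.ax j ∧ f.w = g.w := by
      refine hends.resolve_right fun h => ?_
      have a1 := m1 f.w
      have a2 := m2 f.w
      rw [← hc] at a1 a2
      have := hax g
      rw [← h.2] at this
      cases hfc : f.c <;> rw [hfc] at a1 a2 <;> simp at a1 a2 <;> tauto
    rcases eq_or_eq_mir_of_edge hf hg hc hi hends'.1 hends'.2 with rfl | rfl
    · exact absurd rfl hSf
    · exact ⟨_, Or.inl rfl, hS⟩
  · have hends' : f.ax j = g.w ∧ f.w = g.ax j := by
      refine hends.resolve_left fun h => ?_
      have a1 := m1 f.w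
      have a2 := m2 f.w
      rw [h.2] at a1 a2
      cases hfc : f.c <;> cases hgc : g.c <;> rw [hfc, hgc] at hc a1 a2 <;> simp at hc a1 a2
    obtain ⟨k, hk, hk1, hk2⟩ := exists_even_ex hf.root hi
    have hko := hf.ex hk
    have hkc : k.c = g.c := by
      rw [hk.c_eq]
      cases hfc : f.c <;> cases hgc : g.c <;> rw [hfc, hgc] at hc <;> simp at hc ⊢
    rcases eq_or_eq_mir_of_edge hko hg hkc hi (by rw [hk1, hends'.2]) (by rw [hk2, hends'.1])
      with rfl | rfl
    · exact ⟨_, Or.inr hk, hS⟩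
    -- Since `k` is beyond the side, its reflection lies on the side of `f`, and the two overlap
    -- near `x`.
    · exfalso
      obtain ⟨k₁, l₁, i', k₂, l₂, m, p, q, hgl⟩ := hk.glued hf
      have hxk := (hgl.nhds hv hko.valid hx).2
      have h0 : k.co j x = 0 := by
        refine co_eq_zero_of_mem_segment hko.valid hi ?_
        rw [hk1, hk2, segment_symm, ← hEf]
        exact hxE
      have hij : i' = j := by
        by_contra hne
        exact absurd h0 (hxk.2 j (Ne.symm hne)).ne'
      subst hij
      have hU := (Nbr.nhds hko (Or.inl rfl) hxk).1
      obtain ⟨y, hy1, hy2⟩ := exists_interior_near hv (hx.mem hv) (interior_mem_nhds.2 hU)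
      have hopen : IsOpen (interior (k.tile.region ∪ (k.mir i').tile.region) ∩
        interior f.tile.region) := isOpen_interior.inter isOpen_interior
      have hsub : interior (k.tile.region ∪ (k.mir i').tile.region) ∩ interior f.tile.region ⊆
          (k.mir i').tile.region := by
        rintro z ⟨hz1, hz2⟩
        refine (interior_subset hz1).resolve_left fun hz => ?_
        have e1 := (mem_region hko.valid).1 hz i'
        have e2 := (mem_interior hv).1 hz2 i'
        rw [hgl.coi] at e1
        nlinarith [hgl.pos]
      exact Set.disjoint_left.1 hdisj (interior_mono Set.subset_union_left hy2)
        (interior_mono Set.subset_union_left (interior_maximal hsub hopen ⟨hy1, hy2⟩))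

/-- The triangle tiling of a Penrose tiling by kites and darts satisfies the matching rules. -/
theorem IsPenroseTiling.good {T : Set (Set ℂ)} (hT : IsPenroseTiling T) :
    Good true 1 (aTiling T) where
  shape D hD := by
    obtain ⟨f, hf, rfl, -⟩ := mem_aTiling.1 hD
    exact ⟨f, hf, rfl⟩
  across f hf hfT i := by
    obtain ⟨f', hf', h, hq⟩ := mem_aTiling.1 hfT
    rw [eq_of_tile_eq hf'.valid hf.valid h] at hq
    by_cases hi : i = 2
    · subst hi
      exact ⟨_, Or.inl rfl, mem_aTiling.2 ⟨_, hf.mir 2, rfl, (quad_mir hf.valid).symm ▸ hq⟩⟩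
    · obtain ⟨g, hg, hgT⟩ := hT.across_aTiling hf hq hi
      exact ⟨g, hg, mem_aTiling.2 ⟨g, hf.nbr hg, rfl, hgT⟩⟩
  disj D hD D' hD' := by
    obtain ⟨f, hf, rfl, hfT⟩ := mem_aTiling.1 hD
    obtain ⟨g, hg, rfl, hgT⟩ := mem_aTiling.1 hD'
    rintro ⟨x, hx, hx'⟩
    have hq : f.quad = g.quad := by
      by_contra hne
      exact Set.disjoint_left.1 (hT.disjoint _ hfT _ hgT hne)
        (interior_mono Set.subset_union_left hx) (interior_mono Set.subset_union_left hx')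
    rcases quad_injective hf hg hq with rfl | rfl
    · rfl
    · have h1 := (mem_interior hf.valid).1 hx 2
      have h2 := (mem_interior hg.valid).1 hx' 2
      rw [(co_mir_two hf.valid x).1] at h2
      linarith
  cover x := by
    obtain ⟨S, hS, hx⟩ : ∃ S ∈ T, x ∈ S := by
      have : x ∈ ⋃₀ T := by rw [hT.covers]; trivial
      exact this
    obtain ⟨f, hf, rfl⟩ := hT.exists_frame hS
    rcases hx with hx | hx
    · exact ⟨_, mem_aTiling.2 ⟨f, hf, rfl, hS⟩, hx⟩
    · exact ⟨_, mem_aTiling.2 ⟨_, hf.mir 2, rfl, (quad_mir hf.valid).symm ▸ hS⟩, hx⟩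

end PenroseCurve

end

noncomputable section

namespace PenroseCurve

open PenroseCurve.Frame

/-! ### Tilings with equivalent sequences are isometric -/

theorem Frame.mem_sides {f : Frame} (hf : f.Valid) {x : ℂ} (hx : x ∈ f.tile.region) {i : Fin 3}
    (hi : f.co i x = 0) : x ∈ f.tile.sides := by
  have h := (mem_region hf).1 hx
  have hs := f.co_sum x
  have hx' := eq_sum_vtx hf x
  have key : ∀ {a b : ℝ} {u v : ℂ}, 0 ≤ a → 0 ≤ b → a + b = 1 → x = a * u + b * v →
      x ∈ segment ℝ u v := fun ha hb hab he => ⟨_, _, ha, hb, hab, by rw [he]; simp⟩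
  unfold TriTile.sides
  fin_cases i
  · exact Or.inr (key (h 1) (h 2) (by simp at hi; linarith) (by simp at hi; refine hx'.trans ?_; simp [hi, tile]))
  · exact Or.inl (Or.inr (key (h 0) (h 2) (by simp at hi; linarith)
      (by simp at hi; refine hx'.trans ?_; simp [hi, tile])))
  · exact Or.inl (Or.inl (key (h 0) (h 1) (by simp at hi; linarith)
      (by simp at hi; refine hx'.trans ?_; simp [hi, tile])))

theorem Frame.mem_interior_of_notMem_sides {f : Frame} (hf : f.Valid) {x : ℂ}
    (hx : x ∈ f.tile.region) (h : x ∉ f.tile.sides) : x ∈ interior f.tile.region :=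
  (mem_interior hf).2 fun i => ((mem_region hf).1 hx i).lt_of_ne' fun h0 => h (mem_sides hf hx h0)

theorem isLarge_iff {n : ℕ} {D : TriTile} : IsLarge n D ↔ D.acute = ev n := by
  unfold IsLarge ev
  by_cases h : Even n <;> simp [h]

/-- The point is replaced by the triangle around it: the sequence records the types of the ancestors
of `D`. -/
theorem IsPenroseTilingOf.exists_tile {z : PenroseSeq} {T : Set (Set ℂ)}
    (h : IsPenroseTilingOf z T) : ∃ D ∈ aTiling T, ∀ n, ∀ E ∈ lev (aTiling T) n,
      D.region ⊆ E.region → (z n = 0 ↔ E.acute = ev n) := by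
  obtain ⟨hT, p, hp⟩ := h
  have hG := hT.good
  obtain ⟨D, hD, hpD⟩ := hG.cover p
  have hpi : p ∈ interior D.region := by
    obtain ⟨f, hf, rfl⟩ := hG.shape D hD
    exact mem_interior_of_notMem_sides hf.valid hpD (hp.generic _ hD)
  refine ⟨D, hD, fun n E hE hDE => ?_⟩
  obtain ⟨E', hE', hpE', hz⟩ := hp.code n
  rw [level_eq_lev] at hE'
  rw [hz, isLarge_iff, (hG.lev n).eq_of_mem_interior hE hE' (interior_mono hDE hpi) hpE']

theorem exists_quad_of_mem_image {T : Set (Set ℂ)} (σ : ℂ ≃ᵢ ℂ)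
    (h : ∀ S ∈ T, ∃ f, Ok true 1 f ∧ S = f.quad) :
    ∀ S ∈ (fun S : Set ℂ => σ '' S) '' T, ∃ f, Ok true 1 f ∧ S = f.quad := by
  rintro _ ⟨S, hS, rfl⟩
  obtain ⟨f, hf, rfl⟩ := h S hS
  cases hc : f.c
  · obtain ⟨g, hg, -, -, -, -, -, h⟩ := isDart_iff.1
      ((isDart_image σ).2 (isDart_iff.2 ⟨f, hf, hc, rfl, rfl, rfl, rfl, rfl⟩))
    exact ⟨g, hg, h⟩
  · obtain ⟨g, hg, -, -, -, -, -, h⟩ := isKite_iff.1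
      ((isKite_image σ).2 (isKite_iff.2 ⟨f, hf, hc, rfl, rfl, rfl, rfl, rfl⟩))
    exact ⟨g, hg, h⟩

theorem subset_of_aTiling_subset {T T' : Set (Set ℂ)} (h : ∀ S ∈ T, ∃ f, Ok true 1 f ∧ S = f.quad)
    (hTT' : aTiling T ⊆ aTiling T') : T ⊆ T' := by
  intro S hS
  obtain ⟨f, hf, rfl⟩ := h S hS
  obtain ⟨g, hg, hgf, hgT⟩ := mem_aTiling.1 (hTT' (mem_aTiling.2 ⟨f, hf, rfl, hS⟩))
  rwa [eq_of_tile_eq hg.valid hf.valid hgf] at hgT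

theorem PenroseSeq.eq_of_zero_iff {z z' : PenroseSeq} {n : ℕ} (h : z n = 0 ↔ z' n = 0) :
    z n = z' n := by
  have : ∀ a b : Fin 2, (a = 0 ↔ b = 0) → a = b := by decide
  exact this _ _ h

variable {z z' : PenroseSeq} {T T' : Set (Set ℂ)}

/-- After applying `σ`, both sequences are read off from the ancestors of two tiles of the same
tiling. -/
theorem equivalent_of_image_eq (h : IsPenroseTilingOf z T) (h' : IsPenroseTilingOf z' T')
    (σ : ℂ ≃ᵢ ℂ) (hσ : (fun S : Set ℂ => σ '' S) '' T = T') : z.Equivalent z' := by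
  obtain ⟨D, hD, hz⟩ := h.exists_tile
  obtain ⟨D', hD', hz'⟩ := h'.exists_tile
  have hG' := h'.1.good
  have hmap : ∀ D : TriTile, D.map σ ∈ aTiling T' ↔ D ∈ aTiling T := by
    rw [← hσ]
    exact map_mem_aTiling σ T
  obtain ⟨N, hN⟩ := hG'.eventually_acute_eq ((hmap D).2 hD) hD'
  refine ⟨N, fun n hn => PenroseSeq.eq_of_zero_iff ?_⟩
  obtain ⟨E, hE, hDE⟩ := h.1.good.exists_anc (n := 0) (Nat.zero_le n) hD
  obtain ⟨E', hE', hDE'⟩ := hG'.exists_anc (n := 0) (Nat.zero_le n) hD'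
  have := hN n hn _ ((map_mem_lev σ hmap n E).2 hE) E' hE'
    (by rw [TriTile.region_map, TriTile.region_map]; exact Set.image_mono hDE) hDE'
  rw [hz n E hE hDE, hz' n E' hE' hDE', ← this]
  rfl

theorem exists_image_eq (h : IsPenroseTilingOf z T) (h' : IsPenroseTilingOf z' T')
    (hzz : z.Equivalent z') : ∃ σ : ℂ ≃ᵢ ℂ, (fun S : Set ℂ => σ '' S) '' T = T' := by
  obtain ⟨m, hm⟩ := hzz
  obtain ⟨D, hD, hz⟩ := h.exists_tile
  obtain ⟨D', hD', hz'⟩ := h'.exists_tile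
  have hG := h.1.good
  have hG' := h'.1.good
  obtain ⟨_, hE, hDE⟩ := hG.exists_anc (n := 0) (Nat.zero_le m) hD
  obtain ⟨f, hf, rfl⟩ := (hG.lev m).shape _ hE
  obtain ⟨_, hE', hDE'⟩ := hG'.exists_anc (n := 0) (Nat.zero_le m) hD'
  obtain ⟨f', hf', rfl⟩ := (hG'.lev m).shape _ hE'
  have hcode : ∀ n ≥ m, ∀ E ∈ lev (aTiling T) n, ∀ E' ∈ lev (aTiling T') n,
      D.region ⊆ E.region → D'.region ⊆ E'.region → E.acute = E'.acute := by
    intro n hn E hE E' hE' h1 h2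
    have h3 := hz n E hE h1
    rw [hm n hn, hz' n E' hE' h2] at h3
    revert h3
    cases E.acute <;> cases E'.acute <;> cases ev n <;> simp
  obtain ⟨σ, φ, hφ, hφf⟩ := exists_acts hf hf' (hcode m le_rfl _ hE _ hE' hDE hDE')
  refine ⟨σ, ?_⟩
  set T₁ := (fun S : Set ℂ => σ '' S) '' T with hT₁
  have hmap := map_mem_aTiling σ T
  have hG₁ := hG.map hφ hmap
  have hDT₁ := (hmap D).2 hD
  -- At level `m` the isometry identifies the two ancestors. Above, the common tile has in both
  -- tilings a parent of the type given by the sequences, so the parents agree.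
  have hstep : ∀ n ≥ m, ∃ E ∈ lev (aTiling T₁) n, E ∈ lev (aTiling T') n ∧
      (D.map σ).region ⊆ E.region ∧ D'.region ⊆ E.region := by
    intro n hn
    induction n, hn using Nat.le_induction with
    | base =>
      refine ⟨f'.tile, ?_, hE', ?_, hDE'⟩
      · rw [← hφf, hφ.tile]
        exact (map_mem_lev σ hmap m _).2 hE
      · rw [← hφf, hφ.tile, TriTile.region_map, TriTile.region_map]
        exact Set.image_mono hDE
    | succ n hn ih =>
      obtain ⟨E, hE₁, hE', h1, h2⟩ := ih
      obtain ⟨g, hg, rfl⟩ := (hG₁.lev n).shape _ hE₁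
      obtain ⟨F, hF, hFT⟩ := (hG₁.lev n).exists_par hg hE₁
      obtain ⟨F', hF', hFT'⟩ := (hG'.lev n).exists_par hg hE'
      have hc : F.c = F'.c := by
        have h3 := (map_mem_lev σ hmap (n + 1) (F.tile.map σ.symm)).1
          (by rwa [TriTile.map_symm_map])
        refine hcode (n + 1) (hn.trans (Nat.le_succ n)) _ h3 _ hFT' ?_
          (h2.trans (hF'.region_subset hg))
        have h4 := h1.trans (hF.region_subset hg)
        rw [← TriTile.map_symm_map σ F.tile, TriTile.region_map, TriTile.region_map] at h4
        exact (Set.image_subset_image_iff σ.injective).1 h4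
      have := hF.eq_of_c_eq hF' hc
      subst this
      exact ⟨F.tile, hFT, hFT', h1.trans (hF.region_subset hg), h2.trans (hF.region_subset hg)⟩
  have heq := hG₁.eq_of_common hG' hDT₁ (m := m) fun n hn => by
    obtain ⟨E, h1, h2, h3, -⟩ := hstep n hn
    exact ⟨E, h1, h2, h3⟩
  exact (subset_of_aTiling_subset (exists_quad_of_mem_image σ fun S hS => h.1.exists_frame hS)
    heq.subset).antisymm (subset_of_aTiling_subset (fun S hS => h'.1.exists_frame hS) heq.superset)

end PenroseCurve

end

noncomputable section

namespace PenroseCurve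

open Topology
open PenroseCurve.Frame

/-! ### Towers of tilings -/

variable {e : Bool} {s : ℝ} {𝒯 : Set TriTile}

theorem TriTile.isClosed_region (D : TriTile) : IsClosed D.region :=
  ((Set.toFinite _).isCompact_convexHull ℝ).isClosed

theorem finite_meeting_ball (hs : 0 < s) (shape : ∀ D ∈ 𝒯, ∃ f, Ok e s f ∧ f.tile = D)
    (disj : ∀ D ∈ 𝒯, ∀ D' ∈ 𝒯, (interior D.region ∩ interior D'.region).Nonempty → D = D') (x : ℂ) :
    {D ∈ 𝒯 | (D.region ∩ Metric.ball x 1).Nonempty}.Finite := by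
  obtain ⟨r, hr, R, hrR⟩ := exists_ball_subset e hs
  have h1 : ∀ D : 𝒯, ∃ y, Metric.ball y r ⊆ D.1.region ∧
      D.1.region ⊆ Metric.closedBall y R := by
    rintro ⟨D, hD⟩
    obtain ⟨f, hf, rfl⟩ := shape D hD
    exact hrR f hf
  choose y h2 h3 using h1
  refine ((finite_of_balls hr h2 h3 (fun D D' hne => ?_) x).image Subtype.val).subset ?_
  · exact Set.disjoint_iff_inter_eq_empty.2 (Set.not_nonempty_iff_eq_empty.1 fun h =>
      hne (Subtype.ext (disj _ D.2 _ D'.2 h)))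
  · rintro D ⟨hD, hDx⟩
    exact ⟨⟨D, hD⟩, hDx, rfl⟩

/-- A point has a neighborhood that only meets tiles which contain the point. -/
theorem exists_ball_mem (hs : 0 < s) (shape : ∀ D ∈ 𝒯, ∃ f, Ok e s f ∧ f.tile = D)
    (disj : ∀ D ∈ 𝒯, ∀ D' ∈ 𝒯, (interior D.region ∩ interior D'.region).Nonempty → D = D') (x : ℂ) :
    ∃ r > 0, ∀ D ∈ 𝒯, (D.region ∩ Metric.ball x r).Nonempty → x ∈ D.region := by
  have hfin : {D | D ∈ 𝒯 ∧ (D.region ∩ Metric.ball x 1).Nonempty ∧ x ∉ D.region}.Finite :=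
    (finite_meeting_ball hs shape disj x).subset fun D hD => ⟨hD.1, hD.2.1⟩
  have hcl : IsClosed (⋃ D ∈ {D | D ∈ 𝒯 ∧ (D.region ∩ Metric.ball x 1).Nonempty ∧ x ∉ D.region},
      D.region) := hfin.isClosed_biUnion fun D _ => D.isClosed_region
  have hx : x ∉ ⋃ D ∈ {D | D ∈ 𝒯 ∧ (D.region ∩ Metric.ball x 1).Nonempty ∧ x ∉ D.region},
      D.region := by
    simp only [Set.mem_iUnion, not_exists]
    exact fun D hD h => hD.2.2 h
  obtain ⟨r, hr, hrs⟩ := Metric.isOpen_iff.1 hcl.isOpen_compl x hx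
  refine ⟨min r 1, lt_min hr one_pos, fun D hD ⟨y, hyD, hyx⟩ => by_contra fun hxD => ?_⟩
  refine hrs (Metric.ball_subset_ball (min_le_left _ _) hyx) (Set.mem_biUnion (x := D) ?_ hyD)
  exact ⟨hD, ⟨y, hyD, Metric.ball_subset_ball (min_le_right _ _) hyx⟩, hxD⟩

/-- Covering is automatic. The union of the tiles is closed by local finiteness and is a
neighborhood of its points that are not vertices, and the complement of the vertices is connected
and dense. -/
theorem Good.of_nonempty (hs : 0 < s) (shape : ∀ D ∈ 𝒯, ∃ f, Ok e s f ∧ f.tile = D)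
    (across : ∀ f, Ok e s f → f.tile ∈ 𝒯 → ∀ i, ∃ g, Nbr e f i g ∧ g.tile ∈ 𝒯)
    (disj : ∀ D ∈ 𝒯, ∀ D' ∈ 𝒯, (interior D.region ∩ interior D'.region).Nonempty → D = D')
    (hne : 𝒯.Nonempty) : Good e s 𝒯 := by
  refine ⟨shape, across, disj, ?_⟩
  have hV : {x | IsVtx 𝒯 x}.Countable := by
    have hc : 𝒯.Countable := by
      refine Set.PairwiseDisjoint.countable_of_isOpen (s := fun D => interior D.region)
        (fun D hD D' hD' hne => ?_) (fun _ _ => isOpen_interior) fun D hD => ?_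
      · exact Set.disjoint_iff_inter_eq_empty.2 (Set.not_nonempty_iff_eq_empty.1 fun h =>
          hne (disj _ hD _ hD' h))
      · obtain ⟨f, hf, rfl⟩ := shape D hD
        exact ⟨_, center_mem_interior hf.valid⟩
    have : {x | IsVtx 𝒯 x} = ⋃ D ∈ 𝒯, {D.t, D.h, D.w} := by
      ext x
      simp [IsVtx]
    rw [this]
    exact hc.biUnion fun D _ => (Set.toFinite _).countable
  set C := ⋃ D ∈ 𝒯, D.region with hC
  have hCl : IsClosed C := by
    rw [← isOpen_compl_iff, Metric.isOpen_iff]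
    intro x hx
    obtain ⟨r, hr, h⟩ := exists_ball_mem hs shape disj x
    refine ⟨r, hr, fun y hy hyC => hx ?_⟩
    obtain ⟨D, hD, hyD⟩ := Set.mem_iUnion₂.1 hyC
    exact Set.mem_biUnion hD (h D hD ⟨y, hyD, hy⟩)
  have hloc : ∀ x ∈ C, ¬ IsVtx 𝒯 x → x ∈ interior C := by
    intro x hx hxV
    obtain ⟨D, hD, hxD⟩ := Set.mem_iUnion₂.1 hx
    obtain ⟨f, hf, rfl⟩ := shape D hD
    rcases mem_region_cases hf.valid hxD with h | ⟨i, h⟩ | ⟨j, rfl⟩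
    · exact interior_mono (Set.subset_biUnion_of_mem (u := TriTile.region) hD) h
    · obtain ⟨g, hg, hgT⟩ := across f hf hD i
      refine mem_interior_iff_mem_nhds.2 (Filter.mem_of_superset (hg.nhds hf h).1
        (Set.union_subset ?_ ?_))
      exacts [Set.subset_biUnion_of_mem (u := TriTile.region) hD,
        Set.subset_biUnion_of_mem (u := TriTile.region) hgT]
    · exact absurd (isVtx_of_vtx hD j) hxV
  have hconn := (hV.isConnected_compl_of_one_lt_rank
    (by simp : 1 < Module.rank ℝ ℂ)).isPreconnected
  have hsub : {x | IsVtx 𝒯 x}ᶜ ⊆ C := by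
    by_contra hns
    obtain ⟨y, hyV, hyC⟩ := Set.not_subset.1 hns
    obtain ⟨D, hD⟩ := hne
    obtain ⟨f, hf, rfl⟩ := shape D hD
    obtain ⟨x, hx, hxV⟩ := (hV.dense_compl ℝ).inter_open_nonempty _ isOpen_interior
      ⟨_, center_mem_interior hf.valid⟩
    obtain ⟨p, -, hp1, hp2⟩ := hconn (interior C) Cᶜ isOpen_interior hCl.isOpen_compl
      (fun x hx => by
        by_cases h : x ∈ C
        exacts [Or.inl (hloc x h hx), Or.inr h])
      ⟨x, hxV, interior_mono (Set.subset_biUnion_of_mem (u := TriTile.region) hD) hx⟩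
      ⟨y, hyV, hyC⟩
    exact hp2 (interior_subset hp1)
  intro x
  have hx : x ∈ C := by
    rw [← hCl.closure_eq]
    exact closure_mono hsub ((hV.dense_compl ℝ) x)
  obtain ⟨D, hD, h⟩ := Set.mem_iUnion₂.1 hx
  exact ⟨D, hD, h⟩

theorem Good.eq_of_subset {𝒯' : Set TriTile} (hG : Good e s 𝒯) (hG' : Good e s 𝒯')
    (h : 𝒯 ⊆ 𝒯') : 𝒯 = 𝒯' := by
  refine h.antisymm fun D' hD' => ?_
  obtain ⟨f, hf, rfl⟩ := hG'.shape D' hD'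
  obtain ⟨D₁, hD₁, hx₁⟩ := hG.cover (center f)
  rwa [hG'.eq_of_mem_interior hD' (h hD₁) (center_mem_interior hf.valid) hx₁]

/-- A sequence of tilings such that the parts of every tile are tiles of the preceding tiling. -/
structure Tower (𝒯 : ℕ → Set TriTile) : Prop where
  good : ∀ n, Good (ev n) (scale n) (𝒯 n)
  child : ∀ n f F, Ok (ev n) (scale n) f → Par (ev n) f F → F.tile ∈ 𝒯 (n + 1) → f.tile ∈ 𝒯 n

theorem nextScale_pos_iff {s : ℝ} : 0 < nextScale e s ↔ 0 < s := by
  unfold nextScale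
  split
  exacts [Iff.rfl, mul_pos_iff_of_pos_left gold_pos]

theorem Frame.Par.ok {f F : Frame} (h : Par e f F) (hF : Ok (!e) (nextScale e s) F) :
    Ok e s f := by
  obtain ⟨h1, h2, h3⟩ := hF
  have h4 := h1.norm
  have h5 := h1.conj.norm
  have h6 := norm_gold
  have h8 := gold_sq
  have h9 := gold_pos
  rw [nextScale_pos_iff] at h2
  cases h <;>
    refine ⟨by first | exact h1 | simpa using h1.conj, h2, ?_⟩ <;>
    simp_all [len, nextScale] <;>
    exact mul_left_cancel₀ h9.ne' (by rwa [abs_of_pos h9] at h3)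

theorem Frame.Par.root {f F : Frame} (h : Par e f F) (hF : IsRoot F.ε) : IsRoot f.ε := by
  cases h <;> first | exact hF | simpa using hF.conj

/-- The substitution is inverted by means of `ε⁻¹ = τ - ε` and `τ⁻¹ = τ - 1`. -/
theorem exists_eq_odd_large {ε t d : ℂ} (h : IsRoot ε) : ∃ ε' t' d', (⟨true, ε, t, d⟩ : Frame) =
    ⟨true, gold - ε', t' + gold * ε' * d', -(gold * ε' ^ 2 * d')⟩ := by
  have hr : ε ^ 2 = gold * ε - 1 := h
  have hC := gold_sq_complex
  exact ⟨gold - ε, t + gold * (gold - ε) * (ε ^ 2 * (gold - 1) * d), -(ε ^ 2 * (gold - 1) * d),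
    mk_congr (by ring) (by grind) (by grind)⟩

/-- The parts of an amalgamated tile are the two tiles that composition looks for. For a tile that
is not amalgamated, composition looks for a mirror image; it is a part of the neighbor in `𝒯'`
across a side where only mirror images are allowed. -/
theorem Good.subset_compose {𝒯' : Set TriTile} (hG : Good e s 𝒯)
    (hG' : Good (!e) (nextScale e s) 𝒯')
    (h : ∀ f F, Ok e s f → Par e f F → F.tile ∈ 𝒯' → f.tile ∈ 𝒯) : 𝒯' ⊆ compose e 𝒯 := by
  intro D hD
  obtain ⟨⟨c, ε, t, d⟩, hF, rfl⟩ := hG'.shape D hD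
  cases e <;> cases c
  · have h1 := Par.odd_obtuse_small ε t d
    have hf := h1.ok hF
    have h2 := h _ _ hf h1 hD
    obtain ⟨g, hg, hgT⟩ := hG'.across _ hF hD 2
    rw [nbr_even_two hg] at hgT
    refine (hG.false_mem_composeB hf).2 ⟨h2, ?_⟩
    exact h _ _ (hf.mir 2) (Par.odd_obtuse_small ..) hgT
  · obtain ⟨ε', t', d', h1⟩ := exists_eq_odd_large (t := t) (d := d) hF.root
    rw [h1] at hD hF ⊢
    have h1 := Par.odd_obtuse_large ε' t' d'
    have hf := h1.ok hF
    refine (hG.true_mem_composeB hf).2 ⟨h _ _ hf h1 hD, ?_⟩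
    refine h _ _ (hf.ex (Ex.odd_obtuse_two ε' t' d')) ?_ hD
    have hr : ε' ^ 2 = gold * ε' - 1 := hf.root
    have hC := gold_sq_complex
    have := Par.odd_acute (gold - ε') t' d'
    convert this using 1
    exact mk_congr rfl (by grind) (by grind)
  · have h1 := Par.even_acute_large ε t d
    have hf := h1.ok hF
    have h2 := h _ _ hf h1 hD
    have hx := Ex.even_acute_zero ε t d
    refine (hG.false_mem_composeA hf).2 ⟨h2, h _ _ (hf.ex hx) ?_ hD⟩
    have hr : ε ^ 2 = gold * ε - 1 := hf.root
    have hC := gold_sq_complex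
    have := Par.even_obtuse ε (t + gold * ε * d) (-((gold - 1) * ε * d))
    convert this using 1
    exact mk_congr rfl (by grind) (by grind)
  · have h1 := Par.even_acute_small ε t d
    have hf := h1.ok hF
    have h2 := h _ _ hf h1 hD
    obtain ⟨g, hg, hgT⟩ := hG'.across _ hF hD 0
    rw [nbr_odd_acute_zero hg] at hgT
    refine (hG.true_mem_composeA hf).2 ⟨h2, ?_⟩
    exact h _ _ (hf.mir 0) (Par.even_acute_small ..) hgT

/-- One inclusion is `Good.subset_compose`, and a tiling that is contained in another tiling equals
it. -/
theorem Tower.eq_lev {𝒯 : ℕ → Set TriTile} (h : Tower 𝒯) (n : ℕ) : 𝒯 n = lev (𝒯 0) n := by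
  induction n with
  | zero => rfl
  | succ n ih =>
    have h1 := (h.good n).subset_compose (by simpa [ev_succ, scale] using h.good (n + 1)) (h.child n)
    have h2 := (h.good n).compose
    rw [lev, ← ih]
    exact ((by simpa [ev_succ, scale] using h.good (n + 1) :
      Good (!ev n) (nextScale (ev n) (scale n)) (𝒯 (n + 1)))).eq_of_subset h2 h1

end PenroseCurve

end

noncomputable section

namespace PenroseCurve

open PenroseCurve.Frame

/-! ### Decomposition -/

namespace Frame

variable {e : Bool} {s : ℝ} {f g F G : Frame}

theorem fin_three : ∀ i : Fin 3, i = 0 ∨ i = 1 ∨ i = 2 := by decide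

theorem Par.congr (h : Par e f F) (hF : F = G) : Par e f G := hF ▸ h

theorem co_eq_mul_of_pt (hf : f.Valid) (hF : F.Valid) (A B : ℝ → ℝ → ℝ)
    (h : ∀ a b, f.pt a b = F.pt (A a b) (B a b)) {i k : Fin 3} (m : ℝ)
    (hm : ∀ a b, (![1 - A a b - F.sig * B a b, A a b, F.sig * B a b] : Fin 3 → ℝ) k =
      m * (![1 - a - f.sig * b, a, f.sig * b] : Fin 3 → ℝ) i) (x : ℂ) :
    F.co k x = m * f.co i x := by
  obtain ⟨a, b, rfl⟩ := exists_pt hf x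
  rw [co_pt hf, h, co_pt hF, hm]

/-- A side of a part `f` of `F` is a side of another part, or it lies on a side of `F`, and a
neighbor of `F` at this side has a part that is a neighbor of `f`. -/
theorem Par.across (hf : Ok e s f) (h : Par e f F) (i : Fin 3) :
    (∃ g, Par e g F ∧ Ex e f i g) ∨ ∃ k m, (∀ x, F.co k x = m * f.co i x) ∧
      ∀ G, Nbr (!e) F k G → ∃ g, Par e g G ∧ Nbr e f i g := by
  have hC := gold_sq_complex
  have hR := gold_sq
  have hv := hf.valid
  have hF := (hf.par h).valid
  have hr : f.ε ^ 2 = gold * f.ε - 1 := hf.root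
  cases h with
  | even_acute_large ε t d =>
    simp only at hr
    rcases fin_three i with rfl | rfl | rfl
    · refine Or.inl ⟨_, Par.congr (Par.even_obtuse ..) ?_, Ex.even_acute_zero ..⟩
      exact mk_congr rfl (by grind) (by grind)
    · refine Or.inr ⟨1, 1, co_eq_mul_of_pt hv hF (fun a b => a) (fun a b => b)
        (fun a b => rfl) _ fun a b => by simp, ?_⟩
      rintro G (rfl | hG)
      · exact ⟨_, Par.congr (by rw [mir_one]; exact Par.even_acute_large _ _ _) rfl, Or.inl rfl⟩
      · cases hG
    · refine Or.inr ⟨2, gold - 1, co_eq_mul_of_pt hv hF (fun a b => a) (fun a b => b)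
        (fun a b => rfl) _ fun a b => by simp, ?_⟩
      rintro G (rfl | hG)
      · exact ⟨_, Par.congr (by rw [mir_two]; exact Par.even_acute_large _ _ _) rfl, Or.inl rfl⟩
      · cases hG
        exact ⟨_, Par.congr (by rw [mir_two]; exact Par.even_acute_small _ _ _) rfl, Or.inl rfl⟩
  | even_acute_small ε t d =>
    simp only at hr
    refine Or.inr ⟨i, 1, fun x => by simp, ?_⟩
    rintro G (rfl | hG)
    · refine ⟨_, ?_, Or.inl rfl⟩
      rcases fin_three i with rfl | rfl | rfl <;> simp only [mir_zero_acute, mir_one, mir_two] <;> exact Par.even_acute_small ..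
    · cases hG with
      | odd_acute_two =>
        exact ⟨_, Par.congr (by rw [mir_two]; exact Par.even_acute_large _ _ _) rfl, Or.inl rfl⟩
      | odd_acute_one =>
        refine ⟨_, Par.congr (Par.even_obtuse ..) ?_, Or.inr (Ex.even_acute_one ..)⟩
        exact mk_congr rfl (by grind) (by grind)
  | even_obtuse ε t d =>
    simp only at hr
    have hpt : ∀ a b : ℝ, pt ⟨false, ε, t, d⟩ a b =
        pt ⟨false, ε, t + gold ^ 2 * d, -(gold * (gold - ε) * d)⟩ ((gold - 1) * b)
          (gold + (1 - gold) * a - b) := fun a b => by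
      simp only [pt]; push_cast; grind
    rcases fin_three i with rfl | rfl | rfl
    · refine Or.inl ⟨_, Par.congr (Par.even_acute_large ..) ?_, Ex.even_obtuse_zero ..⟩
      rfl
    · refine Or.inr ⟨0, 2 - gold, co_eq_mul_of_pt hv hF _ _ hpt _ fun a b => by
        simp; grind, ?_⟩
      rintro G (rfl | hG)
      · refine ⟨_, Par.congr (by rw [mir_one]; exact Par.even_obtuse _ _ _) ?_, Or.inl rfl⟩
        rw [mir_zero_obtuse]
        exact mk_congr rfl (by grind) (by grind)
      · cases hG
        refine ⟨_, Par.congr (Par.even_acute_small ..) ?_, Or.inr (Ex.even_obtuse_one ..)⟩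
        exact mk_congr rfl (by grind) (by grind)
    · refine Or.inr ⟨1, 1, co_eq_mul_of_pt hv hF _ _ hpt _ fun a b => by simp, ?_⟩
      rintro G (rfl | hG)
      · refine ⟨_, Par.congr (by rw [mir_two]; exact Par.even_obtuse _ _ _) ?_, Or.inl rfl⟩
        rw [mir_one]
        exact mk_congr rfl (by grind) (by grind)
      · cases hG
  | odd_acute ε t d =>
    simp only at hr
    have hpt : ∀ a b : ℝ, pt ⟨true, ε, t, d⟩ a b =
        pt ⟨true, ε, t + ε * d + gold * (gold - ε) ^ 2 * d, -(gold * (gold - ε) ^ 2 * d)⟩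
          ((gold - 1) * a + b) (1 - a - b) := fun a b => by
      simp only [pt]; push_cast; grind
    rcases fin_three i with rfl | rfl | rfl
    · refine Or.inr ⟨2, 1, co_eq_mul_of_pt hv hF _ _ hpt _ fun a b => by simp, ?_⟩
      rintro G (rfl | hG)
      · refine ⟨_, Par.congr (by rw [mir_zero_acute]; exact Par.odd_acute _ _ _) ?_,
          Or.inl rfl⟩
        rw [mir_two]
        exact mk_congr rfl (by grind) (by grind)
      · cases hG
    · refine Or.inr ⟨0, 2 - gold, co_eq_mul_of_pt hv hF _ _ hpt _ fun a b => by
        simp; grind, ?_⟩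
      rintro G (rfl | hG)
      · refine ⟨_, Par.congr (by rw [mir_one]; exact Par.odd_acute _ _ _) ?_, Or.inl rfl⟩
        rw [mir_zero_acute]
        exact mk_congr rfl (by grind) (by grind)
      · cases hG
        refine ⟨_, Par.congr (Par.odd_obtuse_small ..) ?_, Or.inr (Ex.odd_acute_one ..)⟩
        exact mk_congr rfl (by grind) (by grind)
    · refine Or.inl ⟨_, Par.congr (Par.odd_obtuse_large ..) ?_, Ex.odd_acute_two ..⟩
      exact mk_congr (by grind) (by grind) (by grind)
  | odd_obtuse_large ε t d =>
    simp only at hr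
    have hpt : ∀ a b : ℝ, pt ⟨false, ε, t, d⟩ a b =
        pt ⟨true, gold - ε, t + gold * ε * d, -(gold * ε ^ 2 * d)⟩ ((gold - 1) * a)
          (1 - a - (gold - 1) * b) := fun a b => by
      simp only [pt]; push_cast; grind
    rcases fin_three i with rfl | rfl | rfl
    · refine Or.inr ⟨2, 1, co_eq_mul_of_pt hv hF _ _ hpt _ fun a b => by simp, ?_⟩
      rintro G (rfl | hG)
      · refine ⟨_, Par.congr (by rw [mir_zero_obtuse]; exact Par.odd_obtuse_large _ _ _)
          ?_, Or.inl rfl⟩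
        rw [mir_two]
        exact mk_congr rfl (by grind) (by grind)
      · cases hG
    · refine Or.inr ⟨1, gold - 1, co_eq_mul_of_pt hv hF _ _ hpt _ fun a b => by simp, ?_⟩
      rintro G (rfl | hG)
      · refine ⟨_, Par.congr (by rw [mir_one]; exact Par.odd_obtuse_large _ _ _) ?_, Or.inl rfl⟩
        rw [mir_one]
        exact mk_congr rfl (by grind) (by grind)
      · cases hG
        refine ⟨_, Par.congr (by rw [mir_one]; exact Par.odd_obtuse_small _ _ _) ?_, Or.inl rfl⟩
        exact mk_congr rfl (by grind) (by grind)
    · refine Or.inl ⟨_, Par.congr (Par.odd_acute ..) ?_, Ex.odd_obtuse_two ..⟩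
      exact mk_congr rfl (by grind) (by grind)
  | odd_obtuse_small ε t d =>
    simp only at hr
    refine Or.inr ⟨i, 1, fun x => by simp, ?_⟩
    rintro G (rfl | hG)
    · refine ⟨_, ?_, Or.inl rfl⟩
      rcases fin_three i with rfl | rfl | rfl <;> simp only [mir_zero_obtuse, mir_one, mir_two] <;> exact Par.odd_obtuse_small ..
    · cases hG with
      | even_obtuse_one =>
        refine ⟨_, Par.congr (by rw [mir_one]; exact Par.odd_obtuse_large _ _ _) ?_, Or.inl rfl⟩
        exact mk_congr (by grind) (by grind) (by grind)
      | even_obtuse_zero =>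
        refine ⟨_, Par.congr (Par.odd_acute ..) ?_, Or.inr (Ex.odd_obtuse_zero ..)⟩
        exact mk_congr rfl (by grind) (by grind)

/-- Distinct parts of a tile fit to each other. -/
theorem Par.eq_or_ex (hF : IsRoot F.ε) (h : Par e f F) (h' : Par e g F) :
    f = g ∨ ∃ i, Ex e f i g := by
  have hC := gold_sq_complex
  have hr : f.ε ^ 2 = gold * f.ε - 1 := h.root hF
  have hr' : g.ε ^ 2 = gold * g.ε - 1 := h'.root hF
  clear hF
  generalize hFG : F = F' at h'
  cases h <;> cases h' <;> simp only [Frame.mk.injEq, Bool.true_eq_false, Bool.false_eq_true,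
    false_and, true_and] at hFG hr hr' <;> obtain ⟨h1, h2, h3⟩ := hFG
  · exact Or.inl (mk_congr h1 h2 h3)
  · subst h1
    refine Or.inr ⟨0, ?_⟩
    convert Ex.even_acute_zero _ _ _ using 1
    exact mk_congr rfl (by grind) (by grind)
  · exact Or.inl (mk_congr h1 h2 h3)
  · subst h1
    refine Or.inr ⟨0, ?_⟩
    convert Ex.even_obtuse_zero _ _ _ using 1
    exact mk_congr rfl (by grind) (by grind)
  · subst h1
    exact Or.inl (mk_congr rfl (by grind) (by grind))
  · obtain rfl := sub_right_injective h1
    exact Or.inl (mk_congr rfl (by grind) (by grind))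
  · subst h1
    refine Or.inr ⟨2, ?_⟩
    convert Ex.odd_obtuse_two _ _ _ using 1
    exact mk_congr rfl (by grind) (by grind)
  · exact Or.inl (mk_congr h1 h2 h3)
  · subst h1
    refine Or.inr ⟨2, ?_⟩
    convert Ex.odd_acute_two _ _ _ using 1
    exact mk_congr (by grind) (by grind) (by grind)
  · subst h1
    exact Or.inl (mk_congr rfl (by grind) (by grind))

end Frame

end PenroseCurve

end

noncomputable section

namespace PenroseCurve

open PenroseCurve.Frame

/-! ### Towers from chains of tiles -/

namespace Frame

/-- `Desc L Ω n f`: the tile `f` of level `n` is one of the parts into which the tile `Ω` of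
level `L` is decomposed. -/
inductive Desc (L : ℕ) (Ω : Frame) : ℕ → Frame → Prop
  | top : Desc L Ω L Ω
  | step {n : ℕ} {f F : Frame} : Par (ev n) f F → Desc L Ω (n + 1) F → Desc L Ω n f

variable {e : Bool} {s : ℝ} {L n : ℕ} {Ω f g F : Frame}

theorem Par.ok_level (h : Par (ev n) f F) (hF : Ok (ev (n + 1)) (scale (n + 1)) F) :
    Ok (ev n) (scale n) f :=
  h.ok (by simpa [ev_succ, scale] using hF)

theorem Ok.par_level (hf : Ok (ev n) (scale n) f) (h : Par (ev n) f F) :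
    Ok (ev (n + 1)) (scale (n + 1)) F := by
  simpa [ev_succ, scale] using hf.par h

theorem Ex.unique {i : Fin 3} (h : Ex e f i g) (h' : Ex e f i F) : g = F := by
  cases h <;> cases h' <;> rfl

theorem Nbr.disjoint (hf : Ok e s f) {i : Fin 3} (h : Nbr e f i g) :
    ¬ (interior f.tile.region ∩ interior g.tile.region).Nonempty := by
  rintro ⟨x, hxf, hxg⟩
  obtain ⟨k, l, i', k', l', m, p, q, hG⟩ := h.glued hf
  have h1 := (mem_interior hf.valid).1 hxf i
  have h2 := (mem_interior (hf.nbr h).valid).1 hxg i'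
  rw [hG.coi] at h2
  nlinarith [hG.pos]

namespace Desc

theorem le (h : Desc L Ω n f) : n ≤ L := by
  induction h with
  | top => exact le_rfl
  | step _ _ ih => omega

variable (hΩ : Ok (ev L) (scale L) Ω)
include hΩ

theorem ok (h : Desc L Ω n f) : Ok (ev n) (scale n) f := by
  induction h with
  | top => exact hΩ
  | step h _ ih => exact h.ok_level ih

theorem region_subset (h : Desc L Ω n f) : f.tile.region ⊆ Ω.tile.region := by
  induction h with
  | top => exact subset_rfl
  | step h h' ih => exact (h.region_subset (h.ok_level (h'.ok hΩ))).trans ih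

/-- By induction from the top: overlapping tiles have overlapping, hence equal, parents, and
distinct parts of one tile have disjoint interiors. -/
theorem eq_of_interior (h : Desc L Ω n f) (h' : Desc L Ω n g)
    (hx : (interior f.tile.region ∩ interior g.tile.region).Nonempty) : f = g := by
  induction h generalizing g with
  | top =>
    cases h' with
    | top => rfl
    | step _ h' => exact absurd h'.le (by omega)
  | step h1 h2 ih =>
    cases h' with
    | top => exact absurd h2.le (by omega)
    | step h3 h4 =>
      have hf := h1.ok_level (h2.ok hΩ)
      have hg := h3.ok_level (h4.ok hΩ)
      obtain ⟨x, hxf, hxg⟩ := hx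
      obtain rfl := ih h4 ⟨x, interior_mono (h1.region_subset hf) hxf,
        interior_mono (h3.region_subset hg) hxg⟩
      refine (h1.eq_or_ex (h2.ok hΩ).root h3).resolve_right fun ⟨i, hi⟩ => ?_
      exact Nbr.disjoint hf (Or.inr hi) ⟨x, hxf, hxg⟩

/-- A side of a part is matched inside `Ω` unless it lies on a side of `Ω` itself. -/
theorem across (h : Desc L Ω n f) (i : Fin 3) : (∃ g, Desc L Ω n g ∧ Nbr (ev n) f i g) ∨
    ∃ k m, ∀ x, Ω.co k x = m * f.co i x := by
  induction h generalizing i with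
  | top => exact Or.inr ⟨i, 1, fun x => by simp⟩
  | step h1 h2 ih =>
    rcases Par.across (h1.ok_level (h2.ok hΩ)) h1 i with ⟨g, hg, hgi⟩ | ⟨k, m, hk, hG⟩
    · exact Or.inl ⟨g, step hg h2, Or.inr hgi⟩
    · rcases ih k with ⟨G, hG1, hG2⟩ | ⟨k', m', hk'⟩
      · rw [ev_succ] at hG2
        obtain ⟨g, hg, hgi⟩ := hG G hG2
        exact Or.inl ⟨g, step hg hG1, hgi⟩
      · exact Or.inr ⟨k', m' * m, fun x => by rw [hk', hk, mul_assoc]⟩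

omit hΩ in
theorem par {Ω' : Frame} (hP : Par (ev L) Ω Ω') (h : Desc L Ω n f) : Desc (L + 1) Ω' n f := by
  induction h with
  | top => exact step hP top
  | step h1 _ ih => exact step h1 ih

end Desc

end Frame

section Chain

variable {F : ℕ → Frame} (h0 : Ok true 1 (F 0)) (hF : ∀ n, Par (ev n) (F n) (F (n + 1)))

/-- The tiles of level `n` of the decompositions of the tiles of a chain. -/
def chainTower (F : ℕ → Frame) (n : ℕ) : Set TriTile :=
  {D | ∃ L f, Desc L (F L) n f ∧ f.tile = D}

include hF

theorem desc_mono {L L' n : ℕ} {f : Frame} (hL : L ≤ L') (h : Desc L (F L) n f) :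
    Desc L' (F L') n f := by
  induction L', hL using Nat.le_induction with
  | base => exact h
  | succ L' _ ih => exact ih.par (hF L')

include h0

theorem ok_chain (n : ℕ) : Ok (ev n) (scale n) (F n) := by
  induction n with
  | zero => exact h0
  | succ n ih => exact ih.par_level (hF n)

theorem region_chain_mono {n m : ℕ} (h : n ≤ m) : (F n).tile.region ⊆ (F m).tile.region := by
  induction m, h using Nat.le_induction with
  | base => exact subset_rfl
  | succ m _ ih => exact ih.trans ((hF m).region_subset (ok_chain h0 hF m))

theorem tile_mem_chainTower {n : ℕ} {f : Frame} (hf : Ok (ev n) (scale n) f) :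
    f.tile ∈ chainTower F n ↔ ∃ L, Desc L (F L) n f := by
  constructor
  · rintro ⟨L, g, hg, hgf⟩
    rw [eq_of_tile_eq (hg.ok (ok_chain h0 hF L)).valid hf.valid hgf] at hg
    exact ⟨L, hg⟩
  · rintro ⟨L, h⟩
    exact ⟨L, f, h, rfl⟩

/-- By `hdeep` every tile is interior to some `F m`. No side of it lies on the boundary of `F m`, so
all its neighbors are already present in the decomposition of `F m`. -/
theorem tower_chainTower
    (hdeep : ∀ n, ∃ m ≥ n, (F n).tile.region ⊆ interior (F m).tile.region) :
    Tower (chainTower F) := by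
  have hok := ok_chain h0 hF
  refine ⟨fun n => Good.of_nonempty (hok n).pos ?_ ?_ ?_ ⟨_, n, F n, Desc.top, rfl⟩, ?_⟩
  · rintro _ ⟨L, f, h, rfl⟩
    exact ⟨f, h.ok (hok L), rfl⟩
  · intro f hf hfT i
    obtain ⟨L, hL⟩ := (tile_mem_chainTower h0 hF hf).1 hfT
    obtain ⟨m, hm, hLm⟩ := hdeep L
    rcases (desc_mono hF hm hL).across (hok m) i with ⟨g, hg, hgi⟩ | ⟨k, c, hk⟩
    · exact ⟨g, hgi, m, g, hg, rfl⟩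
    · obtain ⟨x, hx⟩ := exists_openEdge hf.valid i
      have := (mem_interior (hok m).valid).1
        (hLm (hL.region_subset (hok L) (hx.mem hf.valid))) k
      rw [hk, hx.1, mul_zero] at this
      exact absurd this (lt_irrefl 0)
  · rintro _ ⟨L, f, hf, rfl⟩ _ ⟨L', g, hg, rfl⟩ hx
    rw [Desc.eq_of_interior (hok (max L L')) (desc_mono hF (le_max_left _ _) hf)
      (desc_mono hF (le_max_right _ _) hg) hx]
  · rintro n f G hf hP hG
    obtain ⟨L, hL⟩ := (tile_mem_chainTower h0 hF (hf.par_level hP)).1 hG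
    exact ⟨L, f, Desc.step hP hL, rfl⟩

end Chain

/-- The limit of a sequence of towers that have a tile in common at every level. -/
theorem exists_tower_limit {𝒯 : ℕ → ℕ → Set TriTile} (h𝒯 : ∀ j, Tower (𝒯 j)) (D : ℕ → TriTile)
    (hD : ∀ n, ∃ J, ∀ j ≥ J, D n ∈ 𝒯 j n) : ∃ 𝒯', Tower 𝒯' ∧ ∀ n, D n ∈ 𝒯' n := by
  -- Across a given side there are only two candidates for a neighbor, and an ultrafilter selects
  -- one of them. Along a mere subsequence this choice would have to be repeated for every side.
  let U : Filter ℕ := (Filter.hyperfilter ℕ : Filter ℕ)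
  have hU : U ≤ Filter.atTop := by
    rw [← Nat.cofinite_eq_atTop]
    exact Filter.hyperfilter_le_cofinite
  have hmem : ∀ n, ∀ᶠ j in U, D n ∈ 𝒯 j n := fun n => by
    obtain ⟨J, hJ⟩ := hD n
    exact hU (Filter.eventually_atTop.2 ⟨J, hJ⟩)
  refine ⟨fun n => {E | ∀ᶠ j in U, E ∈ 𝒯 j n}, ⟨fun n => ?_, fun n f G hf hP hG => ?_⟩, hmem⟩
  · have hshape : ∀ E ∈ {E | ∀ᶠ j in U, E ∈ 𝒯 j n}, ∃ f, Ok (ev n) (scale n) f ∧ f.tile = E := by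
      intro E hE
      obtain ⟨j, hj⟩ := Filter.Eventually.exists hE
      exact ((h𝒯 j).good n).shape E hj
    refine Good.of_nonempty ?_ hshape (fun f hf hfT i => ?_) (fun E hE E' hE' hx => ?_) ⟨_, hmem n⟩
    · obtain ⟨f, hf, -⟩ := hshape _ (hmem n)
      exact hf.pos
    · have h1 : ∀ᶠ j in U, (f.mir i).tile ∈ 𝒯 j n ∨ ∃ g, Ex (ev n) f i g ∧ g.tile ∈ 𝒯 j n := by
        filter_upwards [hfT] with j hj
        obtain ⟨g, rfl | hg, hgT⟩ := ((h𝒯 j).good n).across f hf hj i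
        exacts [Or.inl hgT, Or.inr ⟨g, hg, hgT⟩]
      rcases (Ultrafilter.eventually_or (f := Filter.hyperfilter ℕ)).1 h1 with h1 | h1
      · exact ⟨_, Or.inl rfl, h1⟩
      · obtain ⟨j, g, hg, -⟩ := h1.exists
        refine ⟨g, Or.inr hg, h1.mono ?_⟩
        rintro j ⟨g', hg', hgT⟩
        rwa [hg.unique hg']
    · obtain ⟨j, h1, h2⟩ := (Filter.Eventually.and hE hE').exists
      exact ((h𝒯 j).good n).disj E h1 E' h2 hx
  · exact Filter.Eventually.mono hG fun j hj => (h𝒯 j).child n f G hf hP hj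

end PenroseCurve

end

noncomputable section

namespace PenroseCurve

open PenroseCurve.Frame

/-! ### Existence of tilings with a given sequence -/

/-- The larger frame is the ancestor computed in `chain_subset_interior`. On the acute triangle all
three of its barycentric coordinates are positive. -/
theorem Frame.region_subset_interior {ε t d : ℂ} (hf : Valid ⟨true, ε, t, d⟩)
    (hF : Valid ⟨false, gold - ε, t + (-gold + (2 + 2 * gold) * ε) * d,
      (1 + 2 * gold - (2 + 3 * gold) * ε) * d⟩) :
    (tile ⟨true, ε, t, d⟩).region ⊆ interior (tile ⟨false, gold - ε,
      t + (-gold + (2 + 2 * gold) * ε) * d, (1 + 2 * gold - (2 + 3 * gold) * ε) * d⟩).region := by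
  have hC := gold_sq_complex
  have hR := gold_sq
  have h1 := gold_gt
  have h2 := gold_lt
  have hr : ε ^ 2 = gold * ε - 1 := hf.root
  intro x hx
  obtain ⟨a, b, rfl⟩ := exists_pt hf x
  rw [mem_region hf] at hx
  simp only [co_pt hf] at hx
  have ha : 0 ≤ a := hx 1
  have hb : 0 ≤ b := by simpa using hx 2
  have hab : 0 ≤ 1 - a - b := by simpa using hx 0
  have hpt : pt ⟨true, ε, t, d⟩ a b = pt ⟨false, gold - ε,
      t + (-gold + (2 + 2 * gold) * ε) * d, (1 + 2 * gold - (2 + 3 * gold) * ε) * d⟩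
      (2 - gold + (2 * gold - 3) * a) (gold - 1 + (gold - 2) * a + (3 - 2 * gold) * b) := by
    simp only [pt]; push_cast; grind
  rw [hpt, mem_interior hF]
  intro i
  rw [co_pt hF]
  rcases fin_three i with rfl | rfl | rfl
  · have : 1 - (2 - gold + (2 * gold - 3) * a) -
        (gold - 1) * (gold - 1 + (gold - 2) * a + (3 - 2 * gold) * b) =
        (2 * gold - 3) * (1 - a - b) + (2 * gold - 3) * a + (2 - gold) * b := by
      linear_combination (-1 - a + 2 * b) * hR
    simp only [Matrix.cons_val_zero, sig_false, this]
    nlinarith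
  · simp only [Matrix.cons_val_one, Matrix.cons_val_zero]
    nlinarith
  · simp only [Matrix.cons_val_two, Matrix.tail_cons, Matrix.head_cons, sig_false]
    exact mul_pos (by linarith) (by nlinarith)

section Chain

variable {F : ℕ → Frame} (h0 : Ok true 1 (F 0)) (hF : ∀ n, Par (ev n) (F n) (F (n + 1)))
include h0 hF

/-- As `M` is even, these shapes encode the terms `0, 1, 0, 0, 0, 1, 0, 0`, two periods of `0, 1, 0,
0`. The ancestors are computed explicitly, one step at a time. -/
theorem chain_subset_interior {M : ℕ} (hM : Even M) (c0 : (F M).c = true)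
    (c1 : (F (M + 1)).c = true) (c2 : (F (M + 2)).c = true) (c3 : (F (M + 3)).c = false)
    (c4 : (F (M + 4)).c = true) (c5 : (F (M + 5)).c = true) (c6 : (F (M + 6)).c = true)
    (c7 : (F (M + 7)).c = false) :
    (F M).tile.region ⊆ interior (F (M + 7)).tile.region := by
  have hC := gold_sq_complex
  have hv := (ok_chain h0 hF M).valid
  have hv' := (ok_chain h0 hF (M + 7)).valid
  have hr : (F M).ε ^ 2 = gold * (F M).ε - 1 := hv.root
  have p0 := hF M
  have p1 := hF (M + 1)
  have p2 := hF (M + 2)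
  have p3 := hF (M + 3)
  have p4 := hF (M + 4)
  have p5 := hF (M + 5)
  have p6 := hF (M + 6)
  have e0 : ev M = true := by simpa [ev] using hM
  simp only [ev_succ, e0, Bool.not_true, Bool.not_false] at p0 p1 p2 p3 p4 p5 p6
  generalize F M = f0 at *
  generalize F (M + 1) = f1 at *
  generalize F (M + 2) = f2 at *
  generalize F (M + 3) = f3 at *
  generalize F (M + 4) = f4 at *
  generalize F (M + 5) = f5 at *
  generalize F (M + 6) = f6 at *
  generalize F (M + 7) = f7 at *
  obtain ⟨c, ε, t, d⟩ := f0
  obtain rfl : c = true := c0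
  simp only at hr
  obtain rfl := p0.eq_of_c_eq (Par.even_acute_small ..) c1
  obtain rfl := p1.eq_of_c_eq ((Par.odd_acute ε t d).congr
    (G := ⟨true, ε, t + (1 + gold - gold * ε) * d, (-1 - gold + (1 + gold) * ε) * d⟩)
    (mk_congr rfl (by grind) (by grind))) c2
  obtain rfl := p2.eq_of_c_eq (Par.even_acute_large ..) c3
  obtain rfl := p3.eq_of_c_eq ((Par.odd_obtuse_large ε _ _).congr
    (G := ⟨true, gold - ε, t + (-gold + ε) * d, (1 + gold) * d⟩)
    (mk_congr rfl (by grind) (by grind))) c4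
  obtain rfl := p4.eq_of_c_eq (Par.even_acute_small ..) c5
  obtain rfl := p5.eq_of_c_eq ((Par.odd_acute (gold - ε) _ _).congr
    (G := ⟨true, gold - ε, t + (-gold + (2 + 2 * gold) * ε) * d,
      (1 + 2 * gold - (2 + 3 * gold) * ε) * d⟩)
    (mk_congr rfl (by grind) (by grind))) c6
  obtain rfl := p6.eq_of_c_eq (Par.even_acute_large ..) c7
  exact region_subset_interior hv hv'

end Chain

/-- The shape of the tile of level `n` at a point with the sequence `z`. -/
def PenroseSeq.shape (z : PenroseSeq) (n : ℕ) : Bool := if z n = 0 then ev n else !ev n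

/-- A large tile has a possible parent of each type, a small tile only a large one. This is where
the absence of consecutive 1s enters. -/
theorem PenroseSeq.exists_par (z : PenroseSeq) {n : ℕ} {f : Frame} (hf : f.c = z.shape n) :
    ∃ F, Par (ev n) f F ∧ F.c = z.shape (n + 1) := by
  obtain ⟨c, ε, t, d⟩ := f
  have hz := z.no_consecutive n
  have h2 : ∀ a : Fin 2, a ≠ 0 → a = 1 := by decide
  unfold shape at hf ⊢
  rw [ev_succ]
  simp only at hf
  subst hf
  by_cases h : z n = 0
  · by_cases h' : z (n + 1) = 0 <;> cases ev n <;> simp only [h, h', if_true, if_false]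
    exacts [⟨_, Par.odd_obtuse_large .., rfl⟩, ⟨_, Par.even_acute_large .., rfl⟩,
      ⟨_, Par.odd_obtuse_small .., rfl⟩, ⟨_, Par.even_acute_small .., rfl⟩]
  · have h' : z (n + 1) = 0 := by
      by_contra h'
      exact hz ⟨h2 _ h, h2 _ h'⟩
    cases ev n <;> simp only [h, h', if_true, if_false]
    exacts [⟨_, Par.odd_acute .., rfl⟩, ⟨_, Par.even_obtuse .., rfl⟩]

/-- A tile of level `0` with shape given by the sequence `z`. -/
def PenroseSeq.base (z : PenroseSeq) : Frame := ⟨z.shape 0, zeta, 0, len true 1 (z.shape 0)⟩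

theorem PenroseSeq.ok_base (z : PenroseSeq) : Ok true 1 z.base :=
  ⟨isRoot_zeta, one_pos, by
    simp only [base]
    rw [Complex.norm_real, Real.norm_of_nonneg (len_pos true one_pos _).le]⟩

theorem PenroseSeq.exists_chain (z : PenroseSeq) : ∃ F : ℕ → Frame, F 0 = z.base ∧
    (∀ n, Par (ev n) (F n) (F (n + 1))) ∧ ∀ n, (F n).c = z.shape n := by
  choose! next hnext using fun n (f : Frame) => z.exists_par (n := n) (f := f)
  let F : ℕ → Frame := fun n => Nat.rec z.base (fun n f => next n f) n
  have hc : ∀ n, (F n).c = z.shape n := fun n => by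
    induction n with
    | zero => rfl
    | succ n ih => exact (hnext n _ ih).2
  exact ⟨F, rfl, fun n => (hnext n _ (hc n)).1, hc⟩

/-- The sequence `z`, continued periodically from the index `4 * j + 1` on. -/
def PenroseSeq.truncate (z : PenroseSeq) (j : ℕ) : PenroseSeq where
  -- The terms with index `4 * j + 1` and `4 * j + 2` are 0, so no consecutive 1s arise at the seam.
  val n := if n ≤ 4 * j then z n else if n % 4 = 3 then 1 else 0
  no_consecutive n := by
    have := z.no_consecutive n
    split_ifs <;> first | exact this | omega

theorem PenroseSeq.exists_tower (z : PenroseSeq) :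
    ∃ (𝒯 : ℕ → Set TriTile) (F : ℕ → Frame), Tower 𝒯 ∧ F 0 = z.base ∧
    (∀ n, Par (ev n) (F n) (F (n + 1))) ∧ (∀ n, (F n).c = z.shape n) ∧
    ∀ n, (F n).tile ∈ 𝒯 n := by
  choose F hF0 hF hFc using PenroseSeq.exists_chain
  have htower : ∀ j, Tower (chainTower (F (z.truncate j))) := fun j => by
    have h0 : Ok true 1 (F (z.truncate j) 0) := by rw [hF0]; exact PenroseSeq.ok_base _
    refine tower_chainTower h0 (hF _) fun n => ?_
    -- This index is even, at least `n`, and beyond the truncation. As it is 2 modulo 4, the 1s are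
    -- at `m + 1` and `m + 5`, as `chain_subset_interior` requires.
    set m := 4 * (n + j) + 2 with hm
    have hc : ∀ i, (F (z.truncate j) (m + i)).c =
        if (m + i) % 4 = 3 then !ev (m + i) else ev (m + i) := fun i => by
      have : ¬ m + i ≤ 4 * j := by omega
      rw [hFc, shape]
      simp only [truncate, this, if_false]
      by_cases h3 : (m + i) % 4 = 3 <;> simp [h3]
    have hev : Even m := ⟨2 * (n + j) + 1, by omega⟩
    have hev' : ev m = true := by simpa [ev] using hev
    have h4 : m % 4 = 2 := by omega
    refine ⟨m + 7, by omega, (region_chain_mono h0 (hF _) (by omega : n ≤ m)).trans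
      (chain_subset_interior h0 (hF _) hev ?_ ?_ ?_ ?_ ?_ ?_ ?_ ?_)⟩
    · simpa [h4, hev'] using hc 0
    all_goals
      rw [hc, Nat.add_mod, h4]
      simp [ev_succ, hev']
  -- Up to the index `j` the truncated sequence agrees with `z`, and the types determine the chain,
  -- so the chains agree there too.
  have heq : ∀ n, ∀ j ≥ n, F (z.truncate j) n = F z n := fun n => by
    have hs : ∀ n, ∀ j ≥ n, (z.truncate j).shape n = z.shape n := fun n j hj => by
      simp [shape, truncate, (by omega : n ≤ 4 * j)]
    induction n with
    | zero => intro j hj; rw [hF0, hF0, base, base, hs 0 j hj]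
    | succ n ih =>
      intro j hj
      have h1 := hF (z.truncate j) n
      rw [ih j (by omega)] at h1
      exact h1.eq_of_c_eq (hF z n) (by rw [hFc, hFc, hs _ j hj])
  obtain ⟨𝒯, h1, h2⟩ := exists_tower_limit htower (fun n => (F z n).tile) fun n =>
    ⟨n, fun j hj => ⟨n, F (z.truncate j) n, Desc.top, by rw [heq n j hj]⟩⟩
  exact ⟨𝒯, F z, h1, hF0 z, hF z, hFc z, h2⟩

end PenroseCurve

end

noncomputable section

namespace PenroseCurve

open Topology
open PenroseCurve.Frame

/-! ### Triangle tilings as Penrose tilings by kites and darts -/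

/-- A disc is homeomorphic to the plane, where complements of countable sets are connected. -/
theorem isPreconnected_ball_diff {V : Set ℂ} (hV : V.Countable) (x : ℂ) {r : ℝ} (hr : 0 < r) :
    IsPreconnected (Metric.ball x r \ V) := by
  set φ := OpenPartialHomeomorph.univBall (E := ℂ) x r
  have hs : φ.source = Set.univ := OpenPartialHomeomorph.univBall_source x r
  have ht : φ.target = Metric.ball x r := OpenPartialHomeomorph.univBall_target x hr
  have hinj : Set.InjOn φ Set.univ := hs ▸ φ.injOn
  have h1 : (φ ⁻¹' V).Countable := hV.preimage_of_injOn (hinj.mono (Set.subset_univ _))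
  have h2 := (h1.isConnected_compl_of_one_lt_rank
    (by simp : 1 < Module.rank ℝ ℂ)).isPreconnected.image φ
    (OpenPartialHomeomorph.continuous_univBall x r).continuousOn
  convert h2 using 1
  ext y
  constructor
  · rintro ⟨hy, hyV⟩
    rw [← ht] at hy
    exact ⟨φ.symm y, fun h => hyV (by rwa [Set.mem_preimage, φ.right_inv hy] at h),
      φ.right_inv hy⟩
  · rintro ⟨z, hz, rfl⟩
    exact ⟨ht ▸ φ.map_source (hs ▸ Set.mem_univ z), hz⟩

/-- The color of the vertex number `k` of a tile of an even level (`true` is black). -/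
def color (c : Bool) (k : Fin 3) : Bool := c == decide (k ≠ 2)

namespace Frame

variable {f g : Frame} {s : ℝ}

theorem vtx_mem_region (hf : f.Valid) (k : Fin 3) : f.vtx k ∈ f.tile.region := by
  rw [mem_region hf]
  intro i
  rw [co_vtx hf]
  split <;> norm_num

theorem vtx_injective (hf : f.Valid) {k l : Fin 3} (h : f.vtx k = f.vtx l) : k = l := by
  have := co_vtx hf k k
  rw [h, co_vtx hf] at this
  by_contra hkl
  simp [hkl] at this

theorem Nbr.exists_vtx (hf : f.Valid) {j k : Fin 3} (h : Nbr true f j g) (hk : k ≠ j) :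
    ∃ l, g.vtx l = f.vtx k ∧ color g.c l = color f.c k := by
  have hr : f.ε ^ 2 = gold * f.ε - 1 := hf.root
  have hC := gold_sq_complex
  rcases h with rfl | h
  · refine ⟨k, ?_, by rw [mir_c]⟩
    obtain ⟨c, ε, t, d⟩ := f
    simp only at hr
    rcases fin_three j with rfl | rfl | rfl <;> rcases fin_three k with rfl | rfl | rfl <;>
      first
      | exact absurd rfl hk
      | cases c <;> simp [mir, vtx] <;> grind
  · cases h <;> simp only at hr <;> rcases fin_three k with rfl | rfl | rfl <;>
      first
      | exact absurd rfl hk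
      | (refine ⟨0, ?_, rfl⟩; simp [vtx]; done)
      | (refine ⟨0, ?_, rfl⟩; simp [vtx]; grind)
      | (refine ⟨1, ?_, rfl⟩; simp [vtx]; done)
      | (refine ⟨1, ?_, rfl⟩; simp [vtx]; grind)
      | (refine ⟨2, ?_, rfl⟩; simp [vtx]; done)
      | (refine ⟨2, ?_, rfl⟩; simp [vtx]; grind)

end Frame

/-- Every tile that contains a vertex of a tile has this point as a vertex of the same color. -/
theorem Good.exists_vtx {s : ℝ} {𝒯 : Set TriTile} (hG : Good true s 𝒯) {f g : Frame}
    (hf : Ok true s f) (hfT : f.tile ∈ 𝒯) (hg : Ok true s g) (hgT : g.tile ∈ 𝒯) {k : Fin 3}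
    (h : f.vtx k ∈ g.tile.region) : ∃ l, g.vtx l = f.vtx k ∧ color g.c l = color f.c k := by
  set v := f.vtx k with hv
  obtain ⟨r, hr, hrv⟩ := exists_ball_mem hf.pos hG.shape hG.disj v
  have hne : ∀ g : Frame, Ok true s g → v ∈ g.tile.region →
      (g.tile.region ∩ (Metric.ball v r \ {x | IsVtx 𝒯 x})).Nonempty := by
    intro g hg hvg
    obtain ⟨y, hy, hy'⟩ := exists_interior_near hg.valid hvg (Metric.ball_mem_nhds v hr)
    obtain ⟨z, ⟨hz, hz'⟩, hzV⟩ := (hG.countable_isVtx.dense_compl ℝ).inter_open_nonempty _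
      (Metric.isOpen_ball.inter isOpen_interior) ⟨y, hy, hy'⟩
    exact ⟨z, interior_subset hz', hz, hzV⟩
  -- In a small disc around `v` only tiles through `v` occur. Without the vertices the disc is
  -- connected, so the property spreads from `f` across sides.
  refine hG.mem_of_preconnected (isPreconnected_ball_diff hG.countable_isVtx v hr)
    (fun x hx => hx.2)
    {D | ∀ g, Ok true s g → g.tile = D → ∃ l, g.vtx l = v ∧ color g.c l = color f.c k}
    ⟨_, hfT, fun g hg hgf => ?_, hne f hf (vtx_mem_region hf.valid k)⟩ ?_ _ hgT (hne g hg h) g hg rfl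
  · rw [eq_of_tile_eq hg.valid hf.valid hgf]
    exact ⟨k, rfl, rfl⟩
  · rintro D hD hDS _ hD' x hx hxD hxD' g₂ hg₂ rfl
    obtain ⟨g₁, hg₁, rfl⟩ := hG.shape D hD
    obtain ⟨l, hl, hlc⟩ := hDS g₁ hg₁ rfl
    rcases hG.eq_or_nbr hx.2 hg₁ hg₂ hD hD' hxD hxD' with rfl | ⟨j, -, hj⟩
    · exact ⟨l, hl, hlc⟩
    · have hvg₂ := hrv _ hD' ⟨x, hxD', hx.1⟩
      -- If `v` were the vertex opposite to the crossed side, it would lie strictly on the wrong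
      -- side of that line for the neighbor, which contains `v`.
      have hlj : l ≠ j := by
        rintro rfl
        obtain ⟨_, _, i', _, _, m, _, _, hgl⟩ := hj.glued hg₁
        have h1 := (mem_region hg₂.valid).1 hvg₂ i'
        rw [hgl.coi, ← hl, co_vtx hg₁.valid, if_pos rfl] at h1
        linarith [hgl.pos]
      obtain ⟨l', hl', hc'⟩ := hj.exists_vtx hg₁.valid hlj
      exact ⟨l', hl'.trans hl, hc'.trans hlc⟩

/-- `v` is a black (if `b = true`) or a white (if `b = false`) vertex of the tile `S`. -/
def IsColored (b : Bool) (S : Set ℂ) (v : ℂ) : Prop :=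
  if b then IsBlackVertex S v else IsWhiteVertex S v

theorem IsColored.isVertex {b : Bool} {S : Set ℂ} {v : ℂ} (h : IsColored b S v) :
    IsVertex S v := by
  cases b
  exacts [Or.inr h, Or.inl h]

theorem isColored_quad {f : Frame} (hf : Ok true 1 f) {b : Bool} {v : ℂ} :
    IsColored b f.quad v ↔
      (f.c = b ∧ (v = f.t ∨ v = f.h)) ∨ (f.c = !b ∧ (v = f.w ∨ v = f.w')) := by
  cases b
  · simp only [IsColored, isWhiteVertex_quad hf, Bool.false_eq_true, if_false, Bool.not_false]
    exact or_comm
  · simp only [IsColored, isBlackVertex_quad hf, if_true, Bool.not_true]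

theorem isColored_vtx {f : Frame} (hf : Ok true 1 f) (k : Fin 3) :
    IsColored (color f.c k) f.quad (f.vtx k) := by
  rw [isColored_quad hf]
  rcases fin_three k with rfl | rfl | rfl <;> cases hc : f.c <;>
    simp [color, vtx, Frame.h, Frame.w]

theorem exists_vtx_of_isColored {f : Frame} (hf : Ok true 1 f) {b : Bool} {v : ℂ}
    (h : IsColored b f.quad v) :
    ∃ g k, (g = f ∨ g = f.mir 2) ∧ g.vtx k = v ∧ color g.c k = b := by
  rw [isColored_quad hf] at h
  rcases h with ⟨hc, rfl | rfl⟩ | ⟨hc, rfl | rfl⟩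
  · exact ⟨f, 0, Or.inl rfl, rfl, by rw [hc]; cases b <;> rfl⟩
  · exact ⟨f, 1, Or.inl rfl, rfl, by rw [hc]; cases b <;> rfl⟩
  · exact ⟨f, 2, Or.inl rfl, rfl, by rw [hc]; cases b <;> rfl⟩
  · exact ⟨f.mir 2, 2, Or.inr rfl, rfl, by rw [mir_c, hc]; cases b <;> rfl⟩

/-- The kites and darts that are composed of the triangles of a tiling. -/
def quads (𝒯 : Set TriTile) : Set (Set ℂ) := {S | ∃ f, Ok true 1 f ∧ f.tile ∈ 𝒯 ∧ S = f.quad}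

theorem mem_quad {f : Frame} {x : ℂ} (hx : x ∈ f.quad) :
    ∃ g, (g = f ∨ g = f.mir 2) ∧ x ∈ g.tile.region := by
  rcases hx with hx | hx
  exacts [⟨f, Or.inl rfl, hx⟩, ⟨_, Or.inr rfl, hx⟩]

/-- In kites and darts the vertices on the axis have one color and those off the axis the other, so
two vertices of different colors are always joined by an edge. -/
theorem isEdge_of_isColored {f : Frame} (hf : Ok true 1 f) {b : Bool} {u v : ℂ}
    (hu : IsColored b f.quad u) (hv : IsColored (!b) f.quad v) :
    IsEdge f.quad (segment ℝ u v) ∧ segment ℝ u v ⊆ f.quad := by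
  have key : ∀ g, (g = f ∨ g = f.mir 2) → ∀ t, (t = g.t ∨ t = g.h) →
      IsEdge f.quad (segment ℝ t g.w) ∧ segment ℝ t g.w ⊆ f.quad := by
    intro g hg t ht
    have hg' : Ok true 1 g ∧ f.quad = g.quad := by
      rcases hg with rfl | rfl
      exacts [⟨hf, rfl⟩, ⟨hf.mir 2, (quad_mir hf.valid).symm⟩]
    rw [hg'.2]
    constructor
    · refine isEdge_iff.2 ⟨g, hg'.1, rfl, ?_⟩
      rcases ht with rfl | rfl
      exacts [Or.inl rfl, Or.inr rfl]
    · refine subset_trans (segment_subset_convexHull ?_ ?_) Set.subset_union_left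
      · rcases ht with rfl | rfl <;> simp [tile, Frame.h]
      · simp [tile, Frame.w]
  have hw' : (f.mir 2).w = f.w' := rfl
  rw [isColored_quad hf] at hu hv
  rcases hu with ⟨hc, hu⟩ | ⟨hc, hu⟩
  · have hv := (hv.resolve_left fun h => by simp [hc] at h).2
    rcases hv with rfl | rfl
    exacts [key f (Or.inl rfl) u hu, hw' ▸ key _ (Or.inr rfl) u hu]
  · have hv := (hv.resolve_right fun h => by simp [hc] at h).2
    rw [segment_symm]
    rcases hu with rfl | rfl
    exacts [key f (Or.inl rfl) v hv, hw' ▸ key _ (Or.inr rfl) v hv]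

namespace Good

variable {𝒯 : Set TriTile} (hG : Good true 1 𝒯) {f g : Frame} (hf : Ok true 1 f)
  (hfT : f.tile ∈ 𝒯) (hg : Ok true 1 g) (hgT : g.tile ∈ 𝒯)
include hG hf hfT

theorem half_mem {g : Frame} (h : g = f ∨ g = f.mir 2) :
    Ok true 1 g ∧ g.tile ∈ 𝒯 ∧ g.quad = f.quad := by
  rcases h with rfl | rfl
  exacts [⟨hf, hfT, rfl⟩, ⟨hf.mir 2, hG.mir_two_mem hf hfT, quad_mir hf.valid⟩]

include hg hgT

theorem quad_eq_of_openEdge {x : ℂ} (hx : f.OpenEdge 2 x) (hxg : x ∈ g.quad) :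
    f.quad = g.quad := by
  obtain ⟨g', hg', hxg'⟩ := mem_quad hxg
  obtain ⟨h1, h2, h3⟩ := hG.half_mem hg hgT hg'
  rcases hG.eq_or_eq_of_nhds h2 hfT (hG.mir_two_mem hf hfT) (Nbr.nhds hf (Or.inl rfl) hx).1 hxg'
    with h | h
  · rw [← h3, eq_of_tile_eq h1.valid hf.valid h]
  · rw [← h3, eq_of_tile_eq h1.valid (hf.mir 2).valid h, quad_mir hf.valid]

theorem quad_eq_of_interior (h : (interior f.quad ∩ interior g.quad).Nonempty) :
    f.quad = g.quad := by
  obtain ⟨x, hxf, hxg⟩ := h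
  obtain ⟨f', hf', hxf'⟩ := mem_quad (interior_subset hxf)
  obtain ⟨h1, h2, h3⟩ := hG.half_mem hf hfT hf'
  obtain ⟨y, hy, hy'⟩ := exists_interior_near h1.valid hxf' (isOpen_interior.mem_nhds hxg)
  obtain ⟨g', hg', hyg'⟩ := mem_quad (interior_subset hy)
  obtain ⟨h4, h5, h6⟩ := hG.half_mem hg hgT hg'
  rw [← h3, ← h6, eq_of_tile_eq h1.valid h4.valid (hG.eq_of_mem_interior h2 h5 hy' hyg')]

theorem isColored_unique {b c : Bool} {v : ℂ} (hb : IsColored b f.quad v)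
    (hc : IsColored c g.quad v) : b = c := by
  obtain ⟨f', k, hf', rfl, rfl⟩ := exists_vtx_of_isColored hf hb
  obtain ⟨g', l, hg', hl, rfl⟩ := exists_vtx_of_isColored hg hc
  obtain ⟨h1, h2, -⟩ := hG.half_mem hf hfT hf'
  obtain ⟨h4, h5, -⟩ := hG.half_mem hg hgT hg'
  obtain ⟨l', h7, h8⟩ := hG.exists_vtx h1 h2 h4 h5 (hl ▸ vtx_mem_region h4.valid l)
  rw [← h8, vtx_injective h4.valid (h7.trans hl.symm)]

end Good

end PenroseCurve

end

/-! ### Kites and darts of a triangle tiling meet edge to edge, and the existence of tilings. -/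

noncomputable section

namespace PenroseCurve

open Topology
open PenroseCurve.Frame

theorem Frame.openEdge_two_pt {f : Frame} (hf : f.Valid) {a : ℝ} (h0 : 0 < a) (h1 : a < 1) :
    f.OpenEdge 2 (f.pt a 0) := by
  refine ⟨by rw [co_pt hf]; simp, fun j hj => ?_⟩
  rw [co_pt hf]
  rcases fin_three j with rfl | rfl | rfl
  · simpa using h1
  · simpa using h0
  · exact absurd rfl hj

theorem Frame.exists_segment {f : Frame} (hf : f.Valid) {i : Fin 3} {x : ℂ} (hx : f.OpenEdge i x) :
    ∃ k l, k ≠ i ∧ l ≠ i ∧ x ∈ segment ℝ (f.vtx k) (f.vtx l) := by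
  have h := (mem_region hf).1 (hx.mem hf)
  have hs := f.co_sum x
  have hx' := eq_sum_vtx hf x
  have key : ∀ {a b : ℝ} {u v : ℂ}, 0 ≤ a → 0 ≤ b → a + b = 1 → x = a * u + b * v →
      x ∈ segment ℝ u v := fun ha hb hab he => ⟨_, _, ha, hb, hab, by rw [he]; simp⟩
  rcases fin_three i with rfl | rfl | rfl
  · exact ⟨1, 2, by decide, by decide, key (h 1) (h 2) (by linarith [hx.1])
      (hx'.trans (by simp [hx.1, vtx]))⟩
  · exact ⟨0, 2, by decide, by decide, key (h 0) (h 2) (by linarith [hx.1])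
      (hx'.trans (by simp [hx.1, vtx]))⟩
  · exact ⟨0, 1, by decide, by decide, key (h 0) (h 1) (by linarith [hx.1])
      (hx'.trans (by simp [hx.1, vtx]))⟩

namespace Good

variable {𝒯 : Set TriTile} (hG : Good true 1 𝒯) {f g : Frame} (hf : Ok true 1 f)
  (hfT : f.tile ∈ 𝒯) (hg : Ok true 1 g) (hgT : g.tile ∈ 𝒯)
include hG hf hfT hg hgT

/-- A half dart of a tiling is determined by its vertex `w` and the mirror image of `w`. -/
theorem eq_of_w_eq (hfc : f.c = false) (hgc : g.c = false) (hw : f.w = g.w) (hw' : f.w' = g.w') :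
    f = g := by
  have hC := gold_sq_complex
  have hR := gold_sq
  have h1 := one_lt_gold
  have hr : f.ε ^ 2 = gold * f.ε - 1 := hf.root
  have hgv := hg.valid
  obtain ⟨c, ε, t, d⟩ := f
  obtain ⟨c', ε', t', d'⟩ := g
  simp only at hfc hgc hr
  subst hfc hgc
  simp only [Frame.w, Frame.w', kap_false] at hw hw'
  have h5 : (gold : ℂ) * (gold - 2 * ε) ≠ 0 := by
    refine mul_ne_zero gold_ne_zero_complex fun h => hf.root.ne_conj ?_
    linear_combination -h
  rcases hf.root.eq_or hg.root with h | h <;> simp only at h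
  · subst h
    have : (gold * (gold - 2 * ε')) * (d - d') = 0 := by linear_combination hw' - hw
    obtain rfl : d = d' := sub_eq_zero.1 ((mul_eq_zero.1 this).resolve_left h5)
    obtain rfl : t = t' := by linear_combination hw
    rfl
  -- With the opposite orientation `g` would lie inside the acute tile that absorbs `f`.
  · exfalso
    subst h
    have : (gold * (gold - 2 * ε)) * (d + d') = 0 := by linear_combination hw' - hw
    obtain rfl : d' = -d := by
      linear_combination (mul_eq_zero.1 this).resolve_left h5
    obtain rfl : t' = t + gold ^ 2 * d := by linear_combination -hw
    have hA := hG.even_obtuse_zero_mem hf hfT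
    have hAv := (hf.ex (Ex.even_obtuse_zero ε t d)).valid
    have hsub := Frame.region_subset hgv hAv (fun a b => (gold - 1) * b) (fun a b => (gold - 1) * a)
      (fun a b => by simp only [pt]; push_cast; grind) (fun a b ha hb hab => by
        simp only [sig_true, sig_false] at *
        exact ⟨by nlinarith, by nlinarith, by nlinarith⟩)
    have := hG.eq_of_mem_interior hgT hA (center_mem_interior hgv)
      (hsub (interior_subset (center_mem_interior hgv)))
    exact absurd (congrArg TriTile.acute this) (by simp [tile])

/-- Distinct kites or darts do not have two vertices of the same color in common. -/
theorem quad_eq_of_isColored {b : Bool} {u v : ℂ} (huv : u ≠ v) (huf : IsColored b f.quad u)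
    (hvf : IsColored b f.quad v) (hug : IsColored b g.quad u) (hvg : IsColored b g.quad v) :
    f.quad = g.quad := by
  have hR := gold_sq
  have h1 := gold_gt
  have h2 := gold_lt
  have hpair : ∀ {p q p' q' : ℂ}, (u = p ∨ u = q) → (v = p ∨ v = q) → (u = p' ∨ u = q') →
      (v = p' ∨ v = q') → (p = p' ∧ q = q') ∨ (p = q' ∧ q = p') := by
    rintro p q p' q' (rfl | rfl) (rfl | rfl) (h3 | h3) (h4 | h4) <;> simp_all
  have hlen : ∀ c, len true 1 c ^ 2 ≠ gold + 2 := fun c => by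
    cases c <;> simp [len] <;> linarith
  rw [isColored_quad hf] at huf hvf
  rw [isColored_quad hg] at hug hvg
  have nb : ∀ {c b : Bool}, c = b → c = (!b) → False := fun h h' => by
    subst h
    simp at h'
  have hmid : ∀ {k : Frame}, k.Valid → (k.pt (1 / 2) 0 : ℂ) = (k.t + k.h) / 2 := fun _ => by
    simp only [pt, Frame.h]; push_cast; ring
  -- For pairs on both axes the midpoints of the axes coincide, which identifies the tiles. A pair
  -- on one axis and off the other has the wrong distance. For pairs off both axes, the midpoint of
  -- `w w'` lies on the axis of a kite; for darts it does not, and `eq_of_w_eq` is used.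
  rcases huf with ⟨hfc, huf⟩ | ⟨hfc, huf⟩
  · have hvf := (hvf.resolve_right fun h => nb hfc h.1).2
    rcases hug with ⟨hgc, hug⟩ | ⟨hgc, hug⟩
    · have hvg := (hvg.resolve_right fun h => nb hgc h.1).2
      have he : f.t + f.h = g.t + g.h := by
        rcases hpair huf hvf hug hvg with ⟨h3, h4⟩ | ⟨h3, h4⟩ <;> rw [h3, h4]
        exact add_comm _ _
      have hx := openEdge_two_pt hf.valid (a := 1 / 2) (by norm_num) (by norm_num)
      refine hG.quad_eq_of_openEdge hf hfT hg hgT hx (Or.inl ?_)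
      rw [hmid hf.valid, he, ← hmid hg.valid]
      exact (openEdge_two_pt hg.valid (by norm_num) (by norm_num)).mem hg.valid
    · have hvg := (hvg.resolve_left fun h => nb h.1 hgc).2
      have h3 := hf.dist_t_h
      have h4 := hg.dist_w_w'
      refine absurd ?_ (hlen f.c)
      rw [← h3, ← h4]
      rcases hpair huf hvf hug hvg with ⟨h5, h6⟩ | ⟨h5, h6⟩ <;> rw [h5, h6]
      rw [dist_comm]
  · have hvf := (hvf.resolve_left fun h => nb h.1 hfc).2
    rcases hug with ⟨hgc, hug⟩ | ⟨hgc, hug⟩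
    · have hvg := (hvg.resolve_right fun h => nb hgc h.1).2
      have h3 := hg.dist_t_h
      have h4 := hf.dist_w_w'
      refine absurd ?_ (hlen g.c)
      rw [← h3, ← h4]
      rcases hpair huf hvf hug hvg with ⟨h5, h6⟩ | ⟨h5, h6⟩ <;> rw [h5, h6]
      rw [dist_comm]
    · have hvg := (hvg.resolve_left fun h => nb h.1 hgc).2
      have hww := hpair huf hvf hug hvg
      cases hc : f.c
      · have hgc' : g.c = false := by rw [hgc, ← hfc, hc]
        rcases hww with ⟨h5, h6⟩ | ⟨h5, h6⟩
        · rw [hG.eq_of_w_eq hf hfT hg hgT hc hgc' h5 h6]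
        · rw [hG.eq_of_w_eq hf hfT (hg.mir 2) (hG.mir_two_mem hg hgT) hc hgc' h5
            (h6.trans (Frame.w'_mir g).symm), quad_mir hg.valid]
      · have hgc' : g.c = true := by rw [hgc, ← hfc, hc]
        have hm : ∀ {k : Frame}, k.c = true → k.pt (gold / 2) 0 = (k.w + k.w') / 2 := fun {k} h => by
          obtain ⟨c, ε, t, d⟩ := k
          subst h
          simp only [pt, Frame.w, Frame.w', kap_true]; push_cast; ring
        have he : f.w + f.w' = g.w + g.w' := by
          rcases hww with ⟨h3, h4⟩ | ⟨h3, h4⟩ <;> rw [h3, h4]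
          exact add_comm _ _
        have hx := openEdge_two_pt hf.valid (a := gold / 2) (by linarith) (by linarith)
        refine hG.quad_eq_of_openEdge hf hfT hg hgT hx (Or.inl ?_)
        rw [hm hc, he, ← hm hgc']
        exact (openEdge_two_pt hg.valid (by linarith) (by linarith)).mem hg.valid

/-- The common points of two tiles lie between common vertices. -/
theorem exists_common_vertices (hne : f.quad ≠ g.quad) {x : ℂ} (hxf : x ∈ f.quad)
    (hxg : x ∈ g.quad) : ∃ u v, (∃ b, IsColored b f.quad u ∧ IsColored b g.quad u) ∧
      (∃ b, IsColored b f.quad v ∧ IsColored b g.quad v) ∧ x ∈ segment ℝ u v := by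
  obtain ⟨f', hf', hxf'⟩ := mem_quad hxf
  obtain ⟨g', hg', hxg'⟩ := mem_quad hxg
  obtain ⟨h1, h2, h3⟩ := hG.half_mem hf hfT hf'
  obtain ⟨h4, h5, h6⟩ := hG.half_mem hg hgT hg'
  rw [← h3, ← h6] at hne ⊢
  have key : ∀ k l, g'.vtx l = f'.vtx k → color g'.c l = color f'.c k →
      ∃ b, IsColored b f'.quad (f'.vtx k) ∧ IsColored b g'.quad (f'.vtx k) := fun k l h7 h8 =>
    ⟨_, isColored_vtx h1 k, h7 ▸ h8 ▸ isColored_vtx h4 l⟩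
  by_cases hV : IsVtx 𝒯 x
  · obtain ⟨D, hD, hx⟩ := hV
    obtain ⟨k, hk, rfl⟩ := hG.shape D hD
    obtain ⟨m, hm⟩ : ∃ m, x = k.vtx m := by
      rcases hx with hx | hx | hx
      exacts [⟨0, hx⟩, ⟨1, hx⟩, ⟨2, hx⟩]
    subst hm
    obtain ⟨l, h7, h8⟩ := hG.exists_vtx hk hD h1 h2 hxf'
    obtain ⟨l', h7', h8'⟩ := hG.exists_vtx hk hD h4 h5 hxg'
    have := key l l' (h7'.trans h7.symm) (h8'.trans h8.symm)
    rw [h7] at this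
    exact ⟨_, _, this, this, left_mem_segment ℝ _ _⟩
  · rcases hG.eq_or_nbr hV h1 h4 h2 h5 hxf' hxg' with rfl | ⟨j, hj, hn⟩
    · exact absurd rfl hne
    · obtain ⟨k, l, hk, hl, hx⟩ := exists_segment h1.valid hj
      obtain ⟨k', h7, h8⟩ := hn.exists_vtx h1.valid hk
      obtain ⟨l', h7', h8'⟩ := hn.exists_vtx h1.valid hl
      exact ⟨_, _, key k k' h7 h8, key l l' h7' h8', hx⟩

/-- Distinct tiles share at most one vertex of each color, and their common points lie between
common vertices. So the intersection is one vertex, or the segment between two vertices of different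
colors, which is an edge of both. -/
theorem inter_quad (hne : f.quad ≠ g.quad) (hx : (f.quad ∩ g.quad).Nonempty) :
    (∃ v, f.quad ∩ g.quad = {v} ∧ IsVertex f.quad v ∧ IsVertex g.quad v) ∨
      (IsEdge f.quad (f.quad ∩ g.quad) ∧ IsEdge g.quad (f.quad ∩ g.quad)) := by
  have hcom : ∀ x ∈ f.quad ∩ g.quad, _ := fun x hx =>
    hG.exists_common_vertices hf hfT hg hgT hne hx.1 hx.2
  have hsame := fun {b : Bool} {u v : ℂ} (huf : IsColored b f.quad u) (hug : IsColored b g.quad u)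
    (hvf : IsColored b f.quad v) (hvg : IsColored b g.quad v) => by_contra fun h : u ≠ v =>
      hne (hG.quad_eq_of_isColored hf hfT hg hgT h huf hvf hug hvg)
  obtain ⟨x₀, hx₀⟩ := hx
  obtain ⟨u, -, ⟨b, huf, hug⟩, -, -⟩ := hcom x₀ hx₀
  have huS : u ∈ f.quad ∩ g.quad := by
    have : ∀ {k : Frame}, Ok true 1 k → IsColored b k.quad u → u ∈ k.quad := fun {k} hk h => by
      obtain ⟨k', m, hk', rfl, -⟩ := exists_vtx_of_isColored hk h
      rcases hk' with rfl | rfl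
      exacts [Or.inl (vtx_mem_region hk.valid m), Or.inr (vtx_mem_region (hk.mir 2).valid m)]
    exact ⟨this hf huf, this hg hug⟩
  by_cases hv : ∃ v, v ≠ u ∧ ∃ c, IsColored c f.quad v ∧ IsColored c g.quad v
  · obtain ⟨v, hvu, c, hvf, hvg⟩ := hv
    obtain rfl : c = !b := by
      by_contra hcb
      obtain rfl : c = b := by revert hcb; cases c <;> cases b <;> simp
      exact hvu (hsame hvf hvg huf hug)
    obtain ⟨h1, h2⟩ := isEdge_of_isColored hf huf hvf
    obtain ⟨h3, h4⟩ := isEdge_of_isColored hg hug hvg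
    have hany : ∀ y, (∃ c, IsColored c f.quad y ∧ IsColored c g.quad y) → y ∈ segment ℝ u v := by
      rintro y ⟨c, hyf, hyg⟩
      by_cases hcb : c = b
      · subst hcb
        rw [hsame hyf hyg huf hug]
        exact left_mem_segment ℝ _ _
      · obtain rfl : c = !b := by revert hcb; cases c <;> cases b <;> simp
        rw [hsame hyf hyg hvf hvg]
        exact right_mem_segment ℝ _ _
    have heq : f.quad ∩ g.quad = segment ℝ u v := by
      refine subset_antisymm (fun x hx => ?_) (Set.subset_inter h2 h4)
      obtain ⟨u', v', hu', hv', hx'⟩ := hcom x hx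
      exact (convex_segment u v).segment_subset (hany u' hu') (hany v' hv') hx'
    rw [heq]
    exact Or.inr ⟨h1, h3⟩
  · have hany : ∀ y, (∃ c, IsColored c f.quad y ∧ IsColored c g.quad y) → y = u := fun y hy =>
      by_contra fun h => hv ⟨y, h, hy⟩
    refine Or.inl ⟨u, ?_, huf.isVertex, hug.isVertex⟩
    refine Set.eq_singleton_iff_unique_mem.2 ⟨huS, fun x hx => ?_⟩
    obtain ⟨u', v', hu', hv', hx'⟩ := hcom x hx
    rw [hany u' hu', hany v' hv', segment_same] at hx'
    exact hx'

omit hf hfT hg hgT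

theorem aTiling_quads : aTiling (quads 𝒯) = 𝒯 := by
  ext D
  rw [mem_aTiling]
  constructor
  · rintro ⟨f, hf, rfl, g, hg, hgT, h⟩
    rcases quad_injective hg hf h.symm with rfl | rfl
    exacts [hgT, hG.mir_two_mem hg hgT]
  · intro hD
    obtain ⟨f, hf, rfl⟩ := hG.shape D hD
    exact ⟨f, hf, rfl, f, hf, hD, rfl⟩

theorem isPenroseTiling_quads : IsPenroseTiling (quads 𝒯) where
  countable := by
    have : Nonempty Frame := ⟨⟨true, 0, 0, 0⟩⟩
    choose! F hF using hG.shape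
    refine (hG.countable.image fun D => (F D).quad).mono ?_
    rintro _ ⟨f, hf, hfT, rfl⟩
    refine ⟨_, hfT, ?_⟩
    exact congrArg quad (eq_of_tile_eq (hF _ hfT).1.valid hf.valid (hF _ hfT).2)
  prototiles := by
    rintro _ ⟨f, hf, -, rfl⟩
    cases hc : f.c
    · exact ⟨_, _, _, _, Or.inr (isDart_iff.2 ⟨f, hf, hc, rfl, rfl, rfl, rfl, rfl⟩)⟩
    · exact ⟨_, _, _, _, Or.inl (isKite_iff.2 ⟨f, hf, hc, rfl, rfl, rfl, rfl, rfl⟩)⟩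
  covers := by
    refine Set.eq_univ_of_forall fun x => ?_
    obtain ⟨D, hD, hx⟩ := hG.cover x
    obtain ⟨f, hf, rfl⟩ := hG.shape D hD
    exact ⟨f.quad, ⟨f, hf, hD, rfl⟩, Or.inl hx⟩
  disjoint := by
    rintro _ ⟨f, hf, hfT, rfl⟩ _ ⟨g, hg, hgT, rfl⟩ hne
    exact Set.disjoint_iff_inter_eq_empty.2 (Set.not_nonempty_iff_eq_empty.1 fun h =>
      hne (hG.quad_eq_of_interior hf hfT hg hgT h))
  edge_to_edge := by
    rintro _ ⟨f, hf, hfT, rfl⟩ _ ⟨g, hg, hgT, rfl⟩ hne hx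
    exact hG.inter_quad hf hfT hg hgT hne hx
  matching := by
    rintro _ ⟨f, hf, hfT, rfl⟩ _ ⟨g, hg, hgT, rfl⟩ v ⟨h1, h2⟩
    exact absurd (hG.isColored_unique hf hfT hg hgT (b := true) (c := false) h1 h2) (by decide)

end Good

theorem TriTile.sides_subset_region (D : TriTile) : D.sides ⊆ D.region := by
  refine Set.union_subset (Set.union_subset ?_ ?_) ?_ <;>
    exact segment_subset_convexHull (by simp) (by simp)

theorem notMem_interior_of_mem_sides {f : Frame} (hf : f.Valid) {x : ℂ} (hx : x ∈ f.tile.sides) :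
    x ∉ interior f.tile.region := by
  intro hi
  rw [mem_interior hf] at hi
  have key : ∀ i k l : Fin 3, k ≠ i → l ≠ i → x ∉ segment ℝ (f.vtx k) (f.vtx l) := by
    rintro i k l hk hl ⟨a, b, -, -, hab, rfl⟩
    have := hi i
    simp only [Complex.real_smul] at this
    rw [co_comb _ _ _ _ hab, co_vtx hf, co_vtx hf, if_neg hk.symm, if_neg hl.symm] at this
    simp at this
  rcases hx with (hx | hx) | hx
  · exact key 2 0 1 (by decide) (by decide) hx
  · exact key 1 0 2 (by decide) (by decide) hx
  · exact key 0 1 2 (by decide) (by decide) hx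

theorem PenroseSeq.exists_tiling (z : PenroseSeq) : ∃ T, IsPenroseTilingOf z T := by
  obtain ⟨𝒯, F, hT, h0, hF, hc, hmem⟩ := z.exists_tower
  have hG : Good true 1 (𝒯 0) := hT.good 0
  have h0 : Ok true 1 (F 0) := by rw [h0]; exact z.ok_base
  have hx := center_mem_interior h0.valid
  -- The centroid of `F 0` is an interior point, so it is on no side, and it belongs to all tiles of
  -- the chain.
  refine ⟨quads (𝒯 0), hG.isPenroseTiling_quads, center (F 0), fun D hD hDs => ?_, fun n => ?_⟩
  · rw [hG.aTiling_quads] at hD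
    obtain ⟨f, hf, rfl⟩ := hG.shape D hD
    have := hG.eq_of_mem_interior (hmem 0) hD hx (TriTile.sides_subset_region _ hDs)
    exact notMem_interior_of_mem_sides hf.valid hDs (this ▸ hx)
  · refine ⟨(F n).tile, ?_, ?_, ?_⟩
    · rw [level_eq_lev, hG.aTiling_quads, ← hT.eq_lev]
      exact hmem n
    · exact region_chain_mono h0 hF (Nat.zero_le n) (interior_subset hx)
    · rw [isLarge_iff]
      change _ ↔ (F n).c = ev n
      rw [hc, shape]
      by_cases h : z n = 0 <;> simp [h]

end PenroseCurve

end

theorem theorem1p2 (k : Type*) [Field k] :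
    (∀ z : PenroseCurve.PenroseSeq, CategoryTheory.Simple (PenroseCurve.pointSheaf k z)) ∧
    (∀ z : PenroseCurve.PenroseSeq, ∃ T, PenroseCurve.IsPenroseTilingOf z T) ∧
    ∀ (z z' : PenroseCurve.PenroseSeq) (T T' : Set (Set ℂ)),
      PenroseCurve.IsPenroseTilingOf z T → PenroseCurve.IsPenroseTilingOf z' T' →
      List.TFAE [
        Nonempty (PenroseCurve.pointSheaf k z ≅ PenroseCurve.pointSheaf k z'),
        z.Equivalent z',
        ∃ σ : ℂ ≃ᵢ ℂ, (fun S : Set ℂ => σ '' S) '' T = T'] := by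
  refine ⟨fun z => PenroseCurve.simple_pointSheaf z, fun z => z.exists_tiling,
    fun z z' T T' h h' => ?_⟩
  tfae_have 1 ↔ 2 := PenroseCurve.nonempty_iso_iff_equivalent z z'
  tfae_have 2 → 3 := PenroseCurve.exists_image_eq h h'
  tfae_have 3 → 2 := fun ⟨σ, hσ⟩ => PenroseCurve.equivalent_of_image_eq h h' σ hσ
  tfae_finish
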